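/- Let $d\ge 1$. For $\beta>0$ write $\beta=k+\theta$ with $k\in\mathbb{N}_0$, $\theta\in(0,1]$, and let $\mathcal C^\beta$ be the space of $C^k$ functions on $\mathbb{R}^d$ whose derivatives of order $0,\dots,k$ are bounded and whose $k$-th derivative is $\theta$-Hölder, with the natural norm; $\mathcal C^0$ is the space of bounded measurable functions with the supremum norm. For a $d$-dimensional Lévy process $L$ put $\mathcal P_tf(x)=\mathbb{E}f(x+L_t)$ and let $\mathcal L f$ be the uniform limit of $(\mathcal P_tf-f)/t$ as $t\downarrow0$. For $\alpha\in(0,2]$, $\tilde\alpha\in(0,\infty]$ we say that $L$ satisfies H1–H3 with $(\alpha,\tilde\alpha)$ (and constants $M$) if * (H1) there is $M$ such that for all $f\in\mathcal C^0$ and $0<t\le1$, $\mathcal P_tf$ is differentiable and $\|\nabla\mathcal P_tf\|_{\mathcal C^0}\le Mt^{-1/\alpha}\|f\|_{\mathcal C^0}$; * (H2) for $\delta\in\{0,1\}$ and $\varepsilon>0$ there is $M=M(\delta,\varepsilon)$ such that for all $f\in\mathcal C^{\alpha+\delta+\varepsilon}$, $\mathcal Lf$ exists and $\|\mathcal Lf\|_{\mathcal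 C^\delta}\le M\|f\|_{\mathcal C^{\alpha+\delta+\varepsilon}}$; * (H3) for all $p\in(0,\tilde\alpha)$ and $\varepsilon>0$ there is $M=M(p,\varepsilon)$ such that $\mathbb{E}[|L_t|^p\wedge1]\le Mt^{p/\alpha-\varepsilon}$ for $0<t\le1$. Given $\beta>0$, $p>2$, $\varepsilon>0$, $B$, $N$, we say that the *Euler bound* holds for $L$ with constant $N$ if the following is true for every complete right-continuous filtration $\mathbb F=(\mathcal F_t)_{t\in[0,1]}$ to which $L$ is adapted and such that $L_t-L_s$ is independent of $\mathcal F_s$ for $s\le t$, every $b:\mathbb{R}^d\to\mathbb{R}^d$ with $\|b\|_{\mathcal C^\beta}\le B$, every $n\ge1$ and all $x_0,x_0^n\in\mathbb{R}^d$: if $X$ is an $\mathbb F$-adapted solution of $dX_t=b(X_t)\,dt+dL_t$, $X_0=x_0$ on $[0,1]$, and $X^n$ is the Euler–Maruyama approximation $dX^n_t=b(X^n_{\lfloor nt\rfloor/n})\,dt+dL_t$, $X^n_0=x^n_0$, then $$\Big\|\,\|X-X^n\|_{\mathcal C^{1/2-1/p-\varepsilon}([0,1])}\Big\|_{L_p(\Omega)}\le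 N n^{-\left(\frac12+\min\left(\frac\beta2,\frac1p\right)\right)+\varepsilon}+N|x_0-x_0^n|$$ (for $\varepsilon\ge\frac12-\frac1p$ the inner norm is the supremum norm). (a) Let $L^{(1)},L^{(2)}$ be independent Lévy processes on the same probability space satisfying H1–H3 with $(\alpha_1,\tilde\alpha_1)$ and $(\alpha_2,\tilde\alpha_2)$, where $\alpha_1\le\alpha_2$. Then $L^{(1)}+L^{(2)}$ is a Lévy process satisfying H1–H3 with $\alpha=\alpha_2$ and $\tilde\alpha=\min\left(\tilde\alpha_1\frac{\alpha_2}{\alpha_1},\tilde\alpha_2\right)$. (b) Let $\alpha\in(0,2)$, $c>0$, $\beta>0$, $p>2$, $\varepsilon>0$, $B\in\mathbb{R}$. There is a constant $N>0$, depending only on these and $d$, such that the Euler bound holds with constant $N$ for $L=W+Z$ whenever $W$ is a standard $d$-dimensional Brownian motion and $Z$ is an independent Lévy process with $\mathbb{E}e^{i\langle\lambda,Z_t\rangle}=e^{-tc|\lambda|^\alpha}$. (c) Let $L$ be a Lévy process with generating triplet $(a,Q,\nu)$ such that $Q$ is positive definite and $\int_{|y|>1}|y|^\gamma\,\nu(dy)<\infty$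 for some $\gamma>0$. Then $L$ satisfies H1–H3 with $\alpha=\tilde\alpha=2$. Moreover, for all $\beta>0$, $p>2$, $\varepsilon>0$, $B\in\mathbb{R}$ and every collection $M$ of constants there is $N=N(d,\beta,p,\varepsilon,M,B)>0$ such that the Euler bound with constant $N$ holds for every such $L$ that satisfies H1–H3 with $\alpha=\tilde\alpha=2$ and constants $M$. -/

import Mathlib

open MeasureTheory ProbabilityTheory Filter Topology
open scoped NNReal ENNReal unitInterval

namespace LevyEuler

/-! ### Hölder norms -/

/-- The supremum of `|f|`, with values in `[0, ∞]`. -/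
noncomputable def supENorm {X F : Type*} [NormedAddCommGroup F] (f : X → F) : ℝ≥0∞ :=
  ⨆ x, ‖f x‖ₑ

/-- The largest integer strictly smaller than `β` (for `β > 0`). -/
noncomputable def holderOrder (β : ℝ) : ℕ := ⌈β⌉₊ - 1

open Classical in
/-- The norm of `C^β`, equal to `∞` for functions that are not in `C^β`.
For `β = 0` this is the supremum norm on bounded measurable functions. For `β > 0` write
`β = k + θ` with `k` a natural number and `0 < θ ≤ 1`: the function is `k` times
continuously differentiable, its derivatives of order `0, …, k` are bounded, and the one of order
`k` is `θ`-Hölder. For integer `β ≥ 1` (`θ = 1`) the derivative of order `β - 1` is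
Lipschitz, i.e. the weak derivatives of order `β` are bounded; for non-integer `β` one has
`k = ⌊β⌋`. -/
noncomputable def cNorm {E F : Type*} [NormedAddCommGroup E] [NormedSpace ℝ E]
    [MeasurableSpace E] [NormedAddCommGroup F] [NormedSpace ℝ F] [MeasurableSpace F]
    (β : ℝ) (f : E → F) : ℝ≥0∞ :=
  if β ≤ 0 then
    if Measurable f then supENorm f else ∞
  else if ContDiff ℝ (holderOrder β : ℕ∞) f then
    (∑ j ∈ Finset.range (holderOrder β + 1), supENorm (iteratedFDeriv ℝ j f))
      + eHolderNorm (β - holderOrder β).toNNReal (iteratedFDeriv ℝ (holderOrder β) f)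
  else ∞

/-- The `C^τ([0,1])` norm of a path for `τ < 1`; for `τ ≤ 0` it is the supremum norm. -/
noncomputable def pathNorm {F : Type*} [NormedAddCommGroup F] (τ : ℝ) (f : I → F) : ℝ≥0∞ :=
  if τ ≤ 0 then supENorm f else supENorm f + eHolderNorm τ.toNNReal f

/-! ### Lévy processes -/

variable {d : ℕ} {Ω : Type*} [mΩ : MeasurableSpace Ω]

/-- `d`-dimensional Lévy processes. -/
structure IsLevyProcess (L : ℝ≥0 → Ω → EuclideanSpace ℝ (Fin d)) (P : Measure Ω) : Prop where
  measurable : ∀ t, Measurable (L t)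
  zero : ∀ᵐ ω ∂P, L 0 ω = 0
  indep : HasIndepIncrements L P
  stationary : ∀ s t, IdentDistrib (fun ω ↦ L (s + t) ω - L s ω) (L t) P P
  cadlag : ∀ᵐ ω ∂P, ∀ t, ContinuousWithinAt (fun s ↦ L s ω) (Set.Ici t) t ∧
    ∃ l, Tendsto (fun s ↦ L s ω) (𝓝[<] t) (𝓝 l)

/-- The Markov transition semigroup `P_t f (x) = E f(x + L_t)`. -/
noncomputable def semigroup (L : ℝ≥0 → Ω → EuclideanSpace ℝ (Fin d)) (P : Measure Ω) (t : ℝ≥0)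
    (f : EuclideanSpace ℝ (Fin d) → ℝ) (x : EuclideanSpace ℝ (Fin d)) : ℝ :=
  ∫ ω, f (x + L t ω) ∂P

/-- `f` is in the domain of the generator of the semigroup and the generator maps it to `g`:
`(P_t f - f) / t` converges to `g` uniformly as `t ↓ 0`. -/
def HasGenerator (L : ℝ≥0 → Ω → EuclideanSpace ℝ (Fin d)) (P : Measure Ω)
    (f g : EuclideanSpace ℝ (Fin d) → ℝ) : Prop :=
  Tendsto (fun t : ℝ≥0 ↦ supENorm fun x ↦ (t : ℝ)⁻¹ * (semigroup L P t f x - f x) - g x)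
    (𝓝[>] 0) (𝓝 0)

/-- The constants in the three assumptions on the driving process. -/
structure HConstants where
  /-- the constant of the gradient bound on the semigroup -/
  grad : ℝ≥0
  /-- the constants of the bound on the generator, as a function of `δ` and `ε` -/
  gen : ℕ → ℝ → ℝ≥0
  /-- the constants of the moment bound, as a function of `p` and `ε` -/
  mom : ℝ → ℝ → ℝ≥0

/-- The gradient bound H1 on the semigroup, the bound H2 on the generator and the moment
bound H3, with parameters `α ∈ (0, 2]`, `α' ∈ (0, ∞]` and the constants `M`. -/
structure SatisfiesHWith (L : ℝ≥0 → Ω → EuclideanSpace ℝ (Fin d)) (P : Measure Ω)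
    (α : ℝ) (α' : ℝ≥0∞) (M : HConstants) : Prop where
  h1 : ∀ f : EuclideanSpace ℝ (Fin d) → ℝ, cNorm 0 f < ∞ → ∀ t : ℝ≥0, 0 < t → t ≤ 1 →
    Differentiable ℝ (semigroup L P t f) ∧
    supENorm (fderiv ℝ (semigroup L P t f)) ≤
      ENNReal.ofReal (M.grad * (t : ℝ) ^ (-(1 / α))) * cNorm 0 f
  h2 : ∀ δ : ℕ, δ ≤ 1 → ∀ ε : ℝ, 0 < ε → ∀ f : EuclideanSpace ℝ (Fin d) → ℝ,
    cNorm (α + δ + ε) f < ∞ →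
    ∃ g, HasGenerator L P f g ∧ cNorm (δ : ℝ) g ≤ M.gen δ ε * cNorm (α + δ + ε) f
  h3 : ∀ p : ℝ, 0 < p → ENNReal.ofReal p < α' → ∀ ε : ℝ, 0 < ε → ∀ t : ℝ≥0, 0 < t → t ≤ 1 →
    ∫ ω, min (‖L t ω‖ ^ p) 1 ∂P ≤ M.mom p ε * (t : ℝ) ^ (p / α - ε)

/-- H1–H3 hold with parameters `α`, `α'` (for some constants). -/
def SatisfiesH (L : ℝ≥0 → Ω → EuclideanSpace ℝ (Fin d)) (P : Measure Ω)
    (α : ℝ) (α' : ℝ≥0∞) : Prop :=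
  ∃ M, SatisfiesHWith L P α α' M

/-- The characteristic exponent associated with `(a, Q, ν)`. -/
noncomputable def symbol (a : EuclideanSpace ℝ (Fin d)) (Q : Matrix (Fin d) (Fin d) ℝ)
    (ν : Measure (EuclideanSpace ℝ (Fin d))) (u : EuclideanSpace ℝ (Fin d)) : ℂ :=
  -Complex.I * (inner ℝ a u : ℝ) + 1 / 2 * (dotProduct u.ofLp (Q.mulVec u.ofLp) : ℝ)
    + ∫ y, (1 - Complex.exp (Complex.I * (inner ℝ u y : ℝ))
        + Complex.I * (inner ℝ u y : ℝ) * (if ‖y‖ ≤ 1 then 1 else 0)) ∂ν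

/-- `(a, Q, ν)` is the generating triplet of `L`. -/
structure HasTriplet (L : ℝ≥0 → Ω → EuclideanSpace ℝ (Fin d)) (P : Measure Ω)
    (a : EuclideanSpace ℝ (Fin d)) (Q : Matrix (Fin d) (Fin d) ℝ)
    (ν : Measure (EuclideanSpace ℝ (Fin d))) : Prop where
  posSemidef : Q.PosSemidef
  zero : ν {0} = 0
  integrable : ∫⁻ y, ENNReal.ofReal (min 1 (‖y‖ ^ 2)) ∂ν < ∞
  charFun_eq : ∀ (t : ℝ≥0) (u : EuclideanSpace ℝ (Fin d)),
    charFun (P.map (L t)) u = Complex.exp (-(t : ℝ) * symbol a Q ν u)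

/-- Standard `d`-dimensional Brownian motion: the coordinates are independent standard Brownian
motions. -/
def IsBrownian (W : ℝ≥0 → Ω → EuclideanSpace ℝ (Fin d)) (P : Measure Ω) : Prop :=
  (∀ i, IsBrownianReal (fun t ω ↦ W t ω i) P) ∧
    iIndepFun (fun (i : Fin d) (ω : Ω) (t : ℝ≥0) ↦ W t ω i) P

/-- Standard `d`-dimensional `α`-stable process: a Lévy process with characteristic function
`exp (-t c |u|^α)`. -/
def IsStandardStable (Z : ℝ≥0 → Ω → EuclideanSpace ℝ (Fin d)) (P : Measure Ω) (α c : ℝ) : Prop :=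
  IsLevyProcess Z P ∧ ∀ (t : ℝ≥0) (u : EuclideanSpace ℝ (Fin d)),
    charFun (P.map (Z t)) u = Complex.exp (-((t : ℝ) * c * ‖u‖ ^ α : ℝ))

/-! ### The equation and the Euler scheme -/

/-- `F` is complete and right-continuous, and `L` is a Lévy process with respect to `F`: it is
adapted and its increments are independent of the past. -/
structure IsFiltrationFor (F : Filtration I mΩ) (L : ℝ≥0 → Ω → EuclideanSpace ℝ (Fin d))
    (P : Measure Ω) : Prop where
  complete : ∀ s : Set Ω, P s = 0 → MeasurableSet[F 0] s
  rightCont : F.IsRightContinuous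
  adapted : ∀ t : I, Measurable[F t] (L (unitInterval.toNNReal t))
  indep : ∀ s t : I, s ≤ t → Indep
    (MeasurableSpace.comap
      (fun ω ↦ L (unitInterval.toNNReal t) ω - L (unitInterval.toNNReal s) ω) inferInstance)
    (F s) P

/-- `X` is a solution on `[0,1]`, adapted to `F`, of `dX = b(X) dt + dL`, `X_0 = x₀`. -/
structure IsSolution (F : Filtration I mΩ) (L : ℝ≥0 → Ω → EuclideanSpace ℝ (Fin d))
    (P : Measure Ω) (b : EuclideanSpace ℝ (Fin d) → EuclideanSpace ℝ (Fin d))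
    (x₀ : EuclideanSpace ℝ (Fin d)) (X : I → Ω → EuclideanSpace ℝ (Fin d)) : Prop where
  adapted : ∀ t : I, Measurable[F t] (X t)
  path_measurable : ∀ᵐ ω ∂P, Measurable fun s ↦ X s ω
  eqn : ∀ᵐ ω ∂P, ∀ t : I,
    X t ω = x₀ + (∫ s in Set.Iic t, b (X s ω)) + L (unitInterval.toNNReal t) ω

/-- `κ_n(t) = ⌊n t⌋ / n`. -/
noncomputable def kappa (n : ℕ) (t : I) : I :=
  ⟨⌊(n : ℝ) * t⌋₊ / (n : ℝ), by positivity, by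
    refine div_le_one_of_le₀ ?_ (Nat.cast_nonneg n)
    have ht : (n : ℝ) * t ≤ n := mul_le_of_le_one_right (Nat.cast_nonneg n) t.2.2
    exact (Nat.floor_le (mul_nonneg (Nat.cast_nonneg n) t.2.1)).trans ht⟩

/-- `Y` is the Euler–Maruyama approximation with step `1/n` and initial condition `y₀`:
`dY_t = b(Y_{κ_n(t)}) dt + dL_t`. -/
def IsEulerScheme (L : ℝ≥0 → Ω → EuclideanSpace ℝ (Fin d)) (P : Measure Ω)
    (b : EuclideanSpace ℝ (Fin d) → EuclideanSpace ℝ (Fin d)) (n : ℕ)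
    (y₀ : EuclideanSpace ℝ (Fin d)) (Y : I → Ω → EuclideanSpace ℝ (Fin d)) : Prop :=
  ∀ᵐ ω ∂P, ∀ t : I,
    Y t ω = y₀ + (∫ s in Set.Iic t, b (Y (kappa n s) ω)) + L (unitInterval.toNNReal t) ω

/-- For every drift with `‖b‖_{C^β} ≤ B` and all initial conditions, the error of the Euler scheme
in `L_p(Ω; C^{1/2 - 1/p - ε}([0,1]))` is at most
`N n^{-(1/2 + (β/2) ∧ (1/p)) + ε} + N |x₀ - x₀ⁿ|`. -/
def EulerBound (L : ℝ≥0 → Ω → EuclideanSpace ℝ (Fin d)) (P : Measure Ω)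
    (β p ε B N : ℝ) : Prop :=
  ∀ F : Filtration I mΩ, IsFiltrationFor F L P →
  ∀ b : EuclideanSpace ℝ (Fin d) → EuclideanSpace ℝ (Fin d), cNorm β b ≤ ENNReal.ofReal B →
  ∀ n : ℕ, 1 ≤ n → ∀ (x₀ y₀ : EuclideanSpace ℝ (Fin d))
    (X Y : I → Ω → EuclideanSpace ℝ (Fin d)),
    IsSolution F L P b x₀ X → IsEulerScheme L P b n y₀ Y →
    eLpNorm (fun ω ↦ pathNorm (1 / 2 - 1 / p - ε) fun t ↦ X t ω - Y t ω) (ENNReal.ofReal p) P ≤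
      ENNReal.ofReal (N * (n : ℝ) ^ (-(1 / 2 + min (β / 2) (1 / p)) + ε) + N * ‖x₀ - y₀‖)

end LevyEuler

/-!
The three assertions reduce to properties of the one-dimensional laws `m t` of the driver, that
is, of the convolution operators `P_t f = avg (m t) f`.

**The Euler bound.** Let `m` satisfy the three assumptions with both parameters equal to `2`
(`IsHeatSemigroup`); a component `f` of the drift may be taken `β`-Hölder with `β < 1`. The
generator bound controls `P_t f - f` for smooth `f`, and the gradient bound, iterated along the
semigroup, makes `P_t f` smooth. Together they give `exists_isRegularized`: for `γ < β/2` the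
first and second differences of `P_t f` in space are of order `t^(γ - 1/2)` and `t^(γ - 1)`, and
those in time over `[t, t + r]` are of order `r t^(γ - 1)`; in particular the time integrals
`∫₀^τ P_r f dr` are Lipschitz. With `h = 1/n`, the increment of the error `X - X^n` over one step
is the sum of three terms.

* The `freezeError` `∫ f(X_r) dr - ∫₀ʰ P_r f(X_s) dr`: the conditional mean given the past differs
  from zero only by the effect of the drift. Sums of such terms grow like the square root of their
  number (`HasLpBound.sum_of_small_bias`), by an `L_p` inequality for martingale differences that
  is proved from an expansion of `|x + y|^p`.
* The `defect` `∫₀ʰ P_r f(X^n_s) dr - h f(X^n_s)`. Summation by parts against the corrector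
  `∑ P_{jh} (defect)` (`sum_defect_eq`) turns these into martingale differences, up to a boundary
  term and the effect of the drift. With the previous terms they add up to an error of the order
  of the rate (`hasLpBound_error_sub_sum_germ`).
* The `germ` `∫₀ʰ (P_r f(X_s) - P_r f(X^n_s)) dr`. Dyadic coarsening replaces the sum of the germs
  by one germ over the whole interval; the defect of additivity at each level is again nearly a
  martingale difference. This discrete form of stochastic sewing gives `hasLpBound_sum_germ`.

On a short interval the germs are absorbed by the left-hand side, and finitely many short
intervals cover `[0, 1]` (`hasLpBound_gridError`). Chaining over dyadic intervals passes from
`L_p` bounds on increments to Hölder norms in `L_p`, at the cost of `1/p` in the Hölder exponent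
(`exists_holder_const`), and between grid points the error is Lipschitz. The drift is used with a
Hölder exponent `β₀` just below `min (β, 2/p)`: then the truncated moment of order `β₀ p < 2` of
`L_h` is available, and it contributes the factor `h^(β₀/2)`, up to `ε`, to the rate. All
constants depend only on those of the semigroup: `exists_eulerBound`.

**Sums.** The law of `L¹_t + L²_t` is `m¹_t ∗ m²_t`. The gradient bound is inherited from the
second factor, truncated moments are subadditive up to a constant, and the generator of the sum is
the sum of the generators: `SatisfiesHLaws.conv`.

**Brownian motion plus a stable process.** Here the laws are explicit through their characteristic
functions. The Gaussian factor smoothes bounded functions (`differentiable_avg_gaussMeasure`), the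
truncated second moment is controlled by `1 - charFun` (`integral_min_sq_le`), and by symmetry
only second differences matter for `P_t f - f`: `isHeatSemigroup_of_charFun`.

**General triplets.** The process is approximated by random walks whose steps are drawn from the
drift, the vectors `± w i` of a decomposition `Q = ∑ w i ⊗ w i` and the jumps larger than `r`.
Taylor expansion shows that a step of time `h` acts on `C²` functions as `1 + h ℒ` up to a small
error, and telescoping (`abs_avg_convPow_sub_le`) with the convergence of the characteristic
functions transfers this to `m t` (`abs_avg_sub_sub_levyGen_le`). This gives the generator and
moment bounds. For the gradient bound, `Q - κ` is still positive semidefinite for some `κ > 0`, so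
that random walks for the triplet `(a, Q - κ, ν)` converge, by Lévy's continuity theorem, to a law
`μ` with `m t = N(0, κ t) ∗ μ` (`exists_eq_gaussMeasure_conv`).
-/

namespace LevyEuler

set_option linter.unusedSectionVars false

/-! ### A martingale inequality in `L^p` -/

/-- A second-order expansion of `|x|^p` with a remainder that is explicit in `y`. -/
lemma abs_add_rpow_le {p : ℝ} (hp : 2 < p) (x y : ℝ) :
    |x + y| ^ p ≤ |x| ^ p + p * (|x| ^ (p - 2) * x) * y
      + (p ^ 2 + (p + 1) ^ p + p ^ p) * (|x| ^ (p - 2) * y ^ 2 + |y| ^ p) := by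
  wlog hx : 0 ≤ x generalizing x y
  · have := this (-x) (-y) (by linarith)
    rw [← neg_add, abs_neg, abs_neg, abs_neg] at this
    linarith [this, (by ring : p * (|x| ^ (p - 2) * -x) * -y = p * (|x| ^ (p - 2) * x) * y),
      (by ring : (-y) ^ 2 = y ^ 2)]
  rw [abs_of_nonneg hx]
  by_cases h : p * |y| ≤ x
  · rcases hx.eq_or_lt with h0 | hx
    · obtain rfl : y = 0 := abs_nonpos_iff.1 (by nlinarith [abs_nonneg y])
      simp [← h0, Real.zero_rpow (by linarith : p ≠ 0)]
    set u := y / x with hu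
    have hy : y = x * u := by rw [hu]; field_simp
    have hpu : |p * u| ≤ 1 := by
      rw [abs_mul, abs_of_pos (by linarith : 0 < p), hu, abs_div, abs_of_pos hx, ← mul_div_assoc]
      exact (div_le_one hx).2 h
    have hu1 : 0 ≤ 1 + u := by
      rw [abs_mul, abs_of_pos (by linarith : 0 < p)] at hpu
      nlinarith [abs_nonneg u, neg_abs_le u]
    have h1 : (1 + u) ^ p ≤ 1 + p * u + p ^ 2 * u ^ 2 := by
      have h4 := Real.rpow_le_rpow hu1 (by linarith [Real.add_one_le_exp u] : 1 + u ≤ Real.exp u)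
        (by linarith : 0 ≤ p)
      rw [← Real.exp_mul, mul_comm u p] at h4
      linarith [(abs_le.1 (Real.abs_exp_sub_one_sub_id_le hpu)).2, mul_pow p u 2]
    have e2 : x ^ p = x ^ (p - 2) * x ^ 2 := by
      rw [← Real.rpow_natCast x 2, ← Real.rpow_add hx]; norm_num
    have h7 := mul_le_mul_of_nonneg_left h1 (by positivity : 0 ≤ x ^ p)
    rw [show x + y = x * (1 + u) by rw [hy]; ring, abs_of_nonneg (by positivity),
      Real.mul_rpow hx.le hu1]
    refine h7.trans ?_
    have : 0 ≤ ((p + 1) ^ p + p ^ p) * (x ^ (p - 2) * y ^ 2 + |y| ^ p) + p ^ 2 * |y| ^ p := by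
      positivity
    rw [e2]
    linear_combination this + (p * x ^ (p - 2) * x + p ^ 2 * x ^ (p - 2) * (y + x * u)) * (-hy)
  · push Not at h
    have hy : 0 < |y| := pos_of_mul_pos_right (hx.trans_lt h) (by linarith)
    have h1 : |x + y| ≤ (p + 1) * |y| := by
      have := abs_add_le x y
      rw [abs_of_nonneg hx] at this; linarith
    have h2 := Real.rpow_le_rpow (abs_nonneg _) h1 (by linarith : 0 ≤ p)
    rw [Real.mul_rpow (by linarith) hy.le] at h2
    have e : x ^ (p - 2) * x ≤ p ^ (p - 1) * |y| ^ (p - 1) := by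
      rcases hx.eq_or_lt with h0 | hx
      · rw [← h0]; simp; positivity
      rw [← Real.rpow_add_one hx.ne', ← Real.mul_rpow (by linarith) hy.le,
        show p - 2 + 1 = p - 1 by ring]
      exact Real.rpow_le_rpow hx.le h.le (by linarith)
    have h3 : p * (x ^ (p - 2) * x) * -y ≤ p ^ p * |y| ^ p := by
      have := neg_le_abs y
      calc _ ≤ p * (x ^ (p - 2) * x) * |y| := by gcongr
        _ ≤ p * (p ^ (p - 1) * |y| ^ (p - 1)) * |y| := by gcongr
        _ = (p ^ (p - 1) * p) * (|y| ^ (p - 1) * |y|) := by ring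
        _ = _ := by
          rw [← Real.rpow_add_one (by linarith), ← Real.rpow_add_one hy.ne', sub_add_cancel]
    have : 0 ≤ x ^ p + (p ^ 2 + (p + 1) ^ p + p ^ p) * (x ^ (p - 2) * y ^ 2) + p ^ 2 * |y| ^ p := by
      positivity
    linarith

/-- Young's inequality in the form that distributes the error evenly over `m` steps. -/
lemma rpow_mul_sq_le {p m : ℝ} (hp : 2 < p) (hm : 0 < m) (x y : ℝ) :
    |x| ^ (p - 2) * y ^ 2 ≤ |x| ^ p / m + m ^ (p / 2 - 1) * |y| ^ p := by
  have key : ∀ z : ℝ, 0 ≤ z → z ^ (p - 2) * z ^ 2 = z ^ p := by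
    intro z hz
    rw [← Real.rpow_natCast z 2, ← Real.rpow_add_of_nonneg hz (by linarith) (by norm_num)]
    norm_num
  rw [← sq_abs y]
  have a0 := abs_nonneg x
  have b0 := abs_nonneg y
  set a := |x|
  set b := |y|
  by_cases h : m * b ^ 2 ≤ a ^ 2
  · refine le_add_of_le_of_nonneg ?_ (by positivity)
    rw [← key a a0, mul_div_assoc]
    gcongr
    rwa [le_div_iff₀' hm]
  · push Not at h
    refine le_add_of_nonneg_of_le (by positivity) ?_
    have h1 : a ≤ m ^ (1 / 2 : ℝ) * b := by
      rw [← Real.sqrt_eq_rpow]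
      refine abs_le_of_sq_le_sq' ?_ (by positivity) |>.2
      rw [mul_pow, Real.sq_sqrt hm.le]; exact h.le
    calc _ ≤ (m ^ (1 / 2 : ℝ) * b) ^ (p - 2) * b ^ 2 := by gcongr
      _ = m ^ (p / 2 - 1) * (b ^ (p - 2) * b ^ 2) := by
          rw [Real.mul_rpow (by positivity) b0, ← Real.rpow_mul hm.le]
          ring_nf
      _ = _ := by rw [key b b0]

section Lp

variable {Ω : Type*} {mΩ : MeasurableSpace Ω} {P : Measure Ω}

lemma eLpNorm_le_ofReal_iff {p a : ℝ} (hp : 0 < p) (ha : 0 ≤ a) {f : Ω → ℝ}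
    (hf : MemLp f (ENNReal.ofReal p) P) :
    eLpNorm f (ENNReal.ofReal p) P ≤ ENNReal.ofReal a ↔ ∫ ω, |f ω| ^ p ∂P ≤ a ^ p := by
  rw [hf.eLpNorm_eq_integral_rpow_norm (by simpa using hp) ENNReal.ofReal_ne_top,
    ENNReal.toReal_ofReal hp.le, ENNReal.ofReal_le_ofReal_iff ha]
  exact Real.rpow_inv_le_iff_of_pos (integral_nonneg fun _ ↦ by positivity) ha hp

/-- The constant in `eLpNorm_sum_martingale_le`. -/
noncomputable def martConst (p : ℝ) : ℝ :=
  (2 * (p ^ 2 + (p + 1) ^ p + p ^ p) * Real.exp (p ^ 2 + (p + 1) ^ p + p ^ p)) ^ (1 / p)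

lemma martConst_nonneg {p : ℝ} (hp : 2 < p) : 0 ≤ martConst p := by unfold martConst; positivity

lemma integrable_of_bounded [IsFiniteMeasure P] {f : Ω → ℝ} (hf : AEStronglyMeasurable f P) {c : ℝ}
    (h : ∀ ω, |f ω| ≤ c) : Integrable f P :=
  Integrable.of_bound hf c (ae_of_all _ h)

/-- Bounded martingale differences `e k` with `‖e k‖_p ≤ a` have partial sums of `L^p` norm at most
`C √m a`. -/
theorem eLpNorm_sum_martingale_le [IsProbabilityMeasure P] {p : ℝ} (hp : 2 < p)
    (𝓕 : ℕ → MeasurableSpace Ω) (hle : ∀ k, 𝓕 k ≤ mΩ) (hmono : Monotone 𝓕) {e : ℕ → Ω → ℝ} {a : ℝ}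
    (ha : 0 ≤ a) (m : ℕ) (hmeas : ∀ k < m, Measurable[𝓕 (k + 1)] (e k))
    (hbdd : ∀ k < m, ∃ c, ∀ ω, |e k ω| ≤ c) (hmart : ∀ k < m, P[e k|𝓕 k] =ᵐ[P] 0)
    (hnorm : ∀ k < m, eLpNorm (e k) (ENNReal.ofReal p) P ≤ ENNReal.ofReal a) :
    eLpNorm (fun ω ↦ ∑ k ∈ Finset.range m, e k ω) (ENNReal.ofReal p) P
      ≤ ENNReal.ofReal (martConst p * √m * a) := by
  rcases Nat.eq_zero_or_pos m with h0 | hm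
  · subst h0; simp
  have hm' : (0 : ℝ) < m := by exact_mod_cast hm
  set C := p ^ 2 + (p + 1) ^ p + p ^ p with hC
  have hC0 : 0 ≤ C := by positivity
  set S : ℕ → Ω → ℝ := fun k ω ↦ ∑ i ∈ Finset.range k, e i ω with hS
  have hSm : ∀ k ≤ m, Measurable[𝓕 k] (S k) := by
    intro k hk
    refine Finset.measurable_fun_sum _ fun i hi ↦ ?_
    have hi := Finset.mem_range.1 hi
    exact (hmeas i (hi.trans_le hk)).mono (hmono hi) le_rfl
  have hSb : ∀ k ≤ m, ∃ c, ∀ ω, |S k ω| ≤ c := by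
    intro k hk
    choose! c hc using hbdd
    refine ⟨∑ i ∈ Finset.range k, c i, fun ω ↦ (Finset.abs_sum_le_sum_abs _ _).trans ?_⟩
    exact Finset.sum_le_sum fun i hi ↦ hc i ((Finset.mem_range.1 hi).trans_le hk) ω
  have hint : ∀ (f : Ω → ℝ), Measurable f → (∃ c, ∀ ω, |f ω| ≤ c) → ∀ q : ℝ, 0 ≤ q →
      Integrable (fun ω ↦ |f ω| ^ q) P := by
    rintro f hf ⟨c, hc⟩ q hq
    refine integrable_of_bounded (c := c ^ q) ((hf.abs.pow_const q).aestronglyMeasurable) fun ω ↦ ?_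
    rw [abs_of_nonneg (by positivity)]
    exact Real.rpow_le_rpow (abs_nonneg _) (hc ω) hq
  have step : ∀ k < m, ∫ ω, |S (k + 1) ω| ^ p ∂P ≤ (1 + C / m) * ∫ ω, |S k ω| ^ p ∂P
      + C * ((m : ℝ) ^ (p / 2 - 1) + 1) * a ^ p := by
    intro k hk
    have mS := (hSm k hk.le).mono (hle k) le_rfl
    have me := (hmeas k hk).mono (hle _) le_rfl
    obtain ⟨c1, hc1⟩ := hSb k hk.le
    obtain ⟨c2, hc2⟩ := hbdd k hk
    have i1 := hint _ mS ⟨c1, hc1⟩ p (by linarith)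
    have i2 := hint _ me ⟨c2, hc2⟩ p (by linarith)
    set g : Ω → ℝ := fun ω ↦ |S k ω| ^ (p - 2) * S k ω with hg
    have hgm : Measurable[𝓕 k] g := by
      refine Measurable.mul ?_ (hSm k hk.le)
      exact (measurable_abs.comp (hSm k hk.le)).pow_const _
    have hgb : ∀ ω, |g ω| ≤ c1 ^ (p - 2) * c1 := by
      intro ω
      rw [hg, abs_mul, abs_of_nonneg (by positivity : 0 ≤ |S k ω| ^ (p - 2))]
      have := hc1 ω
      have h1 : 0 ≤ p - 2 := by linarith
      have h2 : 0 ≤ c1 := (abs_nonneg _).trans this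
      gcongr
    have ige : Integrable (fun ω ↦ g ω * e k ω) P := by
      refine integrable_of_bounded (c := (c1 ^ (p - 2) * c1) * c2)
        ((hgm.mono (hle k) le_rfl).mul me).aestronglyMeasurable fun ω ↦ ?_
      rw [abs_mul]
      exact mul_le_mul (hgb ω) (hc2 ω) (abs_nonneg _) ((abs_nonneg _).trans (hgb ω))
    have ie : Integrable (e k) P := integrable_of_bounded me.aestronglyMeasurable hc2
    have hz : ∫ ω, g ω * e k ω ∂P = 0 := by
      have h1 := condExp_mul_of_stronglyMeasurable_left hgm.stronglyMeasurable ige ie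
      rw [← integral_condExp (hle k), integral_eq_zero_of_ae]
      filter_upwards [h1, hmart k hk] with ω h1 hω
      exact h1.trans (by simp [hω])
    have hpt : ∀ ω, |S (k + 1) ω| ^ p ≤ (1 + C / m) * |S k ω| ^ p + p * (g ω * e k ω)
        + C * ((m : ℝ) ^ (p / 2 - 1) + 1) * |e k ω| ^ p := by
      intro ω
      have h1 := abs_add_rpow_le hp (S k ω) (e k ω)
      have h4 := mul_le_mul_of_nonneg_left (rpow_mul_sq_le hp hm' (S k ω) (e k ω)) hC0
      rw [← hC] at h1
      simp only [hS, hg, Finset.sum_range_succ] at h1 h4 ⊢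
      linear_combination h1 + h4
    have hE := (eLpNorm_le_ofReal_iff (by linarith) ha
      (MemLp.of_bound me.aestronglyMeasurable c2 (ae_of_all _ hc2))).1 (hnorm k hk)
    obtain ⟨c3, hc3⟩ := hSb (k + 1) hk
    have i3 := hint _ ((hSm (k + 1) hk).mono (hle _) le_rfl) ⟨c3, hc3⟩ p (by linarith)
    have i12 : Integrable (fun ω ↦ (1 + C / m) * |S k ω| ^ p + p * (g ω * e k ω)) P :=
      (i1.const_mul (1 + C / m)).add (ige.const_mul p)
    have h5 := integral_mono i3 (i12.add (i2.const_mul (C * ((m : ℝ) ^ (p / 2 - 1) + 1)))) hpt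
    simp only [Pi.add_apply] at h5
    rw [integral_add i12 (i2.const_mul _), integral_add (i1.const_mul _) (ige.const_mul _),
      integral_const_mul,
      integral_const_mul, integral_const_mul, hz] at h5
    linarith [mul_le_mul_of_nonneg_left hE (by positivity : 0 ≤ C * ((m : ℝ) ^ (p / 2 - 1) + 1))]
  set D := C * ((m : ℝ) ^ (p / 2 - 1) + 1) * a ^ p with hD
  have hD0 : 0 ≤ D := by positivity
  have ind : ∀ k ≤ m, ∫ ω, |S k ω| ^ p ∂P ≤ k * (1 + C / m) ^ k * D := by
    intro k
    induction k with
    | zero =>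
      intro _
      simp [hS, Real.zero_rpow (by linarith : p ≠ 0)]
    | succ k ih =>
      intro hk
      have h3 : 1 ≤ 1 + C / m := le_add_of_nonneg_right (by positivity)
      have h4 : D ≤ (1 + C / m) ^ (k + 1) * D := le_mul_of_one_le_left hD0 (one_le_pow₀ h3)
      have h5 := mul_le_mul_of_nonneg_left (ih (by omega)) (by linarith : 0 ≤ 1 + C / m)
      push_cast
      linear_combination step k hk + h4 + h5
  have hexp : (1 + C / m) ^ m ≤ Real.exp C := by
    have h1 : 1 + C / m ≤ Real.exp (C / m) := by linarith [Real.add_one_le_exp (C / m)]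
    calc (1 + C / m) ^ m ≤ Real.exp (C / m) ^ m := by gcongr
      _ = Real.exp C := by rw [← Real.exp_nat_mul]; congr 1; field_simp
  obtain ⟨c3, hc3⟩ := hSb m le_rfl
  have mS := (hSm m le_rfl).mono (hle m) le_rfl
  refine (eLpNorm_le_ofReal_iff (by linarith) (by have := martConst_nonneg hp; positivity)
    (MemLp.of_bound mS.aestronglyMeasurable c3 (ae_of_all _ hc3))).2 ((ind m le_rfl).trans ?_)
  have h1m : (1 : ℝ) ≤ m := by exact_mod_cast hm
  have hone : (1 : ℝ) ≤ (m : ℝ) ^ (p / 2 - 1) := Real.one_le_rpow h1m (by linarith)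
  have hK : (martConst p * √m * a) ^ p = 2 * C * Real.exp C * (m : ℝ) ^ (p / 2) * a ^ p := by
    rw [Real.mul_rpow (by have := martConst_nonneg hp; positivity) ha,
      Real.mul_rpow (martConst_nonneg hp) (by positivity), martConst,
      ← Real.rpow_mul (by positivity), one_div_mul_cancel (by linarith), Real.rpow_one,
      Real.sqrt_eq_rpow, ← Real.rpow_mul hm'.le, ← hC]
    ring_nf
  rw [hK]
  have e2 : (m : ℝ) ^ (p / 2) = m * (m : ℝ) ^ (p / 2 - 1) := by
    rw [mul_comm, ← Real.rpow_add_one hm'.ne']; congr 1; ring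
  rw [e2, hD]
  have hap : 0 ≤ a ^ p := by positivity
  calc (m : ℝ) * (1 + C / m) ^ m * (C * ((m : ℝ) ^ (p / 2 - 1) + 1) * a ^ p)
      ≤ m * Real.exp C * (C * ((m : ℝ) ^ (p / 2 - 1) + (m : ℝ) ^ (p / 2 - 1)) * a ^ p) := by gcongr
    _ = _ := by ring

end Lp

/-! ### Averages over translations -/

/-- The average `∫ f(x + y) m(dy)` of the translates of `f`. If `m` is the law of `L_t`, this is
the transition semigroup `P_t f (x)`. -/
noncomputable def avg {E : Type*} [Add E] [MeasurableSpace E] (m : Measure E) (f : E → ℝ) (x : E) :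
    ℝ :=
  ∫ y, f (x + y) ∂m

section Avg

variable {E : Type*} [NormedAddCommGroup E] [MeasurableSpace E] [BorelSpace E]
  [SecondCountableTopology E] {m m' : Measure E} [IsProbabilityMeasure m]
  [IsProbabilityMeasure m'] {f g : E → ℝ} {A : ℝ}

lemma integrable_translate (hf : Measurable f) (hA : ∀ x, |f x| ≤ A) (x : E) :
    Integrable (fun y ↦ f (x + y)) m :=
  integrable_of_bounded (hf.comp (measurable_const_add x)).aestronglyMeasurable fun _ ↦ hA _

lemma integrableOn_comp_of_bounded {Ω : Type*} [MeasurableSpace Ω] {P : Measure Ω}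
    [IsProbabilityMeasure P] (hf : Measurable f) (hA : ∀ x, |f x| ≤ A) {Z : Ω → E}
    (hZ : Measurable Z) (S : Set Ω) : IntegrableOn (fun ω ↦ f (Z ω)) S P :=
  (integrable_of_bounded (hf.comp hZ).aestronglyMeasurable fun _ ↦ hA _).integrableOn

lemma integrable_min_norm_rpow (θ : ℝ) : Integrable (fun y : E ↦ min (‖y‖ ^ θ) 1) m :=
  integrable_of_bounded (c := 1) (Measurable.aestronglyMeasurable (by fun_prop)) fun y ↦ by
    rw [abs_of_nonneg (by positivity)]; exact min_le_right _ _

lemma abs_integral_le_of_bounded {Ω : Type*} [MeasurableSpace Ω] {P : Measure Ω}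
    [IsProbabilityMeasure P] {f : Ω → ℝ} (hA : ∀ x, |f x| ≤ A) : |∫ y, f y ∂P| ≤ A := by
  have := norm_integral_le_of_norm_le_const (μ := P) (f := f) (C := A) (ae_of_all _ hA)
  simpa using this

lemma abs_avg_le (hA : ∀ x, |f x| ≤ A) (x : E) : |avg m f x| ≤ A :=
  abs_integral_le_of_bounded fun _ ↦ hA _

lemma measurable_avg (hf : Measurable f) : Measurable (avg m f) := by
  have h : StronglyMeasurable (fun p : E × E ↦ f (p.1 + p.2)) :=
    (hf.comp (measurable_fst.add measurable_snd)).stronglyMeasurable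
  exact h.integral_prod_right.measurable

lemma avg_sub (hf : Measurable f) (hA : ∀ x, |f x| ≤ A) {B : ℝ} (hg : Measurable g)
    (hB : ∀ x, |g x| ≤ B) (x : E) : avg m (fun y ↦ f y - g y) x = avg m f x - avg m g x :=
  integral_sub (integrable_translate hf hA x) (integrable_translate hg hB x)

lemma avg_const_mul (c : ℝ) (x : E) : avg m (fun y ↦ c * f y) x = c * avg m f x :=
  integral_const_mul _ _

lemma avg_translate (h x : E) : avg m (fun y ↦ f (y + h)) x = avg m f (x + h) := by
  simp only [avg, add_right_comm]

lemma avg_conv (hf : Measurable f) (hA : ∀ x, |f x| ≤ A) (x : E) :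
    avg (m ∗ m') f x = avg m (avg m' f) x := by
  have hm : Measurable fun y ↦ f (x + y) := hf.comp (measurable_const_add x)
  unfold avg
  rw [Measure.conv, integral_map (by fun_prop) hm.aestronglyMeasurable, integral_prod]
  · simp only [add_assoc]
  · exact integrable_of_bounded ((hm.comp measurable_add).aestronglyMeasurable) fun _ ↦ hA _

lemma avg_sub_const (hf : Measurable f) (hA : ∀ x, |f x| ≤ A) (c : ℝ) (x : E) :
    avg m f x - c = ∫ y, (f (x + y) - c) ∂m := by
  rw [integral_sub (integrable_translate hf hA x) (integrable_const _)]
  simp [avg]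

/-- Averaging preserves any modulus of continuity. -/
lemma abs_avg_sub_avg_le (hf : Measurable f) (hA : ∀ x, |f x| ≤ A) {x y : E} {c : ℝ}
    (h : ∀ z, |f (x + z) - f (y + z)| ≤ c) : |avg m f x - avg m f y| ≤ c := by
  unfold avg
  rw [← integral_sub (integrable_translate hf hA x) (integrable_translate hf hA y)]
  exact abs_integral_le_of_bounded h

/-- The independence lemma: if `Z` is `𝓕`-measurable and `ξ` is independent of `𝓕`, then the
conditional expectation of `f (Z + ξ)` is the average of `f` over the law of `ξ`, at `Z`. -/
theorem setIntegral_indep_add {Ω : Type*} {𝓕 mΩ : MeasurableSpace Ω} {P : Measure Ω}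
    [IsProbabilityMeasure P] (h𝓕 : 𝓕 ≤ mΩ) {Z ξ : Ω → E}
    (hZ : Measurable[𝓕] Z) (hξ : Measurable ξ)
    (hind : Indep (MeasurableSpace.comap ξ inferInstance) 𝓕 P) (hlaw : P.map ξ = m)
    (hf : Measurable f) (hA : ∀ x, |f x| ≤ A) {s : Set Ω} (hs : MeasurableSet[𝓕] s) :
    ∫ ω in s, f (Z ω + ξ ω) ∂P = ∫ ω in s, avg m f (Z ω) ∂P := by
  classical
  set U : Ω → ℝ × E := fun ω ↦ (s.indicator (fun _ ↦ (1 : ℝ)) ω, Z ω) with hU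
  have hUm : Measurable[𝓕] U := Measurable.prodMk (Measurable.indicator measurable_const hs) hZ
  have hUm' : Measurable U := hUm.mono h𝓕 le_rfl
  have hI : IndepFun U ξ P := by
    rw [IndepFun_iff_Indep]
    exact indep_of_indep_of_le_left hind.symm (measurable_iff_comap_le.1 hUm)
  have hmap := (indepFun_iff_map_prod_eq_prod_map_map hUm'.aemeasurable hξ.aemeasurable).1 hI
  rw [hlaw] at hmap
  have : IsProbabilityMeasure (P.map U) := Measure.isProbabilityMeasure_map hUm'.aemeasurable
  have hG : Measurable (fun q : (ℝ × E) × E ↦ q.1.1 * f (q.1.2 + q.2)) := by fun_prop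
  have hs' := h𝓕 _ hs
  have key : ∀ φ : Ω → ℝ, ∫ ω in s, φ ω ∂P = ∫ ω, (U ω).1 * φ ω ∂P := fun φ ↦ by
    rw [← integral_indicator hs']
    refine integral_congr_ae (ae_of_all _ fun ω ↦ ?_)
    by_cases h : ω ∈ s <;> simp [hU, h]
  have hf' := measurable_avg (m := m) hf
  have hG2 : Measurable (fun q : ℝ × E ↦ q.1 * avg m f q.2) := by fun_prop
  rw [key, key, ← integral_map (φ := fun ω ↦ (U ω, ξ ω)) (by fun_prop) hG.aestronglyMeasurable,
    hmap, ← integral_map (φ := U) hUm'.aemeasurable hG2.aestronglyMeasurable, integral_prod]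
  · refine integral_congr_ae (ae_of_all _ fun q ↦ ?_)
    simp only [avg, integral_const_mul]
  · rw [← hmap]
    refine (integrable_map_measure hG.aestronglyMeasurable (by fun_prop)).2 ?_
    refine integrable_of_bounded (c := A) (hG.comp (hUm'.prodMk hξ)).aestronglyMeasurable fun ω ↦ ?_
    have hA' := hA (Z ω + ξ ω)
    by_cases h : ω ∈ s
    · simpa [hU, h] using hA'
    · simpa [hU, h] using (abs_nonneg _).trans hA'

end Avg

/-- A bound on all integrals over `𝓕`-measurable sets bounds the conditional expectation. -/
lemma abs_condExp_le_of_forall_setIntegral {Ω : Type*} {𝓕 mΩ : MeasurableSpace Ω} {P : Measure Ω}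
    [IsProbabilityMeasure P] (h𝓕 : 𝓕 ≤ mΩ) {e : Ω → ℝ} (he : Integrable e P)
    {a : ℝ} (h : ∀ s, MeasurableSet[𝓕] s → |∫ ω in s, e ω ∂P| ≤ a * P.real s) :
    ∀ᵐ ω ∂P, |(P[e|𝓕]) ω| ≤ a := by
  have key : ∀ e : Ω → ℝ, Integrable e P →
      (∀ s, MeasurableSet[𝓕] s → |∫ ω in s, e ω ∂P| ≤ a * P.real s) →
      P[e|𝓕] ≤ᵐ[P] fun _ ↦ a := by
    intro e he h
    have h1 : P[e|𝓕] ≤ᵐ[P.trim h𝓕] fun _ ↦ a := by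
      refine ae_le_of_forall_setIntegral_le ?_ (integrable_const _) fun s hs _ ↦ ?_
      · exact integrable_condExp.trim h𝓕 stronglyMeasurable_condExp
      · rw [← setIntegral_trim h𝓕 stronglyMeasurable_condExp hs, setIntegral_condExp h𝓕 he hs,
          setIntegral_const, measureReal_def, trim_measurableSet_eq h𝓕 hs, smul_eq_mul, mul_comm]
        exact (le_abs_self _).trans (h s hs)
    exact ae_le_of_ae_le_trim h1
  have h2 := key (-e) he.neg fun s hs ↦ by simpa [integral_neg] using h s hs
  filter_upwards [key e he h, h2, condExp_neg (μ := P) e 𝓕] with ω h3 h4 h5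
  rw [h5] at h4
  simp only [Pi.neg_apply] at h4
  exact abs_le.2 ⟨by linarith, h3⟩

/-! ### Hölder norms -/

section HolderNorms

variable {E F : Type*} [NormedAddCommGroup E] [NormedSpace ℝ E] [MeasurableSpace E] [BorelSpace E]
  [NormedAddCommGroup F] [NormedSpace ℝ F] [MeasurableSpace F] {β β' : ℝ} {f : E → F}

lemma supENorm_le_ofReal_iff {X F : Type*} [NormedAddCommGroup F] {f : X → F} {A : ℝ}
    (hA : 0 ≤ A) : supENorm f ≤ ENNReal.ofReal A ↔ ∀ x, ‖f x‖ ≤ A := by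
  simp only [supENorm, iSup_le_iff, ← ofReal_norm, ENNReal.ofReal_le_ofReal_iff hA]

lemma cNorm_zero_le_ofReal {f : E → ℝ} {A : ℝ} (hf : Measurable f) (hA : ∀ x, |f x| ≤ A) :
    cNorm 0 f ≤ ENNReal.ofReal A := by
  rw [cNorm, if_pos le_rfl, if_pos hf, supENorm_le_ofReal_iff ((abs_nonneg _).trans (hA 0))]
  exact hA

lemma measurable_of_cNorm_lt_top {β : ℝ} {f : E → ℝ} (h : cNorm β f < ∞) : Measurable f := by
  unfold cNorm at h
  split_ifs at h with h1 h2 h3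
  · exact h2
  · exact absurd h (lt_irrefl _)
  · exact h3.continuous.measurable
  · exact absurd h (lt_irrefl _)

lemma holderOrder_lt (hβ : 0 < β) : (holderOrder β : ℝ) < β := by
  have h1 : 1 ≤ ⌈β⌉₊ := Nat.ceil_pos.2 hβ
  have h2 := Nat.ceil_lt_add_one hβ.le
  rw [holderOrder, Nat.cast_sub h1]
  push_cast; linarith

lemma holderOrder_mono (h : β' ≤ β) : holderOrder β' ≤ holderOrder β :=
  Nat.sub_le_sub_right (Nat.ceil_mono h) 1

lemma bounds_of_cNorm_lt_top (hβ : 0 < β) (h : cNorm β f < ∞) : ContDiff ℝ (holderOrder β : ℕ∞) f ∧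
      (∀ j ≤ holderOrder β, ∀ x, ‖iteratedFDeriv ℝ j f x‖ ≤ (cNorm β f).toReal) ∧
      ∀ x y, ‖iteratedFDeriv ℝ (holderOrder β) f x - iteratedFDeriv ℝ (holderOrder β) f y‖
        ≤ (cNorm β f).toReal * ‖x - y‖ ^ (β - holderOrder β) := by
  have he : cNorm β f = ENNReal.ofReal (cNorm β f).toReal := (ENNReal.ofReal_toReal h.ne).symm
  set N := (cNorm β f).toReal with hN
  have hN0 : 0 ≤ N := ENNReal.toReal_nonneg
  unfold cNorm at he h
  rw [if_neg (not_le.2 hβ)] at he h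
  split_ifs at he h with h1
  swap
  · exact absurd h (lt_irrefl _)
  refine ⟨h1, fun j hj ↦ ?_, fun x y ↦ ?_⟩
  · refine (supENorm_le_ofReal_iff hN0).1 (he ▸ le_trans ?_ le_self_add)
    exact Finset.single_le_sum (f := fun j ↦ supENorm (iteratedFDeriv ℝ j f))
      (fun _ _ ↦ zero_le) (Finset.mem_range.2 (by omega))
  · have h2 : eHolderNorm (β - holderOrder β).toNNReal (iteratedFDeriv ℝ (holderOrder β) f)
        ≤ ENNReal.ofReal N := he ▸ le_add_self
    have hm : MemHolder (β - holderOrder β).toNNReal (iteratedFDeriv ℝ (holderOrder β) f) :=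
      eHolderNorm_lt_top.1 (h2.trans_lt ENNReal.ofReal_lt_top)
    have h3 := hm.holderWith.dist_le x y
    rw [← hm.coe_nnHolderNorm_eq_eHolderNorm, ENNReal.coe_nnreal_eq,
      ENNReal.ofReal_le_ofReal_iff hN0] at h2
    rw [Real.coe_toNNReal _ (sub_nonneg.2 (holderOrder_lt hβ).le), dist_eq_norm, dist_eq_norm] at h3
    exact h3.trans (by gcongr)

lemma cNorm_le_of_bounds {a c : ℝ} (hβ : 0 < β) (hf : ContDiff ℝ (holderOrder β : ℕ∞) f)
    (ha0 : 0 ≤ a) (hc0 : 0 ≤ c)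
    (ha : ∀ j ≤ holderOrder β, ∀ x, ‖iteratedFDeriv ℝ j f x‖ ≤ a)
    (hc : ∀ x y, ‖iteratedFDeriv ℝ (holderOrder β) f x - iteratedFDeriv ℝ (holderOrder β) f y‖
      ≤ c * ‖x - y‖ ^ (β - holderOrder β)) :
    cNorm β f ≤ ENNReal.ofReal ((holderOrder β + 1) * a + c) := by
  have hθ := sub_nonneg.2 (holderOrder_lt hβ).le
  rw [cNorm, if_neg (not_le.2 hβ), if_pos hf, ENNReal.ofReal_add (by positivity) hc0]
  gcongr
  · calc _ ≤ ∑ j ∈ Finset.range (holderOrder β + 1), ENNReal.ofReal a :=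
          Finset.sum_le_sum fun j hj ↦ (supENorm_le_ofReal_iff ha0).2
            (ha j (Nat.lt_succ_iff.1 (Finset.mem_range.1 hj)))
      _ = _ := by
          rw [Finset.sum_const, Finset.card_range, nsmul_eq_mul, ENNReal.ofReal_mul (by positivity),
            ← Nat.cast_succ, ENNReal.ofReal_natCast]
  · have hw : HolderWith c.toNNReal (β - holderOrder β).toNNReal
        (iteratedFDeriv ℝ (holderOrder β) f) := by
      intro x y
      rw [edist_dist, edist_dist, dist_eq_norm, dist_eq_norm, Real.coe_toNNReal _ hθ,
        ENNReal.ofReal_rpow_of_nonneg (norm_nonneg _) hθ]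
      exact (ENNReal.ofReal_le_ofReal (hc x y)).trans_eq (ENNReal.ofReal_mul hc0)
    exact hw.eHolderNorm_le

/-- Interpolation of a bound and a Hölder bound. -/
lemma le_rpow_of_le_of_le_rpow {q N r a b : ℝ} (hN : 0 ≤ N) (hr : 0 ≤ r) (ha : 0 < a) (hab : a ≤ b)
    (h1 : q ≤ 2 * N) (h2 : q ≤ N * r ^ b) : q ≤ 2 * N * r ^ a := by
  rcases le_total r 1 with h | h
  · have h3 : r ^ b ≤ r ^ a := by
      rcases hr.eq_or_lt with rfl | h0
      · rw [Real.zero_rpow ha.ne', Real.zero_rpow (by linarith)]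
      · exact Real.rpow_le_rpow_of_exponent_ge h0 h hab
    have h4 : 0 ≤ r ^ a := by positivity
    nlinarith [mul_le_mul_of_nonneg_left h3 hN, mul_nonneg hN h4]
  · have h3 : 1 ≤ r ^ a := Real.one_le_rpow h ha.le
    nlinarith

lemma cNorm_mono (hβ' : 0 < β') (h : β' ≤ β) (hfin : cNorm β f < ∞) :
    cNorm β' f ≤ ((holderOrder β' + 3 : ℕ) : ℝ≥0) * cNorm β f := by
  have hβ := hβ'.trans_le h
  obtain ⟨h1, h2, h3⟩ := bounds_of_cNorm_lt_top hβ hfin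
  set N := (cNorm β f).toReal with hN
  have hN0 : 0 ≤ N := ENNReal.toReal_nonneg
  set k := holderOrder β with hk
  set k' := holderOrder β' with hk'
  have hkk : k' ≤ k := holderOrder_mono h
  have hθ : 0 < β' - k' := sub_pos.2 (holderOrder_lt hβ')
  have key : ∀ x y, ‖iteratedFDeriv ℝ k' f x - iteratedFDeriv ℝ k' f y‖
      ≤ 2 * N * ‖x - y‖ ^ (β' - k') := by
    intro x y
    have hb : ‖iteratedFDeriv ℝ k' f x - iteratedFDeriv ℝ k' f y‖ ≤ 2 * N :=
      (norm_sub_le _ _).trans (by linarith [h2 k' hkk x, h2 k' hkk y])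
    rcases hkk.eq_or_lt with he | hlt
    · refine le_rpow_of_le_of_le_rpow hN0 (norm_nonneg _) hθ
        (b := β - k) (by rw [he]; linarith) hb ?_
      rw [he]; exact h3 x y
    · refine le_rpow_of_le_of_le_rpow hN0 (norm_nonneg _) hθ (b := 1) ?_ hb ?_
      · have := Nat.le_ceil β'
        have h4 : ⌈β'⌉₊ ≤ k' + 1 := by rw [hk', holderOrder]; omega
        have h5 : (⌈β'⌉₊ : ℝ) ≤ k' + 1 := by exact_mod_cast h4
        linarith
      · rw [Real.rpow_one]
        have hd : Differentiable ℝ (iteratedFDeriv ℝ k' f) :=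
          h1.differentiable_iteratedFDeriv (by exact_mod_cast hlt)
        refine Convex.norm_image_sub_le_of_norm_fderiv_le (fun z _ ↦ hd z) (fun z _ ↦ ?_)
          convex_univ (Set.mem_univ y) (Set.mem_univ x)
        rw [norm_fderiv_iteratedFDeriv]
        exact h2 _ hlt z
  have h4 := cNorm_le_of_bounds hβ' (h1.of_le (by exact_mod_cast hkk)) hN0
    (mul_nonneg zero_le_two hN0) (fun j hj ↦ h2 j (hj.trans hkk)) key
  refine h4.trans (le_of_eq ?_)
  have h5 : ((k' : ℝ) + 1) * N + 2 * N = (k' + 3 : ℕ) * N := by push_cast; ring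
  rw [h5, ENNReal.ofReal_mul (by positivity), ENNReal.ofReal_natCast, hN,
    ENNReal.ofReal_toReal hfin.ne]
  simp

lemma holderOrder_two_add {η : ℝ} (hη : 0 < η) (hη1 : η ≤ 1) : holderOrder (2 + η) = 2 := by
  have : ⌈2 + η⌉₊ = 3 := (Nat.ceil_eq_iff (by norm_num)).2 ⟨by push_cast; linarith,
    by push_cast; linarith⟩
  rw [holderOrder, this]

lemma holderOrder_one : holderOrder 1 = 0 := by simp [holderOrder]

lemma cNorm_one_le_of_bounds {f : E → ℝ} {a c : ℝ} (hc0 : 0 ≤ c) (ha : ∀ x, |f x| ≤ a)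
    (hc : ∀ x y, |f x - f y| ≤ c * ‖x - y‖) : cNorm 1 f ≤ ENNReal.ofReal (a + c) := by
  have hcont : Continuous f := by
    refine (LipschitzWith.of_dist_le_mul (K := c.toNNReal) fun x y ↦ ?_).continuous
    rw [Real.dist_eq, dist_eq_norm, Real.coe_toNNReal _ hc0]
    exact hc x y
  have h := cNorm_le_of_bounds (f := f) (β := 1) (a := a) (c := c) one_pos
    (by rw [holderOrder_one]; exact contDiff_zero.2 hcont) ((abs_nonneg _).trans (ha 0)) hc0
    (fun j hj x ↦ ?_) fun x y ↦ ?_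
  · simpa [holderOrder_one] using h
  · rw [holderOrder_one, Nat.le_zero] at hj
    rw [hj, norm_iteratedFDeriv_zero]
    exact ha x
  · rw [holderOrder_one, iteratedFDeriv_zero_eq_comp]
    simp only [Function.comp]
    rw [← map_sub, LinearIsometryEquiv.norm_map]
    simpa using hc x y

lemma norm_le_of_cNorm_lt_top (hβ : 0 < β) (h : cNorm β f < ∞) (x : E) :
    ‖f x‖ ≤ (cNorm β f).toReal := by
  simpa using (bounds_of_cNorm_lt_top hβ h).2.1 0 (Nat.zero_le _) x

lemma holder_of_cNorm_lt_top (hβ' : 0 < β') (hβ1 : β' ≤ 1) (hβ : β' ≤ β) (h : cNorm β f < ∞)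
    (x y : E) : ‖f x - f y‖ ≤ 3 * (cNorm β f).toReal * ‖x - y‖ ^ β' := by
  have hk : holderOrder β' = 0 := by
    rw [holderOrder, Nat.sub_eq_zero_iff_le]; exact Nat.ceil_le.2 (by simpa)
  have h1 := cNorm_mono hβ' hβ h
  rw [hk] at h1
  have hlt : ((0 + 3 : ℕ) : ℝ≥0) * cNorm β f < ∞ := ENNReal.mul_lt_top (by simp) h
  have h2 := ENNReal.toReal_mono hlt.ne h1
  have h3 := (bounds_of_cNorm_lt_top hβ' (h1.trans_lt hlt)).2.2 x y
  rw [hk, iteratedFDeriv_zero_eq_comp] at h3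
  simp only [Function.comp, ← map_sub, LinearIsometryEquiv.norm_map, Nat.cast_zero, sub_zero] at h3
  refine h3.trans (by gcongr; simpa using h2)

lemma abs_le_of_cNorm_lt_top (hβ : 0 ≤ β) {f : E → ℝ} (h : cNorm β f < ∞) (x : E) :
    |f x| ≤ (cNorm β f).toReal := by
  rcases hβ.eq_or_lt with rfl | hβ
  · have h2 := (ENNReal.ofReal_toReal h.ne).ge
    rw [cNorm, if_pos le_rfl, if_pos (measurable_of_cNorm_lt_top h)] at h2 ⊢
    exact (supENorm_le_ofReal_iff ENNReal.toReal_nonneg).1 h2 x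
  · exact norm_le_of_cNorm_lt_top hβ h x

end HolderNorms

/-! ### Regularization by the semigroup -/

/-- The difference operator `f ↦ f(· + h) - f`. -/
def incr {E F : Type*} [Add E] [Sub F] (h : E) (f : E → F) (x : E) : F := f (x + h) - f x

section Incr

variable {E : Type*} [NormedAddCommGroup E] [MeasurableSpace E] [BorelSpace E]
  [SecondCountableTopology E] {f : E → ℝ} {A : ℝ}

lemma measurable_incr (hf : Measurable f) (h : E) : Measurable (incr h f) :=
  (hf.comp (measurable_add_const h)).sub hf

lemma abs_incr_le (hA : ∀ x, |f x| ≤ A) (h x : E) : |incr h f x| ≤ 2 * A := by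
  have := abs_sub (f (x + h)) (f x)
  unfold incr; linarith [hA x, hA (x + h)]

lemma avg_incr {m : Measure E} [IsProbabilityMeasure m] (hf : Measurable f) (hA : ∀ x, |f x| ≤ A)
    (h : E) : avg m (incr h f) = incr h (avg m f) := by
  ext x
  have hm : Measurable fun y ↦ f (y + h) := hf.comp (measurable_add_const h)
  unfold incr
  rw [avg_sub hm (fun _ ↦ hA _) hf hA, ← avg_translate h x]

lemma measurable_of_abs_sub_le {Λ : ℝ} (h : ∀ x y, |f x - f y| ≤ Λ * ‖x - y‖) : Measurable f := by
  have : LipschitzWith Λ.toNNReal f := LipschitzWith.of_dist_le_mul fun x y ↦ by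
    rw [Real.dist_eq, dist_eq_norm, Real.coe_toNNReal']
    exact (h x y).trans (by gcongr; exact le_max_left _ _)
  exact this.continuous.measurable

/-- Approximation of a bounded Hölder function by a Lipschitz function at scale `ρ`, by
infimal convolution with a multiple of the norm. -/
lemma exists_lipschitz_approx {β ρ : ℝ} (hβ : 0 < β) (hβ1 : β < 1) (hρ : 0 < ρ)
    (hA : ∀ x, |f x| ≤ A) (hf : ∀ x y, |f x - f y| ≤ A * ‖x - y‖ ^ β) :
    ∃ g : E → ℝ, Measurable g ∧ (∀ x, |g x| ≤ A) ∧
      (∀ x y, |g x - g y| ≤ A * ρ ^ (β - 1) * ‖x - y‖) ∧ ∀ x, |f x - g x| ≤ A * ρ ^ β := by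
  have hA0 : 0 ≤ A := (abs_nonneg _).trans (hA 0)
  set Λ := A * ρ ^ (β - 1) with hΛ
  have hΛ0 : 0 ≤ Λ := by positivity
  set g : E → ℝ := fun x ↦ ⨅ y, (f y + Λ * ‖x - y‖) with hg
  have hlow : ∀ x y, -A ≤ f y + Λ * ‖x - y‖ := fun x y ↦ by
    have := (abs_le.1 (hA y)).1
    have : 0 ≤ Λ * ‖x - y‖ := by positivity
    linarith
  have hbdd : ∀ x, BddBelow (Set.range fun y ↦ f y + Λ * ‖x - y‖) := fun x ↦
    ⟨-A, by rintro _ ⟨y, rfl⟩; exact hlow x y⟩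
  have hgf : ∀ x, g x ≤ f x := fun x ↦ by
    have := ciInf_le (hbdd x) x
    simpa using this
  have hlip1 : ∀ x y, g x ≤ g y + Λ * ‖x - y‖ := fun x y ↦ by
    rw [← sub_le_iff_le_add]
    refine le_ciInf fun z ↦ ?_
    have h1 := ciInf_le (hbdd x) z
    have h2 : Λ * ‖x - z‖ ≤ Λ * ‖x - y‖ + Λ * ‖y - z‖ := by
      rw [← mul_add]; gcongr; exact norm_sub_le_norm_sub_add_norm_sub x y z
    have h3 : g x ≤ f z + Λ * ‖x - z‖ := h1
    linarith
  have hlip : ∀ x y, |g x - g y| ≤ Λ * ‖x - y‖ := fun x y ↦ by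
    have h1 := hlip1 x y
    have h2 := hlip1 y x
    rw [norm_sub_rev y x] at h2
    exact abs_le.2 ⟨by linarith, by linarith⟩
  refine ⟨g, measurable_of_abs_sub_le hlip, fun x ↦ abs_le.2 ⟨le_ciInf (hlow x),
    (hgf x).trans (abs_le.1 (hA x)).2⟩, hlip, fun x ↦ ?_⟩
  rw [abs_of_nonneg (by linarith [hgf x])]
  have : f x - A * ρ ^ β ≤ g x := le_ciInf fun y ↦ by
    have h1 := (abs_le.1 (hf x y)).2
    have h2 : A * ‖x - y‖ ^ β ≤ A * ρ ^ β + Λ * ‖x - y‖ := by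
      rcases le_total ‖x - y‖ ρ with h | h
      · have : A * ‖x - y‖ ^ β ≤ A * ρ ^ β := by gcongr
        have : 0 ≤ Λ * ‖x - y‖ := by positivity
        linarith
      · have h0 : 0 < ‖x - y‖ := hρ.trans_le h
        have h3 : ‖x - y‖ ^ β ≤ ρ ^ (β - 1) * ‖x - y‖ := by
          have : ‖x - y‖ ^ β = ‖x - y‖ ^ (β - 1) * ‖x - y‖ := by
            rw [← Real.rpow_add_one h0.ne']; congr 1; ring
          rw [this]
          exact mul_le_mul_of_nonneg_right
            (Real.rpow_le_rpow_of_nonpos hρ h (sub_nonpos.2 hβ1.le)) h0.le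
        have h4 := mul_le_mul_of_nonneg_left h3 hA0
        have : 0 ≤ A * ρ ^ β := by positivity
        rw [hΛ, mul_assoc]; linarith
    linarith
  linarith

end Incr

variable {E : Type*} [NormedAddCommGroup E] [InnerProductSpace ℝ E] [FiniteDimensional ℝ E]
  [MeasurableSpace E] [BorelSpace E]

/-- The laws `m t` of a process with stationary independent increments that satisfies
the gradient, generator and moment bounds with `α = α' = 2` and constants `M`. The generator bound
enters through its consequence `|P_h f - f| ≤ h ‖ℒ f‖`. -/
structure IsHeatSemigroup (m : ℝ → Measure E) (M : HConstants) : Prop where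
  prob : ∀ t, IsProbabilityMeasure (m t)
  conv : ∀ s t, 0 ≤ s → 0 ≤ t → m (s + t) = m s ∗ m t
  diff : ∀ (f : E → ℝ) (A : ℝ), Measurable f → (∀ x, |f x| ≤ A) → ∀ t, 0 < t → t ≤ 1 →
    Differentiable ℝ (avg (m t) f)
  lip : ∀ (f : E → ℝ) (A : ℝ), Measurable f → (∀ x, |f x| ≤ A) → ∀ t, 0 < t → t ≤ 1 →
    ∀ x h, |incr h (avg (m t) f) x| ≤ M.grad * t ^ (-(1 / 2) : ℝ) * A * ‖h‖
  gen : ∀ ε : ℝ, 0 < ε → ∀ f : E → ℝ, cNorm (2 + ε) f < ∞ → ∀ h, 0 ≤ h → ∀ x,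
    |avg (m h) f x - f x| ≤ h * (M.gen 0 ε * (cNorm (2 + ε) f).toReal)
  mom : ∀ p : ℝ, 0 < p → p < 2 → ∀ ε : ℝ, 0 < ε → ∀ t, 0 < t → t ≤ 1 →
    ∫ y, min (‖y‖ ^ p) 1 ∂(m t) ≤ M.mom p ε * t ^ (p / 2 - ε)

section

variable {F : Type*} [NormedAddCommGroup F] [NormedSpace ℝ F]

lemma fderiv_incr {G : E → F} (hG : Differentiable ℝ G) (h : E) :
    fderiv ℝ (incr h G) = incr h (fderiv ℝ G) := by
  ext1 x
  have hd : DifferentiableAt ℝ (fun z ↦ G (z + h)) x :=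
    (hG (x + h)).comp x (differentiableAt_id.add_const h)
  unfold incr
  rw [fderiv_fun_sub hd (hG x), fderiv_comp_add_right]

lemma contDiff_incr {k : WithTop ℕ∞} {G : E → F} (hG : ContDiff ℝ k G) (h : E) :
    ContDiff ℝ k (incr h G) :=
  (hG.comp (contDiff_id.add contDiff_const)).sub hG

lemma iteratedFDeriv_incr {k : ℕ} {G : E → F} (hG : ContDiff ℝ k G) (h x : E) :
    iteratedFDeriv ℝ k (incr h G) x = iteratedFDeriv ℝ k G (x + h) - iteratedFDeriv ℝ k G x := by
  have h1 : incr h G = (fun z ↦ G (z + h)) - G := rfl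
  have h2 : ContDiff ℝ k fun z ↦ G (z + h) := hG.comp (contDiff_id.add contDiff_const)
  rw [h1, iteratedFDeriv_sub h2 hG, Pi.sub_apply, iteratedFDeriv_comp_add_right]

end

/-- A bound on `C^{2+η}` norms in terms of bounds on differences of order up to three. -/
lemma cNorm_le_of_incr {η : ℝ} (hη : 0 < η) (hη1 : η < 1) {F : E → ℝ} (hF : ContDiff ℝ (2 : ℕ) F)
    {a₀ a₁ a₂ a₃ : ℝ} (ha₁ : 0 ≤ a₁) (ha₂ : 0 ≤ a₂) (ha₃ : 0 ≤ a₃) (h₀ : ∀ x, |F x| ≤ a₀)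
    (h₁ : ∀ h x, |incr h F x| ≤ a₁ * ‖h‖)
    (h₂ : ∀ h k x, |incr h (incr k F) x| ≤ a₂ * ‖k‖ * ‖h‖)
    (h₃ : ∀ h k l x, |incr h (incr k (incr l F)) x| ≤ a₃ * ‖l‖ * ‖k‖ * ‖h‖) :
    cNorm (2 + η) F ≤ ENNReal.ofReal (3 * (a₀ + a₁ + a₂) + (2 * a₂) ^ (1 - η) * a₃ ^ η) := by
  have ha₀ : 0 ≤ a₀ := (abs_nonneg _).trans (h₀ 0)
  -- the derivative is bounded by the first differences
  have hfd : ∀ {G : E → ℝ} {c : ℝ}, 0 ≤ c → (∀ h x, |incr h G x| ≤ c * ‖h‖) →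
      ∀ x, ‖fderiv ℝ G x‖ ≤ c := by
    intro G c hc h x
    refine norm_fderiv_le_of_lip' ℝ hc (Eventually.of_forall fun y ↦ ?_)
    simpa [incr] using h (y - x) x
  have hsec : ∀ {G : E → ℝ} (_ : ContDiff ℝ (2 : ℕ) G) {c : ℝ}, 0 ≤ c →
      (∀ h k x, |incr h (incr k G) x| ≤ c * ‖k‖ * ‖h‖) →
      ∀ x, ‖iteratedFDeriv ℝ 2 G x‖ ≤ c := by
    intro G hG c hc h x
    rw [← norm_iteratedFDeriv_fderiv (n := 1), norm_iteratedFDeriv_one]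
    refine norm_fderiv_le_of_lip' ℝ hc (Eventually.of_forall fun y ↦ ?_)
    have := hfd (G := incr (y - x) G) (c := c * ‖y - x‖) (by positivity)
      (fun h' z ↦ h h' (y - x) z) x
    rw [fderiv_incr (hG.differentiable (by norm_num))] at this
    simpa [incr] using this
  have hord := holderOrder_two_add hη hη1.le
  have b₂ := hsec hF ha₂ h₂
  refine (cNorm_le_of_bounds (a := a₀ + a₁ + a₂) (c := (2 * a₂) ^ (1 - η) * a₃ ^ η)
    (by linarith) (by rwa [hord]) (by positivity) (by positivity) (fun j hj x ↦ ?_)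
    fun x y ↦ ?_).trans_eq (by rw [hord]; norm_num)
  · rw [hord] at hj
    interval_cases j
    · rw [norm_iteratedFDeriv_zero, Real.norm_eq_abs]; linarith [h₀ x]
    · rw [norm_iteratedFDeriv_one]; linarith [hfd ha₁ h₁ x]
    · linarith [b₂ x]
  · have b3 := hsec (contDiff_incr hF (x - y)) (c := a₃ * ‖x - y‖) (by positivity)
      (fun h k z ↦ h₃ h k (x - y) z) y
    rw [iteratedFDeriv_incr hF, add_sub_cancel] at b3
    rw [hord]
    have b4 := norm_sub_le (iteratedFDeriv ℝ 2 F x) (iteratedFDeriv ℝ 2 F y)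
    set q := ‖iteratedFDeriv ℝ 2 F x - iteratedFDeriv ℝ 2 F y‖
    have hq0 : 0 ≤ q := norm_nonneg _
    calc q = q ^ (1 - η) * q ^ η := by
          rw [← Real.rpow_add_of_nonneg hq0 (by linarith) hη.le]; simp
      _ ≤ (2 * a₂) ^ (1 - η) * (a₃ * ‖x - y‖) ^ η := by
          gcongr
          linarith [b₂ x, b₂ y]
      _ = _ := by rw [Real.mul_rpow ha₃ (norm_nonneg _), Nat.cast_ofNat, add_sub_cancel_left]; ring

lemma half_rpow_le {t a : ℝ} (ht : 0 < t) (ha : -2 ≤ a) : (t / 2) ^ a ≤ 4 * t ^ a := by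
  rw [Real.div_rpow ht.le (by norm_num), div_le_iff₀ (by positivity)]
  have h1 : (2 : ℝ) ^ (-2 : ℝ) ≤ 2 ^ a := Real.rpow_le_rpow_of_exponent_le (by norm_num) ha
  have h2 : (2 : ℝ) ^ (-2 : ℝ) = 1 / 4 := by rw [Real.rpow_neg (by norm_num)]; norm_num
  rw [h2] at h1
  have : 0 ≤ t ^ a := by positivity
  nlinarith

namespace IsHeatSemigroup

variable {m : ℝ → Measure E} {M : HConstants} (hm : IsHeatSemigroup m M)
include hm

lemma avg_add_time {f : E → ℝ} {A : ℝ} (hf : Measurable f) (hA : ∀ x, |f x| ≤ A) {s t : ℝ}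
    (hs : 0 ≤ s) (ht : 0 ≤ t) : avg (m (s + t)) f = avg (m s) (avg (m t) f) := by
  have := hm.prob
  ext x
  rw [hm.conv s t hs ht, avg_conv hf hA]

lemma avg_half {f : E → ℝ} {A : ℝ} (hf : Measurable f) (hA : ∀ x, |f x| ≤ A) {t : ℝ}
    (ht : 0 ≤ t) : avg (m t) f = avg (m (t / 2)) (avg (m (t / 2)) f) := by
  rw [← hm.avg_add_time hf hA (by positivity) (by positivity), add_halves]

lemma abs_incr_avg_le_of_lipschitz {f : E → ℝ} {A Λ : ℝ} (hf : Measurable f) (hA : ∀ x, |f x| ≤ A)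
    (hΛ : ∀ x y, |f x - f y| ≤ Λ * ‖x - y‖) (t : ℝ) (h x : E) :
    |incr h (avg (m t) f) x| ≤ Λ * ‖h‖ := by
  have := hm.prob
  refine abs_avg_sub_avg_le hf hA fun z ↦ ?_
  have := hΛ (x + h + z) (x + z)
  rwa [show x + h + z - (x + z) = h by abel] at this

/-- The semigroup maps bounded functions to smooth functions. -/
lemma contDiff_avg (n : ℕ) : ∀ {f : E → ℝ} {A : ℝ}, Measurable f → (∀ x, |f x| ≤ A) →
    ∀ {t : ℝ}, 0 < t → t ≤ 1 → ContDiff ℝ n (avg (m t) f) := by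
  have hp := hm.prob
  induction n with
  | zero =>
    intro f A hf hA t ht ht1
    exact contDiff_zero.2 (hm.diff f A hf hA t ht ht1).continuous
  | succ n ih =>
    intro f A hf hA t ht ht1
    have hA0 : 0 ≤ A := (abs_nonneg _).trans (hA 0)
    set G := avg (m (t / 2)) f with hG
    have hGd : Differentiable ℝ G := hm.diff f A hf hA _ (by positivity) (by linarith)
    have hGA : ∀ x, |G x| ≤ A := fun x ↦ abs_avg_le hA x
    have hGm : Measurable G := measurable_avg hf
    set Λ := M.grad * (t / 2) ^ (-(1 / 2) : ℝ) * A with hΛ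
    have hΛ0 : 0 ≤ Λ := by positivity
    have hGb : ∀ x, ‖fderiv ℝ G x‖ ≤ Λ := fun x ↦ by
      refine norm_fderiv_le_of_lip' ℝ hΛ0 (Eventually.of_forall fun y ↦ ?_)
      have := hm.lip f A hf hA (t / 2) (by positivity) (by linarith) x (y - x)
      rwa [incr, add_sub_cancel] at this
    have hFd : ∀ x, HasFDerivAt (avg (m (t / 2)) G) (∫ y, fderiv ℝ G (x + y) ∂(m (t / 2))) x := by
      intro x
      refine hasFDerivAt_integral_of_dominated_of_fderiv_le (bound := fun _ ↦ Λ)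
        (F' := fun x y ↦ fderiv ℝ G (x + y)) univ_mem ?_ ?_ ?_ ?_ (integrable_const _) ?_
      · exact Eventually.of_forall fun z ↦ (hGm.comp (measurable_const_add z)).aestronglyMeasurable
      · exact integrable_translate hGm hGA x
      · exact ((measurable_fderiv ℝ G).comp (measurable_const_add x)).aestronglyMeasurable
      · exact ae_of_all _ fun y z _ ↦ hGb _
      · exact ae_of_all _ fun y z _ ↦ (hasFDerivAt_comp_add_right y).2 (hGd (z + y)).hasFDerivAt
    have hF : avg (m t) f = avg (m (t / 2)) G := hm.avg_half hf hA ht.le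
    rw [hF]
    push_cast
    rw [contDiff_succ_iff_fderiv_apply]
    refine ⟨fun x ↦ (hFd x).differentiableAt, by simp, fun v ↦ ?_⟩
    have e : (fun x ↦ fderiv ℝ (avg (m (t / 2)) G) x v)
        = avg (m (t / 2)) (fun z ↦ fderiv ℝ G z v) := by
      ext x
      rw [(hFd x).fderiv, ContinuousLinearMap.integral_apply]
      · rfl
      · exact Integrable.of_bound
          ((measurable_fderiv ℝ G).comp (measurable_const_add x)).aestronglyMeasurable Λ
          (ae_of_all _ fun y ↦ hGb _)
    rw [e]
    exact ih (A := Λ * ‖v‖) (measurable_fderiv_apply_const ℝ G v)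
      (fun x ↦ ((fderiv ℝ G x).le_opNorm v).trans (by gcongr; exact hGb x))
      (by positivity) (by linarith)

/-- The time regularity of `P_t f` for Lipschitz `f`, from the generator bound. -/
lemma abs_avg_add_sub_avg_le_of_lipschitz {η : ℝ} (hη : 0 < η) (hη1 : η < 1) {f : E → ℝ}
    {A Λ : ℝ} (hf : Measurable f) (hA : ∀ x, |f x| ≤ A)
    (hΛ : ∀ x y, |f x - f y| ≤ Λ * ‖x - y‖) (hΛ0 : 0 ≤ Λ) {t r : ℝ} (ht : 0 < t) (ht1 : t ≤ 1)
    (hr : 0 ≤ r) (x : E) :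
    |avg (m (t + r)) f x - avg (m t) f x| ≤
      r * (M.gen 0 η * (3 * A + 8 * (M.grad + 1) ^ 2 * Λ * t ^ (-(1 + η) / 2))) := by
  have hp := hm.prob
  have hA0 : 0 ≤ A := (abs_nonneg _).trans (hA 0)
  set K : ℝ := M.grad + 1 with hK
  have hg0 : (0 : ℝ) ≤ M.grad := M.grad.2
  have hK1 : 1 ≤ K := by linarith
  set F := avg (m t) f with hF
  have hFm : Measurable F := measurable_avg hf
  have hFA : ∀ x, |F x| ≤ A := fun x ↦ abs_avg_le hA x
  have lip : ∀ {g : E → ℝ} {B : ℝ}, Measurable g → (∀ x, |g x| ≤ B) → ∀ {s : ℝ}, 0 < s → s ≤ 1 →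
      ∀ h x, |incr h (avg (m s) g) x| ≤ K * s ^ (-(1 / 2) : ℝ) * B * ‖h‖ := by
    intro g B hg hB s hs hs1 h x
    have hB0 : 0 ≤ B := (abs_nonneg _).trans (hB 0)
    refine (hm.lip g B hg hB s hs hs1 x h).trans ?_
    gcongr
    linarith
  have hfi : ∀ k x, |incr k f x| ≤ Λ * ‖k‖ := fun k x ↦ by
    have := hΛ (x + k) x
    rwa [add_sub_cancel_left] at this
  have i1 : ∀ k, incr k F = avg (m t) (incr k f) := fun k ↦ (avg_incr hf hA k).symm
  have i2 : ∀ k l, incr k (incr l F)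
      = avg (m (t / 2)) (incr k (avg (m (t / 2)) (incr l f))) := fun k l ↦ by
    have hb := abs_incr_le hA l
    rw [i1, hm.avg_half (measurable_incr hf l) hb ht.le, avg_incr (measurable_avg
      (measurable_incr hf l)) (fun x ↦ abs_avg_le hb x)]
  have hKK : K ≤ K ^ 2 := by nlinarith
  have c := cNorm_le_of_incr hη hη1 (F := F) (a₀ := A) (a₁ := Λ)
    (a₂ := K ^ 2 * Λ * t ^ (-(1 / 2) : ℝ)) (a₃ := 2 * K ^ 2 * Λ * t ^ (-1 : ℝ))
    (hm.contDiff_avg 2 hf hA ht ht1) hΛ0 (by positivity) (by positivity) hFA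
    (fun h x ↦ hm.abs_incr_avg_le_of_lipschitz hf hA hΛ t h x)
    (fun h k x ↦ by
      rw [i1]
      refine (lip (measurable_incr hf k) (hfi k) ht ht1 h x).trans ?_
      calc _ = K * Λ * t ^ (-(1 / 2) : ℝ) * ‖k‖ * ‖h‖ := by ring
        _ ≤ _ := by gcongr)
    (fun h k l x ↦ by
      rw [i2]
      refine (lip (measurable_incr (measurable_avg (measurable_incr hf l)) k)
        (fun y ↦ lip (measurable_incr hf l) (hfi l) (by positivity) (by linarith) k y)
        (by positivity) (by linarith) h x).trans_eq ?_
      have : (t / 2) ^ (-(1 / 2) : ℝ) * (t / 2) ^ (-(1 / 2) : ℝ) = 2 * t ^ (-1 : ℝ) := by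
        rw [← Real.rpow_add (by positivity), ← sub_eq_zero]
        norm_num [Real.rpow_neg_one]
        field_simp
        norm_num
      linear_combination K ^ 2 * Λ * ‖l‖ * ‖k‖ * ‖h‖ * this)
  rw [add_comm t r, hm.avg_add_time hf hA hr ht.le]
  refine (hm.gen η hη F (c.trans_lt ENNReal.ofReal_lt_top) r hr x).trans ?_
  gcongr
  refine (ENNReal.toReal_le_of_le_ofReal (by positivity) c).trans ?_
  have p1 : 1 ≤ t ^ (-(1 + η) / 2) := Real.one_le_rpow_of_pos_of_le_one_of_nonpos ht ht1
    (by linarith)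
  have p2 : t ^ (-(1 / 2) : ℝ) ≤ t ^ (-(1 + η) / 2) :=
    Real.rpow_le_rpow_of_exponent_ge ht ht1 (by linarith)
  have p3 : (2 * (K ^ 2 * Λ * t ^ (-(1 / 2) : ℝ))) ^ (1 - η) * (2 * K ^ 2 * Λ * t ^ (-1 : ℝ)) ^ η
      = 2 * K ^ 2 * Λ * t ^ (-(1 + η) / 2) := by
    rw [← mul_assoc, ← mul_assoc,
      Real.mul_rpow (x := 2 * K ^ 2 * Λ) (by positivity) (by positivity),
      Real.mul_rpow (x := 2 * K ^ 2 * Λ) (by positivity) (by positivity), ← Real.rpow_mul ht.le,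
      ← Real.rpow_mul ht.le,
      mul_mul_mul_comm, ← Real.rpow_add ht,
      ← Real.rpow_add_of_nonneg (by positivity) (by linarith) hη.le, sub_add_cancel, Real.rpow_one]
    ring_nf
  have p4 : Λ ≤ K ^ 2 * Λ * t ^ (-(1 + η) / 2) := by
    calc Λ = 1 * Λ * 1 := by ring
      _ ≤ _ := by gcongr; exact hK1.trans hKK
  have p5 := mul_le_mul_of_nonneg_left p2 (by positivity : 0 ≤ K ^ 2 * Λ)
  linarith

/-- The time regularity of `P_t f` for bounded `f`. -/
lemma abs_avg_add_sub_avg_le_of_bounded {η : ℝ} (hη : 0 < η) (hη1 : η < 1) {f : E → ℝ}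
    {A : ℝ} (hf : Measurable f) (hA : ∀ x, |f x| ≤ A) {t r : ℝ} (ht : 0 < t) (ht1 : t ≤ 1)
    (hr : 0 ≤ r) (x : E) :
    |avg (m (t + r)) f x - avg (m t) f x| ≤
      r * (35 * M.gen 0 η * (M.grad + 1) ^ 3 * A * t ^ (-1 - η / 2)) := by
  have hp := hm.prob
  have hA0 : 0 ≤ A := (abs_nonneg _).trans (hA 0)
  have hg0 : (0 : ℝ) ≤ M.grad := M.grad.2
  have hG0 : (0 : ℝ) ≤ M.gen 0 η := (M.gen 0 η).2
  set K : ℝ := M.grad + 1 with hK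
  have hK1 : 1 ≤ K := by linarith
  set g := avg (m (t / 2)) f with hg
  have hgA : ∀ x, |g x| ≤ A := fun x ↦ abs_avg_le hA x
  have hgm : Measurable g := measurable_avg hf
  set Λ := K * (t / 2) ^ (-(1 / 2) : ℝ) * A with hΛ
  have hgΛ : ∀ x y, |g x - g y| ≤ Λ * ‖x - y‖ := fun x y ↦ by
    have := hm.lip f A hf hA (t / 2) (by positivity) (by linarith) y (x - y)
    simp only [incr, add_sub_cancel] at this
    refine this.trans ?_
    rw [hΛ]; gcongr; linarith
  have e1 : avg (m t) f = avg (m (t / 2)) g := hm.avg_half hf hA ht.le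
  have e2 : avg (m (t + r)) f = avg (m (t / 2 + r)) g := by
    rw [hg, ← hm.avg_add_time hf hA (by positivity) (by positivity)]
    congr 2; ring
  rw [e1, e2]
  refine (hm.abs_avg_add_sub_avg_le_of_lipschitz hη hη1 hgm hgA hgΛ (by positivity)
    (by positivity : 0 < t / 2) (by linarith) hr x).trans ?_
  have p1 : Λ * (t / 2) ^ (-(1 + η) / 2) ≤ K * A * (4 * t ^ (-1 - η / 2)) := by
    rw [hΛ]
    have : (t / 2) ^ (-(1 / 2) : ℝ) * (t / 2) ^ (-(1 + η) / 2) = (t / 2) ^ (-1 - η / 2) := by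
      rw [← Real.rpow_add (by positivity)]; ring_nf
    calc K * (t / 2) ^ (-(1 / 2) : ℝ) * A * (t / 2) ^ (-(1 + η) / 2)
        = K * A * (t / 2) ^ (-1 - η / 2) := by rw [← this]; ring
      _ ≤ _ := by gcongr; exact half_rpow_le ht (by linarith)
  have p2 : 1 ≤ t ^ (-1 - η / 2) := Real.one_le_rpow_of_pos_of_le_one_of_nonpos ht ht1 (by linarith)
  have p3 : A ≤ K ^ 3 * A * t ^ (-1 - η / 2) := by
    have : 1 ≤ K ^ 3 := one_le_pow₀ hK1
    calc A = 1 * A * 1 := by ring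
      _ ≤ _ := by gcongr
  have p4 := mul_le_mul_of_nonneg_left p1 (by positivity : 0 ≤ 8 * K ^ 2)
  calc _ ≤ r * (M.gen 0 η * (35 * (K ^ 3 * A * t ^ (-1 - η / 2)))) := by gcongr; nlinarith
    _ = _ := by ring

end IsHeatSemigroup

/-- The regularization estimates for a function `f`, with exponent `γ`. Informally, they say that
`f` behaves like a function of Hölder regularity `2 γ`. -/
structure IsRegularized (m : ℝ → Measure E) (f : E → ℝ) (A C γ : ℝ) : Prop where
  prob : ∀ t, IsProbabilityMeasure (m t)
  conv : ∀ s t, 0 ≤ s → 0 ≤ t → m (s + t) = m s ∗ m t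
  cont : Continuous f
  bdd : ∀ x, |f x| ≤ A
  nonneg : 0 ≤ C
  lip : ∀ t, 0 < t → t ≤ 1 → ∀ h x, |incr h (avg (m t) f) x| ≤ C * t ^ (γ - 1 / 2) * ‖h‖
  lip₂ : ∀ t, 0 < t → t ≤ 1 → ∀ h k x,
    |incr h (incr k (avg (m t) f)) x| ≤ C * t ^ (γ - 1) * ‖k‖ * ‖h‖
  sub : ∀ t, 0 < t → t ≤ 1 → ∀ x, |avg (m t) f x - f x| ≤ C * t ^ γ
  time : ∀ t, 0 < t → t ≤ 1 → ∀ r, 0 ≤ r → ∀ x,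
    |avg (m (t + r)) f x - avg (m t) f x| ≤ C * r * t ^ (γ - 1)
  time_lip : ∀ t, 0 < t → t ≤ 1 → ∀ r, 0 ≤ r → ∀ h x,
    |incr h (avg (m (t + r)) f) x - incr h (avg (m t) f) x| ≤ C * r * t ^ (γ - 3 / 2) * ‖h‖

lemma continuous_of_holder {f : E → ℝ} {A β : ℝ} (hβ : 0 < β)
    (h : ∀ x y, |f x - f y| ≤ A * ‖x - y‖ ^ β) : Continuous f := by
  refine continuous_iff_continuousAt.2 fun x ↦ tendsto_iff_norm_sub_tendsto_zero.2 ?_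
  have h2 : Tendsto (fun y ↦ A * ‖y - x‖ ^ β) (𝓝 x) (𝓝 (A * ‖x - x‖ ^ β)) := by
    refine Tendsto.const_mul _ (Tendsto.rpow_const ?_ (Or.inr hβ.le))
    exact ((continuous_id.sub continuous_const).norm).tendsto x
  rw [sub_self, norm_zero, Real.zero_rpow hβ.ne', mul_zero] at h2
  exact squeeze_zero (fun _ ↦ norm_nonneg _) (fun y ↦ h y x) h2

lemma abs_incr_le_min {f : E → ℝ} {A β : ℝ} (hA : ∀ x, |f x| ≤ A)
    (h : ∀ x y, |f x - f y| ≤ A * ‖x - y‖ ^ β) (y x : E) :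
    |f (x + y) - f x| ≤ 2 * A * min (‖y‖ ^ β) 1 := by
  have hA0 : 0 ≤ A := (abs_nonneg _).trans (hA 0)
  rw [mul_min_of_nonneg _ _ (by positivity), mul_one]
  refine le_min ?_ (abs_incr_le hA _ _)
  have h1 := h (x + y) x
  rw [add_sub_cancel_left] at h1
  have : 0 ≤ A * ‖y‖ ^ β := by positivity
  linarith

/-- Bounded `β`-Hölder functions are regularized with any exponent `γ = (β - η) / 2`. -/
theorem exists_isRegularized (M : HConstants) {β η A : ℝ} (hη : 0 < η) (hηβ : η < β)
    (hβ1 : β < 1) (hA0 : 0 ≤ A) : ∃ C, 0 ≤ C ∧ ∀ (m : ℝ → Measure E), IsHeatSemigroup m M →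
      ∀ f : E → ℝ, (∀ x, |f x| ≤ A) → (∀ x y, |f x - f y| ≤ A * ‖x - y‖ ^ β) →
        IsRegularized m f A C ((β - η) / 2) := by
  have hβ : 0 < β := hη.trans hηβ
  have hη1 : η < 1 := hηβ.trans hβ1
  set K : ℝ := M.grad + 1 with hK
  have hg0 : (0 : ℝ) ≤ M.grad := M.grad.2
  have hK1 : 1 ≤ K := by linarith
  set G : ℝ := (M.gen 0 η : ℝ) with hG
  have hG0 : 0 ≤ G := (M.gen 0 η).2
  set Mo : ℝ := (M.mom β (η / 2) : ℝ) with hMo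
  have hMo0 : 0 ≤ Mo := (M.mom β (η / 2)).2
  set C := 2 * K * A + 8 * K ^ 2 * A + 2 * A * Mo + 50 * G * K ^ 3 * A + 280 * G * K ^ 4 * A
    with hC
  have c1 : 0 ≤ 2 * K * A := by positivity
  have c2 : 0 ≤ 8 * K ^ 2 * A := by positivity
  have c3 : 0 ≤ 2 * A * Mo := by positivity
  have c4 : 0 ≤ 50 * G * K ^ 3 * A := by positivity
  have c5 : 0 ≤ 280 * G * K ^ 4 * A := by positivity
  have hC0 : 0 ≤ C := by positivity
  refine ⟨C, hC0, fun m hm f hA hf ↦ ?_⟩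
  have hp := hm.prob
  have hfc := continuous_of_holder hβ hf
  have hfm := hfc.measurable
  have mono : ∀ {t : ℝ}, 0 < t → t ≤ 1 → ∀ {a b : ℝ}, b ≤ a → t ^ a ≤ t ^ b :=
    fun ht ht1 _ _ h ↦ Real.rpow_le_rpow_of_exponent_ge ht ht1 h
  have mul : ∀ {t : ℝ}, 0 < t → ∀ {a b c : ℝ}, a + b = c → t ^ a * t ^ b = t ^ c :=
    fun ht _ _ _ h ↦ by rw [← Real.rpow_add ht, h]
  -- the gradient estimate, by splitting `f` at scale `√t`
  have r1 : ∀ {t : ℝ}, 0 < t → t ≤ 1 → ∀ h x,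
      |incr h (avg (m t) f) x| ≤ 2 * K * A * t ^ ((β - 1) / 2) * ‖h‖ := by
    intro t ht ht1 h x
    obtain ⟨g, hgm, hgA, hgΛ, hfg⟩ := exists_lipschitz_approx hβ hβ1
      (by positivity : 0 < t ^ (1 / 2 : ℝ)) hA hf
    have q1 := hm.abs_incr_avg_le_of_lipschitz hgm hgA hgΛ t h x
    have q2 := hm.lip (fun x ↦ f x - g x) _ (hfm.sub hgm) hfg t ht ht1 x h
    have e : incr h (avg (m t) f) x
        = incr h (avg (m t) g) x + incr h (avg (m t) fun x ↦ f x - g x) x := by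
      simp_rw [incr, avg_sub hfm hA hgm hgA]; ring
    rw [← Real.rpow_mul ht.le] at q1 q2
    rw [e]
    refine (abs_add_le _ _).trans ((add_le_add q1 q2).trans ?_)
    have e2 := mul ht (show -(1 / 2) + 1 / 2 * β = (β - 1) / 2 by ring)
    have : 0 ≤ A * t ^ ((β - 1) / 2) * ‖h‖ := by positivity
    rw [show (1 / 2 : ℝ) * (β - 1) = (β - 1) / 2 by ring, hK]
    linear_combination M.grad * A * ‖h‖ * e2 + (M.grad + 1) * this
  have r4 : ∀ {t : ℝ}, 0 < t → t ≤ 1 → ∀ {r : ℝ}, 0 ≤ r → ∀ x,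
      |avg (m (t + r)) f x - avg (m t) f x| ≤ 50 * G * K ^ 3 * A * r * t ^ ((β - η) / 2 - 1) := by
    intro t ht ht1 r hr x
    obtain ⟨g, hgm, hgA, hgΛ, hfg⟩ := exists_lipschitz_approx hβ hβ1
      (by positivity : 0 < t ^ (1 / 2 : ℝ)) hA hf
    have q1 := hm.abs_avg_add_sub_avg_le_of_lipschitz hη hη1 hgm hgA hgΛ (by positivity) ht ht1 hr x
    have q2 := hm.abs_avg_add_sub_avg_le_of_bounded hη hη1 (hfm.sub hgm) hfg ht ht1 hr x
    have e : avg (m (t + r)) f x - avg (m t) f x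
        = (avg (m (t + r)) g x - avg (m t) g x) + (avg (m (t + r)) (fun x ↦ f x - g x) x
          - avg (m t) (fun x ↦ f x - g x) x) := by
      simp_rw [avg_sub hfm hA hgm hgA]; ring
    rw [← Real.rpow_mul ht.le] at q1 q2
    rw [e]
    have s1 := mul ht (show 1 / 2 * (β - 1) + -(1 + η) / 2 = (β - η) / 2 - 1 by ring)
    have s2 := mul ht (show 1 / 2 * β + (-1 - η / 2) = (β - η) / 2 - 1 by ring)
    have s3 : 1 ≤ t ^ ((β - η) / 2 - 1) :=
      Real.one_le_rpow_of_pos_of_le_one_of_nonpos ht ht1 (by linarith)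
    refine (abs_add_le _ _).trans ((add_le_add q1 q2).trans ?_)
    set T := t ^ ((β - η) / 2 - 1) with hT
    have k2 : K ^ 2 ≤ K ^ 3 := pow_le_pow_right₀ hK1 (by norm_num)
    calc _ = r * G * A * (3 + 8 * K ^ 2 * T + 35 * K ^ 3 * T) := by
          linear_combination r * G * A * 8 * K ^ 2 * s1 + r * G * A * 35 * K ^ 3 * s2
      _ ≤ r * G * A * (50 * K ^ 3 * T) := by
          gcongr
          nlinarith [one_le_pow₀ hK1 (n := 3)]
      _ = _ := by ring
  refine ⟨hm.prob, hm.conv, hfc, hA, hC0, ?_, ?_, ?_, ?_, ?_⟩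
  · intro t ht ht1 h x
    refine (r1 ht ht1 h x).trans ?_
    have h1 : t ^ ((β - 1) / 2) ≤ t ^ ((β - η) / 2 - 1 / 2) := mono ht ht1 (by linarith)
    have h2 : 2 * K * A ≤ C := by linarith
    gcongr
  · intro t ht ht1 h k x
    have e : incr k (avg (m t) f) = avg (m (t / 2)) (incr k (avg (m (t / 2)) f)) := by
      rw [hm.avg_half hfm hA ht.le, avg_incr (measurable_avg hfm) (fun x ↦ abs_avg_le hA x)]
    rw [e]
    have q := hm.lip _ _ (measurable_incr (measurable_avg hfm) k)
      (fun y ↦ r1 (t := t / 2) (by positivity) (by linarith) k y) (t / 2) (by positivity)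
      (by linarith) x h
    refine q.trans ?_
    have s : (t / 2) ^ (-(1 / 2) : ℝ) * (t / 2) ^ ((β - 1) / 2) ≤ 4 * t ^ ((β - η) / 2 - 1) := by
      rw [← Real.rpow_add (by positivity)]
      refine (half_rpow_le ht (by linarith)).trans ?_
      exact mul_le_mul_of_nonneg_left (mono ht ht1 (by linarith)) (by norm_num)
    calc _ = 2 * M.grad * K * A * ((t / 2) ^ (-(1 / 2) : ℝ) * (t / 2) ^ ((β - 1) / 2))
          * ‖k‖ * ‖h‖ := by ring
      _ ≤ 2 * K * K * A * (4 * t ^ ((β - η) / 2 - 1)) * ‖k‖ * ‖h‖ := by gcongr; linarith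
      _ = 8 * K ^ 2 * A * t ^ ((β - η) / 2 - 1) * ‖k‖ * ‖h‖ := by ring
      _ ≤ _ := by gcongr; linarith
  · intro t ht ht1 x
    have q := hm.mom β hβ (by linarith) (η / 2) (by positivity) t ht ht1
    rw [avg_sub_const hfm hA]
    calc _ ≤ ∫ y, |f (x + y) - f x| ∂(m t) := abs_integral_le_integral_abs
      _ ≤ ∫ y, 2 * A * min (‖y‖ ^ β) 1 ∂(m t) := integral_mono_of_nonneg
          (ae_of_all _ fun _ ↦ abs_nonneg _) ((integrable_min_norm_rpow β).const_mul _)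
          (ae_of_all _ fun y ↦ abs_incr_le_min hA hf y x)
      _ = 2 * A * ∫ y, min (‖y‖ ^ β) 1 ∂(m t) := integral_const_mul _ _
      _ ≤ 2 * A * (Mo * t ^ (β / 2 - η / 2)) := by gcongr
      _ = 2 * A * Mo * t ^ ((β - η) / 2) := by ring_nf
      _ ≤ _ := by gcongr; linarith
  · intro t ht ht1 r hr x
    exact (r4 ht ht1 hr x).trans (by gcongr; linarith)
  · intro t ht ht1 r hr h x
    set g := incr h (avg (m (t / 2)) f) with hg
    have hgm : Measurable g := measurable_incr (measurable_avg hfm) h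
    have hgA : ∀ y, |g y| ≤ 2 * K * A * (t / 2) ^ ((β - 1) / 2) * ‖h‖ :=
      fun y ↦ r1 (t := t / 2) (by positivity) (by linarith) h y
    have key : ∀ s, 0 ≤ s → incr h (avg (m (t / 2 + s)) f) = avg (m s) g := fun s hs ↦ by
      rw [add_comm, hm.avg_add_time hfm hA hs (by positivity), hg,
        avg_incr (measurable_avg hfm) (fun x ↦ abs_avg_le hA x)]
    have e1 := key (t / 2) (by positivity)
    have e2 := key (t / 2 + r) (by positivity)
    rw [add_halves] at e1
    rw [← add_assoc, add_halves] at e2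
    rw [e1, e2]
    have q := hm.abs_avg_add_sub_avg_le_of_bounded hη hη1 hgm hgA (by positivity : 0 < t / 2)
      (by linarith) hr x
    refine q.trans ?_
    have s : (t / 2) ^ ((β - 1) / 2) * (t / 2) ^ (-1 - η / 2) ≤ 4 * t ^ ((β - η) / 2 - 3 / 2) := by
      rw [← Real.rpow_add (by positivity)]
      refine (half_rpow_le ht (by linarith)).trans (le_of_eq ?_)
      ring_nf
    calc _ = 70 * G * K ^ 4 * A * r * ((t / 2) ^ ((β - 1) / 2) * (t / 2) ^ (-1 - η / 2)) * ‖h‖ := by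
          ring
      _ ≤ 70 * G * K ^ 4 * A * r * (4 * t ^ ((β - η) / 2 - 3 / 2)) * ‖h‖ := by gcongr
      _ = 280 * G * K ^ 4 * A * r * t ^ ((β - η) / 2 - 3 / 2) * ‖h‖ := by ring
      _ ≤ _ := by gcongr; linarith

/-! ### Time integrals of the semigroup -/

/-- The time integral `∫₀^τ P_r f dr` of the semigroup. -/
noncomputable def timeInt (m : ℝ → Measure E) (f : E → ℝ) (τ : ℝ) (x : E) : ℝ :=
  ∫ r in (0 : ℝ)..τ, avg (m r) f x

lemma abs_intervalIntegral_le_rpow {g : ℝ → ℝ} {c a τ : ℝ} (ha : -1 < a) (hτ : 0 ≤ τ)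
    (h : ∀ r, 0 < r → r ≤ τ → |g r| ≤ c * r ^ a) :
    |∫ r in (0 : ℝ)..τ, g r| ≤ c * (τ ^ (a + 1) / (a + 1)) := by
  have h1 : ‖∫ r in (0 : ℝ)..τ, g r‖ ≤ ∫ r in (0 : ℝ)..τ, c * r ^ a :=
    intervalIntegral.norm_integral_le_of_norm_le hτ (ae_of_all _ fun r hr ↦ h r hr.1 hr.2)
      ((intervalIntegral.intervalIntegrable_rpow' ha).const_mul c)
  rw [intervalIntegral.integral_const_mul, integral_rpow (Or.inl ha),
    Real.zero_rpow (by linarith), sub_zero] at h1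
  exact h1

lemma rpow_two_mul {h a : ℝ} (hh : 0 < h) (j : ℕ) :
    h ^ (2 : ℕ) * ((↑(j + 1) : ℝ) * h) ^ a = h ^ (2 + a) * (↑(j + 1) : ℝ) ^ a := by
  rw [Real.mul_rpow (by positivity) hh.le, Real.rpow_add hh, ← Real.rpow_natCast h 2]
  push_cast; ring

lemma abs_sum_le_of_le_rpow {F : ℕ → ℝ} {c h a : ℝ} (hh : 0 < h) {k : ℕ}
    (hF : ∀ j < k, |F j| ≤ c * h ^ (2 : ℕ) * ((↑(j + 1) : ℝ) * h) ^ a) :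
    |∑ j ∈ Finset.range k, F j| ≤ c * h ^ (2 + a) * ∑ j ∈ Finset.range k, (↑(j + 1) : ℝ) ^ a := by
  rw [Finset.mul_sum]
  refine (Finset.abs_sum_le_sum_abs _ _).trans (Finset.sum_le_sum fun j hj ↦
    (hF j (Finset.mem_range.1 hj)).trans_eq ?_)
  rw [mul_assoc, rpow_two_mul hh, mul_assoc]

lemma succ_mul_le_one {h : ℝ} {j k : ℕ} (hh : 0 < h) (hk : (k + 1) * h ≤ 1) (hj : j < k) :
    ((↑(j + 1) : ℝ) + 1) * h ≤ 1 := by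
  refine le_trans ?_ hk
  gcongr
  exact_mod_cast hj

lemma sum_rpow_le_sqrt {a : ℝ} (ha : a ≤ -(1 / 2)) (k : ℕ) :
    ∑ j ∈ Finset.range k, (↑(j + 1) : ℝ) ^ a ≤ 2 * √k := by
  induction k with
  | zero => simp
  | succ k ih =>
    rw [Finset.sum_range_succ]
    have h1 : (↑(k + 1) : ℝ) ^ a ≤ (↑(k + 1) : ℝ) ^ (-(1 / 2) : ℝ) :=
      Real.rpow_le_rpow_of_exponent_le (by push_cast; linarith [(Nat.cast_nonneg k : (0:ℝ) ≤ k)]) ha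
    rw [Real.rpow_neg (by positivity), ← Real.sqrt_eq_rpow] at h1
    have hk0 : 0 < √((k + 1 : ℕ) : ℝ) := Real.sqrt_pos.2 (by positivity)
    have hs1 := Real.sq_sqrt (by positivity : (0 : ℝ) ≤ ((k + 1 : ℕ) : ℝ))
    have hs2 := Real.sq_sqrt (by positivity : (0 : ℝ) ≤ (k : ℝ))
    have hk1 := Real.sqrt_nonneg (k : ℝ)
    have : (√((k + 1 : ℕ) : ℝ))⁻¹ ≤ 2 * √((k + 1 : ℕ) : ℝ) - 2 * √k := by
      rw [inv_le_iff_one_le_mul₀ hk0]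
      push_cast at *
      nlinarith [sq_nonneg (√((k : ℝ) + 1) - √k)]
    linarith

lemma summable_rpow {a : ℝ} (ha : a < -1) : Summable fun j : ℕ ↦ (↑(j + 1) : ℝ) ^ a :=
  (summable_nat_add_iff 1).2 (Real.summable_nat_rpow.2 ha)

namespace IsRegularized

variable {m : ℝ → Measure E} {f : E → ℝ} {A C γ : ℝ} (hf : IsRegularized m f A C γ)
include hf

lemma bound_nonneg : 0 ≤ A := (abs_nonneg _).trans (hf.bdd 0)

lemma abs_avg_sub_avg_le_min {s t : ℝ} (hs : 0 < s) (ht : 0 < t) (hs1 : s ≤ 1) (ht1 : t ≤ 1)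
    (x : E) : |avg (m s) f x - avg (m t) f x| ≤ C * |s - t| * min s t ^ (γ - 1) := by
  rcases le_total s t with h | h
  · have := hf.time s hs hs1 (t - s) (by linarith) x
    rw [add_sub_cancel] at this
    rw [min_eq_left h, abs_sub_comm, abs_sub_comm s t, abs_of_nonneg (sub_nonneg.2 h)]
    exact this
  · have := hf.time t ht ht1 (s - t) (by linarith) x
    rw [add_sub_cancel] at this
    rw [min_eq_right h, abs_of_nonneg (sub_nonneg.2 h)]
    exact this

lemma continuousOn_avg :
    ContinuousOn (fun q : ℝ × E ↦ avg (m q.1) f q.2) (Set.Ioc 0 1 ×ˢ Set.univ) := by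
  rintro ⟨t, x⟩ ⟨ht, -⟩
  obtain ⟨ht0 : 0 < t, ht1 : t ≤ 1⟩ := ht
  refine tendsto_iff_norm_sub_tendsto_zero.2 ?_
  set g : ℝ × E → ℝ := fun q ↦ C * |q.1 - t| * min q.1 t ^ (γ - 1)
    + C * t ^ (γ - 1 / 2) * ‖q.2 - x‖ with hg
  have hg0 : Tendsto g (𝓝[Set.Ioc 0 1 ×ˢ Set.univ] (t, x)) (𝓝 0) := by
    have : ContinuousAt g (t, x) := by
      have h1 : ContinuousAt (fun q : ℝ × E ↦ min q.1 t ^ (γ - 1)) (t, x) :=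
        ContinuousAt.rpow_const (by fun_prop) (Or.inl (by simp [ht0.ne']))
      exact (ContinuousAt.mul (by fun_prop) h1).add (by fun_prop)
    have h2 : g (t, x) = 0 := by simp [hg]
    rw [← h2]
    exact this.tendsto.mono_left nhdsWithin_le_nhds
  refine squeeze_zero' (Eventually.of_forall fun _ ↦ norm_nonneg _) ?_ hg0
  filter_upwards [self_mem_nhdsWithin] with q hq
  obtain ⟨⟨hq0, hq1⟩, -⟩ := hq
  have h1 := hf.abs_avg_sub_avg_le_min hq0 ht0 hq1 ht1 q.2
  have h2 := hf.lip t ht0 ht1 (q.2 - x) x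
  rw [incr, add_sub_cancel] at h2
  calc _ = |(avg (m q.1) f q.2 - avg (m t) f q.2) + (avg (m t) f q.2 - avg (m t) f x)| := by
        rw [Real.norm_eq_abs]; congr 1; ring
    _ ≤ _ := (abs_add_le _ _).trans (add_le_add h1 h2)

lemma intervalIntegrable_avg (x : E) {a b : ℝ} (ha : 0 ≤ a) (ha1 : a ≤ 1) (hb : 0 ≤ b)
    (hb1 : b ≤ 1) : IntervalIntegrable (fun r ↦ avg (m r) f x) volume a b := by
  have := hf.prob
  have h01 : IntegrableOn (fun r ↦ avg (m r) f x) (Set.Ioc 0 1) := by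
    refine Integrable.of_bound (C := A) ?_ (ae_of_all _ fun r ↦ abs_avg_le hf.bdd x)
    refine ContinuousOn.aestronglyMeasurable ?_ measurableSet_Ioc
    exact hf.continuousOn_avg.comp (f := fun r ↦ (r, x)) (by fun_prop) fun r hr ↦ ⟨hr, trivial⟩
  refine intervalIntegrable_iff.2 (h01.mono_set fun r hr ↦ ?_)
  exact ⟨(le_min ha hb).trans_lt hr.1, hr.2.trans (max_le ha1 hb1)⟩

lemma intervalIntegrable_avg_add {s h : ℝ} (hs : 0 ≤ s) (hh : 0 ≤ h) (h1 : s + h ≤ 1) (x : E) :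
    IntervalIntegrable (fun r ↦ avg (m (s + r)) f x) volume 0 h := by
  simpa using (hf.intervalIntegrable_avg x hs (by linarith) (b := s + h) (by linarith)
    h1).comp_add_left s

lemma abs_timeInt_le {τ : ℝ} (hτ : 0 ≤ τ) (x : E) : |timeInt m f τ x| ≤ A * τ := by
  have := hf.prob
  have := intervalIntegral.norm_integral_le_of_norm_le_const (a := 0) (b := τ) (C := A)
    (f := fun r ↦ avg (m r) f x) fun r _ ↦ abs_avg_le hf.bdd x
  rwa [sub_zero, abs_of_nonneg hτ] at this

lemma incr_timeInt {τ : ℝ} (hτ : 0 ≤ τ) (hτ1 : τ ≤ 1) (h x : E) :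
    incr h (timeInt m f τ) x = ∫ r in (0 : ℝ)..τ, incr h (avg (m r) f) x := by
  unfold incr timeInt
  rw [intervalIntegral.integral_sub] <;>
  exact hf.intervalIntegrable_avg _ le_rfl zero_le_one hτ hτ1

lemma abs_incr_timeInt_le (hγ : 0 < γ) {τ : ℝ} (hτ : 0 ≤ τ) (hτ1 : τ ≤ 1) (h x : E) :
    |incr h (timeInt m f τ) x| ≤ 2 * C * τ ^ (γ + 1 / 2) * ‖h‖ := by
  rw [hf.incr_timeInt hτ hτ1]
  refine (abs_intervalIntegral_le_rpow (c := C * ‖h‖) (a := γ - 1 / 2) (by linarith) hτ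
    fun r hr hr1 ↦ ?_).trans ?_
  · rw [mul_right_comm]; exact hf.lip r hr (hr1.trans hτ1) h x
  · have e : γ - 1 / 2 + 1 = γ + 1 / 2 := by ring
    have := hf.nonneg
    rw [e, mul_div_assoc', div_le_iff₀ (by linarith)]
    have : 0 ≤ C * ‖h‖ * τ ^ (γ + 1 / 2) := by positivity
    nlinarith

lemma abs_incr_incr_timeInt_le (hγ : 0 < γ) {τ : ℝ} (hτ : 0 ≤ τ) (hτ1 : τ ≤ 1) (h k x : E) :
    |incr h (incr k (timeInt m f τ)) x| ≤ C / γ * τ ^ γ * ‖k‖ * ‖h‖ := by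
  have e0 : incr h (incr k (timeInt m f τ)) x
      = ∫ r in (0 : ℝ)..τ, incr h (incr k (avg (m r) f)) x := by
    conv_lhs => rw [incr, hf.incr_timeInt hτ hτ1, hf.incr_timeInt hτ hτ1]
    rw [← intervalIntegral.integral_sub]
    · rfl
    all_goals
      exact (hf.intervalIntegrable_avg _ le_rfl zero_le_one hτ hτ1).sub
        (hf.intervalIntegrable_avg _ le_rfl zero_le_one hτ hτ1)
  rw [e0]
  refine (abs_intervalIntegral_le_rpow (c := C * ‖k‖ * ‖h‖) (a := γ - 1) (by linarith) hτ
    fun r hr hr1 ↦ ?_).trans (le_of_eq ?_)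
  · rw [mul_right_comm, mul_right_comm C]; exact hf.lip₂ r hr (hr1.trans hτ1) h k x
  · rw [sub_add_cancel]; field_simp

lemma measurable_timeInt {τ : ℝ} (hγ : 0 < γ) (hτ : 0 ≤ τ) (hτ1 : τ ≤ 1) :
    Measurable (timeInt m f τ) := by
  refine measurable_of_abs_sub_le (Λ := 2 * C * τ ^ (γ + 1 / 2)) fun x y ↦ ?_
  have := hf.abs_incr_timeInt_le hγ hτ hτ1 (x - y) y
  rwa [incr, add_sub_cancel] at this

lemma integrable_prod_avg (μ : Measure E) [IsFiniteMeasure μ] {τ : ℝ} (hτ1 : τ ≤ 1) :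
    Integrable (fun q : ℝ × E ↦ avg (m q.1) f q.2) ((volume.restrict (Set.Ioc 0 τ)).prod μ) := by
  have hp := hf.prob
  refine Integrable.of_bound ?_ A (ae_of_all _ fun q ↦ abs_avg_le hf.bdd _)
  rw [← Measure.restrict_univ (μ := μ), Measure.prod_restrict]
  exact (hf.continuousOn_avg.mono (Set.prod_mono_left (Set.Ioc_subset_Ioc_right hτ1))
    ).aestronglyMeasurable (measurableSet_Ioc.prod MeasurableSet.univ)

/-- The time integral of the semigroup may be exchanged with an integral in space. -/
lemma integral_timeInt (μ : Measure E) [IsFiniteMeasure μ] {τ : ℝ} (hτ : 0 ≤ τ) (hτ1 : τ ≤ 1) :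
    ∫ x, timeInt m f τ x ∂μ = ∫ r in (0 : ℝ)..τ, ∫ x, avg (m r) f x ∂μ := by
  unfold timeInt
  simp_rw [intervalIntegral.integral_of_le hτ]
  exact integral_integral_swap (f := fun x r ↦ avg (m r) f x) (hf.integrable_prod_avg μ hτ1).swap

/-- The semigroup shifts the window of the time integral. -/
lemma avg_timeInt (hγ : 0 < γ) {s τ : ℝ} (hs : 0 ≤ s) (hτ : 0 ≤ τ) (h1 : s + τ ≤ 1) (x : E) :
    avg (m s) (timeInt m f τ) x = timeInt m f (s + τ) x - timeInt m f s x := by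
  have hp := hf.prob
  have hfm := hf.cont.measurable
  have e1 := hf.integral_timeInt ((m s).map (x + ·)) hτ (by linarith)
  rw [integral_map (by fun_prop)
    (hf.measurable_timeInt hγ hτ (by linarith)).aestronglyMeasurable] at e1
  simp_rw [integral_map (measurable_const_add x).aemeasurable
    (measurable_avg hfm).aestronglyMeasurable] at e1
  have e2 : ∫ r in (0 : ℝ)..τ, avg (m s) (avg (m r) f) x
      = ∫ r in (0 : ℝ)..τ, avg (m (r + s)) f x := by
    refine intervalIntegral.integral_congr fun r hr ↦ ?_
    rw [Set.uIcc_of_le hτ] at hr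
    rw [add_comm, hf.conv s r hs hr.1, avg_conv hfm hf.bdd]
  refine e1.trans (e2.trans ?_)
  rw [intervalIntegral.integral_comp_add_right (fun r ↦ avg (m r) f x), zero_add, add_comm τ s]
  unfold timeInt
  rw [intervalIntegral.integral_interval_sub_left] <;>
  exact hf.intervalIntegrable_avg _ le_rfl zero_le_one (by linarith) (by linarith)

/-! ### The quadrature corrector -/

/-- The quadrature defect `∫₀^h P_r f dr - h f` over one step, moved by `j` steps. -/
noncomputable def _root_.LevyEuler.defect (m : ℝ → Measure E) (f : E → ℝ) (h : ℝ) (j : ℕ) : E → ℝ :=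
  if j = 0 then fun x ↦ timeInt m f h x - h * f x
  else fun x ↦ ∫ r in (0 : ℝ)..h, (avg (m (j * h + r)) f x - avg (m (j * h)) f x)

lemma abs_defect_zero_le (hγ : 0 < γ) {h : ℝ} (hh : 0 ≤ h) (hh1 : h ≤ 1) (x : E) :
    |defect m f h 0 x| ≤ C * h ^ (1 + γ) := by
  have e : defect m f h 0 x = ∫ r in (0 : ℝ)..h, (avg (m r) f x - f x) := by
    rw [intervalIntegral.integral_sub (hf.intervalIntegrable_avg x le_rfl zero_le_one hh hh1)
      intervalIntegrable_const]
    simp [defect, timeInt]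
  rw [e]
  refine (abs_intervalIntegral_le_rpow (c := C) (a := γ) (by linarith) hh
    fun r hr hr1 ↦ hf.sub r hr (hr1.trans hh1) x).trans ?_
  have := hf.nonneg
  rw [add_comm γ 1]
  gcongr
  exact div_le_self (by positivity) (by linarith)

lemma defect_eq {h : ℝ} (hh : 0 ≤ h) {j : ℕ} (hj : 0 < j) (hj1 : (j + 1) * h ≤ 1) (x : E) :
    defect m f h j x = timeInt m f (j * h + h) x - timeInt m f (j * h) x
      - h * avg (m (j * h)) f x := by
  have hjh : 0 ≤ (j : ℝ) * h := by positivity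
  have b1 : (j : ℝ) * h + h ≤ 1 := by linarith
  rw [defect, if_neg hj.ne']
  have e := intervalIntegral.integral_comp_add_left (a := 0) (b := h)
    (fun r ↦ avg (m r) f x) (j * h)
  rw [add_zero] at e
  rw [intervalIntegral.integral_sub, e]
  · unfold timeInt
    rw [intervalIntegral.integral_interval_sub_left]
    · simp
    all_goals exact hf.intervalIntegrable_avg _ le_rfl zero_le_one (by linarith) (by linarith)
  · exact hf.intervalIntegrable_avg_add hjh hh b1 x
  · exact intervalIntegrable_const

lemma measurable_defect (hγ : 0 < γ) {h : ℝ} (hh : 0 ≤ h) {j : ℕ} (hj1 : (j + 1) * h ≤ 1) :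
    Measurable (defect m f h j) := by
  have := hf.prob
  have hjh : 0 ≤ (j : ℝ) * h := by positivity
  rcases Nat.eq_zero_or_pos j with rfl | hj
  · have := hf.measurable_timeInt hγ hh (by simpa using hj1)
    have h2 := hf.cont.measurable
    simp only [defect, if_true]
    fun_prop
  · have e : defect m f h j = fun x ↦ timeInt m f (j * h + h) x - timeInt m f (j * h) x
      - h * avg (m (j * h)) f x := funext (hf.defect_eq hh hj hj1)
    rw [e]
    have h1 := hf.measurable_timeInt hγ (τ := j * h + h) (by linarith) (by linarith)
    have h2 := hf.measurable_timeInt hγ (τ := j * h) (by linarith) (by linarith)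
    have h3 := measurable_avg (m := m (j * h)) hf.cont.measurable
    fun_prop

lemma abs_defect_le {h : ℝ} (hh : 0 < h) {j : ℕ} (hj : 0 < j) (hj1 : (j + 1) * h ≤ 1) (x : E) :
    |defect m f h j x| ≤ C * h ^ (2 : ℕ) * (j * h) ^ (γ - 1) := by
  have hjh : 0 < (j : ℝ) * h := by positivity
  have := hf.nonneg
  rw [defect, if_neg hj.ne']
  have q := intervalIntegral.norm_integral_le_of_norm_le_const (a := 0) (b := h)
    (C := C * h * (j * h) ^ (γ - 1))
    (f := fun r ↦ avg (m (j * h + r)) f x - avg (m (j * h)) f x) fun r hr ↦ by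
      rw [Set.uIoc_of_le hh.le] at hr
      refine (hf.time (j * h) hjh (by linarith) r hr.1.le x).trans ?_
      gcongr
      exact hr.2
  rw [sub_zero, abs_of_pos hh] at q
  exact q.trans_eq (by ring)

lemma abs_incr_defect_le {h : ℝ} (hh : 0 < h) {j : ℕ} (hj : 0 < j) (hj1 : (j + 1) * h ≤ 1)
    (y x : E) : |incr y (defect m f h j) x| ≤ C * h ^ (2 : ℕ) * (j * h) ^ (γ - 3 / 2) * ‖y‖ := by
  have hjh : 0 < (j : ℝ) * h := by positivity
  have := hf.nonneg
  have J : ∀ x, IntervalIntegrable (fun r ↦ avg (m (j * h + r)) f x - avg (m (j * h)) f x)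
      volume 0 h := fun x ↦ (hf.intervalIntegrable_avg_add hjh.le hh.le (by linarith) x).sub
    intervalIntegrable_const
  have e : incr y (defect m f h j) x = ∫ r in (0 : ℝ)..h,
      (incr y (avg (m (j * h + r)) f) x - incr y (avg (m (j * h)) f) x) := by
    simp only [incr, defect, if_neg hj.ne']
    rw [← intervalIntegral.integral_sub (J _) (J _)]
    congr 1; ext r; ring
  rw [e]
  have q := intervalIntegral.norm_integral_le_of_norm_le_const (a := 0) (b := h)
    (C := C * h * (j * h) ^ (γ - 3 / 2) * ‖y‖)
    (f := fun r ↦ incr y (avg (m (j * h + r)) f) x - incr y (avg (m (j * h)) f) x) fun r hr ↦ by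
      rw [Set.uIoc_of_le hh.le] at hr
      refine (hf.time_lip (j * h) hjh (by linarith) r hr.1.le y x).trans ?_
      gcongr
      exact hr.2
  rw [sub_zero, abs_of_pos hh] at q
  exact q.trans_eq (by ring)

/-- Interpolation between `abs_defect_le` and `abs_incr_defect_le`. -/
lemma abs_incr_defect_le_min {θ : ℝ} (hθ : 0 < θ) (hθ1 : θ < 1) {h : ℝ} (hh : 0 < h) {j : ℕ}
    (hj : 0 < j) (hj1 : (j + 1) * h ≤ 1) (y x : E) :
    |incr y (defect m f h j) x| ≤
      2 * C * h ^ (2 : ℕ) * (j * h) ^ (γ - 1 - θ / 2) * min (‖y‖ ^ θ) 1 := by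
  have hjh : 0 < (j : ℝ) * h := by positivity
  have := hf.nonneg
  have b1 := abs_incr_le (fun x ↦ hf.abs_defect_le hh hj hj1 x) y x
  have b2 := hf.abs_incr_defect_le hh hj hj1 y x
  set q := |incr y (defect m f h j) x| with hq
  have hq0 : 0 ≤ q := abs_nonneg _
  set c := 2 * C * h ^ (2 : ℕ) with hc
  have hc0 : 0 ≤ c := by positivity
  rcases le_total (‖y‖ ^ θ) 1 with h1 | h1
  · rw [min_eq_left h1]
    have h2 : q ≤ c * ((j * h) ^ (γ - 3 / 2) * ‖y‖) := by
      have : 0 ≤ C * h ^ (2 : ℕ) * (j * h) ^ (γ - 3 / 2) * ‖y‖ := by positivity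
      linarith
    have h3 : q ≤ c * (j * h) ^ (γ - 1) := by linarith
    calc q = q ^ (1 - θ) * q ^ θ := by
          rw [← Real.rpow_add_of_nonneg hq0 (by linarith) hθ.le]; simp
      _ ≤ (c * (j * h) ^ (γ - 1)) ^ (1 - θ) * (c * ((j * h) ^ (γ - 3 / 2) * ‖y‖)) ^ θ :=
          mul_le_mul (Real.rpow_le_rpow hq0 h3 (by linarith)) (Real.rpow_le_rpow hq0 h2 hθ.le)
            (by positivity) (by positivity)
      _ = _ := by
          rw [Real.mul_rpow hc0 (by positivity), Real.mul_rpow hc0 (by positivity),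
            Real.mul_rpow (y := ‖y‖) (by positivity) (by positivity), mul_mul_mul_comm,
            ← Real.rpow_add_of_nonneg hc0 (by linarith) hθ.le, ← Real.rpow_mul hjh.le,
            ← Real.rpow_mul hjh.le, ← mul_assoc (_ ^ _), mul_assoc (c ^ _),
            ← mul_assoc (_ ^ _) (_ ^ _) (‖y‖ ^ θ), ← Real.rpow_add hjh, sub_add_cancel,
            Real.rpow_one]
          ring_nf
  · rw [min_eq_right h1, mul_one]
    have h2 : ((j : ℝ) * h) ^ (γ - 1) ≤ ((j : ℝ) * h) ^ (γ - 1 - θ / 2) :=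
      Real.rpow_le_rpow_of_exponent_ge hjh (by linarith) (by linarith)
    linarith [mul_le_mul_of_nonneg_left h2 hc0]

lemma avg_defect (hγ : 0 < γ) {h : ℝ} (hh : 0 < h) {j : ℕ} (hj1 : (j + 2) * h ≤ 1) (x : E) :
    avg (m h) (defect m f h j) x = defect m f h (j + 1) x := by
  have hp := hf.prob
  have hfm := hf.cont.measurable
  have hjh : 0 ≤ (j : ℝ) * h := by positivity
  have hsum : ∀ s, 0 ≤ s → avg (m h) (avg (m s) f) x = avg (m (h + s)) f x := fun s hs ↦ by
    rw [hf.conv h s hh.le hs, avg_conv hfm hf.bdd]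
  rw [hf.defect_eq hh.le (Nat.succ_pos j) (by push_cast; linarith)]
  have M1 := hf.measurable_timeInt hγ (τ := j * h + h) (by linarith) (by linarith)
  have M2 := hf.measurable_timeInt hγ (τ := j * h) (by linarith) (by linarith)
  have B1 := hf.abs_timeInt_le (τ := j * h + h) (by linarith)
  have B2 := hf.abs_timeInt_le (τ := j * h) (by linarith)
  have e1 : h + (j * h + h) = (↑(j + 1) * h + h) := by push_cast; ring
  have e2 : h + j * h = ↑(j + 1) * h := by push_cast; ring
  rcases Nat.eq_zero_or_pos j with rfl | hj
  · have M3 : Measurable fun x ↦ h * f x := hfm.const_mul h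
    have B3 : ∀ x, |h * f x| ≤ h * A := fun x ↦ by
      rw [abs_mul, abs_of_pos hh]; gcongr; exact hf.bdd x
    simp only [Nat.cast_zero, zero_mul, zero_add] at M1 B1
    have : defect m f h 0 = fun x ↦ timeInt m f h x - h * f x := by simp [defect]
    rw [this, avg_sub M1 B1 M3 B3, hf.avg_timeInt hγ hh.le hh.le (by push_cast at hj1; linarith),
      avg_const_mul]
    simp
  · have M3 : Measurable fun x ↦ h * avg (m (j * h)) f x := (measurable_avg hfm).const_mul h
    have B3 : ∀ x, |h * avg (m (j * h)) f x| ≤ h * A := fun x ↦ by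
      rw [abs_mul, abs_of_pos hh]; gcongr; exact abs_avg_le hf.bdd x
    have e0 : defect m f h j = fun x ↦ (timeInt m f (j * h + h) x - timeInt m f (j * h) x)
      - h * avg (m (j * h)) f x := funext (hf.defect_eq hh.le hj (by linarith))
    have M4 : Measurable fun x ↦ timeInt m f (j * h + h) x - timeInt m f (j * h) x := M1.sub M2
    have B4 : ∀ x, |timeInt m f (j * h + h) x - timeInt m f (j * h) x|
        ≤ A * (j * h + h) + A * (j * h) := fun x ↦
      (abs_sub _ _).trans (add_le_add (B1 x) (B2 x))
    rw [e0, avg_sub M4 B4 M3 B3, avg_sub M1 B1 M2 B2, hf.avg_timeInt hγ hh.le (by linarith)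
      (by linarith), hf.avg_timeInt hγ hh.le hjh (by linarith), avg_const_mul, hsum _ hjh, e1, e2]
    ring

/-- The corrector `∑_{j < k} T^j H`, where `H` is the quadrature defect and `T = P_h`. -/
noncomputable def _root_.LevyEuler.corrector (m : ℝ → Measure E) (f : E → ℝ) (h : ℝ) (k : ℕ)
    (x : E) : ℝ :=
  ∑ j ∈ Finset.range k, defect m f h j x

/-- The corrector without its first term. -/
noncomputable def _root_.LevyEuler.correctorTail (m : ℝ → Measure E) (f : E → ℝ) (h : ℝ) (k : ℕ)
    (x : E) : ℝ :=
  ∑ j ∈ Finset.range k, defect m f h (j + 1) x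

lemma corrector_succ {h : ℝ} (k : ℕ) (x : E) :
    corrector m f h (k + 1) x = correctorTail m f h k x + defect m f h 0 x := by
  unfold corrector correctorTail
  rw [Finset.sum_range_succ']

lemma measurable_corrector (hγ : 0 < γ) {h : ℝ} (hh : 0 ≤ h) {k : ℕ} (hk : k * h ≤ 1) :
    Measurable (corrector m f h k) := by
  refine Finset.measurable_fun_sum _ fun j hj ↦ hf.measurable_defect hγ hh (le_trans ?_ hk)
  gcongr
  exact_mod_cast Finset.mem_range.1 hj

lemma measurable_correctorTail (hγ : 0 < γ) {h : ℝ} (hh : 0 ≤ h) {k : ℕ} (hk : (k + 1) * h ≤ 1) :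
    Measurable (correctorTail m f h k) := by
  refine Finset.measurable_fun_sum _ fun j hj ↦ hf.measurable_defect hγ hh (le_trans ?_ hk)
  gcongr
  exact_mod_cast Finset.mem_range.1 hj

lemma abs_correctorTail_le (hγ1 : γ ≤ 1 / 2) {h : ℝ} (hh : 0 < h) {k : ℕ}
    (hk : (k + 1) * h ≤ 1) (x : E) :
    |correctorTail m f h k x| ≤ 2 * C * h ^ (1 + γ) * √k := by
  have hC := hf.nonneg
  refine (abs_sum_le_of_le_rpow (a := γ - 1) hh fun j hj ↦
    hf.abs_defect_le hh (Nat.succ_pos j) (succ_mul_le_one hh hk hj) x).trans ?_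
  have := sum_rpow_le_sqrt (a := γ - 1) (by linarith) k
  calc _ ≤ C * h ^ (2 + (γ - 1)) * (2 * √k) := by gcongr
    _ = _ := by ring_nf

lemma abs_corrector_le (hγ : 0 < γ) (hγ1 : γ ≤ 1 / 2) {h : ℝ} (hh : 0 < h) {k : ℕ}
    (hk : k * h ≤ 1) (x : E) : |corrector m f h k x| ≤ 3 * C * h ^ (1 + γ) * √k := by
  have hC := hf.nonneg
  cases k with
  | zero => simp [corrector]
  | succ k =>
    push_cast at hk
    have hh1 : h ≤ 1 := by nlinarith [mul_nonneg (Nat.cast_nonneg k : (0 : ℝ) ≤ k) hh.le]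
    rw [hf.corrector_succ]
    have h1 := hf.abs_correctorTail_le hγ1 hh hk x
    have h2 := hf.abs_defect_zero_le hγ hh.le hh1 x
    have h3 : √(k : ℝ) ≤ √((k + 1 : ℕ) : ℝ) := Real.sqrt_le_sqrt (by push_cast; linarith)
    have h4 : 1 ≤ √((k + 1 : ℕ) : ℝ) := Real.one_le_sqrt.2 (by simp)
    have h5 : 0 ≤ C * h ^ (1 + γ) := by positivity
    refine (abs_add_le _ _).trans ((add_le_add h1 h2).trans ?_)
    nlinarith [mul_le_mul_of_nonneg_left h3 h5, mul_le_mul_of_nonneg_left h4 h5]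

lemma incr_correctorTail (h : ℝ) (k : ℕ) (y x : E) :
    incr y (correctorTail m f h k) x = ∑ j ∈ Finset.range k, incr y (defect m f h (j + 1)) x := by
  simp [incr, correctorTail, Finset.sum_sub_distrib]

lemma abs_incr_correctorTail_le (hγ1 : γ < 1 / 2) {h : ℝ} (hh : 0 < h) {k : ℕ}
    (hk : (k + 1) * h ≤ 1) (y x : E) :
    |incr y (correctorTail m f h k) x|
      ≤ C * (∑' j : ℕ, (↑(j + 1) : ℝ) ^ (γ - 3 / 2)) * h ^ (1 / 2 + γ) * ‖y‖ := by
  have hC := hf.nonneg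
  rw [hf.incr_correctorTail]
  refine (abs_sum_le_of_le_rpow (c := C * ‖y‖) (a := γ - 3 / 2) hh fun j hj ↦
    (hf.abs_incr_defect_le hh (Nat.succ_pos j) (succ_mul_le_one hh hk hj) y x).trans_eq
      (by ring)).trans ?_
  have := (summable_rpow (a := γ - 3 / 2) (by linarith)).sum_le_tsum (Finset.range k)
    (fun j _ ↦ by positivity)
  calc _ ≤ C * ‖y‖ * h ^ (2 + (γ - 3 / 2)) * ∑' j : ℕ, (↑(j + 1) : ℝ) ^ (γ - 3 / 2) := by gcongr
    _ = _ := by ring_nf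

lemma abs_incr_correctorTail_le_min {θ : ℝ} (hθ : 0 < θ) (hθ1 : θ < 1) (hγθ : γ < θ / 2) {h : ℝ}
    (hh : 0 < h) {k : ℕ} (hk : (k + 1) * h ≤ 1) (y x : E) :
    |incr y (correctorTail m f h k) x|
      ≤ 2 * C * (∑' j : ℕ, (↑(j + 1) : ℝ) ^ (γ - 1 - θ / 2)) * h ^ (1 + γ - θ / 2)
        * min (‖y‖ ^ θ) 1 := by
  have hC := hf.nonneg
  rw [hf.incr_correctorTail]
  refine (abs_sum_le_of_le_rpow (c := 2 * C * min (‖y‖ ^ θ) 1) (a := γ - 1 - θ / 2) hh fun j hj ↦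
    (hf.abs_incr_defect_le_min hθ hθ1 hh (Nat.succ_pos j) (succ_mul_le_one hh hk hj) y x).trans_eq
      (by ring)).trans ?_
  have := (summable_rpow (a := γ - 1 - θ / 2) (by linarith)).sum_le_tsum (Finset.range k)
    (fun j _ ↦ by positivity)
  calc _ ≤ 2 * C * min (‖y‖ ^ θ) 1 * h ^ (2 + (γ - 1 - θ / 2))
        * ∑' j : ℕ, (↑(j + 1) : ℝ) ^ (γ - 1 - θ / 2) := by gcongr
    _ = _ := by ring_nf

lemma avg_corrector (hγ : 0 < γ) {h : ℝ} (hh : 0 < h) {k : ℕ} (hk : (k + 1) * h ≤ 1) (x : E) :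
    avg (m h) (corrector m f h k) x = correctorTail m f h k x := by
  have hp := hf.prob
  unfold correctorTail
  have e : avg (m h) (corrector m f h k) x
      = ∑ j ∈ Finset.range k, avg (m h) (defect m f h j) x := by
    unfold avg corrector
    refine integral_finsetSum _ fun j hj ↦ ?_
    have hb : (j + 1) * h ≤ 1 := le_trans (by gcongr; exact (Finset.mem_range.1 hj).le) hk
    have hm := hf.measurable_defect hγ hh.le hb
    rcases Nat.eq_zero_or_pos j with rfl | hj0
    · exact integrable_translate hm (hf.abs_defect_zero_le hγ hh.le (by simpa using hb)) x
    · exact integrable_translate hm (hf.abs_defect_le hh hj0 hb) x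
  rw [e]
  refine Finset.sum_congr rfl fun j hj ↦ hf.avg_defect hγ hh (le_trans ?_ hk) x
  have hj' : (j : ℝ) + 1 ≤ k := by exact_mod_cast Finset.mem_range.1 hj
  nlinarith

/-- The modulus of continuity of the corrector. -/
lemma abs_incr_corrector_le_min (hγ : 0 < γ) {θ : ℝ} (hθ : 0 < θ) (hθ1 : θ < 1)
    (hγθ : γ < θ / 2) {h : ℝ} (hh : 0 < h) {k : ℕ} (hk : k * h ≤ 1) (y x : E) :
    |incr y (corrector m f h k) x|
      ≤ 2 * C * (∑' j : ℕ, (↑(j + 1) : ℝ) ^ (γ - 1 - θ / 2)) * h ^ (1 + γ - θ / 2)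
        * min (‖y‖ ^ θ) 1 + 2 * (C * h ^ (1 + γ)) := by
  have hC := hf.nonneg
  have hS : 0 ≤ ∑' j : ℕ, (↑(j + 1) : ℝ) ^ (γ - 1 - θ / 2) := tsum_nonneg fun j ↦ by positivity
  have hmin : 0 ≤ min (‖y‖ ^ θ) 1 := le_min (by positivity) zero_le_one
  cases k with
  | zero =>
    simp only [incr, corrector, Finset.range_zero, Finset.sum_empty, sub_self, abs_zero]
    positivity
  | succ k =>
    push_cast at hk
    have hh1 : h ≤ 1 := by nlinarith [mul_nonneg (Nat.cast_nonneg k : (0 : ℝ) ≤ k) hh.le]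
    have h1 := hf.abs_incr_correctorTail_le_min hθ hθ1 hγθ hh hk y x
    have h2 := abs_incr_le (fun x ↦ hf.abs_defect_zero_le hγ hh.le hh1 x) y x
    have e : incr y (corrector m f h (k + 1)) x
        = incr y (correctorTail m f h k) x + incr y (defect m f h 0) x := by
      simp only [incr, hf.corrector_succ]; ring
    rw [e]
    exact (abs_add_le _ _).trans (add_le_add h1 h2)

/-- Summation by parts for the quadrature defects along a path. -/
lemma sum_defect_eq {h : ℝ} (N : ℕ) (y z : ℕ → E) : ∑ k ∈ Finset.range N, defect m f h 0 (y k)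
      = corrector m f h N (y 0) + ∑ k ∈ Finset.range N, (corrector m f h (N - (k + 1)) (y (k + 1))
          - correctorTail m f h (N - (k + 1)) (z k))
        + ∑ k ∈ Finset.range N, (correctorTail m f h (N - (k + 1)) (z k)
          - correctorTail m f h (N - (k + 1)) (y k)) := by
  have h1 := Finset.sum_range_sub' (fun k ↦ corrector m f h (N - k) (y k)) N
  simp only [Nat.sub_zero, Nat.sub_self] at h1
  have h2 : corrector m f h 0 (y N) = 0 := by simp [corrector]
  rw [h2, sub_zero] at h1
  rw [← h1, ← Finset.sum_add_distrib, ← Finset.sum_add_distrib]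
  refine Finset.sum_congr rfl fun k hk ↦ ?_
  have hk' := Finset.mem_range.1 hk
  have e : N - k = N - (k + 1) + 1 := by omega
  rw [e, hf.corrector_succ]
  ring

end IsRegularized

/-! ### Bounds in `L_p` -/

section LpBound

variable {Ω : Type*} {mΩ : MeasurableSpace Ω}

/-- The function `f` is measurable with `L_p(P)` norm at most the real number `a`. -/
structure HasLpBound (P : Measure Ω) (p : ℝ) (f : Ω → ℝ) (a : ℝ) : Prop where
  meas : AEStronglyMeasurable f P
  nonneg : 0 ≤ a
  le : eLpNorm f (ENNReal.ofReal p) P ≤ ENNReal.ofReal a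

namespace HasLpBound

variable {P : Measure Ω} {p : ℝ} {f g : Ω → ℝ} {a b : ℝ}

lemma mono (hf : HasLpBound P p f a) (h : a ≤ b) : HasLpBound P p f b :=
  ⟨hf.meas, hf.nonneg.trans h, hf.le.trans (ENNReal.ofReal_le_ofReal h)⟩

lemma of_abs_le (hg : HasLpBound P p g a) (hf : AEStronglyMeasurable f P)
    (h : ∀ᵐ ω ∂P, |f ω| ≤ g ω) : HasLpBound P p f a :=
  ⟨hf, hg.nonneg, (eLpNorm_mono_ae_real h).trans hg.le⟩

lemma congr (hg : HasLpBound P p g a) (h : f =ᵐ[P] g) : HasLpBound P p f a :=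
  ⟨hg.meas.congr h.symm, hg.nonneg, (eLpNorm_congr_ae h).trans_le hg.le⟩

lemma of_ae_bound [IsProbabilityMeasure P] (hf : AEStronglyMeasurable f P) (ha : 0 ≤ a)
    (h : ∀ᵐ ω ∂P, |f ω| ≤ a) : HasLpBound P p f a := by
  refine ⟨hf, ha, ?_⟩
  have := eLpNorm_le_of_ae_bound (p := ENNReal.ofReal p) (f := f) (C := a) h
  simpa using this

lemma const [IsProbabilityMeasure P] (ha : 0 ≤ a) : HasLpBound P p (fun _ ↦ a) a :=
  of_ae_bound aestronglyMeasurable_const ha (ae_of_all _ fun _ ↦ (abs_of_nonneg ha).le)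

lemma of_tendsto {b : ℕ → ℝ} (h : ∀ r, HasLpBound P p f (b r))
    (hb : Tendsto b atTop (𝓝 a)) : HasLpBound P p f a :=
  ⟨(h 0).meas, ge_of_tendsto' hb fun r ↦ (h r).nonneg,
    ge_of_tendsto' (ENNReal.tendsto_ofReal hb) fun r ↦ (h r).le⟩

lemma zero : HasLpBound P p (fun _ ↦ 0) 0 := ⟨aestronglyMeasurable_const, le_rfl, by simp⟩

lemma add (hp : 1 ≤ p) (hf : HasLpBound P p f a) (hg : HasLpBound P p g b) :
    HasLpBound P p (fun ω ↦ f ω + g ω) (a + b) := by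
  refine ⟨hf.meas.add hg.meas, add_nonneg hf.nonneg hg.nonneg, ?_⟩
  rw [ENNReal.ofReal_add hf.nonneg hg.nonneg]
  exact (eLpNorm_add_le hf.meas hg.meas (ENNReal.one_le_ofReal.2 hp)).trans (add_le_add hf.le hg.le)

lemma neg (hf : HasLpBound P p f a) : HasLpBound P p (fun ω ↦ -f ω) a := ⟨hf.meas.neg, hf.nonneg, by
    rw [show (fun ω ↦ -f ω) = -f from rfl, eLpNorm_neg]; exact hf.le⟩

lemma sub (hp : 1 ≤ p) (hf : HasLpBound P p f a) (hg : HasLpBound P p g b) :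
    HasLpBound P p (fun ω ↦ f ω - g ω) (a + b) := by
  simpa only [sub_eq_add_neg] using hf.add hp hg.neg

lemma abs (hf : HasLpBound P p f a) : HasLpBound P p (fun ω ↦ |f ω|) a :=
  ⟨hf.meas.norm, hf.nonneg, (eLpNorm_norm f).trans_le hf.le⟩

lemma const_mul {c : ℝ} (hc : 0 ≤ c) (hf : HasLpBound P p f a) :
    HasLpBound P p (fun ω ↦ c * f ω) (c * a) := by
  refine ⟨hf.meas.const_mul c, mul_nonneg hc hf.nonneg, ?_⟩
  rw [ENNReal.ofReal_mul hc]
  refine (eLpNorm_const_smul_le (c := c) (f := f)).trans ?_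
  rw [← ofReal_norm, Real.norm_of_nonneg hc]
  exact mul_le_mul_right hf.le _

lemma sum (hp : 1 ≤ p) {ι : Type*} (s : Finset ι) {f : ι → Ω → ℝ} {a : ι → ℝ}
    (h : ∀ i ∈ s, HasLpBound P p (f i) (a i)) :
    HasLpBound P p (fun ω ↦ ∑ i ∈ s, f i ω) (∑ i ∈ s, a i) := by
  classical
  induction s using Finset.induction_on with
  | empty => simpa using zero
  | insert i s hi ih =>
    simp only [Finset.sum_insert hi]
    exact (h i (Finset.mem_insert_self _ _)).add hp
      (ih fun j hj ↦ h j (Finset.mem_insert_of_mem hj))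

lemma lintegral_le (hp : 0 < p) (hf : HasLpBound P p f a) :
    ∫⁻ ω, ‖f ω‖ₑ ^ p ∂P ≤ ENNReal.ofReal a ^ p := by
  have := hf.le
  rwa [eLpNorm_eq_lintegral_rpow_enorm_toReal (by simpa using hp) ENNReal.ofReal_ne_top,
    ENNReal.toReal_ofReal hp.le, one_div, ENNReal.rpow_inv_le_iff hp] at this

lemma of_integral_le (hp : 0 < p) (ha : 0 ≤ a) (hf : MemLp f (ENNReal.ofReal p) P)
    (h : ∫ ω, |f ω| ^ p ∂P ≤ a ^ p) : HasLpBound P p f a :=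
  ⟨hf.1, ha, (eLpNorm_le_ofReal_iff hp ha hf).2 h⟩

/-- A sum of bounded martingale differences grows like the square root of their number. -/
lemma sum_martingale [IsProbabilityMeasure P] (hp : 2 < p) (𝓕 : ℕ → MeasurableSpace Ω)
    (hle : ∀ k, 𝓕 k ≤ mΩ) (hmono : Monotone 𝓕) {e : ℕ → Ω → ℝ} (ha : 0 ≤ a) (k : ℕ)
    (hmeas : ∀ j < k, Measurable[𝓕 (j + 1)] (e j)) (hbdd : ∀ j < k, ∃ c, ∀ ω, |e j ω| ≤ c)
    (hmart : ∀ j < k, P[e j|𝓕 j] =ᵐ[P] 0) (hnorm : ∀ j < k, HasLpBound P p (e j) a) :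
    HasLpBound P p (fun ω ↦ ∑ j ∈ Finset.range k, e j ω) (martConst p * √k * a) := by
  refine ⟨?_, mul_nonneg (mul_nonneg (martConst_nonneg hp) (Real.sqrt_nonneg _)) ha,
    eLpNorm_sum_martingale_le hp 𝓕 hle hmono ha k hmeas hbdd hmart fun j hj ↦ (hnorm j hj).le⟩
  exact Finset.aestronglyMeasurable_fun_sum _ fun j hj ↦ (hnorm j (Finset.mem_range.1 hj)).meas

/-- Minkowski's inequality for a time integral. -/
lemma intervalIntegral [IsProbabilityMeasure P] (hp : 1 ≤ p) {g : ℝ → Ω → ℝ} {s t K : ℝ}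
    (hst : s < t) (hK : 0 ≤ K)
    (hm : AEStronglyMeasurable (Function.uncurry g) ((volume.restrict (Set.Ioc s t)).prod P))
    (hg : ∀ r, s < r → r ≤ t → HasLpBound P p (g r) K) :
    HasLpBound P p (fun ω ↦ ∫ r in s..t, g r ω) ((t - s) * K) := by
  have hp0 : 0 < p := by linarith
  set μ := volume.restrict (Set.Ioc s t) with hμ
  set T := ENNReal.ofReal (t - s) with hT
  have hμT : μ Set.univ = T := by simp [hμ, hT]
  have hpe : ENNReal.ofReal p ≠ 0 := by simpa using hp0
  simp_rw [intervalIntegral.integral_of_le hst.le]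
  refine ⟨hm.prod_swap.integral_prod_right', mul_nonneg (sub_pos.2 hst).le hK, ?_⟩
  rw [eLpNorm_eq_lintegral_rpow_enorm_toReal hpe ENNReal.ofReal_ne_top,
    ENNReal.toReal_ofReal hp0.le, one_div, ENNReal.rpow_inv_le_iff hp0]
  have hTp : T ^ (p - 1) * T = T ^ p := by
    nth_rw 2 [← ENNReal.rpow_one T]
    rw [← ENNReal.rpow_add_of_nonneg _ _ (by linarith) zero_le_one, sub_add_cancel]
  calc ∫⁻ ω, ‖∫ r, g r ω ∂μ‖ₑ ^ p ∂P
      ≤ ∫⁻ ω, T ^ (p - 1) * ∫⁻ r, ‖g r ω‖ₑ ^ p ∂μ ∂P := by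
        refine lintegral_mono_ae ?_
        filter_upwards [hm.prod_swap.prodMk_left] with ω hω
        have h := (enorm_integral_le_lintegral_enorm _).trans
          ((eLpNorm_one_eq_lintegral_enorm (μ := μ) (f := fun r ↦ g r ω)).symm.trans_le
          (eLpNorm_le_eLpNorm_mul_rpow_measure_univ (ENNReal.one_le_ofReal.2 hp) hω))
        rw [eLpNorm_eq_lintegral_rpow_enorm_toReal hpe ENNReal.ofReal_ne_top,
          ENNReal.toReal_ofReal hp0.le, hμT] at h
        refine (ENNReal.rpow_le_rpow h hp0.le).trans_eq ?_
        rw [ENNReal.mul_rpow_of_nonneg _ _ hp0.le, ← ENNReal.rpow_mul, ← ENNReal.rpow_mul,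
          one_div_mul_cancel hp0.ne', ENNReal.rpow_one, mul_comm, ENNReal.toReal_one, sub_mul,
          one_div_mul_cancel hp0.ne', div_one, one_mul]
    _ = T ^ (p - 1) * ∫⁻ r, ∫⁻ ω, ‖g r ω‖ₑ ^ p ∂P ∂μ := by
        rw [lintegral_const_mul' _ _ (ENNReal.rpow_ne_top_of_nonneg (by linarith)
          ENNReal.ofReal_ne_top), lintegral_lintegral_swap]
        exact (hm.prod_swap.enorm.pow_const p)
    _ ≤ T ^ (p - 1) * ∫⁻ r, ENNReal.ofReal K ^ p ∂μ := by
        refine mul_le_mul_right ?_ _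
        exact setLIntegral_mono' measurableSet_Ioc fun r hr ↦ (hg r hr.1 hr.2).lintegral_le hp0
    _ = _ := by
        rw [lintegral_const, hμT, ENNReal.ofReal_mul (sub_pos.2 hst).le,
          ENNReal.mul_rpow_of_nonneg _ _ hp0.le, ← hTp]
        ring

end HasLpBound

end LpBound

/-! ### Paths with bounded drift -/

/-- The process `L` on `[0,1]` has increments with laws `m`, independent of the past `𝓕`. -/
structure IsDriver {Ω : Type*} {mΩ : MeasurableSpace Ω} (P : Measure Ω)
    (𝓕 : ℝ → MeasurableSpace Ω) (m : ℝ → Measure E) (L : ℝ → Ω → E) : Prop where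
  le : ∀ t, 𝓕 t ≤ mΩ
  mono : Monotone 𝓕
  adapted : ∀ t, Measurable[𝓕 t] (L t)
  indep : ∀ s t, 0 ≤ s → s ≤ t → t ≤ 1 →
    Indep (MeasurableSpace.comap (fun ω ↦ L t ω - L s ω) inferInstance) (𝓕 s) P
  law : ∀ s t, 0 ≤ s → s ≤ t → t ≤ 1 → P.map (fun ω ↦ L t ω - L s ω) = m (t - s)

/-- The process `X` is adapted and right-continuous on `[0,1]`, and `X - L` is Lipschitz with
constant `B`. -/
structure IsDrivenPath {Ω : Type*} {mΩ : MeasurableSpace Ω} (P : Measure Ω)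
    (𝓕 : ℝ → MeasurableSpace Ω) (L : ℝ → Ω → E) (B : ℝ) (X : ℝ → Ω → E) : Prop where
  nonneg : 0 ≤ B
  adapted : ∀ t, Measurable[𝓕 t] (X t)
  drift : ∀ᵐ ω ∂P, ∀ s t, 0 ≤ s → s ≤ t → t ≤ 1 → ‖X t ω - (X s ω + (L t ω - L s ω))‖ ≤ B * (t - s)
  rightCont : ∀ᵐ ω ∂P, ∀ t, 0 ≤ t → t < 1 → ContinuousWithinAt (fun s ↦ X s ω) (Set.Ici t) t

/-- The truncated moments of order `θ` of `m t` are bounded in `L_p` by `K t^κ`. -/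
structure HasMoment (m : ℝ → Measure E) (p θ K κ : ℝ) : Prop where
  nonneg : 0 ≤ K
  le : ∀ t, 0 < t → t ≤ 1 → ∫ y, (min (‖y‖ ^ θ) 1) ^ p ∂(m t) ≤ (K * t ^ κ) ^ p

section Paths

variable {Ω : Type*} {mΩ : MeasurableSpace Ω} {P : Measure Ω} [IsProbabilityMeasure P]
  {𝓕 : ℝ → MeasurableSpace Ω} {m : ℝ → Measure E} {L : ℝ → Ω → E} {X : ℝ → Ω → E}
  {f : E → ℝ} {A B C γ β p K κ : ℝ}

lemma IsDriver.measurable (hL : IsDriver P 𝓕 m L) (t : ℝ) : Measurable (L t) :=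
  (hL.adapted t).mono (hL.le t) le_rfl

lemma IsDriver.measurable_sub (hL : IsDriver P 𝓕 m L) (s t : ℝ) :
    Measurable fun ω ↦ L t ω - L s ω := (hL.measurable t).sub (hL.measurable s)

lemma HasMoment.hasLpBound {θ t : ℝ} (hp : 0 < p) (hM : HasMoment m p θ K κ)
    [IsProbabilityMeasure (m t)] (ht : 0 < t) (ht1 : t ≤ 1) :
    HasLpBound (m t) p (fun y ↦ min (‖y‖ ^ θ) 1) (K * t ^ κ) := by
  have h0 : ∀ y : E, 0 ≤ min (‖y‖ ^ θ) 1 := fun y ↦ by positivity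
  refine HasLpBound.of_integral_le hp (mul_nonneg hM.nonneg (by positivity)) (MemLp.of_bound
    (integrable_min_norm_rpow θ).1 1 (ae_of_all _ fun y ↦ ?_)) ?_
  · rw [Real.norm_of_nonneg (h0 y)]; exact min_le_right _ _
  · simpa only [abs_of_nonneg (h0 _)] using hM.le t ht ht1

lemma HasMoment.integral_le {θ t : ℝ} (hp : 1 ≤ p) (hM : HasMoment m p θ K κ)
    [IsProbabilityMeasure (m t)] (ht : 0 < t) (ht1 : t ≤ 1) :
    ∫ y, min (‖y‖ ^ θ) 1 ∂(m t) ≤ K * t ^ κ := by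
  have h := hM.hasLpBound (by linarith) ht ht1
  have h1 := (eLpNorm_le_eLpNorm_of_exponent_le (ENNReal.one_le_ofReal.2 hp) h.meas).trans h.le
  rw [eLpNorm_one_eq_lintegral_enorm,
    ← ofReal_integral_norm_eq_lintegral_enorm (integrable_min_norm_rpow θ),
    ENNReal.ofReal_le_ofReal_iff h.nonneg] at h1
  exact (integral_mono_of_nonneg (ae_of_all _ fun y ↦ by positivity)
    (integrable_min_norm_rpow θ).norm (ae_of_all _ fun y ↦ le_abs_self _)).trans h1

lemma IsDriver.hasLpBound_incr (hL : IsDriver P 𝓕 m L) {θ : ℝ} (hp : 0 < p)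
    (hM : HasMoment m p θ K κ) {s t : ℝ} (hs : 0 ≤ s) (hst : s < t) (ht : t ≤ 1) :
    HasLpBound P p (fun ω ↦ min (‖L t ω - L s ω‖ ^ θ) 1) (K * (t - s) ^ κ) := by
  have hm := hL.measurable_sub s t
  have hl := hL.law s t hs hst.le ht
  have : IsProbabilityMeasure (m (t - s)) := hl ▸ Measure.isProbabilityMeasure_map hm.aemeasurable
  have h := hM.hasLpBound hp (sub_pos.2 hst) (by linarith)
  refine ⟨Measurable.aestronglyMeasurable (by fun_prop), h.nonneg, le_trans (le_of_eq ?_) h.le⟩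
  rw [← hl, eLpNorm_map_measure (by rw [hl]; exact h.meas) hm.aemeasurable]
  rfl

lemma IsDrivenPath.measurable (hX : IsDrivenPath P 𝓕 L B X) (hL : IsDriver P 𝓕 m L) (t : ℝ) :
    Measurable (X t) := (hX.adapted t).mono (hL.le t) le_rfl

/-- A right-continuous process is jointly measurable up to modification. -/
lemma IsDrivenPath.aestronglyMeasurable_uncurry (hX : IsDrivenPath P 𝓕 L B X)
    (hL : IsDriver P 𝓕 m L) (hf : Continuous f) {s t : ℝ} (hs : 0 ≤ s) (ht : t ≤ 1) :
    AEStronglyMeasurable (Function.uncurry fun r ω ↦ f (X r ω))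
      ((volume.restrict (Set.Ioc s t)).prod P) := by
  -- approximate `r` from the right by `⌈r n⌉ / n`
  refine aestronglyMeasurable_of_tendsto_ae atTop
    (f := fun (n : ℕ) (q : ℝ × Ω) ↦ f (X (⌈q.1 * n⌉₊ / n) q.2)) (fun n ↦ ?_) ?_
  · have h1 : Measurable fun q : ℕ × Ω ↦ f (X (q.1 / n) q.2) :=
      measurable_from_prod_countable_right fun k ↦ hf.measurable.comp (hX.measurable hL (k / n))
    have h2 : Measurable fun q : ℝ × Ω ↦ (⌈q.1 * n⌉₊, q.2) :=
      (Nat.measurable_ceil.comp (measurable_fst.mul_const _)).prodMk measurable_snd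
    exact (h1.comp h2).aestronglyMeasurable
  · have e1 : ∀ᵐ q ∂((volume.restrict (Set.Ioc s t)).prod P), ∀ r, 0 ≤ r → r < 1 →
        ContinuousWithinAt (fun s ↦ X s q.2) (Set.Ici r) r :=
      Measure.quasiMeasurePreserving_snd.ae hX.rightCont
    have e2 : ∀ᵐ q ∂((volume.restrict (Set.Ioc s t)).prod P), q.1 ∈ Set.Ioc s t ∧ q.1 ≠ 1 := by
      refine Measure.quasiMeasurePreserving_fst.ae (p := fun r ↦ r ∈ Set.Ioc s t ∧ r ≠ 1) ?_
      filter_upwards [ae_restrict_mem measurableSet_Ioc,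
        ae_restrict_of_ae (Measure.ae_ne volume (1 : ℝ))] with r h1 h2 using ⟨h1, h2⟩
    filter_upwards [e1, e2] with q h1 h2
    have hq0 : 0 ≤ q.1 := hs.trans h2.1.1.le
    have hq1 : q.1 < 1 := lt_of_le_of_ne (h2.1.2.trans ht) h2.2
    have h3 : Tendsto (fun n : ℕ ↦ (⌈q.1 * n⌉₊ : ℝ) / n) atTop (𝓝[≥] q.1) := by
      refine tendsto_nhdsWithin_iff.2
        ⟨(tendsto_nat_ceil_mul_div_atTop hq0).comp tendsto_natCast_atTop_atTop, ?_⟩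
      filter_upwards [eventually_gt_atTop 0] with n hn
      rw [Set.mem_Ici, le_div_iff₀ (by exact_mod_cast hn)]
      exact Nat.le_ceil _
    exact (hf.tendsto _).comp ((h1 q.1 hq0 hq1).tendsto.comp h3)

/-- The semigroup predicts `f (X_t)` from `X_s` with a bias of order `(t - s)^{1/2 + γ}`: on
halving the interval, the drift on the first half is regularized by the semigroup on the second
half. -/
lemma IsDrivenPath.abs_bias_le (hX : IsDrivenPath P 𝓕 L B X) (hL : IsDriver P 𝓕 m L)
    (hf : IsRegularized m f A C γ) (hβ : 0 < β) (hγ : 0 ≤ γ)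
    (hfβ : ∀ x y, |f x - f y| ≤ A * ‖x - y‖ ^ β) {s t : ℝ} (hs : 0 ≤ s) (hst : s < t)
    (ht : t ≤ 1) {S : Set Ω} (hS : MeasurableSet[𝓕 s] S) :
    |∫ ω in S, (f (X t ω) - avg (m (t - s)) f (X s ω)) ∂P|
      ≤ 3 * C * B * (t - s) ^ (1 / 2 + γ) * P.real S := by
  have hfm := hf.cont.measurable
  have hprob := hf.prob
  have hC := hf.nonneg
  have hB := hX.nonneg
  have hA := hf.bound_nonneg
  have hXm := hX.measurable hL
  have hint {g : E → ℝ} (hg : Measurable g) (hb : ∀ x, |g x| ≤ A) {Z : Ω → E} (hZ : Measurable Z) :=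
    integrableOn_comp_of_bounded (P := P) hg hb hZ
  have step : ∀ N : ℕ, ∀ s t : ℝ, 0 ≤ s → s < t → t ≤ 1 → ∀ S : Set Ω, MeasurableSet[𝓕 s] S →
      |∫ ω in S, (f (X t ω) - avg (m (t - s)) f (X s ω)) ∂P|
        ≤ 3 * C * B * (t - s) ^ (1 / 2 + γ) * P.real S
          + A * (B * ((t - s) / 2 ^ N)) ^ β * P.real S := by
    intro N
    induction N with
    | zero =>
      intro s t hs hst ht S hS
      have hd : 0 < t - s := sub_pos.2 hst
      have e := setIntegral_indep_add (hL.le s) (hX.adapted s) (hL.measurable_sub s t)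
        (hL.indep s t hs hst.le ht) (hL.law s t hs hst.le ht) hfm hf.bdd hS
      rw [integral_sub (hint hfm hf.bdd (hXm t) S)
        (hint (measurable_avg hfm) (abs_avg_le hf.bdd) (hXm s) S), ← e, ← integral_sub
        (hint hfm hf.bdd (hXm t) S)
        (hint hfm hf.bdd (Z := fun ω ↦ X s ω + (L t ω - L s ω))
          ((hXm s).add (hL.measurable_sub s t)) S)]
      have h1 := norm_setIntegral_le_of_norm_le_const_ae (μ := P) (s := S)
        (f := fun ω ↦ f (X t ω) - f (X s ω + (L t ω - L s ω))) (C := A * (B * (t - s)) ^ β)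
        (measure_lt_top _ _) (by
          filter_upwards [ae_restrict_of_ae hX.drift] with ω hω
          refine (hfβ _ _).trans ?_
          gcongr
          exact hω s t hs hst.le ht)
      have h2 : 0 ≤ 3 * C * B * (t - s) ^ (1 / 2 + γ) * P.real S := by positivity
      rw [pow_zero, div_one]
      rw [Real.norm_eq_abs] at h1
      linarith
    | succ N ih =>
      intro s t hs hst ht S hS
      set u := (s + t) / 2 with hu
      set δ := (t - s) / 2 with hδ
      have hδ0 : 0 < δ := by rw [hδ]; linarith
      have e1 : t - u = δ := by rw [hu, hδ]; ring
      have e2 : u - s = δ := by rw [hu, hδ]; ring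
      have e3 : t - s = 2 * δ := by rw [hδ]; ring
      have hu0 : 0 ≤ u := by linarith
      have hu1 : u ≤ 1 := by linarith
      have hfirst := ih u t hu0 (by linarith) ht S (hL.mono (by linarith) S hS)
      rw [e1] at hfirst
      have hgm : Measurable (avg (m δ) f) := measurable_avg hfm
      have hgb : ∀ x, |avg (m δ) f x| ≤ A := abs_avg_le hf.bdd
      have e := setIntegral_indep_add (hL.le s) (hX.adapted s) (hL.measurable_sub s u)
        (hL.indep s u hs (by linarith) hu1) (hL.law s u hs (by linarith) hu1) hgm hgb hS
      have ecv : avg (m (u - s)) (avg (m δ) f) = avg (m (t - s)) f := by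
        ext x
        rw [e2, e3, two_mul, hf.conv _ _ hδ0.le hδ0.le, avg_conv hfm hf.bdd]
      rw [ecv] at e
      -- the regularized drift on the first half
      have h1 := norm_setIntegral_le_of_norm_le_const_ae (μ := P) (s := S)
        (f := fun ω ↦ avg (m δ) f (X u ω) - avg (m δ) f (X s ω + (L u ω - L s ω)))
        (C := C * δ ^ (γ - 1 / 2) * (B * δ))
        (measure_lt_top _ _) (by
          filter_upwards [ae_restrict_of_ae hX.drift] with ω hω
          have h3 := hf.lip δ hδ0 (by linarith) (X u ω - (X s ω + (L u ω - L s ω)))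
            (X s ω + (L u ω - L s ω))
          rw [incr, add_sub_cancel] at h3
          refine h3.trans ?_
          gcongr
          exact (hω s u hs (by linarith) hu1).trans_eq (by rw [e2]))
      have hsplit : ∫ ω in S, (f (X t ω) - avg (m (t - s)) f (X s ω)) ∂P
          = ∫ ω in S, (f (X t ω) - avg (m δ) f (X u ω)) ∂P
            + ∫ ω in S, (avg (m δ) f (X u ω) - avg (m δ) f (X s ω + (L u ω - L s ω))) ∂P := by
        rw [integral_sub (hint hfm hf.bdd (hXm t) S)
          (hint (measurable_avg hfm) (abs_avg_le hf.bdd) (hXm s) S), ← e,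
          integral_sub (hint hfm hf.bdd (hXm t) S) (hint hgm hgb (hXm u) S),
          integral_sub (hint hgm hgb (hXm u) S) (hint hgm hgb (Z := fun ω ↦ X s ω + (L u ω - L s ω))
              ((hXm s).add (hL.measurable_sub s u)) S)]
        ring
      rw [hsplit]
      rw [Real.norm_eq_abs] at h1
      have e4 : δ ^ (γ - 1 / 2) * δ = δ ^ (1 / 2 + γ) := by
        rw [← Real.rpow_add_one hδ0.ne']; ring_nf
      have e5 : (1.4 : ℝ) * δ ^ (1 / 2 + γ) ≤ (2 * δ) ^ (1 / 2 + γ) := by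
        rw [Real.mul_rpow (by norm_num) hδ0.le]
        gcongr
        calc (1.4 : ℝ) ≤ √2 := Real.le_sqrt_of_sq_le (by norm_num)
          _ = 2 ^ (1 / 2 : ℝ) := Real.sqrt_eq_rpow 2
          _ ≤ 2 ^ (1 / 2 + γ) := Real.rpow_le_rpow_of_exponent_le (by norm_num) (by linarith)
      have e6 : (t - s) / 2 ^ (N + 1) = δ / 2 ^ N := by rw [hδ, pow_succ]; field_simp
      rw [e6, e3]
      refine (abs_add_le _ _).trans ((add_le_add hfirst h1).trans ?_)
      have h8 : 0 ≤ C * B * P.real S := by positivity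
      have h9 := mul_nonneg h8 (by positivity : 0 ≤ δ ^ (1 / 2 + γ))
      linear_combination 3 * C * B * P.real S * e5 + C * B * P.real S * e4 + h9 / 5
  have hlim : Tendsto (fun N : ℕ ↦ 3 * C * B * (t - s) ^ (1 / 2 + γ) * P.real S
          + A * (B * ((t - s) / 2 ^ N)) ^ β * P.real S) atTop
      (𝓝 (3 * C * B * (t - s) ^ (1 / 2 + γ) * P.real S + A * (B * 0) ^ β * P.real S)) := by
    refine tendsto_const_nhds.add ((Tendsto.const_mul _ ?_).mul_const _)
    refine Tendsto.rpow_const (p := β) (Tendsto.const_mul _ ?_) (Or.inr hβ.le)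
    exact tendsto_const_nhds.div_atTop (tendsto_pow_atTop_atTop_of_one_lt one_lt_two)
  rw [mul_zero, Real.zero_rpow hβ.ne', mul_zero, zero_mul, add_zero] at hlim
  exact ge_of_tendsto' hlim fun N ↦ step N s t hs hst ht S hS

/-- The error made by replacing `∫ f(X_r) dr` on an interval by its prediction at the left
endpoint. -/
noncomputable def freezeError (m : ℝ → Measure E) (f : E → ℝ) (X : ℝ → Ω → E) (s t : ℝ)
    (ω : Ω) : ℝ :=
  (∫ r in s..t, f (X r ω)) - timeInt m f (t - s) (X s ω)

lemma IsRegularized.abs_freezeError_le (hf : IsRegularized m f A C γ) {s t : ℝ}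
    (hst : s ≤ t) (ω : Ω) : |freezeError m f X s t ω| ≤ 2 * A * (t - s) := by
  have h1 := intervalIntegral.norm_integral_le_of_norm_le_const (a := s) (b := t) (C := A)
    (f := fun r ↦ f (X r ω)) fun r _ ↦ hf.bdd _
  have h2 := hf.abs_timeInt_le (sub_nonneg.2 hst) (X s ω)
  rw [abs_of_nonneg (sub_nonneg.2 hst)] at h1
  refine (abs_sub _ _).trans ((add_le_add h1 h2).trans (le_of_eq ?_))
  ring

lemma IsDrivenPath.abs_setIntegral_freezeError_le (hX : IsDrivenPath P 𝓕 L B X)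
    (hL : IsDriver P 𝓕 m L) (hf : IsRegularized m f A C γ) (hβ : 0 < β) (hγ : 0 < γ)
    (hfβ : ∀ x y, |f x - f y| ≤ A * ‖x - y‖ ^ β) {s t : ℝ} (hs : 0 ≤ s) (hst : s < t)
    (ht : t ≤ 1) {S : Set Ω} (hS : MeasurableSet[𝓕 s] S) :
    |∫ ω in S, freezeError m f X s t ω ∂P| ≤ 3 * C * B * (t - s) ^ (3 / 2 + γ) * P.real S := by
  have hd : 0 < t - s := sub_pos.2 hst
  have hC := hf.nonneg
  have hB := hX.nonneg
  have hXm := hX.measurable hL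
  have hprob := hf.prob
  have hj := hX.aestronglyMeasurable_uncurry hL hf.cont hs ht
  have hji : Integrable (Function.uncurry fun r ω ↦ f (X r ω))
      ((volume.restrict (Set.Ioc s t)).prod P) :=
    Integrable.of_bound hj A (ae_of_all _ fun q ↦ hf.bdd _)
  have hjS : Integrable (Function.uncurry fun r ω ↦ f (X r ω))
      ((volume.restrict (Set.Ioc s t)).prod (P.restrict S)) := by
    rw [← Measure.restrict_univ (μ := volume.restrict _), Measure.prod_restrict]
    exact hji.restrict
  have hVm := hf.measurable_timeInt hγ hd.le (by linarith)
  have hVi : Integrable (fun ω ↦ timeInt m f (t - s) (X s ω)) (P.restrict S) :=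
    integrableOn_comp_of_bounded hVm (hf.abs_timeInt_le hd.le) (hXm s) S
  have hIi : Integrable (fun ω ↦ ∫ r in s..t, f (X r ω)) (P.restrict S) := by
    simp_rw [intervalIntegral.integral_of_le hst.le]
    exact hjS.integral_prod_right
  have e1 : ∫ ω in S, (∫ r in s..t, f (X r ω)) ∂P = ∫ r in s..t, ∫ ω in S, f (X r ω) ∂P := by
    simp_rw [intervalIntegral.integral_of_le hst.le]
    exact integral_integral_swap (f := fun ω r ↦ f (X r ω)) hjS.swap
  have e2 : ∫ ω in S, timeInt m f (t - s) (X s ω) ∂P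
      = ∫ r in s..t, ∫ ω in S, avg (m (r - s)) f (X s ω) ∂P := by
    have h1 := hf.integral_timeInt ((P.restrict S).map (X s)) hd.le (by linarith)
    rw [integral_map (hXm s).aemeasurable hVm.aestronglyMeasurable] at h1
    rw [h1, intervalIntegral.integral_comp_sub_right
      (fun r ↦ ∫ ω in S, avg (m r) f (X s ω) ∂P) s, sub_self]
    refine intervalIntegral.integral_congr fun r _ ↦ ?_
    exact integral_map (hXm s).aemeasurable (measurable_avg hf.cont.measurable).aestronglyMeasurable
  have i1 : IntervalIntegrable (fun r ↦ ∫ ω in S, f (X r ω) ∂P) volume s t := by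
    rw [intervalIntegrable_iff, Set.uIoc_of_le hst.le]
    exact hjS.integral_prod_left
  have i2 : IntervalIntegrable (fun r ↦ ∫ ω in S, avg (m (r - s)) f (X s ω) ∂P) volume s t := by
    have := ((intervalIntegrable_iff_integrableOn_Ioc_of_le hd.le).2 (hf.integrable_prod_avg
      ((P.restrict S).map (X s)) (by linarith : t - s ≤ 1)).integral_prod_left).comp_sub_right s
    rw [zero_add, sub_add_cancel] at this
    refine this.congr fun r _ ↦ ?_
    exact integral_map (hXm s).aemeasurable
      (measurable_avg (m := m (r - s)) hf.cont.measurable).aestronglyMeasurable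
  unfold freezeError
  rw [integral_sub hIi hVi, e1, e2, ← intervalIntegral.integral_sub i1 i2]
  have h1 := intervalIntegral.norm_integral_le_of_norm_le_const (a := s) (b := t)
    (C := 3 * C * B * (t - s) ^ (1 / 2 + γ) * P.real S)
    (f := fun r ↦ ∫ ω in S, f (X r ω) ∂P - ∫ ω in S, avg (m (r - s)) f (X s ω) ∂P)
    fun r hr ↦ by
      rw [Set.uIoc_of_le hst.le] at hr
      rw [← integral_sub]
      · refine (hX.abs_bias_le hL hf hβ hγ.le hfβ hs hr.1 (hr.2.trans ht) hS).trans ?_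
        have := hr.1
        gcongr
        exact hr.2
      · exact integrableOn_comp_of_bounded hf.cont.measurable hf.bdd (hXm r) S
      · exact integrableOn_comp_of_bounded (measurable_avg hf.cont.measurable)
          (abs_avg_le hf.bdd) (hXm s) S
  rw [abs_of_pos hd] at h1
  refine h1.trans (le_of_eq ?_)
  rw [show (3 / 2 + γ : ℝ) = 1 / 2 + γ + 1 by ring, Real.rpow_add_one hd.ne']
  ring

lemma IsDrivenPath.hasLpBound_freezeError (hX : IsDrivenPath P 𝓕 L B X)
    (hL : IsDriver P 𝓕 m L) (hf : IsRegularized m f A C γ) (hβ : 0 < β) (hγ : 0 < γ)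
    (hfβ : ∀ x y, |f x - f y| ≤ A * ‖x - y‖ ^ β) (hp : 1 ≤ p) (hM : HasMoment m p β K κ)
    {γ' : ℝ} (hγ' : γ' ≤ γ) (hγκ : γ' ≤ κ) (hγβ : γ' ≤ β) (hκ : 0 ≤ κ)
    {s t : ℝ} (hs : 0 ≤ s) (hst : s < t) (ht : t ≤ 1) :
    HasLpBound P p (freezeError m f X s t) ((A * B ^ β + 2 * A * K + C) * (t - s) ^ (1 + γ')) := by
  have hd : 0 < t - s := sub_pos.2 hst
  have hd1 : t - s ≤ 1 := by linarith
  have hC := hf.nonneg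
  have hA := hf.bound_nonneg
  have hB := hX.nonneg
  have hK := hM.nonneg
  have hXm := hX.measurable hL
  have hfm := hf.cont.measurable
  have hmono : ∀ a, γ' ≤ a → (t - s) ^ a ≤ (t - s) ^ γ' := fun a ha ↦
    Real.rpow_le_rpow_of_exponent_ge hd hd1 ha
  have hpt : ∀ r, s < r → r ≤ t → HasLpBound P p (fun ω ↦ f (X r ω) - f (X s ω))
      (A * (B * (t - s)) ^ β + 2 * A * (K * (t - s) ^ κ)) := by
    intro r hr hrt
    have hL1 := hL.hasLpBound_incr (by linarith) hM hs hr (hrt.trans ht)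
    have h1 : 0 ≤ A * (B * (t - s)) ^ β := by positivity
    have h2 := (HasLpBound.const (P := P) h1).add hp (hL1.const_mul (by positivity : 0 ≤ 2 * A))
    refine (h2.of_abs_le ?_ ?_).mono ?_
    · exact ((hfm.comp (hXm r)).sub (hfm.comp (hXm s))).aestronglyMeasurable
    · filter_upwards [hX.drift] with ω hω
      have h3 : |f (X r ω) - f (X s ω + (L r ω - L s ω))| ≤ A * (B * (t - s)) ^ β := by
        refine (hfβ _ _).trans ?_
        gcongr
        exact (hω s r hs hr.le (hrt.trans ht)).trans (by gcongr)
      have h4 : |f (X s ω + (L r ω - L s ω)) - f (X s ω)|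
          ≤ 2 * A * min (‖L r ω - L s ω‖ ^ β) 1 := abs_incr_le_min hf.bdd hfβ _ _
      calc _ = |(f (X r ω) - f (X s ω + (L r ω - L s ω)))
            + (f (X s ω + (L r ω - L s ω)) - f (X s ω))| := by congr 1; ring
        _ ≤ _ := (abs_add_le _ _).trans (add_le_add h3 h4)
    · have : (r - s) ^ κ ≤ (t - s) ^ κ := Real.rpow_le_rpow (by linarith) (by linarith) hκ
      gcongr
  have hj := hX.aestronglyMeasurable_uncurry hL hf.cont hs ht
  have hjm : AEStronglyMeasurable (Function.uncurry fun r ω ↦ f (X r ω) - f (X s ω))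
      ((volume.restrict (Set.Ioc s t)).prod P) := by
    refine hj.sub ?_
    exact ((hfm.comp (hXm s)).comp measurable_snd).aestronglyMeasurable
  have h1 := HasLpBound.intervalIntegral hp hst (by positivity) hjm hpt
  have h2 : HasLpBound P p (fun ω ↦ defect m f (t - s) 0 (X s ω)) (C * (t - s) ^ (1 + γ)) := by
    refine HasLpBound.of_ae_bound ?_ (by positivity)
      (ae_of_all _ fun ω ↦ hf.abs_defect_zero_le hγ hd.le hd1 _)
    exact ((hf.measurable_defect hγ hd.le (by simpa using hd1)).comp (hXm s)).aestronglyMeasurable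
  refine ((h1.sub hp h2).congr ?_).mono ?_
  · have hmω : ∀ᵐ ω ∂P, AEStronglyMeasurable (fun r ↦ f (X r ω))
        (volume.restrict (Set.Ioc s t)) := hj.prod_swap.prodMk_left
    filter_upwards [hmω] with ω hω
    have hi : IntervalIntegrable (fun r ↦ f (X r ω)) volume s t := by
      rw [intervalIntegrable_iff, Set.uIoc_of_le hst.le]
      exact Integrable.of_bound hω A (ae_of_all _ fun r ↦ hf.bdd _)
    rw [intervalIntegral.integral_sub hi intervalIntegrable_const]
    simp [freezeError, defect]
  · have b1 : (t - s) ^ (1 + γ') = (t - s) * (t - s) ^ γ' := by rw [Real.rpow_add hd, Real.rpow_one]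
    have b2 : (t - s) ^ (1 + γ) = (t - s) * (t - s) ^ γ := by rw [Real.rpow_add hd, Real.rpow_one]
    rw [b1, b2, Real.mul_rpow hB hd.le]
    have := hmono β hγβ
    have := hmono κ hγκ
    have := hmono γ hγ'
    calc _ ≤ (t - s) * (A * (B ^ β * (t - s) ^ γ') + 2 * A * (K * (t - s) ^ γ'))
          + C * ((t - s) * (t - s) ^ γ') := by gcongr
      _ = _ := by ring

end Paths

/-! ### One-step errors of the Euler scheme -/

section AlmostMartingale

variable {Ω : Type*} {mΩ : MeasurableSpace Ω} {P : Measure Ω} [IsProbabilityMeasure P] {p : ℝ}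

lemma abs_clip_le {c : ℝ} (hc : 0 ≤ c) (x : ℝ) : |max (-c) (min c x)| ≤ c := by
  rw [abs_le]
  exact ⟨le_max_left _ _, max_le (by linarith) (min_le_left _ _)⟩

lemma clip_eq_self {c x : ℝ} (h : |x| ≤ c) : max (-c) (min c x) = x := by
  rw [abs_le] at h
  rw [min_eq_right h.2, max_eq_right h.1]

/-- Sums of random variables whose conditional expectation given the past is at most `δ`: apart
from the sum of these conditional expectations, they grow like the square root of the number of
terms. -/
lemma HasLpBound.sum_of_small_bias (hp : 2 < p) (𝓕 : ℕ → MeasurableSpace Ω)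
    (hle : ∀ k, 𝓕 k ≤ mΩ) (hmono : Monotone 𝓕) {e : ℕ → Ω → ℝ} {a c δ : ℝ} (ha : 0 ≤ a)
    (hc : 0 ≤ c) (hδ : 0 ≤ δ) (N : ℕ)
    (hmeas : ∀ k < N, ∃ e', Measurable[𝓕 (k + 1)] e' ∧ e k =ᵐ[P] e')
    (hbdd : ∀ k < N, ∀ᵐ ω ∂P, |e k ω| ≤ c)
    (hbias : ∀ k < N, ∀ S, MeasurableSet[𝓕 k] S → |∫ ω in S, e k ω ∂P| ≤ δ * P.real S)
    (hnorm : ∀ k < N, HasLpBound P p (e k) a) :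
    HasLpBound P p (fun ω ↦ ∑ k ∈ Finset.range N, e k ω) (martConst p * √N * (a + δ) + N * δ) := by
  have hp1 : 1 ≤ p := by linarith
  -- versions that are measurable and bounded everywhere
  have key : ∀ k, ∃ e' g : Ω → ℝ, k < N → (Measurable[𝓕 (k + 1)] e' ∧ Measurable[𝓕 k] g ∧
      (∀ ω, |e' ω| ≤ c) ∧ (∀ ω, |g ω| ≤ δ) ∧ e k =ᵐ[P] e' ∧ g =ᵐ[P] P[e'|𝓕 k]) := by
    intro k
    by_cases hk : k < N
    swap
    · exact ⟨0, 0, fun h ↦ absurd h hk⟩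
    obtain ⟨e₀, hm₀, he₀⟩ := hmeas k hk
    have h1 : e k =ᵐ[P] fun ω ↦ max (-c) (min c (e₀ ω)) := by
      filter_upwards [he₀, hbdd k hk] with ω h1 h2
      rw [← h1, clip_eq_self h2]
    have hm1 : Measurable[𝓕 (k + 1)] fun ω ↦ max (-c) (min c (e₀ ω)) :=
      (measurable_const.max (measurable_const.min hm₀))
    have hint : Integrable (fun ω ↦ max (-c) (min c (e₀ ω))) P :=
      integrable_of_bounded (hm1.mono (hle _) le_rfl).aestronglyMeasurable fun ω ↦ abs_clip_le hc _
    have h3 := abs_condExp_le_of_forall_setIntegral (hle k) hint (a := δ) fun S hS ↦ by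
      rw [← integral_congr_ae (ae_restrict_of_ae h1)]
      exact hbias k hk S hS
    refine ⟨fun ω ↦ max (-c) (min c (e₀ ω)), fun ω ↦ max (-δ) (min δ
      ((P[fun ω ↦ max (-c) (min c (e₀ ω))|𝓕 k]) ω)), fun _ ↦ ⟨hm1, ?_, fun ω ↦ abs_clip_le hc _,
      fun ω ↦ abs_clip_le hδ _, h1, ?_⟩⟩
    · exact measurable_const.max (measurable_const.min stronglyMeasurable_condExp.measurable)
    · filter_upwards [h3] with ω h4
      exact clip_eq_self h4
  choose e' g hk using key
  have hnorm' : ∀ k < N, HasLpBound P p (fun ω ↦ e' k ω - g k ω) (a + δ) := fun k hkN ↦ by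
    obtain ⟨h1, h2, h3, h4, h5, h6⟩ := hk k hkN
    exact ((hnorm k hkN).congr h5.symm).sub hp1 (HasLpBound.of_ae_bound
      (h2.mono (hle _) le_rfl).aestronglyMeasurable hδ (ae_of_all _ h4))
  have hS := HasLpBound.sum_martingale hp 𝓕 hle hmono (e := fun k ω ↦ e' k ω - g k ω)
    (add_nonneg ha hδ) N (fun k hkN ↦ ?_) (fun k hkN ↦ ⟨c + δ, fun ω ↦ ?_⟩) (fun k hkN ↦ ?_) hnorm'
  · have hG := HasLpBound.sum (P := P) hp1 (Finset.range N) (f := g) (a := fun _ ↦ δ) fun k hkN ↦ by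
      obtain ⟨h1, h2, h3, h4, h5, h6⟩ := hk k (Finset.mem_range.1 hkN)
      exact HasLpBound.of_ae_bound (h2.mono (hle _) le_rfl).aestronglyMeasurable hδ (ae_of_all _ h4)
    rw [Finset.sum_const, Finset.card_range, nsmul_eq_mul] at hG
    refine (hS.add hp1 hG).congr ?_
    have hall : ∀ᵐ ω ∂P, ∀ k, k < N → e k ω = e' k ω := by
      refine ae_all_iff.2 fun k ↦ ?_
      by_cases hkN : k < N
      · filter_upwards [(hk k hkN).2.2.2.2.1] with ω h _ using h
      · exact ae_of_all _ fun ω h ↦ absurd h hkN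
    filter_upwards [hall] with ω hω
    rw [← Finset.sum_add_distrib]
    exact Finset.sum_congr rfl fun k hkN ↦ by rw [hω k (Finset.mem_range.1 hkN)]; ring
  · obtain ⟨h1, h2, h3, h4, h5, h6⟩ := hk k hkN
    exact h1.sub (h2.mono (hmono (Nat.le_succ k)) le_rfl)
  · obtain ⟨h1, h2, h3, h4, h5, h6⟩ := hk k hkN
    exact (abs_sub _ _).trans (add_le_add (h3 ω) (h4 ω))
  · obtain ⟨h1, h2, h3, h4, h5, h6⟩ := hk k hkN
    have i1 : Integrable (e' k) P := integrable_of_bounded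
      (h1.mono (hle _) le_rfl).aestronglyMeasurable h3
    have i2 : Integrable (g k) P := integrable_of_bounded
      (h2.mono (hle _) le_rfl).aestronglyMeasurable h4
    have e1 : P[g k|𝓕 k] = g k := condExp_of_stronglyMeasurable (hle k) h2.stronglyMeasurable i2
    refine (condExp_sub i1 i2 (𝓕 k)).trans ?_
    rw [e1]
    filter_upwards [h6] with ω h
    simp [h]

/-- The case of exact martingale differences. -/
lemma HasLpBound.sum_of_zero_bias (hp : 2 < p) (𝓕 : ℕ → MeasurableSpace Ω)
    (hle : ∀ k, 𝓕 k ≤ mΩ) (hmono : Monotone 𝓕) {e : ℕ → Ω → ℝ} {a c : ℝ} (ha : 0 ≤ a)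
    (hc : 0 ≤ c) (N : ℕ)
    (hmeas : ∀ k < N, ∃ e', Measurable[𝓕 (k + 1)] e' ∧ e k =ᵐ[P] e')
    (hbdd : ∀ k < N, ∀ᵐ ω ∂P, |e k ω| ≤ c)
    (hbias : ∀ k < N, ∀ S, MeasurableSet[𝓕 k] S → ∫ ω in S, e k ω ∂P = 0)
    (hnorm : ∀ k < N, HasLpBound P p (e k) a) :
    HasLpBound P p (fun ω ↦ ∑ k ∈ Finset.range N, e k ω) (martConst p * √N * a) := by
  have := HasLpBound.sum_of_small_bias hp 𝓕 hle hmono ha hc le_rfl N hmeas hbdd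
    (fun k hk S hS ↦ by rw [hbias k hk S hS]; simp) hnorm
  simpa using this

end AlmostMartingale

/-- A solution `X` of the equation with driver `L`, together with an Euler scheme `Y` on the grid
of step `1/n`, whose drift `b` satisfies the estimates on which the error bound is based. -/
structure IsEulerPair {d : ℕ} {Ω : Type*} {mΩ : MeasurableSpace Ω} (P : Measure Ω)
    (𝓕 : ℝ → MeasurableSpace Ω) (m : ℝ → Measure (EuclideanSpace ℝ (Fin d)))
    (L : ℝ → Ω → EuclideanSpace ℝ (Fin d)) (p A C γ β K κ B : ℝ) (n : ℕ)
    (b : EuclideanSpace ℝ (Fin d) → EuclideanSpace ℝ (Fin d))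
    (X : ℝ → Ω → EuclideanSpace ℝ (Fin d)) (Y : ℕ → Ω → EuclideanSpace ℝ (Fin d)) : Prop where
  two_lt : 2 < p
  pos : 1 ≤ n
  γ_pos : 0 < γ
  γ_lt : γ < β / 2
  β_lt : β < 1
  κ_le : κ ≤ β / 2
  γ'_pos : 0 < γ - β / 2 + κ
  driver : IsDriver P 𝓕 m L
  path : IsDrivenPath P 𝓕 L B X
  eqn : ∀ᵐ ω ∂P, ∀ s t, 0 ≤ s → s ≤ t → t ≤ 1 → ∀ i,
    (X t ω - (X s ω + (L t ω - L s ω))) i = ∫ r in s..t, b (X r ω) i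
  reg : ∀ i, IsRegularized m (fun x ↦ b x i) A C γ
  holder : ∀ i x y, |b x i - b y i| ≤ A * ‖x - y‖ ^ β
  bdd : ∀ x, ‖b x‖ ≤ B
  moment : HasMoment m p β K κ
  Y_meas : ∀ k : ℕ, Measurable[𝓕 (k * (n : ℝ)⁻¹)] (Y k)
  step : ∀ᵐ ω ∂P, ∀ k < n, Y (k + 1) ω = Y k ω + (n : ℝ)⁻¹ • b (Y k ω)
    + (L ((k + 1 : ℕ) * (n : ℝ)⁻¹) ω - L (k * (n : ℝ)⁻¹) ω)

/-- The error of the Euler scheme at the `k`th grid point. -/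
noncomputable def gridError {d : ℕ} {Ω : Type*} (n : ℕ) (X : ℝ → Ω → EuclideanSpace ℝ (Fin d))
    (Y : ℕ → Ω → EuclideanSpace ℝ (Fin d)) (k : ℕ) (ω : Ω) : EuclideanSpace ℝ (Fin d) :=
  X (k * (n : ℝ)⁻¹) ω - Y k ω

lemma sum_range_two_mul (g : ℕ → ℝ) (M : ℕ) :
    ∑ a ∈ Finset.range (2 * M), g a = ∑ a ∈ Finset.range M, (g (2 * a) + g (2 * a + 1)) := by
  induction M with
  | zero => simp
  | succ M ih =>
    rw [Nat.mul_succ, Finset.sum_range_succ, Finset.sum_range_succ, ih, Finset.sum_range_succ]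
    ring

/-- The constant in the sewing bound. -/
noncomputable def sewConst (p C γ B : ℝ) : ℝ :=
  2 * C + (2 * martConst p * (4 * C) + 4 * (C / γ * B + 2 * C)) / (2 ^ γ - 1)

lemma sewConst_nonneg {p C γ B : ℝ} (hp : 2 < p) (hC : 0 ≤ C) (hγ : 0 < γ)
    (hB : 0 ≤ B) : 0 ≤ sewConst p C γ B := by
  have := martConst_nonneg hp
  have : (1 : ℝ) < 2 ^ γ := Real.one_lt_rpow (by norm_num) hγ
  have : (0 : ℝ) < 2 ^ γ - 1 := by linarith
  unfold sewConst
  positivity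

/-- The constant in the expansion of the error of the Euler scheme. -/
noncomputable def expandConst (p A C γ β K B : ℝ) : ℝ :=
  ((martConst p * (A * B ^ β + 2 * A * K + C + 3 * C * B) + 3 * C * B)
    + (3 * C + martConst p * (4 * C * (∑' j : ℕ, (↑(j + 1) : ℝ) ^ (γ - 1 - β / 2)) * K + 4 * C)
        + C * (∑' j : ℕ, (↑(j + 1) : ℝ) ^ (γ - 3 / 2)) * B))

lemma expandConst_nonneg {p A C γ β K B : ℝ} (hp : 2 < p) (hA : 0 ≤ A) (hC : 0 ≤ C) (hK : 0 ≤ K)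
    (hB : 0 ≤ B) : 0 ≤ expandConst p A C γ β K B := by
  have hS₁ : 0 ≤ ∑' j : ℕ, (↑(j + 1) : ℝ) ^ (γ - 3 / 2) := tsum_nonneg fun j ↦ by positivity
  have hS₂ : 0 ≤ ∑' j : ℕ, (↑(j + 1) : ℝ) ^ (γ - 1 - β / 2) := tsum_nonneg fun j ↦ by positivity
  have := martConst_nonneg hp
  unfold expandConst
  positivity

/-- The constant in the bound on the increments of the error on the grid, in terms of the
admissible length `h₀` of the intervals on which the sewing bound is closed. -/
noncomputable def buckConst (D B h₀ : ℝ) : ℝ :=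
  2 * B / h₀ + (4 * D + 2 / h₀) * (2 + 4 * D) ^ ⌈2 / h₀⌉₊

lemma norm_le_sum_abs {d : ℕ} (v : EuclideanSpace ℝ (Fin d)) : ‖v‖ ≤ ∑ c, |v c| := by
  rw [EuclideanSpace.norm_eq]
  refine Real.sqrt_le_iff.2 ⟨Finset.sum_nonneg fun _ _ ↦ abs_nonneg _, ?_⟩
  exact Finset.sum_sq_le_sq_sum_of_nonneg fun _ _ ↦ abs_nonneg _

namespace IsEulerPair

variable {d : ℕ} {Ω : Type*} {mΩ : MeasurableSpace Ω} {P : Measure Ω} [IsProbabilityMeasure P]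
  {𝓕 : ℝ → MeasurableSpace Ω} {m : ℝ → Measure (EuclideanSpace ℝ (Fin d))}
  {L : ℝ → Ω → EuclideanSpace ℝ (Fin d)} {p A C γ β K κ B : ℝ} {n : ℕ}
  {b : EuclideanSpace ℝ (Fin d) → EuclideanSpace ℝ (Fin d)}
  {X : ℝ → Ω → EuclideanSpace ℝ (Fin d)} {Y : ℕ → Ω → EuclideanSpace ℝ (Fin d)}
  (hE : IsEulerPair P 𝓕 m L p A C γ β K κ B n b X Y)
include hE

lemma n_pos : 0 < (n : ℝ) := by exact_mod_cast hE.pos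

lemma h_pos : 0 < (n : ℝ)⁻¹ := inv_pos.2 hE.n_pos

lemma h_le_one : (n : ℝ)⁻¹ ≤ 1 := inv_le_one_of_one_le₀ (by exact_mod_cast hE.pos)

lemma grid_nonneg (k : ℕ) : 0 ≤ (k : ℝ) * (n : ℝ)⁻¹ := mul_nonneg (Nat.cast_nonneg _) hE.h_pos.le

lemma grid_mono {j k : ℕ} (h : j ≤ k) : (j : ℝ) * (n : ℝ)⁻¹ ≤ (k : ℝ) * (n : ℝ)⁻¹ :=
  mul_le_mul_of_nonneg_right (by exact_mod_cast h) hE.h_pos.le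

lemma grid_le_one {k : ℕ} (h : k ≤ n) : (k : ℝ) * (n : ℝ)⁻¹ ≤ 1 := by
  have := hE.n_pos
  rw [mul_inv_le_iff₀ this, one_mul]
  exact_mod_cast h

lemma grid_succ_sub (k : ℕ) : ((k + 1 : ℕ) : ℝ) * (n : ℝ)⁻¹ - k * (n : ℝ)⁻¹ = (n : ℝ)⁻¹ := by
  push_cast; ring

lemma grid_lt_succ (k : ℕ) : (k : ℝ) * (n : ℝ)⁻¹ < (k + 1 : ℕ) * (n : ℝ)⁻¹ := by
  linarith [hE.grid_succ_sub k, hE.h_pos]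

lemma mul_sqrt_le {N : ℕ} (hN : N ≤ n) : (N : ℝ) * √(n : ℝ)⁻¹ ≤ √N := by
  have h := Real.sqrt_le_one.2 (hE.grid_le_one hN)
  rw [Real.sqrt_mul (Nat.cast_nonneg _)] at h
  nth_rw 1 [← Real.mul_self_sqrt (Nat.cast_nonneg (α := ℝ) N)]
  rw [mul_assoc]
  exact mul_le_of_le_one_right (Real.sqrt_nonneg _) h

lemma C_nonneg (i : Fin d) : 0 ≤ C := (hE.reg i).nonneg

lemma A_nonneg (i : Fin d) : 0 ≤ A := (hE.reg i).bound_nonneg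

lemma B_nonneg : 0 ≤ B := hE.path.nonneg

lemma measurable_Y (k : ℕ) : Measurable (Y k) := (hE.Y_meas k).mono (hE.driver.le _) le_rfl

lemma measurable_X (t : ℝ) : Measurable (X t) := hE.path.measurable hE.driver t

lemma measurable_b : Measurable b := by
  have : Measurable fun x i ↦ b x i := measurable_pi_lambda _ fun i ↦ (hE.reg i).cont.measurable
  exact (WithLp.measurable_toLp 2 _).comp this

lemma β_pos : 0 < β := by linarith [hE.γ_pos, hE.γ_lt]

lemma bounds : 0 < (n : ℝ)⁻¹ ∧ (n : ℝ)⁻¹ ≤ 1 ∧ 0 ≤ B ∧ 0 ≤ K ∧ 0 < γ ∧ 0 < γ - β / 2 + κ ∧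
    γ < β / 2 ∧ κ ≤ β / 2 ∧ 0 < β ∧ β < 1 ∧ 2 < p ∧ 1 ≤ p :=
  ⟨hE.h_pos, hE.h_le_one, hE.B_nonneg, hE.moment.nonneg, hE.γ_pos, hE.γ'_pos, hE.γ_lt, hE.κ_le,
    hE.β_pos, hE.β_lt, hE.two_lt, by linarith [hE.two_lt]⟩

lemma grid_filtration_mono (a : ℕ) : Monotone fun k : ℕ ↦ 𝓕 ((a + k : ℕ) * (n : ℝ)⁻¹) :=
  fun _ _ h ↦ hE.driver.mono (hE.grid_mono (Nat.add_le_add_left h a))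

/-- The sum of the freezing errors over `N` steps. -/
lemma hasLpBound_sum_freezeError (i : Fin d) {a N : ℕ} (haN : a + N ≤ n) :
    HasLpBound P p (fun ω ↦ ∑ k ∈ Finset.range N, freezeError m (fun x ↦ b x i) X
        ((a + k : ℕ) * (n : ℝ)⁻¹) ((a + k + 1 : ℕ) * (n : ℝ)⁻¹) ω)
      ((martConst p * (A * B ^ β + 2 * A * K + C + 3 * C * B) + 3 * C * B)
        * √N * (n : ℝ)⁻¹ ^ (1 + (γ - β / 2 + κ))) := by
  obtain ⟨hh, hh1, hB, hK, hγ, hγ', hγβ, hκ, hβ, hβ1, hp, hp1⟩ := hE.bounds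
  have hC := hE.C_nonneg i
  have hA := hE.A_nonneg i
  have hf := hE.reg i
  have hdiff := fun k : ℕ ↦ hE.grid_succ_sub (a + k)
  have hlt := fun k : ℕ ↦ hE.grid_lt_succ (a + k)
  have hle1 := fun k (hk : k < N) ↦ hE.grid_le_one (by omega : a + k + 1 ≤ n)
  have h4 := hE.mul_sqrt_le (by omega : N ≤ n)
  set h := (n : ℝ)⁻¹ with hdef
  set ρ := h ^ (1 + (γ - β / 2 + κ)) with hρ
  have hS := HasLpBound.sum_of_small_bias (P := P) hp (fun k : ℕ ↦ 𝓕 ((a + k : ℕ) * h))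
    (fun k ↦ hE.driver.le _) (hE.grid_filtration_mono a)
    (e := fun k ↦ freezeError m (fun x ↦ b x i) X ((a + k : ℕ) * h) ((a + k + 1 : ℕ) * h))
    (a := (A * B ^ β + 2 * A * K + C) * ρ) (c := 2 * A * h)
    (δ := 3 * C * B * h ^ (3 / 2 + γ)) (by positivity) (by positivity) (by positivity) N
    (fun k hk ↦ ?_) (fun k hk ↦ ?_) (fun k hk S hS ↦ ?_) (fun k hk ↦ ?_)
  · refine hS.mono ?_
    have h1 : h ^ (3 / 2 + γ) ≤ ρ := Real.rpow_le_rpow_of_exponent_ge hh hh1 (by linarith)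
    have h2 : h ^ (3 / 2 + γ) = √h * h ^ (1 + γ) := by
      rw [Real.sqrt_eq_rpow, ← Real.rpow_add hh]; ring_nf
    have h3 : h ^ (1 + γ) ≤ ρ := Real.rpow_le_rpow_of_exponent_ge hh hh1 (by linarith)
    have hm := martConst_nonneg hp
    have h5 : (N : ℝ) * (3 * C * B * h ^ (3 / 2 + γ)) ≤ 3 * C * B * (√N * ρ) := by
      calc _ = 3 * C * B * ((N * √h) * h ^ (1 + γ)) := by rw [h2]; ring
        _ ≤ _ := by gcongr
    calc _ ≤ martConst p * √N * ((A * B ^ β + 2 * A * K + C) * ρ + 3 * C * B * ρ)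
          + 3 * C * B * (√N * ρ) := by gcongr
      _ = _ := by ring
  · refine ⟨fun ω ↦ (X ((a + k + 1 : ℕ) * h) ω - (X ((a + k : ℕ) * h) ω
      + (L ((a + k + 1 : ℕ) * h) ω - L ((a + k : ℕ) * h) ω))) i
      - timeInt m (fun x ↦ b x i) h (X ((a + k : ℕ) * h) ω), ?_, ?_⟩
    · have hm := hE.driver.mono (hlt k).le
      have m1 := hE.path.adapted ((a + k + 1 : ℕ) * h)
      have m2 := (hE.path.adapted ((a + k : ℕ) * h)).mono hm le_rfl
      have m3 := hE.driver.adapted ((a + k + 1 : ℕ) * h)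
      have m4 := (hE.driver.adapted ((a + k : ℕ) * h)).mono hm le_rfl
      have m5 := hf.measurable_timeInt hγ hh.le hh1
      have m6 : Measurable fun x : EuclideanSpace ℝ (Fin d) ↦ x i := by fun_prop
      exact (m6.comp (m1.sub (m2.add (m3.sub m4)))).sub (m5.comp m2)
    · filter_upwards [hE.eqn] with ω hω
      rw [freezeError, hdiff, hω _ _ (hE.grid_nonneg _) (hlt k).le (hle1 k hk) i]
  · refine ae_of_all _ fun ω ↦ ?_
    have := hf.abs_freezeError_le (X := X) (hlt k).le ω
    rwa [hdiff] at this
  · have := hE.path.abs_setIntegral_freezeError_le hE.driver hf hβ hγ (hE.holder i)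
      (hE.grid_nonneg (a + k)) (hlt k) (hle1 k hk) hS
    rwa [hdiff] at this
  · have := hE.path.hasLpBound_freezeError hE.driver hf hβ hγ (hE.holder i) (by linarith)
      hE.moment (γ' := γ - β / 2 + κ) (by linarith) (by linarith) (by linarith) (by linarith)
      (hE.grid_nonneg (a + k)) (hlt k) (hle1 k hk)
    rwa [hdiff] at this

/-- The sum of the quadrature defects along the Euler scheme. -/
lemma hasLpBound_sum_defect (i : Fin d) {a N : ℕ} (haN : a + N ≤ n) :
    HasLpBound P p (fun ω ↦ ∑ k ∈ Finset.range N,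
        defect m (fun x ↦ b x i) (n : ℝ)⁻¹ 0 (Y (a + k) ω))
      ((3 * C + martConst p * (4 * C * (∑' j : ℕ, (↑(j + 1) : ℝ) ^ (γ - 1 - β / 2)) * K + 4 * C)
        + C * (∑' j : ℕ, (↑(j + 1) : ℝ) ^ (γ - 3 / 2)) * B)
        * √N * (n : ℝ)⁻¹ ^ (1 + (γ - β / 2 + κ))) := by
  obtain ⟨hh, hh1, hB, hK, hγ, hγ', hγβ, hκ, hβ, hβ1, hp, hp1⟩ := hE.bounds
  have hC := hE.C_nonneg i
  have hf := hE.reg i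
  have hprob := hf.prob
  have hdiff := fun k : ℕ ↦ hE.grid_succ_sub (a + k)
  have hlt := fun k : ℕ ↦ hE.grid_lt_succ (a + k)
  have hle1 := fun k (hk : k < N) ↦ hE.grid_le_one (by omega : a + k + 1 ≤ n)
  have hNsqrt := hE.mul_sqrt_le (by omega : N ≤ n)
  set h := (n : ℝ)⁻¹ with hdef
  set f := fun x ↦ b x i with hfdef
  set S₁ := ∑' j : ℕ, (↑(j + 1) : ℝ) ^ (γ - 3 / 2)
  set S₂ := ∑' j : ℕ, (↑(j + 1) : ℝ) ^ (γ - 1 - β / 2)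
  have hS₁ : 0 ≤ S₁ := tsum_nonneg fun j ↦ by positivity
  have hS₂ : 0 ≤ S₂ := tsum_nonneg fun j ↦ by positivity
  have hNh : (N : ℝ) * h ≤ 1 := hE.grid_le_one (by omega)
  set ρ := h ^ (1 + (γ - β / 2 + κ)) with hρ
  have hργ : h ^ (1 + γ) ≤ ρ := Real.rpow_le_rpow_of_exponent_ge hh hh1 (by linarith)
  have hlh : ∀ k < N, ((N - (k + 1) : ℕ) + 1 : ℝ) * h ≤ 1 := fun k hk ↦ by
    have := hE.grid_le_one (k := N - (k + 1) + 1) (by omega)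
    push_cast at this ⊢; exact this
  have hlh' : ∀ k < N, ((N - (k + 1) : ℕ) : ℝ) * h ≤ 1 := fun k hk ↦ by have := hlh k hk; linarith
  set v := corrector m f h with hv
  set w := correctorTail m f h with hw
  set Z : ℕ → Ω → EuclideanSpace ℝ (Fin d) := fun k ω ↦ Y (a + k) ω + h • b (Y (a + k) ω) with hZ
  have hZm : ∀ k, Measurable[𝓕 ((a + k : ℕ) * h)] (Z k) := fun k ↦ by
    have m1 := hE.Y_meas (a + k)
    exact m1.add ((hE.measurable_b.comp m1).const_smul h)
  have hZm' : ∀ k, Measurable (Z k) := fun k ↦ (hZm k).mono (hE.driver.le _) le_rfl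
  have hvm : ∀ k < N, Measurable (v (N - (k + 1))) := fun k hk ↦
    hf.measurable_corrector hγ hh.le (hlh' k hk)
  have hwm : ∀ k < N, Measurable (w (N - (k + 1))) := fun k hk ↦
    hf.measurable_correctorTail hγ hh.le (hlh k hk)
  have hvb : ∀ k < N, ∀ x, |v (N - (k + 1)) x| ≤ 3 * C * h ^ (1 + γ) * √N := fun k hk x ↦ by
    refine (hf.abs_corrector_le hγ (by linarith) hh (hlh' k hk) x).trans ?_
    gcongr
    exact_mod_cast Nat.sub_le _ _
  have htv : ∀ k < N, avg (m h) (v (N - (k + 1))) = w (N - (k + 1)) := fun k hk ↦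
    funext fun x ↦ hf.avg_corrector hγ hh (hlh k hk) x
  have hwb : ∀ k < N, ∀ x, |w (N - (k + 1)) x| ≤ 3 * C * h ^ (1 + γ) * √N := fun k hk x ↦ by
    rw [← htv k hk]; exact abs_avg_le (hvb k hk) _
  set D := 2 * C * S₂ * h ^ (1 + γ - β / 2) with hD
  have hD0 : 0 ≤ D := by positivity
  have hvi : ∀ k < N, ∀ y x, |incr y (v (N - (k + 1))) x|
      ≤ D * min (‖y‖ ^ β) 1 + 2 * (C * h ^ (1 + γ)) := fun k hk y x ↦
    hf.abs_incr_corrector_le_min hγ hβ hβ1 hγβ hh (hlh' k hk) y x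
  have hDK : D * (K * h ^ κ) = 2 * C * S₂ * K * ρ := by
    have : h ^ (1 + γ - β / 2) * h ^ κ = ρ := by rw [← Real.rpow_add hh, hρ]; ring_nf
    rw [hD, ← this]; ring
  -- the martingale part
  have hM := HasLpBound.sum_of_zero_bias (P := P) hp (fun k : ℕ ↦ 𝓕 ((a + k : ℕ) * h))
    (fun k ↦ hE.driver.le _) (hE.grid_filtration_mono a)
    (e := fun k ω ↦ v (N - (k + 1)) (Y (a + k + 1) ω) - w (N - (k + 1)) (Z k ω))
    (a := (4 * C * S₂ * K + 4 * C) * ρ) (c := 2 * (3 * C * h ^ (1 + γ) * √N))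
    (by positivity) (by positivity) N
    (fun k hk ↦ ⟨_, ?_, EventuallyEq.rfl⟩) (fun k hk ↦ ae_of_all _ fun ω ↦ ?_)
    (fun k hk S hS ↦ ?_) (fun k hk ↦ ?_)
  rotate_left
  · have hm := hE.driver.mono (hlt k).le
    exact ((hvm k hk).comp (hE.Y_meas (a + k + 1))).sub ((hwm k hk).comp ((hZm k).mono hm le_rfl))
  · have h1 := hvb k hk (Y (a + k + 1) ω)
    exact (abs_sub _ _).trans (by linarith [hwb k hk (Z k ω)])
  · have e := setIntegral_indep_add (hE.driver.le _) (hZm k) (hE.driver.measurable_sub _ _)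
      (hE.driver.indep _ _ (hE.grid_nonneg _) (hlt k).le (hle1 k hk))
      (hE.driver.law _ _ (hE.grid_nonneg _) (hlt k).le (hle1 k hk)) (hvm k hk) (hvb k hk) hS
    rw [hdiff, htv k hk] at e
    rw [integral_sub (integrableOn_comp_of_bounded (hvm k hk) (hvb k hk) (hE.measurable_Y _) S)
      (integrableOn_comp_of_bounded (hwm k hk) (hwb k hk) (hZm' _) S), ← e, sub_eq_zero]
    refine integral_congr_ae (ae_restrict_of_ae ?_)
    filter_upwards [hE.step] with ω hω
    rw [hω (a + k) (by omega)]
  · have h1 := (hE.driver.hasLpBound_incr (by linarith) hE.moment (hE.grid_nonneg (a + k))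
      (hlt k) (hle1 k hk)).const_mul hD0
    rw [hdiff] at h1
    have h2 := HasLpBound.const (P := P) (p := p)
      (by positivity : 0 ≤ D * (K * h ^ κ) + 4 * (C * h ^ (1 + γ)))
    refine ((h1.add hp1 h2).of_abs_le ?_ ?_).mono ?_
    · exact (((hvm k hk).comp (hE.measurable_Y (a + k + 1))).sub
        ((hwm k hk).comp (hZm' k))).aestronglyMeasurable
    · filter_upwards [hE.step] with ω hω
      rw [hω (a + k) (by omega)]
      have h3 := hvi k hk (L ((a + k + 1 : ℕ) * h) ω - L ((a + k : ℕ) * h) ω) (Z k ω)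
      have h4 : |v (N - (k + 1)) (Z k ω) - w (N - (k + 1)) (Z k ω)|
          ≤ D * (K * h ^ κ) + 2 * (C * h ^ (1 + γ)) := by
        rw [← htv k hk, abs_sub_comm, avg_sub_const (hvm k hk) (hvb k hk), ← Real.norm_eq_abs]
        have hmi := (integrable_min_norm_rpow (m := m h) β).const_mul D
        calc _ ≤ ∫ y, (D * min (‖y‖ ^ β) 1 + 2 * (C * h ^ (1 + γ))) ∂(m h) :=
              norm_integral_le_of_norm_le (hmi.add (integrable_const _))
                (ae_of_all _ fun y ↦ hvi k hk y (Z k ω))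
          _ = D * ∫ y, min (‖y‖ ^ β) 1 ∂(m h) + 2 * (C * h ^ (1 + γ)) := by
              rw [integral_add hmi (integrable_const _), integral_const_mul]
              simp
          _ ≤ D * (K * h ^ κ) + 2 * (C * h ^ (1 + γ)) := by
              gcongr
              exact hE.moment.integral_le hp1 hh hh1
      calc _ = |incr (L ((a + k + 1 : ℕ) * h) ω - L ((a + k : ℕ) * h) ω) (v (N - (k + 1)))
              (Z k ω) + (v (N - (k + 1)) (Z k ω) - w (N - (k + 1)) (Z k ω))| := by
            unfold incr; congr 1; ring
        _ ≤ _ := abs_add_le _ _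
        _ ≤ _ := by linarith
    · rw [hDK]
      nlinarith [mul_le_mul_of_nonneg_left hργ hC]
  -- the boundary term and the drift of the scheme
  have hB0 : HasLpBound P p (fun ω ↦ v N (Y a ω)) (3 * C * ρ * √N) := by
    refine HasLpBound.of_ae_bound ((hf.measurable_corrector hγ hh.le hNh).comp
      (hE.measurable_Y a)).aestronglyMeasurable (by positivity) (ae_of_all _ fun ω ↦ ?_)
    exact (hf.abs_corrector_le hγ (by linarith) hh hNh _).trans (by gcongr)
  have hR : HasLpBound P p (fun ω ↦ ∑ k ∈ Finset.range N,
      (w (N - (k + 1)) (Z k ω) - w (N - (k + 1)) (Y (a + k) ω))) (C * S₁ * B * ρ * √N) := by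
    refine HasLpBound.of_ae_bound ?_ (by positivity) (ae_of_all _ fun ω ↦ ?_)
    · refine (Finset.measurable_fun_sum _ fun k hk ↦ ?_).aestronglyMeasurable
      have hk' := Finset.mem_range.1 hk
      exact ((hwm k hk').comp (hZm' k)).sub ((hwm k hk').comp (hE.measurable_Y (a + k)))
    · have h1 : ∀ k ∈ Finset.range N,
          |w (N - (k + 1)) (Z k ω) - w (N - (k + 1)) (Y (a + k) ω)|
            ≤ C * S₁ * h ^ (1 / 2 + γ) * (h * B) := fun k hk ↦ by
        have hk' := Finset.mem_range.1 hk
        refine (hf.abs_incr_correctorTail_le (by linarith) hh (hlh k hk')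
          (h • b (Y (a + k) ω)) (Y (a + k) ω)).trans ?_
        rw [norm_smul, Real.norm_of_nonneg hh.le]
        gcongr
        exact hE.bdd _
      refine (Finset.abs_sum_le_sum_abs _ _).trans ((Finset.sum_le_sum h1).trans ?_)
      rw [Finset.sum_const, Finset.card_range, nsmul_eq_mul]
      have e1 : h ^ (1 / 2 + γ) * h = √h * h ^ (1 + γ) := by
        rw [Real.sqrt_eq_rpow, ← Real.rpow_add hh, ← Real.rpow_add_one hh.ne']; ring_nf
      calc _ = C * S₁ * B * ((N : ℝ) * (h ^ (1 / 2 + γ) * h)) := by ring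
        _ = C * S₁ * B * (((N : ℝ) * √h) * h ^ (1 + γ)) := by rw [e1]; ring
        _ ≤ C * S₁ * B * (√N * ρ) := by gcongr
        _ = _ := by ring
  refine (((hB0.add hp1 hM).add hp1 hR).congr (ae_of_all _ fun ω ↦ ?_)).mono (le_of_eq (by ring))
  have := hf.sum_defect_eq (h := h) N (fun k ↦ Y (a + k) ω) (fun k ↦ Z k ω)
  simpa only [Nat.add_zero, ← add_assoc] using this

/-- The difference of the time integrals of the semigroup along the solution and along the
scheme, from the `i`th to the `j`th grid point. -/
noncomputable def _root_.LevyEuler.germ (m : ℝ → Measure (EuclideanSpace ℝ (Fin d)))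
    (b : EuclideanSpace ℝ (Fin d) → EuclideanSpace ℝ (Fin d)) (n : ℕ)
    (X : ℝ → Ω → EuclideanSpace ℝ (Fin d)) (Y : ℕ → Ω → EuclideanSpace ℝ (Fin d)) (c : Fin d)
    (i j : ℕ) (ω : Ω) : ℝ :=
  timeInt m (fun x ↦ b x c) ((j - i : ℕ) * (n : ℝ)⁻¹) (X (i * (n : ℝ)⁻¹) ω)
    - timeInt m (fun x ↦ b x c) ((j - i : ℕ) * (n : ℝ)⁻¹) (Y i ω)

/-- The increments of the error of the Euler scheme are sums of germs, up to a remainder that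
has the order of the rate. -/
theorem hasLpBound_error_sub_sum_germ (c : Fin d) {a N : ℕ} (haN : a + N ≤ n) :
    HasLpBound P p (fun ω ↦
        ((X ((a + N : ℕ) * (n : ℝ)⁻¹) ω - Y (a + N) ω) - (X (a * (n : ℝ)⁻¹) ω - Y a ω)) c
          - ∑ k ∈ Finset.range N, germ m b n X Y c (a + k) (a + k + 1) ω)
      (expandConst p A C γ β K B * √N * (n : ℝ)⁻¹ ^ (1 + (γ - β / 2 + κ))) := by
  have hp1 : 1 ≤ p := by linarith [hE.two_lt]
  refine (((hE.hasLpBound_sum_freezeError c haN).add hp1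
    (hE.hasLpBound_sum_defect c haN)).congr ?_).mono (le_of_eq (by unfold expandConst; ring))
  filter_upwards [hE.eqn, hE.step] with ω h1 h2
  have hdiff := fun k : ℕ ↦ hE.grid_succ_sub (a + k)
  set h := (n : ℝ)⁻¹ with hdef
  have htel := Finset.sum_range_sub (fun k ↦ (X ((a + k : ℕ) * h) ω - Y (a + k) ω) c) N
  simp only [Nat.add_zero] at htel
  rw [PiLp.sub_apply, ← htel, ← Finset.sum_sub_distrib, ← Finset.sum_add_distrib]
  refine Finset.sum_congr rfl fun k hk ↦ ?_
  have hk' := Finset.mem_range.1 hk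
  have e1 := h1 _ _ (hE.grid_nonneg (a + k)) (hE.grid_lt_succ _).le (hE.grid_le_one (by omega)) c
  have e2 := h2 (a + k) (by omega)
  rw [PiLp.sub_apply, PiLp.add_apply, PiLp.sub_apply] at e1
  simp only [freezeError, germ, defect, if_true, ← add_assoc, hdiff, e2, Nat.add_sub_cancel_left,
    Nat.cast_one,
    one_mul, PiLp.sub_apply, PiLp.add_apply, PiLp.smul_apply, smul_eq_mul, ← hdef]
  rw [← e1]
  ring

/-! ### Sewing -/

lemma measurable_gridError (k : ℕ) : Measurable (gridError n X Y k) :=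
  (hE.measurable_X _).sub (hE.measurable_Y k)

lemma Y_drift : ∀ᵐ ω ∂P, ∀ k N : ℕ, k + N ≤ n →
    ‖Y (k + N) ω - (Y k ω + (L ((k + N : ℕ) * (n : ℝ)⁻¹) ω - L (k * (n : ℝ)⁻¹) ω))‖
      ≤ B * (N * (n : ℝ)⁻¹) := by
  filter_upwards [hE.step] with ω hω k N hN
  have hh := hE.h_pos
  induction N with
  | zero => simp
  | succ N ih =>
    have h1 := ih (by omega)
    have h2 := hω (k + N) (by omega)
    have e : Y (k + (N + 1)) ω - (Y k ω + (L ((k + (N + 1) : ℕ) * (n : ℝ)⁻¹) ω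
        - L (k * (n : ℝ)⁻¹) ω))
        = (Y (k + N) ω - (Y k ω + (L ((k + N : ℕ) * (n : ℝ)⁻¹) ω - L (k * (n : ℝ)⁻¹) ω)))
          + (n : ℝ)⁻¹ • b (Y (k + N) ω) := by
      rw [← add_assoc, h2]; abel
    rw [e]
    refine (norm_add_le _ _).trans ?_
    rw [norm_smul, Real.norm_of_nonneg hh.le]
    have h3 := mul_le_mul_of_nonneg_left (hE.bdd (Y (k + N) ω)) hh.le
    rw [Nat.cast_succ]
    linarith

lemma germ_self (c : Fin d) (i : ℕ) (ω : Ω) : germ m b n X Y c i i ω = 0 := by simp [germ, timeInt]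

/-- The defect of additivity of the germ, summed over a sequence of intervals. -/
lemma hasLpBound_sum_germ_defect (c : Fin d) {i₀ N : ℕ} (hN : i₀ + N ≤ n) {S K' : ℝ}
    (hS0 : 0 ≤ S) (hK0 : 0 ≤ K')
    (hS : ∀ k, i₀ ≤ k → k ≤ i₀ + N → HasLpBound P p (fun ω ↦ ‖gridError n X Y k ω‖) S)
    (hKk : ∀ k l, i₀ ≤ k → k ≤ l → l ≤ i₀ + N → HasLpBound P p
      (fun ω ↦ ‖gridError n X Y l ω - gridError n X Y k ω‖)
      (K' * √((l - k : ℕ) * (n : ℝ)⁻¹)))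
    (u v w : ℕ → ℕ) (M ℓ : ℕ) (ho : ∀ a, i₀ ≤ u a ∧ u a ≤ v a ∧ v a ≤ w a ∧ w a ≤ u (a + 1) ∧
      w a ≤ i₀ + N ∧ v a - u a ≤ ℓ ∧ w a - v a ≤ ℓ) :
    HasLpBound P p (fun ω ↦ ∑ a ∈ Finset.range M, (germ m b n X Y c (u a) (w a) ω
        - germ m b n X Y c (u a) (v a) ω - germ m b n X Y c (v a) (w a) ω))
      (martConst p * √M * (4 * C * (ℓ * (n : ℝ)⁻¹) ^ (γ + 1 / 2) * S)
        + M * ((C / γ * B * S + 2 * C * K') * (ℓ * (n : ℝ)⁻¹) ^ (γ + 1))) := by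
  obtain ⟨hh, hh1, hB, -, hγ, hγ', hγβ, hκ, hβ, hβ1, hp, hp1⟩ := hE.bounds
  have hC := hE.C_nonneg c
  have hA := hE.A_nonneg c
  have hf := hE.reg c
  have hprob := hf.prob
  set h := (n : ℝ)⁻¹ with hdef
  set V := fun τ : ℝ ↦ timeInt m (fun x ↦ b x c) τ with hV
  set τ := (ℓ : ℝ) * h with hτ
  have hτ0 : 0 ≤ τ := by positivity
  have ht0 : ∀ k : ℕ, 0 ≤ (k : ℝ) * h := fun k ↦ by positivity
  have hguv : ∀ a, (u a : ℝ) * h ≤ v a * h := fun a ↦ hE.grid_mono (ho a).2.1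
  have hvn : ∀ a, (v a : ℝ) * h ≤ 1 := fun a ↦ hE.grid_le_one (by have := ho a; omega)
  have ht1 : ∀ a, ((w a - v a : ℕ) : ℝ) * h ≤ 1 := fun a ↦ hE.grid_le_one (by have := ho a; omega)
  have htτ : ∀ a, ((w a - v a : ℕ) : ℝ) * h ≤ τ := fun a ↦ hE.grid_mono (ho a).2.2.2.2.2.2
  have hsτ : ∀ a, ((v a - u a : ℕ) : ℝ) * h ≤ τ := fun a ↦ hE.grid_mono (ho a).2.2.2.2.2.1
  have hVm : ∀ a, Measurable (V ((w a - v a : ℕ) * h)) := fun a ↦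
    hf.measurable_timeInt hγ (ht0 _) (ht1 a)
  have hVb : ∀ a x, |V ((w a - v a : ℕ) * h) x| ≤ A := fun a x ↦
    (hf.abs_timeInt_le (ht0 _) x).trans (mul_le_of_le_one_right hA (ht1 a))
  have hVL : ∀ a x y, |V ((w a - v a : ℕ) * h) x - V ((w a - v a : ℕ) * h) y|
      ≤ 2 * C * τ ^ (γ + 1 / 2) * ‖x - y‖ := fun a x y ↦ by
    have h1 := hf.abs_incr_timeInt_le hγ (ht0 (w a - v a)) (ht1 a) (x - y) y
    rw [incr, add_sub_cancel] at h1
    refine h1.trans ?_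
    have := Real.rpow_le_rpow (ht0 _) (htτ a) (by linarith : 0 ≤ γ + 1 / 2)
    gcongr
  -- split the defect at the point reached by the driver alone
  set ξ : ℕ → Ω → EuclideanSpace ℝ (Fin d) := fun a ω ↦ L (v a * h) ω - L (u a * h) ω with hξ
  have hξm : ∀ a, Measurable (ξ a) := fun a ↦ hE.driver.measurable_sub _ _
  have hXu : ∀ a, Measurable[𝓕 (u a * h)] (X (u a * h)) := fun a ↦ hE.path.adapted _
  have hYu : ∀ a, Measurable[𝓕 (u a * h)] (Y (u a)) := fun a ↦ hE.Y_meas _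
  have hlen : ∀ a, (v a : ℝ) * h - u a * h = (v a - u a : ℕ) * h := fun a ↦ by
    rw [Nat.cast_sub (ho a).2.1]; ring
  set Q := fun a : ℕ ↦ avg (m ((v a - u a : ℕ) * h)) (V ((w a - v a : ℕ) * h)) with hQ
  have hQm : ∀ a, Measurable (Q a) := fun a ↦ measurable_avg (hVm a)
  have hQb : ∀ a x, |Q a x| ≤ A := fun a x ↦ abs_avg_le (hVb a) x
  have hQeq : ∀ a x, Q a x = V ((w a - u a : ℕ) * h) x - V ((v a - u a : ℕ) * h) x := fun a x ↦ by
    have e1 : ((v a - u a : ℕ) : ℝ) * h + (w a - v a : ℕ) * h = (w a - u a : ℕ) * h := by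
      have : w a - u a = (v a - u a) + (w a - v a) := by have := ho a; omega
      rw [this]; push_cast; ring
    rw [← e1]
    refine hf.avg_timeInt hγ (ht0 _) (ht0 _) ?_ x
    rw [e1]
    exact hE.grid_le_one (by have := ho a; omega)
  set e₁ : ℕ → Ω → ℝ := fun a ω ↦ (Q a (X (u a * h) ω) - Q a (Y (u a) ω))
    - (V ((w a - v a : ℕ) * h) (X (u a * h) ω + ξ a ω)
      - V ((w a - v a : ℕ) * h) (Y (u a) ω + ξ a ω)) with he₁
  set e₂ : ℕ → Ω → ℝ := fun a ω ↦ (V ((w a - v a : ℕ) * h) (X (u a * h) ω + ξ a ω)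
      - V ((w a - v a : ℕ) * h) (Y (u a) ω + ξ a ω))
    - (V ((w a - v a : ℕ) * h) (X (v a * h) ω) - V ((w a - v a : ℕ) * h) (Y (v a) ω)) with he₂
  have hmono : Monotone fun a ↦ 𝓕 (u a * h) := monotone_nat_of_le_succ fun a ↦
    hE.driver.mono (hE.grid_mono (by have := ho a; omega))
  have hS' : ∀ a, HasLpBound P p (fun ω ↦ ‖gridError n X Y (u a) ω‖) S := fun a ↦
    hS _ (ho a).1 (by have := ho a; omega)
  have hXum : ∀ a, Measurable (X (u a * h)) := fun a ↦ hE.measurable_X _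
  have hYum : ∀ a, Measurable (Y (u a)) := fun a ↦ hE.measurable_Y _
  have hM1 := HasLpBound.sum_of_zero_bias (P := P) hp (fun a : ℕ ↦ 𝓕 (u a * h))
    (fun k ↦ hE.driver.le _) hmono (e := e₁) (a := 4 * C * τ ^ (γ + 1 / 2) * S) (c := 4 * A)
    (by positivity) (by positivity) M
    (fun a _ ↦ ⟨_, ?_, EventuallyEq.rfl⟩) (fun a _ ↦ ae_of_all _ fun ω ↦ ?_)
    (fun a _ T hT ↦ ?_) (fun a _ ↦ ?_)
  rotate_left
  · have hle := hE.driver.mono (hguv a)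
    have hle2 : 𝓕 (v a * h) ≤ 𝓕 (u (a + 1) * h) :=
      hE.driver.mono (hE.grid_mono (by have := ho a; omega))
    have m1 := (hXu a).mono hle le_rfl
    have m2 := (hYu a).mono hle le_rfl
    have m3 : Measurable[𝓕 (v a * h)] (ξ a) :=
      (hE.driver.adapted _).sub ((hE.driver.adapted _).mono hle le_rfl)
    have m4 : Measurable[𝓕 (v a * h)] (e₁ a) := (((hQm a).comp m1).sub ((hQm a).comp m2)).sub
        (((hVm a).comp (m1.add m3)).sub ((hVm a).comp (m2.add m3)))
    exact m4.mono hle2 le_rfl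
  · have b1 := hQb a (X (u a * h) ω)
    have b2 := hQb a (Y (u a) ω)
    have b3 := hVb a (X (u a * h) ω + ξ a ω)
    have b4 := hVb a (Y (u a) ω + ξ a ω)
    rw [abs_le] at *
    constructor <;> linarith
  · have key : ∀ Z : Ω → EuclideanSpace ℝ (Fin d), Measurable[𝓕 (u a * h)] Z →
        ∫ ω in T, V ((w a - v a : ℕ) * h) (Z ω + ξ a ω) ∂P = ∫ ω in T, Q a (Z ω) ∂P := by
      intro Z hZ
      have := setIntegral_indep_add (hE.driver.le _) hZ (hξm a)
        (hE.driver.indep _ _ (hE.grid_nonneg _) (hguv a) (hvn a))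
        (hE.driver.law _ _ (hE.grid_nonneg _) (hguv a) (hvn a)) (hVm a) (hVb a) hT
      rwa [hlen] at this
    have i1 {Z : Ω → EuclideanSpace ℝ (Fin d)} (hZ : Measurable Z) :=
      integrableOn_comp_of_bounded (P := P) (hQm a) (hQb a) hZ T
    have i2 {Z : Ω → EuclideanSpace ℝ (Fin d)} (hZ : Measurable Z) :
        Integrable (fun ω ↦ V ((w a - v a : ℕ) * h) (Z ω + ξ a ω)) (P.restrict T) :=
      integrableOn_comp_of_bounded (P := P) (hVm a) (hVb a) (hZ.add (hξm a)) T
    refine (integral_sub ((i1 (hXum a)).sub (i1 (hYum a)))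
      ((i2 (hXum a)).sub (i2 (hYum a)))).trans ?_
    simp only [Pi.sub_apply]
    rw [integral_sub (i1 (hXum a)) (i1 (hYum a)), integral_sub (i2 (hXum a)) (i2 (hYum a)),
      key _ (hXu a), key _ (hYu a), sub_self]
  · refine (((hS' a).const_mul (by positivity : 0 ≤ 4 * C * τ ^ (γ + 1 / 2))).of_abs_le ?_
      (ae_of_all _ fun ω ↦ ?_))
    · exact ((((hQm a).comp (hXum a)).sub ((hQm a).comp (hYum a))).sub
        (((hVm a).comp ((hXum a).add (hξm a))).sub
          ((hVm a).comp ((hYum a).add (hξm a))))).aestronglyMeasurable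
    · have h1 : |Q a (X (u a * h) ω) - Q a (Y (u a) ω)|
          ≤ 2 * C * τ ^ (γ + 1 / 2) * ‖gridError n X Y (u a) ω‖ := by
        refine abs_avg_sub_avg_le (hVm a) (hVb a) fun z ↦ ?_
        have := hVL a (X (u a * h) ω + z) (Y (u a) ω + z)
        rwa [add_sub_add_right_eq_sub] at this
      have h2 := hVL a (X (u a * h) ω + ξ a ω) (Y (u a) ω + ξ a ω)
      rw [add_sub_add_right_eq_sub] at h2
      refine (abs_sub _ _).trans ((add_le_add h1 h2).trans (le_of_eq ?_))
      simp only [gridError, ← hdef]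
      ring
  have hM2 := HasLpBound.sum (P := P) (p := p) hp1 (Finset.range M) (f := e₂)
    (a := fun _ ↦ (C / γ * B * S + 2 * C * K') * τ ^ (γ + 1)) fun a _ ↦ by
    have k1 := (hS' a).const_mul (by positivity : 0 ≤ C / γ * τ ^ γ * (B * τ))
    have k2 := (hKk (u a) (v a) (ho a).1 (ho a).2.1 (by have := ho a; omega)).const_mul
      (by positivity : 0 ≤ 2 * C * τ ^ (γ + 1 / 2))
    refine ((k1.add hp1 k2).of_abs_le ?_ ?_).mono ?_
    · exact (((hVm a).comp ((hXum a).add (hξm a))).sub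
        ((hVm a).comp ((hYum a).add (hξm a)))).sub (((hVm a).comp (hE.measurable_X _)).sub
          ((hVm a).comp (hE.measurable_Y _))) |>.aestronglyMeasurable
    · filter_upwards [hE.Y_drift] with ω hω
      have hd := hω (u a) (v a - u a) (by have := ho a; omega)
      rw [Nat.add_sub_cancel' (ho a).2.1] at hd
      set φ := V ((w a - v a : ℕ) * h) with hφ
      set ψ := gridError n X Y (u a) ω with hψ
      set y := Y (u a) ω + ξ a ω with hy
      have hXY : X (u a * h) ω = Y (u a) ω + ψ := by simp [hψ, gridError, ← hdef]
      have h1 := hf.abs_incr_incr_timeInt_le hγ (ht0 (w a - v a)) (ht1 a) (Y (v a) ω - y) ψ y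
      have h2 := hVL a (Y (v a) ω + ψ) (X (v a * h) ω)
      have h3 : ‖Y (v a) ω + ψ - X (v a * h) ω‖
          = ‖gridError n X Y (v a) ω - gridError n X Y (u a) ω‖ := by
        rw [← norm_neg]; congr 1; simp only [gridError, hψ, ← hdef]; abel
      rw [h3] at h2
      have h4 : |incr (Y (v a) ω - y) (incr ψ φ) y| ≤ C / γ * τ ^ γ * (B * τ) * ‖ψ‖ := by
        have e1 : ‖Y (v a) ω - y‖ ≤ B * τ := hd.trans (mul_le_mul_of_nonneg_left (hsτ a) hB)
        have e2 := Real.rpow_le_rpow (ht0 _) (htτ a) hγ.le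
        refine h1.trans ?_
        calc _ ≤ C / γ * τ ^ γ * ‖ψ‖ * (B * τ) := by gcongr
          _ = _ := by ring
      have e : e₂ a ω = -incr (Y (v a) ω - y) (incr ψ φ) y
          + (φ (Y (v a) ω + ψ) - φ (X (v a * h) ω)) := by
        have e0 : X (u a * h) ω + ξ a ω = y + ψ := by rw [hXY, hy]; abel
        simp only [he₂, e0, incr, add_sub_cancel, ← hφ, ← hy]
        ring
      rw [e]
      refine (abs_add_le _ _).trans (add_le_add ?_ h2)
      rw [abs_neg]; exact h4
    · have r1 : τ ^ (γ + 1) = τ ^ γ * τ := Real.rpow_add_one' hτ0 (by linarith)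
      have r2 : τ ^ (γ + 1) = τ ^ (γ + 1 / 2) * √τ := by
        rw [Real.sqrt_eq_rpow, ← Real.rpow_add_of_nonneg hτ0 (by linarith) (by norm_num)]
        ring_nf
      have r3 : √(((v a - u a : ℕ) : ℝ) * (n : ℝ)⁻¹) ≤ √τ := Real.sqrt_le_sqrt (hsτ a)
      calc _ ≤ C / γ * τ ^ γ * (B * τ) * S + 2 * C * τ ^ (γ + 1 / 2) * (K' * √τ) := by gcongr
        _ = C / γ * B * S * (τ ^ γ * τ) + 2 * C * K' * (τ ^ (γ + 1 / 2) * √τ) := by ring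
        _ = _ := by rw [← r1, ← r2]; ring
  rw [Finset.sum_const, Finset.card_range, nsmul_eq_mul] at hM2
  refine (hM1.add hp1 hM2).congr (ae_of_all _ fun ω ↦ ?_)
  simp only
  rw [← Finset.sum_add_distrib]
  refine Finset.sum_congr rfl fun a _ ↦ ?_
  simp only [he₁, he₂, hQeq, germ, ← hdef, hV]
  ring

/-- The sewing bound: a sum of germs over neighbouring grid points is compared with the germ over
the whole interval by dyadic coarsening. -/
theorem hasLpBound_sum_germ (c : Fin d) {i₀ N : ℕ} (hN : i₀ + N ≤ n) {S K' : ℝ}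
    (hS0 : 0 ≤ S) (hK0 : 0 ≤ K')
    (hS : ∀ k, i₀ ≤ k → k ≤ i₀ + N → HasLpBound P p (fun ω ↦ ‖gridError n X Y k ω‖) S)
    (hKk : ∀ k l, i₀ ≤ k → k ≤ l → l ≤ i₀ + N → HasLpBound P p
      (fun ω ↦ ‖gridError n X Y l ω - gridError n X Y k ω‖)
      (K' * √((l - k : ℕ) * (n : ℝ)⁻¹))) :
    HasLpBound P p (fun ω ↦ ∑ k ∈ Finset.range N, germ m b n X Y c (i₀ + k) (i₀ + k + 1) ω)
      (sewConst p C γ B * (N * (n : ℝ)⁻¹) ^ (γ + 1 / 2) * (S + K')) := by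
  obtain ⟨hh, hh1, hB, -, hγ, hγ', hγβ, hκ, hβ, hβ1, hp, hp1⟩ := hE.bounds
  have hC := hE.C_nonneg c
  have hmc := martConst_nonneg hp
  have hx1 : (1 : ℝ) < 2 ^ γ := Real.one_lt_rpow (by norm_num) hγ
  have hx0 : (0 : ℝ) < 2 ^ γ - 1 := by linarith
  rcases Nat.eq_zero_or_pos N with rfl | hNpos
  · refine HasLpBound.zero.congr (ae_of_all _ fun ω ↦ by simp) |>.mono ?_
    have := sewConst_nonneg hp hC hγ hB
    positivity
  set h := (n : ℝ)⁻¹ with hdef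
  set Q := Nat.log 2 N + 1 with hQ
  have hQ1 : N ≤ 2 ^ Q := (Nat.lt_pow_succ_log_self one_lt_two N).le
  have hQ2 : 2 ^ Q ≤ 2 * N := by
    rw [hQ, pow_succ, mul_comm]
    exact Nat.mul_le_mul_left 2 (Nat.pow_log_le_self 2 hNpos.ne')
  set z : ℕ → ℕ := fun x ↦ i₀ + min x N with hz
  set U : ℕ → Ω → ℝ := fun q ω ↦ ∑ a ∈ Finset.range (2 ^ (Q - q)),
    germ m b n X Y c (z (a * 2 ^ q)) (z ((a + 1) * 2 ^ q)) ω with hU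
  set T := (2 : ℝ) ^ Q * h with hT
  have hT0 : 0 < T := by positivity
  have hNh1 : (N : ℝ) * h ≤ 1 := hE.grid_le_one (by omega)
  have hNh0 : 0 < (N : ℝ) * h := mul_pos (by exact_mod_cast hNpos) hh
  have hTN : T ≤ 2 * (N * h) := by rw [hT, ← mul_assoc]; gcongr; exact_mod_cast hQ2
  have hpow : ∀ q : ℕ, ((2 : ℝ) ^ q * h) ^ γ = h ^ γ * ((2 : ℝ) ^ γ) ^ q := fun q ↦ by
    rw [Real.mul_rpow (by positivity) hh.le, ← Real.rpow_natCast, ← Real.rpow_natCast,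
      ← Real.rpow_mul (by norm_num), ← Real.rpow_mul (by norm_num), mul_comm (q : ℝ), mul_comm]
  -- passing from one dyadic level to the next
  have hlevel : ∀ q < Q, HasLpBound P p (fun ω ↦ U q ω - U (q + 1) ω)
      ((martConst p * (4 * C) * S * √T + (C / γ * B * S + 2 * C * K') * T)
        * (h ^ γ * ((2 : ℝ) ^ γ) ^ q)) := by
    intro q hq
    have hD := hE.hasLpBound_sum_germ_defect c hN hS0 hK0 hS hKk
      (fun a ↦ z ((2 * a) * 2 ^ q)) (fun a ↦ z ((2 * a + 1) * 2 ^ q))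
      (fun a ↦ z ((2 * a + 2) * 2 ^ q)) (2 ^ (Q - (q + 1))) (2 ^ q) fun a ↦ by
        simp only [hz, add_mul, mul_add, one_mul, mul_one]
        generalize 2 * a * 2 ^ q = x
        generalize 2 ^ q = y
        omega
    refine (hD.neg.congr (ae_of_all _ fun ω ↦ ?_)).mono ?_
    · have e1 : 2 ^ (Q - q) = 2 * 2 ^ (Q - (q + 1)) := by rw [← pow_succ']; congr 1; omega
      simp only [hU]
      rw [e1, sum_range_two_mul, ← Finset.sum_sub_distrib, ← Finset.sum_neg_distrib]
      refine Finset.sum_congr rfl fun a _ ↦ ?_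
      rw [show a * 2 ^ (q + 1) = 2 * a * 2 ^ q by ring,
        show (a + 1) * 2 ^ (q + 1) = (2 * a + 2) * 2 ^ q by ring]
      ring
    · push_cast
      set τ := (2 : ℝ) ^ q * h with hτ
      have hτ0 : 0 < τ := by positivity
      have hMT : (2 : ℝ) ^ (Q - (q + 1)) * τ ≤ T := by
        have : (2 : ℝ) ^ Q = 2 ^ (Q - (q + 1)) * 2 ^ q * 2 := by
          rw [← pow_add, ← pow_succ]; congr 1; omega
        rw [hT, hτ, this]
        linarith [(by positivity : 0 ≤ (2 : ℝ) ^ (Q - (q + 1)) * 2 ^ q * h)]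
      have e6 : τ ^ (γ + 1 / 2) = √τ * τ ^ γ := by
        rw [Real.sqrt_eq_rpow, ← Real.rpow_add hτ0, add_comm]
      have e7 : τ ^ (γ + 1) = τ * τ ^ γ := by rw [Real.rpow_add_one hτ0.ne', mul_comm]
      have e8 : √((2 : ℝ) ^ (Q - (q + 1))) * √τ ≤ √T := by
        rw [← Real.sqrt_mul (by positivity)]
        exact Real.sqrt_le_sqrt hMT
      rw [← hpow, ← hτ, e6, e7]
      calc _ = martConst p * (4 * C) * S * (√((2 : ℝ) ^ (Q - (q + 1))) * √τ) * τ ^ γ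
            + (C / γ * B * S + 2 * C * K') * ((2 : ℝ) ^ (Q - (q + 1)) * τ) * τ ^ γ := by ring
        _ ≤ martConst p * (4 * C) * S * √T * τ ^ γ
            + (C / γ * B * S + 2 * C * K') * T * τ ^ γ := by gcongr
        _ = _ := by ring
  have hsum := HasLpBound.sum hp1 (Finset.range Q) fun q hq ↦ hlevel q (Finset.mem_range.1 hq)
  have htop : HasLpBound P p (U Q) (2 * C * (N * h) ^ (γ + 1 / 2) * S) := by
    have e : U Q = germ m b n X Y c i₀ (i₀ + N) := by
      ext ω
      simp [hU, hz, min_eq_right hQ1]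
    rw [e]
    have hf := hE.reg c
    have hm := hf.measurable_timeInt hγ hNh0.le hNh1
    refine ((hS i₀ le_rfl (by omega)).const_mul (by positivity)).of_abs_le ?_
      (ae_of_all _ fun ω ↦ ?_)
    · unfold germ
      rw [Nat.add_sub_cancel_left]
      exact ((hm.comp (hE.measurable_X _)).sub (hm.comp (hE.measurable_Y _))).aestronglyMeasurable
    · have := hf.abs_incr_timeInt_le hγ hNh0.le hNh1 (gridError n X Y i₀ ω) (Y i₀ ω)
      rw [incr] at this
      simpa [germ, gridError, Nat.add_sub_cancel_left] using this
  refine ((htop.add hp1 hsum).congr (ae_of_all _ fun ω ↦ ?_)).mono ?_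
  · have e0 : U 0 ω = ∑ k ∈ Finset.range N, germ m b n X Y c (i₀ + k) (i₀ + k + 1) ω := by
      simp only [hU, pow_zero, mul_one, Nat.sub_zero]
      rw [← Finset.sum_subset (Finset.range_subset_range.2 hQ1)]
      · refine Finset.sum_congr rfl fun a ha ↦ ?_
        have := Finset.mem_range.1 ha
        simp only [hz]
        rw [min_eq_left (by omega), min_eq_left (by omega), add_assoc]
      · intro a _ ha
        have : N ≤ a := by simpa using ha
        simp only [hz]
        rw [min_eq_right this, min_eq_right (by omega), hE.germ_self]
    have := Finset.sum_range_sub' (fun q ↦ U q ω) Q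
    simp only
    rw [this, ← e0]
    ring
  · have hgeo : ∑ q ∈ Finset.range Q, (h ^ γ * ((2 : ℝ) ^ γ) ^ q) ≤ T ^ γ / (2 ^ γ - 1) := by
      rw [← Finset.mul_sum, geom_sum_eq hx1.ne', mul_div_assoc']
      rw [hT, hpow]
      gcongr
      linarith
    rw [← Finset.mul_sum]
    have hT2 : T ≤ 2 := by linarith
    have hsT : √T ≤ 2 := by rw [Real.sqrt_le_left (by norm_num)]; linarith
    have hTγ : √T * T ^ γ ≤ 2 * (N * h) ^ (γ + 1 / 2) := by
      rw [Real.sqrt_eq_rpow, ← Real.rpow_add hT0, add_comm]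
      calc T ^ (γ + 1 / 2) ≤ (2 * (N * h)) ^ (γ + 1 / 2) :=
            Real.rpow_le_rpow hT0.le hTN (by linarith)
        _ ≤ 2 ^ (1 : ℝ) * (N * h) ^ (γ + 1 / 2) := by
            rw [Real.mul_rpow (by norm_num) hNh0.le]
            gcongr
            exacts [by norm_num, by linarith]
        _ = _ := by rw [Real.rpow_one]
    have hTT : T * T ^ γ ≤ 4 * (N * h) ^ (γ + 1 / 2) := by
      calc T * T ^ γ = √T * (√T * T ^ γ) := by rw [← mul_assoc, Real.mul_self_sqrt hT0.le]
        _ ≤ 2 * (2 * (N * h) ^ (γ + 1 / 2)) := by gcongr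
        _ = _ := by ring
    set R := ((N : ℝ) * h) ^ (γ + 1 / 2) with hR
    have hR0 : 0 ≤ R := by positivity
    have hy : 0 ≤ (2 ^ γ - 1 : ℝ)⁻¹ := by positivity
    have hCγ : 0 ≤ C / γ * B := by positivity
    calc _ ≤ 2 * C * R * S + (martConst p * (4 * C) * S * √T
            + (C / γ * B * S + 2 * C * K') * T) * (T ^ γ / (2 ^ γ - 1)) := by gcongr
      _ = 2 * C * R * S + (martConst p * (4 * C) * S * (√T * T ^ γ)
            + (C / γ * B * S + 2 * C * K') * (T * T ^ γ)) * (2 ^ γ - 1)⁻¹ := by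
          rw [div_eq_mul_inv]; ring
      _ ≤ 2 * C * R * S + (martConst p * (4 * C) * S * (2 * R)
            + (C / γ * B * S + 2 * C * K') * (4 * R)) * (2 ^ γ - 1)⁻¹ := by gcongr
      _ ≤ 2 * C * R * (S + K') + (martConst p * (4 * C) * (S + K') * (2 * R)
            + (C / γ * B * (S + K') + 2 * C * (S + K')) * (4 * R)) * (2 ^ γ - 1)⁻¹ := by
          gcongr <;> linarith
      _ = _ := by unfold sewConst; rw [div_eq_mul_inv]; ring

/-! ### Buckling -/

/-- The trivial bound on the increments of the error, in which the noise cancels. -/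
lemma hasLpBound_gridError_trivial {k l : ℕ} (hkl : k ≤ l) (hl : l ≤ n) :
    HasLpBound P p (fun ω ↦ ‖gridError n X Y l ω - gridError n X Y k ω‖)
      (2 * B * ((l - k : ℕ) * (n : ℝ)⁻¹)) := by
  have hB := hE.B_nonneg
  refine HasLpBound.of_ae_bound
    ((hE.measurable_gridError l).sub (hE.measurable_gridError k)).norm.aestronglyMeasurable
    (mul_nonneg (by positivity) (hE.grid_nonneg _)) ?_
  filter_upwards [hE.Y_drift, hE.path.drift] with ω h1 h2
  have e1 := h1 k (l - k) (by omega)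
  rw [Nat.add_sub_cancel' hkl] at e1
  have e2 := h2 _ _ (hE.grid_nonneg k) (hE.grid_mono hkl) (hE.grid_le_one hl)
  rw [← sub_mul, ← Nat.cast_sub hkl] at e2
  rw [abs_norm]
  refine le_trans (le_of_eq ?_) ((norm_sub_le _ _).trans ((add_le_add e2 e1).trans_eq (by ring)))
  congr 1
  simp only [gridError]
  abel

lemma sqrt_mul_rpow (N : ℕ) : √(N : ℝ) * (n : ℝ)⁻¹ ^ (1 + (γ - β / 2 + κ))
    = √(N * (n : ℝ)⁻¹) * (n : ℝ)⁻¹ ^ (1 / 2 + (γ - β / 2 + κ)) := by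
  have hh := hE.h_pos
  rw [Real.sqrt_mul (Nat.cast_nonneg _), mul_assoc, Real.sqrt_eq_rpow (n : ℝ)⁻¹, ← Real.rpow_add hh]
  ring_nf

/-- One improvement of a bound on the `1/2`-Hölder seminorm of the error. -/
lemma hasLpBound_gridError_improve {i₀ N : ℕ} (hN : i₀ + N ≤ n) {S K' : ℝ}
    (hS0 : 0 ≤ S) (hK0 : 0 ≤ K')
    (hS : ∀ k, i₀ ≤ k → k ≤ i₀ + N → HasLpBound P p (fun ω ↦ ‖gridError n X Y k ω‖) S)
    (hK : ∀ k l, i₀ ≤ k → k ≤ l → l ≤ i₀ + N → HasLpBound P p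
      (fun ω ↦ ‖gridError n X Y l ω - gridError n X Y k ω‖)
      (K' * √((l - k : ℕ) * (n : ℝ)⁻¹))) :
    HasLpBound P p (fun ω ↦ ‖gridError n X Y (i₀ + N) ω - gridError n X Y i₀ ω‖)
      (√(N * (n : ℝ)⁻¹) * (d * (expandConst p A C γ β K B * (n : ℝ)⁻¹ ^ (1 / 2 + (γ - β / 2 + κ))
        + sewConst p C γ B * (N * (n : ℝ)⁻¹) ^ γ * (S + K')))) := by
  have hp1 : 1 ≤ p := by linarith [hE.two_lt]
  have hN0 := hE.grid_nonneg N
  have hc : ∀ c ∈ Finset.univ, HasLpBound P p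
      (fun ω ↦ |(gridError n X Y (i₀ + N) ω - gridError n X Y i₀ ω) c|)
      (√(N * (n : ℝ)⁻¹) * (expandConst p A C γ β K B * (n : ℝ)⁻¹ ^ (1 / 2 + (γ - β / 2 + κ))
        + sewConst p C γ B * (N * (n : ℝ)⁻¹) ^ γ * (S + K'))) := fun c _ ↦ by
    have h1 := hE.hasLpBound_error_sub_sum_germ c hN
    have h2 := hE.hasLpBound_sum_germ c hN hS0 hK0 hS hK
    refine ((h1.add hp1 h2).congr (ae_of_all _ fun ω ↦ ?_)).abs.mono (le_of_eq ?_)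
    · simp only [gridError]; ring
    · have e1 : ((N : ℝ) * (n : ℝ)⁻¹) ^ (γ + 1 / 2) = √(N * (n : ℝ)⁻¹) * (N * (n : ℝ)⁻¹) ^ γ := by
        rw [Real.sqrt_eq_rpow, ← Real.rpow_add_of_nonneg hN0 (by norm_num) hE.γ_pos.le, add_comm]
      rw [mul_assoc (expandConst p A C γ β K B), hE.sqrt_mul_rpow, e1]
      ring
  have hsum := HasLpBound.sum hp1 Finset.univ hc
  refine (hsum.of_abs_le ((hE.measurable_gridError _).sub
    (hE.measurable_gridError _)).norm.aestronglyMeasurable (ae_of_all _ fun ω ↦ ?_)).mono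
    (le_of_eq ?_)
  · rw [abs_norm]; exact norm_le_sum_abs _
  · rw [Finset.sum_const, Finset.card_univ, Fintype.card_fin, nsmul_eq_mul]; ring

lemma hasLpBound_gridError_add {i k : ℕ} (hk : k ≤ n) {s K' : ℝ} (hK0 : 0 ≤ K')
    (hs : HasLpBound P p (fun ω ↦ ‖gridError n X Y i ω‖) s)
    (hK : HasLpBound P p (fun ω ↦ ‖gridError n X Y k ω - gridError n X Y i ω‖)
      (K' * √((k - i : ℕ) * (n : ℝ)⁻¹))) :
    HasLpBound P p (fun ω ↦ ‖gridError n X Y k ω‖) (s + K') := by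
  refine ((hs.add (by linarith [hE.two_lt]) hK).of_abs_le
    (hE.measurable_gridError k).norm.aestronglyMeasurable (ae_of_all _ fun ω ↦ ?_)).mono ?_
  · rw [abs_norm, add_comm]
    exact norm_le_norm_sub_add _ _
  · nlinarith [Real.sqrt_le_one.2 (hE.grid_le_one ((Nat.sub_le k i).trans hk))]

lemma mul_expandConst_nonneg (hd : 0 < d) : 0 ≤ d * expandConst p A C γ β K B :=
  mul_nonneg (Nat.cast_nonneg d) (expandConst_nonneg hE.two_lt (hE.A_nonneg ⟨0, hd⟩)
    (hE.C_nonneg ⟨0, hd⟩) hE.moment.nonneg hE.B_nonneg)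

/-- On short intervals, the increments of the error are controlled by its initial value. -/
lemma hasLpBound_gridError_local (hd : 0 < d) {h₀ : ℝ}
    (hh0 : 2 * (d * sewConst p C γ B * h₀ ^ γ) ≤ 1 / 2) {i₀ N : ℕ} (hN : i₀ + N ≤ n)
    (hNh : N * (n : ℝ)⁻¹ ≤ h₀) {s₀ : ℝ}
    (hs₀ : HasLpBound P p (fun ω ↦ ‖gridError n X Y i₀ ω‖) s₀) {k l : ℕ} (hk : i₀ ≤ k)
    (hkl : k ≤ l) (hl : l ≤ i₀ + N) :
    HasLpBound P p (fun ω ↦ ‖gridError n X Y l ω - gridError n X Y k ω‖)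
      (2 * (s₀ + d * expandConst p A C γ β K B * (n : ℝ)⁻¹ ^ (1 / 2 + (γ - β / 2 + κ)))
        * √((l - k : ℕ) * (n : ℝ)⁻¹)) := by
  have hB := hE.B_nonneg
  have hs := sewConst_nonneg hE.two_lt (hE.C_nonneg ⟨0, hd⟩) hE.γ_pos hB
  have he := hE.mul_expandConst_nonneg hd
  have hs0 := hs₀.nonneg
  set ρ := (n : ℝ)⁻¹ ^ (1 / 2 + (γ - β / 2 + κ))
  have hρ0 : 0 ≤ ρ := Real.rpow_nonneg hE.h_pos.le _
  set D := s₀ + d * expandConst p A C γ β K B * ρ with hD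
  have hD0 : 0 ≤ D := by positivity
  have hiter : ∀ r : ℕ, ∀ k l, i₀ ≤ k → k ≤ l → l ≤ i₀ + N → HasLpBound P p
      (fun ω ↦ ‖gridError n X Y l ω - gridError n X Y k ω‖)
      ((2 * B * (1 / 2) ^ r + 2 * D) * √((l - k : ℕ) * (n : ℝ)⁻¹)) := by
    intro r
    induction r with
    | zero =>
      intro k l hk hkl hl
      refine (hE.hasLpBound_gridError_trivial hkl (by omega)).mono ?_
      have h1 := hE.grid_nonneg (l - k)
      have h2 : ((l - k : ℕ) : ℝ) * (n : ℝ)⁻¹ ≤ √((l - k : ℕ) * (n : ℝ)⁻¹) :=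
        Real.le_sqrt_of_sq_le (by nlinarith [hE.grid_le_one (show l - k ≤ n by omega)])
      rw [pow_zero, mul_one]
      nlinarith [mul_le_mul_of_nonneg_left h2 hB,
        mul_nonneg hD0 (Real.sqrt_nonneg (((l - k : ℕ) : ℝ) * (n : ℝ)⁻¹))]
    | succ r ih =>
      intro k l hk hkl hl
      set K' := 2 * B * (1 / 2) ^ r + 2 * D with hK'
      have hK0 : 0 ≤ K' := by positivity
      have hSk : ∀ k', k ≤ k' → k' ≤ k + (l - k) →
          HasLpBound P p (fun ω ↦ ‖gridError n X Y k' ω‖) (s₀ + K') := fun k' h1 h2 ↦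
        hE.hasLpBound_gridError_add (by omega) hK0 hs₀ (ih i₀ k' le_rfl (by omega) (by omega))
      have := hE.hasLpBound_gridError_improve (i₀ := k) (N := l - k) (by omega)
        (by positivity : 0 ≤ s₀ + K') hK0 hSk
        fun k' l' h1 h2 h3 ↦ ih k' l' (by omega) h2 (by omega)
      rw [Nat.add_sub_cancel' hkl] at this
      refine this.mono ?_
      rw [mul_comm (2 * B * (1 / 2) ^ (r + 1) + 2 * D)]
      refine mul_le_mul_of_nonneg_left ?_ (Real.sqrt_nonneg _)
      have h5 : (((l - k : ℕ) : ℝ) * (n : ℝ)⁻¹) ^ γ ≤ h₀ ^ γ :=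
        Real.rpow_le_rpow (hE.grid_nonneg _) ((hE.grid_mono (by omega)).trans hNh) hE.γ_pos.le
      have h6 : d * (sewConst p C γ B * (((l - k : ℕ) : ℝ) * (n : ℝ)⁻¹) ^ γ) ≤ 1 / 4 := by
        have : d * (sewConst p C γ B * (((l - k : ℕ) : ℝ) * (n : ℝ)⁻¹) ^ γ)
            ≤ d * (sewConst p C γ B * h₀ ^ γ) := by gcongr
        linarith
      have h7 : s₀ + K' + K' ≥ 0 := by positivity
      have h8 := mul_le_mul_of_nonneg_right h6 h7
      have h9 : K' / 2 = 2 * B * (1 / 2) ^ (r + 1) + D := by rw [hK', pow_succ]; ring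
      have h10 : d * (expandConst p A C γ β K B * ρ) ≤ D - s₀ := by rw [hD]; linarith
      rw [mul_add, ← mul_assoc (d : ℝ) (_ * _) (s₀ + K' + K')]
      linarith
  refine HasLpBound.of_tendsto (fun r ↦ hiter r k l hk hkl hl) ?_
  have h1 : Tendsto (fun r : ℕ ↦ (1 / 2 : ℝ) ^ r) atTop (𝓝 0) :=
    tendsto_pow_atTop_nhds_zero_of_lt_one (by norm_num) (by norm_num)
  have := ((h1.const_mul (2 * B)).add_const (2 * D)).mul_const √(((l - k : ℕ) : ℝ) * (n : ℝ)⁻¹)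
  simpa using this

lemma floor_mul_le {h₀ : ℝ} (hh : 0 < h₀) {k : ℕ} (hk : k ≤ ⌊h₀ * n⌋₊) :
    (k : ℝ) * (n : ℝ)⁻¹ ≤ h₀ := by
  rw [mul_inv_le_iff₀ hE.n_pos]
  have := hE.n_pos
  exact (Nat.cast_le.2 hk).trans (Nat.floor_le (by positivity))

/-- The error is bounded on the whole grid, by chaining intervals of length `h₀`. -/
lemma hasLpBound_gridError_sup (hd : 0 < d) {h₀ : ℝ} (hh : 0 < h₀)
    (hh0 : 2 * (d * sewConst p C γ B * h₀ ^ γ) ≤ 1 / 2)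
    {s : ℝ} (hs : HasLpBound P p (fun ω ↦ ‖gridError n X Y 0 ω‖) s) (q j : ℕ) (hj : j ≤ n)
    (hjq : j ≤ q * ⌊h₀ * n⌋₊) :
    HasLpBound P p (fun ω ↦ ‖gridError n X Y j ω‖)
      ((2 + 4 * (1 + d * expandConst p A C γ β K B)) ^ q
        * (s + (n : ℝ)⁻¹ ^ (1 / 2 + (γ - β / 2 + κ)))) := by
  have hρ0 := Real.rpow_nonneg hE.h_pos.le (1 / 2 + (γ - β / 2 + κ))
  have hs0 := hs.nonneg
  have he := hE.mul_expandConst_nonneg hd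
  set ρ := (n : ℝ)⁻¹ ^ (1 / 2 + (γ - β / 2 + κ)) with hρ
  set e := d * expandConst p A C γ β K B with hD
  induction q generalizing j with
  | zero =>
    have : j = 0 := by simpa using hjq
    rw [this, pow_zero, one_mul]
    exact hs.mono (by linarith)
  | succ q ih =>
    set r := ⌊h₀ * n⌋₊ with hr
    have h1 := ih (j - r) (by omega) (by rw [Nat.succ_mul] at hjq; omega)
    have h2 := hE.hasLpBound_gridError_local hd hh0 (i₀ := j - r) (N := j - (j - r)) (by omega)
      (hE.floor_mul_le hh (by omega)) h1 le_rfl (Nat.sub_le j r) (by omega)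
    set a := (2 + 4 * (1 + e)) ^ q * (s + ρ) with ha
    have haρ : ρ ≤ a := by nlinarith [one_le_pow₀ (by linarith : 1 ≤ 2 + 4 * (1 + e)) (n := q)]
    refine (hE.hasLpBound_gridError_add hj (by positivity) h1 h2).mono ?_
    have e1 : (2 + 4 * (1 + e)) ^ (q + 1) * (s + ρ) = (2 + 4 * (1 + e)) * a := by
      rw [ha, pow_succ]; ring
    rw [e1]
    nlinarith [mul_le_mul_of_nonneg_left haρ he]

/-- The increments of the error on the grid. -/
theorem hasLpBound_gridError (hd : 0 < d) {h₀ : ℝ} (hh : 0 < h₀)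
    (hh0 : 2 * (d * sewConst p C γ B * h₀ ^ γ) ≤ 1 / 2)
    {s : ℝ} (hs : HasLpBound P p (fun ω ↦ ‖gridError n X Y 0 ω‖) s) {i j : ℕ} (hij : i ≤ j)
    (hj : j ≤ n) :
    HasLpBound P p (fun ω ↦ ‖gridError n X Y j ω - gridError n X Y i ω‖)
      (buckConst (1 + d * expandConst p A C γ β K B) B h₀ * √((j - i : ℕ) * (n : ℝ)⁻¹)
        * (s + (n : ℝ)⁻¹ ^ (1 / 2 + (γ - β / 2 + κ)))) := by
  have hB := hE.B_nonneg
  have hn := hE.h_pos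
  have hnn := hE.n_pos
  have hs0 := hs.nonneg
  have he := hE.mul_expandConst_nonneg hd
  set ρ := (n : ℝ)⁻¹ ^ (1 / 2 + (γ - β / 2 + κ)) with hρ
  have hρ0 : 0 ≤ ρ := by positivity
  set e := d * expandConst p A C γ β K B with hD
  set t := ((j - i : ℕ) : ℝ) * (n : ℝ)⁻¹ with ht
  have ht0 : 0 ≤ t := hE.grid_nonneg _
  have hts : t ≤ √t := Real.le_sqrt_of_sq_le (by
    nlinarith [hE.grid_le_one (show j - i ≤ n by omega)])
  set a := (2 + 4 * (1 + e)) ^ ⌈2 / h₀⌉₊ * (s + ρ) with ha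
  have haρ : ρ ≤ a := by
    nlinarith [one_le_pow₀ (by linarith : 1 ≤ 2 + 4 * (1 + e)) (n := ⌈2 / h₀⌉₊)]
  have ha0 : 0 ≤ a := hρ0.trans haρ
  have hconst : buckConst (1 + e) B h₀ * √t * (s + ρ)
      = 2 * B / h₀ * √t * (s + ρ) + 4 * (1 + e) * a * √t + 2 / h₀ * a * √t := by
    rw [buckConst, ha]; ring
  rw [hconst]
  have n1 : 0 ≤ 2 * B / h₀ * √t * (s + ρ) := by positivity
  have n2 : 0 ≤ 4 * (1 + e) * a * √t := by positivity
  have n3 : 0 ≤ 2 / h₀ * a * √t := by positivity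
  by_cases hcase : h₀ * n < 1
  · refine (hE.hasLpBound_gridError_trivial hij hj).mono ?_
    have h1 : h₀ ≤ (n : ℝ)⁻¹ := by rw [le_inv_comm₀ hh hnn, ← one_div, le_div_iff₀ hh]; linarith
    have h2 := Real.rpow_le_rpow_of_exponent_ge hn hE.h_le_one
      (by linarith [hE.γ_lt, hE.κ_le, hE.β_lt] : 1 / 2 + (γ - β / 2 + κ) ≤ 1)
    rw [Real.rpow_one] at h2
    have h3 : 2 * B * t ≤ 2 * B / h₀ * √t * (s + ρ) := by
      calc 2 * B * t ≤ 2 * B * √t := by gcongr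
        _ = 2 * B / h₀ * √t * h₀ := by field_simp
        _ ≤ _ := by gcongr; linarith
    linarith
  rw [not_lt] at hcase
  have hr1 : (1 : ℝ) ≤ ⌊h₀ * n⌋₊ := by
    exact_mod_cast Nat.le_floor (by exact_mod_cast hcase : ((1 : ℕ) : ℝ) ≤ h₀ * n)
  have hr := Nat.lt_floor_add_one (h₀ * n)
  have hq : n ≤ ⌈2 / h₀⌉₊ * ⌊h₀ * n⌋₊ := by
    have h2 : (n : ℝ) ≤ ⌈2 / h₀⌉₊ * ⌊h₀ * n⌋₊ := by
      calc (n : ℝ) = 2 / h₀ * (h₀ * n / 2) := by field_simp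
        _ ≤ _ := by gcongr; exacts [Nat.le_ceil _, by linarith]
    exact_mod_cast h2
  have hsup : ∀ j ≤ n, HasLpBound P p (fun ω ↦ ‖gridError n X Y j ω‖) a := fun j hj ↦
    hE.hasLpBound_gridError_sup hd hh hh0 hs _ j hj (hj.trans hq)
  by_cases hjr : j - i ≤ ⌊h₀ * n⌋₊
  · refine (hE.hasLpBound_gridError_local hd hh0 (i₀ := i) (N := j - i) (by omega)
      (hE.floor_mul_le hh hjr) (hsup i (by omega)) le_rfl hij (by omega)).mono ?_
    have h6 : 2 * (a + e * ρ) * √t ≤ 4 * (1 + e) * a * √t := by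
      gcongr ?_ * √t
      nlinarith [mul_le_mul_of_nonneg_left haρ he]
    linarith
  · refine (((hsup j hj).add (by linarith [hE.two_lt]) (hsup i (by omega))).of_abs_le
      ((hE.measurable_gridError j).sub (hE.measurable_gridError i)).norm.aestronglyMeasurable
      (ae_of_all _ fun ω ↦ ?_)).mono ?_
    · rw [abs_norm]; exact norm_sub_le _ _
    · have h1 : h₀ ≤ t := by
        have h2 : (⌊h₀ * n⌋₊ : ℝ) + 1 ≤ (j - i : ℕ) := by exact_mod_cast not_le.1 hjr
        rw [ht, ← div_eq_mul_inv, le_div_iff₀ hnn]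
        linarith
      have h5 : a + a ≤ 2 / h₀ * a * √t := by
        calc a + a = 2 * a * 1 := by ring
          _ ≤ 2 * a * (√t / h₀) := by gcongr; rw [le_div_iff₀ hh, one_mul]; linarith
          _ = _ := by ring
      linarith

end IsEulerPair

/-! ### Chaining -/

/-- Dyadic chaining: increments of a sequence are controlled by its increments over dyadic
intervals. -/
lemma norm_sub_le_sum_dyadic {E : Type*} [NormedAddCommGroup E] (q : ℕ) :
    ∀ (φ : ℕ → E) (D : ℕ → ℝ), (∀ r k, ‖φ ((k + 1) * 2 ^ r) - φ (k * 2 ^ r)‖ ≤ D r) →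
    ∀ i j, i ≤ j → j - i < 2 ^ (q + 1) → ‖φ j - φ i‖ ≤ 2 * ∑ r ∈ Finset.range (q + 1), D r := by
  induction q with
  | zero =>
    intro φ D hD i j hij hlt
    have h0 := hD 0
    simp only [pow_zero, mul_one] at h0
    have hD0 : 0 ≤ D 0 := (norm_nonneg _).trans (h0 0)
    rw [zero_add, pow_one] at hlt
    rw [Finset.sum_range_one]
    rcases (by omega : j = i ∨ j = i + 1) with rfl | rfl
    · simpa using hD0
    · linarith [h0 i]
  | succ q ih =>
    intro φ D hD i j hij hlt
    have h0 := hD 0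
    simp only [pow_zero, mul_one] at h0
    have hD0 : 0 ≤ D 0 := (norm_nonneg _).trans (h0 0)
    have hrec := ih (fun k ↦ φ (2 * k)) (fun r ↦ D (r + 1)) fun r k ↦ by
      have := hD (r + 1) k
      rw [pow_succ', ← mul_assoc, ← mul_assoc] at this
      rwa [mul_comm 2 ((k + 1) * 2 ^ r), mul_comm 2 (k * 2 ^ r), mul_right_comm (k + 1),
        mul_right_comm k]
    rw [Finset.sum_range_succ']
    have hrest : 0 ≤ ∑ r ∈ Finset.range (q + 1), D (r + 1) :=
      Finset.sum_nonneg fun r _ ↦ (norm_nonneg _).trans (hD (r + 1) 0)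
    by_cases hle : (i + 1) / 2 ≤ j / 2
    · have h1 := hrec ((i + 1) / 2) (j / 2) hle (by rw [pow_succ] at hlt; omega)
      have h2 : ‖φ j - φ (2 * (j / 2))‖ ≤ D 0 := by
        rcases (by omega : j = 2 * (j / 2) ∨ j = 2 * (j / 2) + 1) with h | h
        · rw [← h, sub_self, norm_zero]; exact hD0
        · have := h0 (2 * (j / 2)); rwa [← h] at this
      have h3 : ‖φ (2 * ((i + 1) / 2)) - φ i‖ ≤ D 0 := by
        rcases (by omega : 2 * ((i + 1) / 2) = i ∨ 2 * ((i + 1) / 2) = i + 1) with h | h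
        · rw [h, sub_self, norm_zero]; exact hD0
        · rw [h]; exact h0 i
      have e : φ j - φ i = (φ j - φ (2 * (j / 2))) + (φ (2 * (j / 2)) - φ (2 * ((i + 1) / 2)))
          + (φ (2 * ((i + 1) / 2)) - φ i) := by abel
      rw [e]
      have h4 := norm_add_le ((φ j - φ (2 * (j / 2)))
        + (φ (2 * (j / 2)) - φ (2 * ((i + 1) / 2)))) (φ (2 * ((i + 1) / 2)) - φ i)
      have h5 := norm_add_le (φ j - φ (2 * (j / 2))) (φ (2 * (j / 2)) - φ (2 * ((i + 1) / 2)))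
      linarith
    · have : j = i := by omega
      rw [this, sub_self, norm_zero]
      linarith

/-- The `ℓ_p` norm of a finite family of random variables. -/
lemma HasLpBound.lp_sum {Ω : Type*} {mΩ : MeasurableSpace Ω} {P : Measure Ω} {p : ℝ} (hp : 1 ≤ p)
    {ι : Type*} (s : Finset ι) {f : ι → Ω → ℝ} {a : ℝ} (ha : 0 ≤ a)
    (h : ∀ k ∈ s, HasLpBound P p (f k) a) :
    HasLpBound P p (fun ω ↦ (∑ k ∈ s, |f k ω| ^ p) ^ (1 / p)) ((s.card : ℝ) ^ (1 / p) * a) := by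
  have hp0 : 0 < p := by linarith
  have hm : ∀ k ∈ s, MemLp (f k) (ENNReal.ofReal p) P := fun k hk ↦
    ⟨(h k hk).meas, (h k hk).le.trans_lt ENNReal.ofReal_lt_top⟩
  have hi : ∀ k ∈ s, Integrable (fun ω ↦ |f k ω| ^ p) P := fun k hk ↦ by
    have := (hm k hk).integrable_norm_rpow (by simpa using hp0) ENNReal.ofReal_ne_top
    rwa [ENNReal.toReal_ofReal hp0.le] at this
  have e : ∀ ω, |(∑ k ∈ s, |f k ω| ^ p) ^ (1 / p)| ^ p = ∑ k ∈ s, |f k ω| ^ p := fun ω ↦ by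
    have h0 : 0 ≤ ∑ k ∈ s, |f k ω| ^ p := Finset.sum_nonneg fun _ _ ↦ by positivity
    rw [abs_of_nonneg (by positivity), ← Real.rpow_mul h0, one_div_mul_cancel hp0.ne',
      Real.rpow_one]
  have hs := integrable_finsetSum s hi
  refine of_integral_le hp0 (by positivity) ((integrable_norm_rpow_iff
    ((Real.continuous_rpow_const (by positivity)).comp_aestronglyMeasurable hs.1)
    (by simpa using hp0) ENNReal.ofReal_ne_top).1 ?_) ?_
  · simp_rw [ENNReal.toReal_ofReal hp0.le, Real.norm_eq_abs, e]; exact hs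
  · simp_rw [e]
    rw [integral_finsetSum s hi, Real.mul_rpow (by positivity) ha, ← Real.rpow_mul (by positivity),
      one_div_mul_cancel hp0.ne', Real.rpow_one, ← nsmul_eq_mul]
    exact Finset.sum_le_card_nsmul _ _ _ fun k hk ↦
      (eLpNorm_le_ofReal_iff hp0 ha (hm k hk)).1 (h k hk).le

/-- Kolmogorov's criterion on a grid: if the increments of a process have `L_p` norms at most
`R` times the square root of the time, then the process is Hölder continuous of any order less
than `1/2 - 1/p`, with a constant in `L_p`. -/
theorem exists_holder_const {E : Type*} [NormedAddCommGroup E] {Ω : Type*} {mΩ : MeasurableSpace Ω}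
    {P : Measure Ω} {p ε R : ℝ} (hp : 2 < p) (hε : 0 < ε) (hε1 : ε ≤ 1)
    (hτ : 0 ≤ 1 / 2 - 1 / p - ε) {n : ℕ} (hn : 1 ≤ n) (hR : 0 ≤ R) (φ : ℕ → Ω → E)
    (hφ : ∀ i j, i ≤ j → j ≤ n → HasLpBound P p (fun ω ↦ ‖φ j ω - φ i ω‖)
      (R * √((j - i : ℕ) * (n : ℝ)⁻¹))) :
    ∃ H : Ω → ℝ, (∀ ω, 0 ≤ H ω) ∧ HasLpBound P p H (16 * R / (2 ^ ε - 1)) ∧ ∀ ω i j, i ≤ j → j ≤ n →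
        ‖φ j ω - φ i ω‖ ≤ H ω * ((j - i : ℕ) * (n : ℝ)⁻¹) ^ (1 / 2 - 1 / p - ε) := by
  have hp1 : 1 ≤ p := by linarith
  have hp0 : 0 < p := by linarith
  set h := (n : ℝ)⁻¹ with hh'
  have hh : 0 < h := inv_pos.2 (by exact_mod_cast hn)
  set τ := 1 / 2 - 1 / p - ε with hτ'
  set Q := Nat.log 2 n + 1 with hQ
  have hQ1 : n ≤ 2 ^ Q := (Nat.lt_pow_succ_log_self one_lt_two n).le
  have hQ2 : 2 ^ Q ≤ 2 * n := by
    rw [hQ, pow_succ, mul_comm]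
    exact Nat.mul_le_mul_left 2 (Nat.pow_log_le_self 2 (by omega))
  set φ' : ℕ → Ω → E := fun k ω ↦ φ (min k n) ω with hφ'
  set D : ℕ → Ω → ℝ := fun r ω ↦ (∑ k ∈ Finset.range (2 ^ (Q - r)),
    |‖φ' ((k + 1) * 2 ^ r) ω - φ' (k * 2 ^ r) ω‖| ^ p) ^ (1 / p) with hD
  have hD0 : ∀ r ω, 0 ≤ D r ω := fun r ω ↦ by positivity
  have hDle : ∀ ω r k, ‖φ' ((k + 1) * 2 ^ r) ω - φ' (k * 2 ^ r) ω‖ ≤ D r ω := by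
    intro ω r k
    by_cases hk : k < 2 ^ (Q - r)
    · have h1 := Finset.single_le_sum
        (f := fun k ↦ |‖φ' ((k + 1) * 2 ^ r) ω - φ' (k * 2 ^ r) ω‖| ^ p)
        (fun k _ ↦ by positivity) (Finset.mem_range.2 hk)
      have h2 := Real.rpow_le_rpow (by positivity) h1 (by positivity : 0 ≤ 1 / p)
      rwa [← Real.rpow_mul (abs_nonneg _), mul_one_div_cancel hp0.ne', Real.rpow_one,
        abs_norm] at h2
    · rw [not_lt] at hk
      have h1 : n ≤ k * 2 ^ r := by
        calc n ≤ 2 ^ Q := hQ1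
          _ ≤ 2 ^ (Q - r + r) := Nat.pow_le_pow_right (by norm_num) (by omega)
          _ = 2 ^ (Q - r) * 2 ^ r := pow_add _ _ _
          _ ≤ k * 2 ^ r := Nat.mul_le_mul_right _ hk
      have h2 : n ≤ (k + 1) * 2 ^ r := h1.trans (Nat.mul_le_mul_right _ (by omega))
      simp only [hφ', min_eq_right h1, min_eq_right h2, sub_self, norm_zero]
      exact hD0 r ω
  have hDp : ∀ r, HasLpBound P p (D r)
      (((2 ^ (Q - r) : ℕ) : ℝ) ^ (1 / p) * (R * √(2 ^ r * h))) := by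
    intro r
    have := HasLpBound.lp_sum (P := P) hp1 (Finset.range (2 ^ (Q - r)))
      (f := fun k ω ↦ ‖φ' ((k + 1) * 2 ^ r) ω - φ' (k * 2 ^ r) ω‖) (a := R * √(2 ^ r * h))
      (by positivity) fun k _ ↦ by
        have hle : k * 2 ^ r ≤ (k + 1) * 2 ^ r := Nat.mul_le_mul_right _ (by omega)
        refine (hφ (min (k * 2 ^ r) n) (min ((k + 1) * 2 ^ r) n) (min_le_min_right _ hle)
          (min_le_right _ _)).mono ?_
        have h1 : ((min ((k + 1) * 2 ^ r) n - min (k * 2 ^ r) n : ℕ) : ℝ) ≤ 2 ^ r := by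
          have e : (k + 1) * 2 ^ r = k * 2 ^ r + 2 ^ r := by ring
          have : ∀ x y : ℕ, min (x + y) n - min x n ≤ y := fun x y ↦ by omega
          rw [e]
          exact_mod_cast this _ _
        gcongr
    rwa [Finset.card_range] at this
  set H : Ω → ℝ := fun ω ↦ 2 * ∑ r ∈ Finset.range (Q + 1), (2 ^ r * h) ^ (-τ) * D r ω with hH
  have hH0 : ∀ ω, 0 ≤ H ω := fun ω ↦ mul_nonneg zero_le_two
    (Finset.sum_nonneg fun r _ ↦ mul_nonneg (by positivity) (hD0 r ω))
  refine ⟨H, hH0, ?_, ?_⟩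
  · have h1 := (HasLpBound.sum hp1 (Finset.range (Q + 1)) fun r _ ↦
      (hDp r).const_mul (by positivity : 0 ≤ ((2 : ℝ) ^ r * h) ^ (-τ))).const_mul zero_le_two
    refine h1.mono ?_
    set T := (2 : ℝ) ^ Q * h with hT
    have hT0 : 0 < T := by positivity
    have hT2 : T ≤ 2 := by
      have : ((2 : ℝ) ^ Q) ≤ 2 * n := by exact_mod_cast hQ2
      calc T ≤ 2 * n * h := by rw [hT]; gcongr
        _ = 2 := by rw [hh', mul_assoc, mul_inv_cancel₀ (by positivity), mul_one]
    have hx1 : (1 : ℝ) < 2 ^ ε := Real.one_lt_rpow (by norm_num) hε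
    have hx0 : (0 : ℝ) < 2 ^ ε - 1 := by linarith
    have hpow : ∀ r : ℕ, ((2 : ℝ) ^ r * h) ^ ε = h ^ ε * ((2 : ℝ) ^ ε) ^ r := fun r ↦ by
      rw [Real.mul_rpow (by positivity) hh.le, ← Real.rpow_natCast, ← Real.rpow_natCast,
        ← Real.rpow_mul (by norm_num), ← Real.rpow_mul (by norm_num), mul_comm (r : ℝ), mul_comm]
    have hterm : ∀ r ∈ Finset.range (Q + 1),
        ((2 : ℝ) ^ r * h) ^ (-τ) * (((2 ^ (Q - r) : ℕ) : ℝ) ^ (1 / p) * (R * √(2 ^ r * h)))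
          = R * T ^ (1 / p) * (h ^ ε * ((2 : ℝ) ^ ε) ^ r) := by
      intro r hr
      have hrQ : r ≤ Q := by have := Finset.mem_range.1 hr; omega
      set y := (2 : ℝ) ^ r * h with hy
      have hy0 : 0 < y := by positivity
      have e1 : T = 2 ^ (Q - r) * y := by
        rw [hT, hy, ← mul_assoc, ← pow_add, Nat.sub_add_cancel hrQ]
      have e3 : y ^ (-τ) * √y = y ^ (1 / p) * y ^ ε := by
        rw [Real.sqrt_eq_rpow, ← Real.rpow_add hy0, ← Real.rpow_add hy0, hτ']
        ring_nf
      rw [← hpow, ← hy, e1, Real.mul_rpow (by positivity) hy0.le]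
      push_cast
      calc _ = R * ((2 : ℝ) ^ (Q - r)) ^ (1 / p) * (y ^ (-τ) * √y) := by ring
        _ = _ := by rw [e3]; ring
    rw [Finset.sum_congr rfl hterm, ← Finset.mul_sum, ← Finset.mul_sum, geom_sum_eq hx1.ne']
    have h2 : ∀ x : ℝ, x ≤ 1 → (2 : ℝ) ^ x ≤ 2 := fun x hx ↦
      (Real.rpow_le_rpow_of_exponent_le one_le_two hx).trans_eq (Real.rpow_one 2)
    have hT1 : T ^ (1 / p) ≤ 2 := (Real.rpow_le_rpow hT0.le hT2 (by positivity)).trans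
      (h2 _ ((div_le_one hp0).2 hp1))
    have hT3 : T ^ ε ≤ 2 := (Real.rpow_le_rpow hT0.le hT2 hε.le).trans (h2 _ hε1)
    have hnum : h ^ ε * (((2 : ℝ) ^ ε) ^ (Q + 1) - 1) ≤ 4 := by
      have : h ^ ε * ((2 : ℝ) ^ ε) ^ (Q + 1) = T ^ ε * 2 ^ ε := by rw [hT, hpow, pow_succ]; ring
      have h3 : 0 ≤ h ^ ε := by positivity
      have h4 : T ^ ε * 2 ^ ε ≤ 2 * 2 := by gcongr; exact h2 _ hε1
      nlinarith
    have hpos : 0 ≤ ((2 : ℝ) ^ ε) ^ (Q + 1) - 1 := sub_nonneg.2 (one_le_pow₀ hx1.le)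
    calc 2 * (R * T ^ (1 / p) * (h ^ ε * ((((2 : ℝ) ^ ε) ^ (Q + 1) - 1) / (2 ^ ε - 1))))
        = 2 * (R * T ^ (1 / p) * ((h ^ ε * (((2 : ℝ) ^ ε) ^ (Q + 1) - 1)) / (2 ^ ε - 1))) := by ring
      _ ≤ 2 * (R * 2 * (4 / (2 ^ ε - 1))) := by gcongr
      _ = _ := by ring
  · intro ω i j hij hjn
    rcases hij.eq_or_lt with rfl | hlt
    · rw [sub_self, norm_zero]
      exact mul_nonneg (hH0 ω) (by positivity)
    set q := Nat.log 2 (j - i) with hq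
    have hq1 : j - i < 2 ^ (q + 1) := Nat.lt_pow_succ_log_self one_lt_two _
    have hq2 : 2 ^ q ≤ j - i := Nat.pow_log_le_self 2 (by omega)
    have hqQ : q + 1 ≤ Q + 1 := by
      have : q ≤ Nat.log 2 n := Nat.log_mono_right (by omega)
      omega
    have h1 := norm_sub_le_sum_dyadic q (fun k ↦ φ' k ω) (fun r ↦ D r ω) (fun r k ↦ hDle ω r k)
      i j hij hq1
    have e1 : φ' j ω = φ j ω := by simp only [hφ', min_eq_left hjn]
    have e2 : φ' i ω = φ i ω := by simp only [hφ', min_eq_left (hij.trans hjn)]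
    simp only [e1, e2] at h1
    refine h1.trans ?_
    have h2 : ∑ r ∈ Finset.range (q + 1), D r ω
        ≤ ∑ r ∈ Finset.range (q + 1), (((2 : ℝ) ^ r * h) ^ (-τ) * D r ω)
          * ((j - i : ℕ) * h) ^ τ := by
      refine Finset.sum_le_sum fun r hr ↦ ?_
      have hr' : r ≤ q := by have := Finset.mem_range.1 hr; omega
      have h3 : (2 : ℝ) ^ r * h ≤ ((j - i : ℕ) : ℝ) * h := by
        have : 2 ^ r ≤ j - i := (Nat.pow_le_pow_right (by norm_num) hr').trans hq2
        gcongr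
        exact_mod_cast this
      have h4 : 1 ≤ ((2 : ℝ) ^ r * h) ^ (-τ) * ((j - i : ℕ) * h) ^ τ := by
        rw [Real.rpow_neg (by positivity), ← div_eq_inv_mul, le_div_iff₀ (by positivity), one_mul]
        exact Real.rpow_le_rpow (by positivity) h3 hτ
      have := mul_le_mul_of_nonneg_left h4 (hD0 r ω)
      linarith
    rw [← Finset.sum_mul] at h2
    refine (mul_le_mul_of_nonneg_left (h2.trans ?_) zero_le_two).trans_eq (mul_assoc _ _ _).symm
    gcongr

/-! ### Hölder norms of paths and coefficients -/

lemma pathNorm_le {F : Type*} [NormedAddCommGroup F] {τ τ₁ s H : ℝ} (hτ : τ ≤ τ₁)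
    (hτ₁ : 0 < τ₁) (hs : 0 ≤ s) (hH : 0 ≤ H) {f : I → F} (h0 : ‖f 0‖ ≤ s)
    (hf : ∀ x y : I, ‖f x - f y‖ ≤ H * |(x : ℝ) - y| ^ τ₁) :
    pathNorm τ f ≤ ENNReal.ofReal (s + 2 * H) := by
  have hd : ∀ x y : I, |(x : ℝ) - y| ≤ 1 := fun x y ↦ by
    rw [abs_le]
    constructor <;> linarith [x.2.1, x.2.2, y.2.1, y.2.2]
  have hsup : supENorm f ≤ ENNReal.ofReal (s + H) := by
    refine iSup_le fun x ↦ ?_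
    rw [← ofReal_norm]
    refine ENNReal.ofReal_le_ofReal ?_
    have h1 := hf x 0
    have h2 : |(x : ℝ) - (0 : I)| ^ τ₁ ≤ 1 := Real.rpow_le_one (abs_nonneg _) (hd x 0) hτ₁.le
    have h3 := norm_le_norm_sub_add (f x) (f 0)
    nlinarith
  unfold pathNorm
  split_ifs with h
  · exact hsup.trans (ENNReal.ofReal_le_ofReal (by linarith))
  · rw [not_le] at h
    have hhol : HolderWith H.toNNReal τ.toNNReal f := by
      intro x y
      rw [edist_dist, edist_dist, dist_eq_norm, ENNReal.coe_nnreal_eq, Real.coe_toNNReal _ hH,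
        Real.coe_toNNReal _ h.le, ENNReal.ofReal_rpow_of_nonneg dist_nonneg h.le,
        ← ENNReal.ofReal_mul hH]
      refine ENNReal.ofReal_le_ofReal ((hf x y).trans ?_)
      rw [Subtype.dist_eq, Real.dist_eq]
      rcases (abs_nonneg ((x : ℝ) - y)).eq_or_lt with h0 | h0
      · rw [← h0, Real.zero_rpow hτ₁.ne', Real.zero_rpow h.ne']
      · gcongr ?_ * ?_
        exact Real.rpow_le_rpow_of_exponent_ge h0 (hd x y) hτ
    have := hhol.eHolderNorm_le
    calc _ ≤ ENNReal.ofReal (s + H) + ENNReal.ofReal H := add_le_add hsup this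
      _ = _ := by rw [← ENNReal.ofReal_add (by linarith) hH]; ring_nf

/-! ### The Euler bound for drivers with a regularizing semigroup -/

/-- The nearest point of the unit interval. -/
noncomputable abbrev prj (t : ℝ) : I := Set.projIcc (0 : ℝ) 1 zero_le_one t

lemma prj_coe (t : I) : prj t = t := Set.projIcc_val _ t

lemma coe_prj {t : ℝ} (h0 : 0 ≤ t) (h1 : t ≤ 1) : (prj t : ℝ) = t := by
  rw [prj, Set.projIcc_of_mem zero_le_one ⟨h0, h1⟩]

lemma setIntegral_Iic_eq_intervalIntegral {E : Type*} [NormedAddCommGroup E] [NormedSpace ℝ E]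
    (g : I → E) (t : I) : ∫ s in Set.Iic t, g s = ∫ r in (0 : ℝ)..t, g (prj r) := by
  have he : MeasurableEmbedding (Subtype.val : I → ℝ) :=
    MeasurableEmbedding.subtype_coe measurableSet_Icc
  have h1 := he.setIntegral_map (μ := (volume : Measure I)) (fun r ↦ g (prj r)) (Set.Iic (t : ℝ))
  have h2 : (volume : Measure I).map Subtype.val = volume.restrict (Set.Icc (0 : ℝ) 1) :=
    map_comap_subtype_coe measurableSet_Icc volume
  simp only [prj_coe] at h1
  have h3 : (Subtype.val : I → ℝ) ⁻¹' Set.Iic (t : ℝ) = Set.Iic t := rfl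
  rw [h3] at h1
  rw [← h1, h2, Measure.restrict_restrict measurableSet_Iic, intervalIntegral.integral_of_le t.2.1,
    ← integral_Icc_eq_integral_Ioc]
  congr 2
  ext r
  simp only [Set.mem_inter_iff, Set.mem_Iic, Set.mem_Icc]
  exact ⟨fun h ↦ ⟨h.2.1, h.1⟩, fun h ↦ ⟨h.2, h.1, h.2.trans t.2.2⟩⟩

section Paths

variable {E : Type*} [NormedAddCommGroup E] [NormedSpace ℝ E] [FiniteDimensional ℝ E]
  [MeasurableSpace E] [BorelSpace E] {u x l : I → E} {x₀ : E} {B : ℝ}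

lemma intervalIntegrable_prj (hu : Measurable u) (hB : ∀ s, ‖u s‖ ≤ B) (s t : ℝ) :
    IntervalIntegrable (fun r ↦ u (prj r)) volume s t := by
  have hm : Measurable fun r ↦ u (prj r) := hu.comp continuous_projIcc.measurable
  rw [intervalIntegrable_iff, Set.uIoc]
  exact Integrable.of_bound hm.aestronglyMeasurable B (ae_of_all _ fun _ ↦ hB _)

lemma path_sub_eq (hu : Measurable u) (hB : ∀ s, ‖u s‖ ≤ B)
    (hx : ∀ t, x t = x₀ + (∫ s in Set.Iic t, u s) + l t) {s t : ℝ} (hs : 0 ≤ s) (hst : s ≤ t)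
    (ht : t ≤ 1) :
    x (prj t) - (x (prj s) + (l (prj t) - l (prj s))) = ∫ r in s..t, u (prj r) := by
  rw [hx, hx, setIntegral_Iic_eq_intervalIntegral, setIntegral_Iic_eq_intervalIntegral,
    coe_prj hs (hst.trans ht), coe_prj (hs.trans hst) ht]
  have := intervalIntegral.integral_add_adjacent_intervals (intervalIntegrable_prj hu hB 0 s)
    (intervalIntegrable_prj hu hB s t)
  rw [← this]
  abel

lemma path_zero (hx : ∀ t, x t = x₀ + (∫ s in Set.Iic t, u s) + l t) (hl : l 0 = 0) : x 0 = x₀ := by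
  rw [hx 0, setIntegral_Iic_eq_intervalIntegral, hl]
  simp

lemma norm_path_sub_le (hu : Measurable u) (hB : ∀ s, ‖u s‖ ≤ B)
    (hx : ∀ t, x t = x₀ + (∫ s in Set.Iic t, u s) + l t) {s t : ℝ} (hs : 0 ≤ s) (hst : s ≤ t)
    (ht : t ≤ 1) :
    ‖x (prj t) - (x (prj s) + (l (prj t) - l (prj s)))‖ ≤ B * (t - s) := by
  rw [path_sub_eq hu hB hx hs hst ht]
  have := intervalIntegral.norm_integral_le_of_norm_le_const (a := s) (b := t) (C := B)
    (f := fun r ↦ u (prj r)) fun r _ ↦ hB _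
  rwa [abs_of_nonneg (sub_nonneg.2 hst)] at this

end Paths

/-- The increments of `L` on `[0,1]` have the laws `m`, and `L` is right-continuous and starts at
`0`. -/
structure HasIncrementLaws {d : ℕ} {Ω : Type*} {mΩ : MeasurableSpace Ω} (P : Measure Ω)
    (m : ℝ → Measure (EuclideanSpace ℝ (Fin d))) (L : ℝ≥0 → Ω → EuclideanSpace ℝ (Fin d)) :
    Prop where
  zero : ∀ᵐ ω ∂P, L 0 ω = 0
  law : ∀ s t : ℝ, 0 ≤ s → s ≤ t → t ≤ 1 →
    P.map (fun ω ↦ L t.toNNReal ω - L s.toNNReal ω) = m (t - s)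
  rightCont : ∀ᵐ ω ∂P, ∀ t : ℝ≥0, t < 1 → ContinuousWithinAt (fun s ↦ L s ω) (Set.Ici t) t

variable {d : ℕ} {Ω : Type*} {mΩ : MeasurableSpace Ω} {P : Measure Ω} [IsProbabilityMeasure P]
  {m : ℝ → Measure (EuclideanSpace ℝ (Fin d))} {L : ℝ≥0 → Ω → EuclideanSpace ℝ (Fin d)}

lemma HasIncrementLaws.isDriver (hL : HasIncrementLaws P m L) {F : Filtration I mΩ}
    (hF : IsFiltrationFor F L P) :
    IsDriver P (fun t ↦ F (prj t)) m (fun t ↦ L (unitInterval.toNNReal (prj t))) where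
  le t := F.le _
  mono s t h := F.mono (Set.monotone_projIcc _ h)
  adapted t := hF.adapted _
  indep s t _ hst _ := hF.indep _ _ (Set.monotone_projIcc _ hst)
  law s t hs hst ht := by
    have e : ∀ r, 0 ≤ r → r ≤ 1 → unitInterval.toNNReal (prj r) = r.toNNReal := fun r h0 h1 ↦ by
      rw [← NNReal.coe_inj, Real.coe_toNNReal _ h0]
      exact coe_prj h0 h1
    simp only [e s hs (hst.trans ht), e t (hs.trans hst) ht]
    exact hL.law s t hs hst ht

lemma isDrivenPath_of_isSolution (hL : HasIncrementLaws P m L) {F : Filtration I mΩ}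
    {b : EuclideanSpace ℝ (Fin d) → EuclideanSpace ℝ (Fin d)} (hb : Measurable b) {B : ℝ}
    (hB0 : 0 ≤ B) (hB : ∀ x, ‖b x‖ ≤ B) {x₀ : EuclideanSpace ℝ (Fin d)}
    {X : I → Ω → EuclideanSpace ℝ (Fin d)} (hX : IsSolution F L P b x₀ X) :
    IsDrivenPath P (fun t ↦ F (prj t)) (fun t ↦ L (unitInterval.toNNReal (prj t))) B
      (fun t ↦ X (prj t)) where
  nonneg := hB0
  adapted t := hX.adapted _
  drift := by
    filter_upwards [hX.path_measurable, hX.eqn] with ω h1 h2 s t hs hst ht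
    exact norm_path_sub_le (u := fun s ↦ b (X s ω)) (x := fun s ↦ X s ω)
      (l := fun s ↦ L (unitInterval.toNNReal s) ω) (hb.comp h1) (fun _ ↦ hB _) h2 hs hst ht
  rightCont := by
    filter_upwards [hX.path_measurable, hX.eqn, hL.rightCont] with ω h1 h2 h3 t ht ht1
    have hcL : ContinuousWithinAt (fun s : ℝ ↦ L (unitInterval.toNNReal (prj s)) ω)
        (Set.Ici t) t := by
      have h4 := h3 (unitInterval.toNNReal (prj t)) (by
        rw [← NNReal.coe_lt_coe]
        change (prj t : ℝ) < _
        rw [coe_prj ht ht1.le]; exact ht1)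
      refine ContinuousWithinAt.comp (t := Set.Ici (unitInterval.toNNReal (prj t)))
        (f := fun s : ℝ ↦ unitInterval.toNNReal (prj s)) h4 ?_ ?_
      · refine Continuous.continuousWithinAt ?_
        exact unitInterval.toNNReal_continuous.comp continuous_projIcc
      · intro s hs
        exact Set.monotone_projIcc zero_le_one (Set.mem_Ici.1 hs)
    have key : ∀ s t : I, s ≤ t → ‖(X t ω - L (unitInterval.toNNReal t) ω)
        - (X s ω - L (unitInterval.toNNReal s) ω)‖ ≤ B * |(t : ℝ) - s| := fun s t hst ↦ by
      have := norm_path_sub_le (u := fun s ↦ b (X s ω)) (x := fun s ↦ X s ω)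
        (l := fun s ↦ L (unitInterval.toNNReal s) ω) (hb.comp h1) (fun _ ↦ hB _) h2
        s.2.1 hst t.2.2
      rw [prj_coe, prj_coe] at this
      rw [abs_of_nonneg (sub_nonneg.2 (Subtype.coe_le_coe.2 hst))]
      refine le_trans (le_of_eq ?_) this
      congr 1; abel
    have hlip : ∀ s, ‖(X (prj s) ω - L (unitInterval.toNNReal (prj s)) ω)
        - (X (prj t) ω - L (unitInterval.toNNReal (prj t)) ω)‖ ≤ B * |(prj s : ℝ) - prj t| := by
      intro s
      rcases le_total (prj s) (prj t) with h | h
      · rw [abs_sub_comm, ← norm_neg, neg_sub]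
        exact key _ _ h
      · exact key _ _ h
    have hcD : ContinuousWithinAt (fun s : ℝ ↦ X (prj s) ω - L (unitInterval.toNNReal (prj s)) ω)
        (Set.Ici t) t := by
      refine ContinuousAt.continuousWithinAt ?_
      refine tendsto_iff_norm_sub_tendsto_zero.2 ?_
      have hc : Continuous fun s : ℝ ↦ B * |(prj s : ℝ) - prj t| := continuous_const.mul
        ((continuous_subtype_val.comp continuous_projIcc).sub continuous_const).abs
      have h5 := hc.tendsto t
      rw [sub_self, abs_zero, mul_zero] at h5
      exact squeeze_zero (fun _ ↦ norm_nonneg _) hlip h5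
    refine (hcD.add hcL).congr (fun s _ ↦ ?_) ?_ <;> simp

lemma kappa_prj_eq {n k : ℕ} (hn : 1 ≤ n) (hk : k < n) {r : ℝ} (h0 : k * (n : ℝ)⁻¹ ≤ r)
    (h1 : r < (k + 1 : ℕ) * (n : ℝ)⁻¹) : kappa n (prj r) = prj (k * (n : ℝ)⁻¹) := by
  have hn0 : (0 : ℝ) < n := by exact_mod_cast hn
  have hr0 : 0 ≤ r := le_trans (by positivity) h0
  have hk1 : ((k + 1 : ℕ) : ℝ) * (n : ℝ)⁻¹ ≤ 1 := by
    rw [mul_inv_le_iff₀ hn0, one_mul]; exact_mod_cast hk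
  have hr1 : r ≤ 1 := h1.le.trans hk1
  have hfl : ⌊(n : ℝ) * r⌋₊ = k := by
    rw [Nat.floor_eq_iff (by positivity)]
    rw [mul_inv_le_iff₀ hn0] at h0
    rw [lt_mul_inv_iff₀ hn0] at h1
    push_cast at h1
    constructor <;> linarith
  ext
  rw [coe_prj (by positivity) (h0.trans hr1)]
  simp only [kappa, coe_prj hr0 hr1, hfl, div_eq_mul_inv]

lemma measurable_comp_kappa {E : Type*} [MeasurableSpace E] (n : ℕ) (y : I → E) :
    Measurable fun s ↦ y (kappa n s) := by
  have h : (fun s ↦ y (kappa n s))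
      = (fun k : ℕ ↦ y (prj (k / n))) ∘ fun s : I ↦ ⌊(n : ℝ) * s⌋₊ := by
    ext s
    have : kappa n s = prj ((⌊(n : ℝ) * s⌋₊ : ℝ) / n) := by rw [← prj_coe (kappa n s)]; rfl
    simp only [Function.comp, this]
  rw [h]
  exact (measurable_from_nat).comp (Nat.measurable_floor.comp (by fun_prop))

/-- The Euler scheme on the grid, driven by `L`. -/
noncomputable def gridScheme (n : ℕ) (b : EuclideanSpace ℝ (Fin d) → EuclideanSpace ℝ (Fin d))
    (L : ℝ → Ω → EuclideanSpace ℝ (Fin d)) (y₀ : EuclideanSpace ℝ (Fin d)) :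
    ℕ → Ω → EuclideanSpace ℝ (Fin d)
  | 0 => fun _ ↦ y₀
  | k + 1 => fun ω ↦ gridScheme n b L y₀ k ω + (n : ℝ)⁻¹ • b (gridScheme n b L y₀ k ω)
      + (L ((k + 1 : ℕ) * (n : ℝ)⁻¹) ω - L (k * (n : ℝ)⁻¹) ω)

lemma min_rpow_rpow {x r q : ℝ} (hx : 0 ≤ x) (hq : 0 ≤ q) :
    min (x ^ r) 1 ^ q = min (x ^ (r * q)) 1 := by
  rw [(Real.monotoneOn_rpow_Ici_of_exponent_nonneg hq).map_min (Set.mem_Ici.2 (by positivity))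
    (Set.mem_Ici.2 zero_le_one), Real.one_rpow, ← Real.rpow_mul hx]

/-- The moment bound of a heat semigroup, raised to the power `p`. -/
lemma HasMoment.of_isHeatSemigroup {M : HConstants} (hm : IsHeatSemigroup m M) {p β δ : ℝ}
    (hp : 0 < p) (hβ : 0 < β) (hβp : β * p < 2) (hδ : 0 < δ) :
    HasMoment m p β ((M.mom (β * p) (p * δ) : ℝ) ^ (1 / p)) (β / 2 - δ) where
  nonneg := by positivity
  le t ht ht1 := by
    have h1 := hm.mom (β * p) (by positivity) hβp (p * δ) (by positivity) t ht ht1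
    simp_rw [min_rpow_rpow (norm_nonneg _) hp.le]
    refine h1.trans (le_of_eq ?_)
    rw [Real.mul_rpow (by positivity) (by positivity), ← Real.rpow_mul (NNReal.coe_nonneg _),
      one_div_mul_cancel hp.ne', Real.rpow_one, ← Real.rpow_mul ht.le]
    congr 2
    ring

lemma buckConst_nonneg {D B h₀ : ℝ} (hD : 0 ≤ D) (hB : 0 ≤ B) (hh : 0 ≤ h₀) :
    0 ≤ buckConst D B h₀ := by
  unfold buckConst; positivity

/-- From the grid to all times: between grid points the error is Lipschitz. -/
lemma norm_sub_le_of_grid {F : Type*} [NormedAddCommGroup F] {ψ : I → F} {B H τ ρ : ℝ} {n : ℕ}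
    (hn : 1 ≤ n) (hB : 0 ≤ B) (hH : 0 ≤ H) (hτ : 0 < τ) (hτ1 : τ ≤ 1)
    (hρ : (n : ℝ)⁻¹ ^ (1 - τ) ≤ ρ)
    (hlip : ∀ s t : I, s ≤ t → ‖ψ t - ψ s‖ ≤ 2 * B * ((t : ℝ) - s))
    (hgrid : ∀ i j : ℕ, i ≤ j → j ≤ n → ‖ψ (prj (j * (n : ℝ)⁻¹)) - ψ (prj (i * (n : ℝ)⁻¹))‖
      ≤ H * ((j - i : ℕ) * (n : ℝ)⁻¹) ^ τ) (x y : I) :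
    ‖ψ x - ψ y‖ ≤ (2 * H + 4 * B * ρ) * |(x : ℝ) - y| ^ τ := by
  have hn0 : (0 : ℝ) < n := by exact_mod_cast hn
  have hh : 0 < (n : ℝ)⁻¹ := inv_pos.2 hn0
  set h := (n : ℝ)⁻¹ with hdef
  have hρ0 : 0 ≤ ρ := le_trans (by positivity) hρ
  have key : ∀ s t : I, s ≤ t → ‖ψ t - ψ s‖ ≤ (2 * H + 4 * B * ρ) * ((t : ℝ) - s) ^ τ := by
    intro s t hst
    rcases (sub_nonneg.2 hst : 0 ≤ (t : ℝ) - s).eq_or_lt with h0 | h0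
    · have : t = s := Subtype.ext (by linarith)
      rw [this, sub_self, norm_zero, sub_self, Real.zero_rpow hτ.ne', mul_zero]
    have hmin : ∀ δ, 0 < δ → δ ≤ h → δ ≤ (t : ℝ) - s → δ ≤ ρ * ((t : ℝ) - s) ^ τ :=
      fun δ hδ h1 h2 ↦ by
        calc δ = δ ^ (1 - τ) * δ ^ τ := by rw [← Real.rpow_add hδ]; simp
          _ ≤ h ^ (1 - τ) * ((t : ℝ) - s) ^ τ := by gcongr
          _ ≤ _ := by gcongr
    rcases le_total ((t : ℝ) - s) h with hle | hle
    · have h3 := mul_le_mul_of_nonneg_left (hmin _ h0 hle le_rfl) hB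
      have h4 : 0 ≤ B * (ρ * ((t : ℝ) - s) ^ τ) := by positivity
      have h5 : 0 ≤ H * ((t : ℝ) - s) ^ τ := by positivity
      linarith [hlip s t hst]
    · -- the neighbouring grid points
      have hgp : ∀ r : I, ∃ k : ℕ, k = ⌊(n : ℝ) * r⌋₊ ∧ k ≤ n ∧ (prj (k * h) : ℝ) = k * h ∧
          (k : ℝ) * h ≤ r ∧ (r : ℝ) ≤ k * h + h := by
        intro r
        have hr0 : 0 ≤ (n : ℝ) * r := mul_nonneg hn0.le r.2.1
        have e1 := Nat.floor_le hr0
        have e2 := Nat.lt_floor_add_one ((n : ℝ) * r)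
        have e3 : ((⌊(n : ℝ) * r⌋₊ : ℕ) : ℝ) * h ≤ r := by rw [mul_inv_le_iff₀ hn0]; linarith
        refine ⟨_, rfl, ?_, coe_prj (by positivity) (e3.trans r.2.2), e3, ?_⟩
        · have : (⌊(n : ℝ) * r⌋₊ : ℝ) ≤ n := e1.trans (mul_le_of_le_one_right hn0.le r.2.2)
          exact_mod_cast this
        · have : (r : ℝ) ≤ ((⌊(n : ℝ) * r⌋₊ : ℕ) + 1 : ℝ) * h := by
            rw [le_mul_inv_iff₀ hn0]; linarith
          linarith
      obtain ⟨i, hi, hin, hi1, hi2, hi3⟩ := hgp s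
      obtain ⟨j, hj, hjn, hj1, hj2, hj3⟩ := hgp t
      have hij : i ≤ j := by
        rw [hi, hj]
        exact Nat.floor_le_floor (mul_le_mul_of_nonneg_left hst hn0.le)
      have h1 := hlip (prj (i * h)) s (Subtype.coe_le_coe.1 (hi1.trans_le hi2))
      have h2 := hlip (prj (j * h)) t (Subtype.coe_le_coe.1 (hj1.trans_le hj2))
      have h3 := hgrid i j hij hjn
      rw [hi1] at h1
      rw [hj1] at h2
      have h4 : ((j - i : ℕ) : ℝ) * h ≤ 2 * ((t : ℝ) - s) := by rw [Nat.cast_sub hij]; linarith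
      have h5 : (((j - i : ℕ) : ℝ) * h) ^ τ ≤ 2 * ((t : ℝ) - s) ^ τ := by
        calc _ ≤ (2 * ((t : ℝ) - s)) ^ τ := Real.rpow_le_rpow (by positivity) h4 hτ.le
          _ = 2 ^ τ * ((t : ℝ) - s) ^ τ := Real.mul_rpow (by norm_num) h0.le
          _ ≤ _ := by
              gcongr
              exact (Real.rpow_le_rpow_of_exponent_le one_le_two hτ1).trans_eq (Real.rpow_one 2)
      have e : ψ t - ψ s = (ψ t - ψ (prj (j * h))) + (ψ (prj (j * h)) - ψ (prj (i * h)))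
          - (ψ s - ψ (prj (i * h))) := by abel
      rw [e]
      have h7 := norm_sub_le ((ψ t - ψ (prj (j * h))) + (ψ (prj (j * h)) - ψ (prj (i * h))))
        (ψ s - ψ (prj (i * h)))
      have h8 := norm_add_le (ψ t - ψ (prj (j * h))) (ψ (prj (j * h)) - ψ (prj (i * h)))
      have h9 := mul_le_mul_of_nonneg_left h5 hH
      have h10 : 2 * B * ((t : ℝ) - j * h) ≤ 2 * B * h := by gcongr; linarith
      have h11 : 2 * B * ((s : ℝ) - i * h) ≤ 2 * B * h := by gcongr; linarith
      have h12 := mul_le_mul_of_nonneg_left (hmin h hh le_rfl hle) hB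
      linarith
  rcases le_total x y with h1 | h1
  · rw [← norm_neg, neg_sub, abs_sub_comm, abs_of_nonneg (sub_nonneg.2 (Subtype.coe_le_coe.2 h1))]
    exact key x y h1
  · rw [abs_of_nonneg (sub_nonneg.2 (Subtype.coe_le_coe.2 h1))]
    exact key y x h1

/-- The Euler bound for drivers with a regularizing semigroup, with a constant that depends only
on the constants of the semigroup. -/
theorem exists_eulerBound {d : ℕ} (hd : 0 < d) (M : HConstants) {β p ε : ℝ} (B : ℝ) (hβ : 0 < β)
    (hp : 2 < p) (hε : 0 < ε) :
    ∃ N : ℝ, 0 < N ∧ ∀ (Ω : Type*) [MeasurableSpace Ω] (P : Measure Ω) [IsProbabilityMeasure P]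
      (m : ℝ → Measure (EuclideanSpace ℝ (Fin d))) (L : ℝ≥0 → Ω → EuclideanSpace ℝ (Fin d)),
      IsHeatSemigroup m M → HasIncrementLaws P m L → EulerBound L P β p ε B N := by
  have hp0 : 0 < p := by linarith
  have hp1 : 1 ≤ p := by linarith
  have hpinv : 0 < 1 / p := by positivity
  have hpinv2 : 1 / p < 1 / 2 := one_div_lt_one_div_of_lt (by norm_num) hp
  -- the parameters: the rate `r`, the loss `e`, and the Hölder exponent `β₀` that is used
  set r := min (β / 2) (1 / p) with hr
  have hr0 : 0 < r := lt_min (by positivity) hpinv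
  have hrβ : r ≤ β / 2 := min_le_left _ _
  have hrp : r ≤ 1 / p := min_le_right _ _
  set e := min ε (min (r / 2) ((1 / 2 - 1 / p) / 2)) with he
  have he0 : 0 < e := lt_min hε (lt_min (by positivity) (by linarith))
  have heε : e ≤ ε := min_le_left _ _
  have her : e ≤ r / 2 := (min_le_right _ _).trans (min_le_left _ _)
  have hep : e ≤ (1 / 2 - 1 / p) / 2 := (min_le_right _ _).trans (min_le_right _ _)
  set β₀ := 2 * r - e with hβ₀
  have hβ₀0 : 0 < β₀ := by linarith
  have hβ₀β : β₀ ≤ β := by linarith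
  have hβ₀1 : β₀ < 1 := by linarith
  have hβ₀p : β₀ * p < 2 := by
    have h1 : β₀ < 2 * (1 / p) := by linarith
    have h2 := mul_lt_mul_of_pos_right h1 hp0
    rwa [mul_assoc, one_div_mul_cancel hp0.ne', mul_one] at h2
  set γ := (β₀ - e / 2) / 2 with hγ
  have hγ0 : 0 < γ := by linarith
  set B' := max B 0 with hB'
  have hB'0 : 0 ≤ B' := le_max_right _ _
  set A := 3 * B' with hA
  obtain ⟨C, hC0, hC⟩ := exists_isRegularized (E := EuclideanSpace ℝ (Fin d)) M (η := e / 2)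
    (β := β₀) (A := A) (by linarith) (by linarith) hβ₀1 (by positivity)
  set K := (M.mom (β₀ * p) (p * (e / 4)) : ℝ) ^ (1 / p) with hK
  have hK0 : 0 ≤ K := by positivity
  have hsew := sewConst_nonneg hp hC0 hγ0 hB'0
  set h₀ := (1 / (4 * d * sewConst p C γ B' + 4)) ^ (1 / γ) with hh₀
  have hh₀0 : 0 < h₀ := by positivity
  have hh₀γ : 2 * (d * sewConst p C γ B' * h₀ ^ γ) ≤ 1 / 2 := by
    rw [hh₀, ← Real.rpow_mul (by positivity), one_div_mul_cancel hγ0.ne', Real.rpow_one,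
      mul_one_div, ← mul_div_assoc, div_le_iff₀ (by positivity)]
    linarith
  set Cst := buckConst (1 + d * expandConst p A C γ β₀ K B') B' h₀ with hCst
  have hCst0 : 0 ≤ Cst := by
    have := expandConst_nonneg (γ := γ) (β := β₀) hp (by positivity : 0 ≤ A) hC0 hK0 hB'0
    exact buckConst_nonneg (by positivity) hB'0 hh₀0.le
  have hx0 : (0 : ℝ) < 2 ^ e - 1 := by
    have : (1 : ℝ) < 2 ^ e := Real.one_lt_rpow (by norm_num) he0
    linarith
  set G := 64 * Cst / (2 ^ e - 1) with hG
  have hG0 : 0 ≤ G := by positivity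
  refine ⟨1 + G + 8 * B', by positivity, ?_⟩
  intro Ω _ P _ m L hm hL F hF b hb n hn x₀ y₀ X Y hX hY
  have hn0 : (0 : ℝ) < n := by exact_mod_cast hn
  have hh : 0 < (n : ℝ)⁻¹ := inv_pos.2 hn0
  have hh1 : (n : ℝ)⁻¹ ≤ 1 := inv_le_one_of_one_le₀ (by exact_mod_cast hn)
  -- the drift
  have hbt := hb.trans_lt ENNReal.ofReal_lt_top
  have hbB' : (cNorm β b).toReal ≤ B' :=
    ENNReal.toReal_le_of_le_ofReal hB'0 (hb.trans (ENNReal.ofReal_le_ofReal (le_max_left _ _)))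
  have hbB : ∀ x, ‖b x‖ ≤ B' := fun x ↦ (norm_le_of_cNorm_lt_top hβ hbt x).trans hbB'
  have hbH : ∀ x y, ‖b x - b y‖ ≤ A * ‖x - y‖ ^ β₀ := fun x y ↦
    (holder_of_cNorm_lt_top hβ₀0 hβ₀1.le hβ₀β hbt x y).trans (by rw [hA]; gcongr)
  have hcoord : ∀ (v : EuclideanSpace ℝ (Fin d)) (i : Fin d), |v i| ≤ ‖v‖ := fun v i ↦
    PiLp.norm_apply_le v i
  have hbi : ∀ i x y, |b x i - b y i| ≤ A * ‖x - y‖ ^ β₀ := fun i x y ↦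
    (hcoord (b x - b y) i).trans (hbH x y)
  have hreg : ∀ i, IsRegularized m (fun x ↦ b x i) A C γ := fun i ↦
    hC m hm _ (fun x ↦ ((hcoord _ i).trans (hbB x)).trans (by linarith)) (hbi i)
  have hbm : Measurable b := by
    have : Measurable fun x i ↦ b x i := measurable_pi_lambda _ fun i ↦ (hreg i).cont.measurable
    exact (WithLp.measurable_toLp 2 _).comp this
  -- processes indexed by real times
  set Lr : ℝ → Ω → EuclideanSpace ℝ (Fin d) := fun t ↦ L (unitInterval.toNNReal (prj t)) with hLr
  set Xr : ℝ → Ω → EuclideanSpace ℝ (Fin d) := fun t ↦ X (prj t) with hXr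
  set Yg := gridScheme n b Lr y₀ with hYg
  have hdr := hL.isDriver hF
  have hgm : ∀ {j k : ℕ}, j ≤ k → (j : ℝ) * (n : ℝ)⁻¹ ≤ k * (n : ℝ)⁻¹ := fun h ↦ by gcongr
  have hE : IsEulerPair P (fun t ↦ F (prj t)) m Lr p A C γ β₀ K (β₀ / 2 - e / 4) B' n b Xr Yg :=
    { two_lt := hp
      pos := hn
      γ_pos := hγ0
      γ_lt := by linarith
      β_lt := hβ₀1
      κ_le := by linarith
      γ'_pos := by linarith
      driver := hdr
      path := isDrivenPath_of_isSolution hL hbm hB'0 hbB hX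
      eqn := by
        filter_upwards [hX.path_measurable, hX.eqn] with ω h1 h2 s t hs hst ht i
        have h3 := path_sub_eq (u := fun s ↦ b (X s ω)) (x := fun s ↦ X s ω)
          (l := fun s ↦ L (unitInterval.toNNReal s) ω) (hbm.comp h1) (fun _ ↦ hbB _) h2 hs hst ht
        simp only [hXr, hLr]
        rw [h3]
        have h4 := intervalIntegrable_prj (u := fun s ↦ b (X s ω)) (hbm.comp h1) (fun _ ↦ hbB _) s t
        exact ((EuclideanSpace.proj i).intervalIntegral_comp_comm h4).symm
      reg := hreg
      holder := hbi
      bdd := hbB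
      moment := HasMoment.of_isHeatSemigroup hm hp0 hβ₀0 hβ₀p (by linarith)
      Y_meas := fun k ↦ by
        induction k with
        | zero => exact measurable_const
        | succ k ih =>
          have hle := hdr.mono (hgm (Nat.le_succ k))
          have m1 := ih.mono hle le_rfl
          have m2 := (hdr.adapted (k * (n : ℝ)⁻¹)).mono hle le_rfl
          have m3 := hdr.adapted ((k + 1 : ℕ) * (n : ℝ)⁻¹)
          exact (m1.add ((hbm.comp m1).const_smul (n : ℝ)⁻¹)).add (m3.sub m2)
      step := ae_of_all _ fun ω k _ ↦ rfl }
  set s := ‖x₀ - y₀‖ with hs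
  have hs0 : 0 ≤ s := norm_nonneg _
  have hstart : HasLpBound P p (fun ω ↦ ‖gridError n Xr Yg 0 ω‖) s := by
    refine HasLpBound.of_ae_bound (hE.measurable_gridError 0).norm.aestronglyMeasurable hs0 ?_
    filter_upwards [hX.eqn, hL.zero] with ω h1 h2
    have h5 : prj ((0 : ℕ) * (n : ℝ)⁻¹) = 0 := by rw [Nat.cast_zero, zero_mul]; exact prj_coe 0
    have h3 := path_zero (x := fun s ↦ X s ω) h1 h2
    rw [abs_norm]
    simp only [gridError, hXr, h5, h3, hYg, gridScheme, hs, le_rfl]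
  set ρ := (n : ℝ)⁻¹ ^ (1 / 2 + (γ - β₀ / 2 + (β₀ / 2 - e / 4))) with hρ
  have hρ0 : 0 ≤ ρ := by positivity
  have hρeq : ρ = (n : ℝ)⁻¹ ^ (1 / 2 + (r - e)) := by rw [hρ]; congr 1; rw [hγ, hβ₀]; ring
  obtain ⟨H, hH0, hHp, hH⟩ := exists_holder_const (P := P) (R := Cst * (s + ρ)) hp he0
    (by linarith) (by linarith) hn (by positivity) (gridError n Xr Yg) fun i j hij hj ↦ by
      refine (hE.hasLpBound_gridError hd hh₀0 hh₀γ hstart hij hj).mono (le_of_eq ?_)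
      rw [← hCst, ← hρ]
      ring
  -- pathwise bound
  have hpath : ∀ᵐ ω ∂P, pathNorm (1 / 2 - 1 / p - ε) (fun t ↦ X t ω - Y t ω)
      ≤ ENNReal.ofReal (s + 2 * (2 * H ω + 4 * B' * ρ)) := by
    filter_upwards [hX.path_measurable, hX.eqn, hY, hL.zero] with ω h1 h2 h3 h0
    have hXl := fun s t (hst : s ≤ t) ↦ norm_path_sub_le (u := fun s ↦ b (X s ω))
      (x := fun s ↦ X s ω) (l := fun s ↦ L (unitInterval.toNNReal s) ω) (hbm.comp h1)
      (fun _ ↦ hbB _) h2 (s := (s : I)) (t := (t : I)) s.2.1 hst t.2.2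
    have hYm : Measurable fun s ↦ b (Y (kappa n s) ω) := measurable_comp_kappa n fun s ↦ b (Y s ω)
    have hYl := fun s t (hst : s ≤ t) ↦ norm_path_sub_le (u := fun s ↦ b (Y (kappa n s) ω))
      (x := fun s ↦ Y s ω) (l := fun s ↦ L (unitInterval.toNNReal s) ω) hYm
      (fun _ ↦ hbB _) h3 (s := (s : I)) (t := (t : I)) s.2.1 hst t.2.2
    simp only [prj_coe] at hXl hYl
    have hlip : ∀ s t : I, s ≤ t →
        ‖(X t ω - Y t ω) - (X s ω - Y s ω)‖ ≤ 2 * B' * ((t : ℝ) - s) := by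
      intro s t hst
      refine le_trans (le_of_eq ?_) ((norm_sub_le _ _).trans
        ((add_le_add (hXl s t hst) (hYl s t hst)).trans_eq (by ring)))
      congr 1; abel
    have hX0 := path_zero (x := fun s ↦ X s ω) h2 h0
    have hY0 := path_zero (x := fun s ↦ Y s ω) h3 h0
    have hYgrid : ∀ k ≤ n, Y (prj (k * (n : ℝ)⁻¹)) ω = Yg k ω := by
      intro k hk
      induction k with
      | zero =>
        rw [Nat.cast_zero, zero_mul]
        exact (congrArg (fun t ↦ Y t ω) (prj_coe 0)).trans hY0
      | succ k ih =>
        have hk1 : ((k + 1 : ℕ) : ℝ) * (n : ℝ)⁻¹ ≤ 1 := by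
          rw [mul_inv_le_iff₀ hn0, one_mul]; exact_mod_cast hk
        have h5 := path_sub_eq (u := fun s ↦ b (Y (kappa n s) ω)) (x := fun s ↦ Y s ω)
          (l := fun s ↦ L (unitInterval.toNNReal s) ω) hYm (fun _ ↦ hbB _) h3
          (s := k * (n : ℝ)⁻¹) (t := (k + 1 : ℕ) * (n : ℝ)⁻¹) (by positivity)
          (hgm (Nat.le_succ k)) hk1
        have h6 : ∫ r in (k * (n : ℝ)⁻¹)..((k + 1 : ℕ) * (n : ℝ)⁻¹),
            b (Y (kappa n (prj r)) ω) = (n : ℝ)⁻¹ • b (Y (prj (k * (n : ℝ)⁻¹)) ω) := by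
          rw [intervalIntegral.integral_congr_ae (g := fun _ ↦ b (Y (prj (k * (n : ℝ)⁻¹)) ω)) ?_,
            intervalIntegral.integral_const]
          · congr 1
            push_cast; ring
          · filter_upwards [Measure.ae_ne volume (((k + 1 : ℕ) : ℝ) * (n : ℝ)⁻¹)] with r hr hr2
            rw [Set.uIoc_of_le (hgm (Nat.le_succ k))] at hr2
            rw [kappa_prj_eq hn (by omega) hr2.1.le (lt_of_le_of_ne hr2.2 hr)]
        rw [h6, ih (by omega), sub_eq_iff_eq_add] at h5
        rw [h5]
        simp only [hYg, gridScheme, hLr]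
        abel
    refine pathNorm_le (τ₁ := 1 / 2 - 1 / p - e) (by linarith) (by linarith) hs0
      (add_nonneg (mul_nonneg zero_le_two (hH0 ω)) (by positivity)) ?_ ?_
    · simp only [hX0, hY0]; exact le_rfl
    · refine norm_sub_le_of_grid hn hB'0 (hH0 ω) (by linarith) (by linarith) ?_ hlip ?_
      · rw [hρeq]
        exact Real.rpow_le_rpow_of_exponent_ge hh hh1 (by linarith)
      · intro i j hij hj
        have := hH ω i j hij hj
        simpa only [gridError, hXr, ← hYgrid i (hij.trans hj), ← hYgrid j hj] using this
  have hU : HasLpBound P p (fun ω ↦ s + 2 * (2 * H ω + 4 * B' * ρ))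
      (s + 2 * (2 * (16 * (Cst * (s + ρ)) / (2 ^ e - 1)) + 4 * B' * ρ)) :=
    (HasLpBound.const hs0).add hp1 (((hHp.const_mul zero_le_two).add hp1
      (HasLpBound.const (by positivity))).const_mul zero_le_two)
  refine (eLpNorm_mono_enorm_ae (g := fun ω ↦ s + 2 * (2 * H ω + 4 * B' * ρ)) ?_).trans
    (hU.le.trans (ENNReal.ofReal_le_ofReal ?_))
  · filter_upwards [hpath] with ω hω
    have := hH0 ω
    rwa [Real.enorm_of_nonneg (by positivity)]
  have hρle : ρ ≤ (n : ℝ) ^ (-(1 / 2 + r) + ε) := by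
    rw [hρeq, Real.inv_rpow hn0.le, ← Real.rpow_neg hn0.le]
    exact Real.rpow_le_rpow_of_exponent_le (by exact_mod_cast hn) (by linarith)
  set ρ' := (n : ℝ) ^ (-(1 / 2 + r) + ε) with hρ'
  have hρ'0 : 0 ≤ ρ' := by positivity
  calc _ = s + G * s + (G + 8 * B') * ρ := by rw [hG]; field_simp; ring
    _ ≤ s + G * s + (G + 8 * B') * ρ' := by gcongr
    _ ≤ _ := by nlinarith [mul_nonneg hB'0 hs0]

/-! ### The assumptions on the driver in terms of its one-dimensional laws -/

section Laws

variable {E : Type*} [NormedAddCommGroup E] [NormedSpace ℝ E] [MeasurableSpace E] [BorelSpace E]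

/-- `g` is the uniform limit of `(∫ f(· + y) m_t(dy) - f) / t` as `t ↓ 0`. -/
def HasSmallTimeLimit (m : ℝ → Measure E) (f g : E → ℝ) : Prop :=
  ∀ η : ℝ, 0 < η → ∀ᶠ t in 𝓝[>] (0 : ℝ), ∀ x, |avg (m t) f x - f x - t * g x| ≤ η * t

/-- The three assumptions on a Lévy process, for the family `m` of its laws. -/
structure SatisfiesHLaws (m : ℝ → Measure E) (α : ℝ) (α' : ℝ≥0∞) (M : HConstants) : Prop where
  diff : ∀ (f : E → ℝ) (A : ℝ), Measurable f → (∀ x, |f x| ≤ A) → ∀ t, 0 < t → t ≤ 1 →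
    Differentiable ℝ (avg (m t) f) ∧ ∀ x, ‖fderiv ℝ (avg (m t) f) x‖ ≤ M.grad * t ^ (-(1 / α)) * A
  gen : ∀ δ : ℕ, δ ≤ 1 → ∀ ε : ℝ, 0 < ε → ∀ f : E → ℝ, cNorm (α + δ + ε) f < ∞ →
    ∃ g, HasSmallTimeLimit m f g ∧ cNorm (δ : ℝ) g ≤ M.gen δ ε * cNorm (α + δ + ε) f
  mom : ∀ p : ℝ, 0 < p → ENNReal.ofReal p < α' → ∀ ε : ℝ, 0 < ε → ∀ t, 0 < t → t ≤ 1 →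
    ∫ y, min (‖y‖ ^ p) 1 ∂(m t) ≤ M.mom p ε * t ^ (p / α - ε)

end Laws

section ProcessLaws

variable {d : ℕ} {Ω : Type*} {mΩ : MeasurableSpace Ω} {P : Measure Ω} [IsProbabilityMeasure P]
  {L : ℝ≥0 → Ω → EuclideanSpace ℝ (Fin d)}

/-- The laws of `L`, indexed by real times. -/
noncomputable def lawOf (L : ℝ≥0 → Ω → EuclideanSpace ℝ (Fin d)) (P : Measure Ω) (t : ℝ) :
    Measure (EuclideanSpace ℝ (Fin d)) :=
  P.map (L t.toNNReal)

lemma semigroup_eq_avg (hL : ∀ t, Measurable (L t)) (t : ℝ≥0) {f : EuclideanSpace ℝ (Fin d) → ℝ}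
    (hf : Measurable f) : semigroup L P t f = avg (lawOf L P t) f := by
  ext x
  have h := integral_map (hL t).aemeasurable (μ := P)
    (hf.comp (measurable_const_add x)).aestronglyMeasurable
  rw [lawOf, Real.toNNReal_coe]
  exact h.symm

lemma hasGenerator_iff (hL : ∀ t, Measurable (L t)) {f g : EuclideanSpace ℝ (Fin d) → ℝ}
    (hf : Measurable f) : HasGenerator L P f g ↔ HasSmallTimeLimit (lawOf L P) f g := by
  have key : ∀ t : ℝ≥0, 0 < t → ∀ η : ℝ, 0 < η →
      ((supENorm fun x ↦ (t : ℝ)⁻¹ * (semigroup L P t f x - f x) - g x) ≤ ENNReal.ofReal η ↔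
        ∀ x, |avg (lawOf L P t) f x - f x - t * g x| ≤ η * t) := by
    intro t ht η hη
    have ht' : (0 : ℝ) < t := ht
    rw [supENorm_le_ofReal_iff hη.le, semigroup_eq_avg hL t hf]
    refine forall_congr' fun x ↦ ?_
    have h1 : avg (lawOf L P t) f x - f x - t * g x
        = ((t : ℝ)⁻¹ * (avg (lawOf L P t) f x - f x) - g x) * t := by field_simp
    rw [h1, abs_mul, abs_of_pos ht', Real.norm_eq_abs, mul_le_mul_iff_left₀ ht']
  have hc : Tendsto Real.toNNReal (𝓝[>] 0) (𝓝[>] 0) := by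
    refine tendsto_nhdsWithin_iff.2 ⟨?_, ?_⟩
    · have := (continuous_real_toNNReal.tendsto 0).mono_left (nhdsWithin_le_nhds (s := Set.Ioi 0))
      simpa using this
    · filter_upwards [self_mem_nhdsWithin] with t ht using Real.toNNReal_pos.2 ht
  have hc' : Tendsto ((↑) : ℝ≥0 → ℝ) (𝓝[>] 0) (𝓝[>] 0) := by
    refine tendsto_nhdsWithin_iff.2 ⟨?_, ?_⟩
    · have := (NNReal.continuous_coe.tendsto 0).mono_left (nhdsWithin_le_nhds (s := Set.Ioi 0))
      simpa using this
    · filter_upwards [self_mem_nhdsWithin] with t ht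
      exact NNReal.coe_pos.2 ht
  unfold HasGenerator HasSmallTimeLimit
  rw [ENNReal.tendsto_nhds_zero]
  constructor
  · intro h η hη
    filter_upwards [hc.eventually (h (ENNReal.ofReal η) (ENNReal.ofReal_pos.2 hη)),
      self_mem_nhdsWithin] with t h1 ht
    have := (key t.toNNReal (Real.toNNReal_pos.2 ht) η hη).1 h1
    rwa [Real.coe_toNNReal t (le_of_lt ht)] at this
  · intro h η hη
    obtain ⟨η', hη', hle⟩ : ∃ η' : ℝ, 0 < η' ∧ ENNReal.ofReal η' ≤ η := by
      rcases eq_or_ne η ∞ with rfl | hne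
      · exact ⟨1, one_pos, le_top⟩
      · exact ⟨η.toReal, ENNReal.toReal_pos hη.ne' hne, ENNReal.ofReal_toReal_le⟩
    filter_upwards [hc'.eventually (h η' hη'), self_mem_nhdsWithin] with t h1 ht
    exact ((key t ht η' hη').2 h1).trans hle

/-- The assumptions on a process are assumptions on its laws. -/
theorem satisfiesHWith_iff (hL : ∀ t, Measurable (L t)) {α : ℝ} {α' : ℝ≥0∞}
    {M : HConstants} : SatisfiesHWith L P α α' M ↔ SatisfiesHLaws (lawOf L P) α α' M := by
  have hmom : ∀ (p : ℝ), 0 < p → ∀ t : ℝ≥0, ∫ ω, min (‖L t ω‖ ^ p) 1 ∂P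
      = ∫ y, min (‖y‖ ^ p) 1 ∂(lawOf L P t) := fun p hp t ↦ by
    have : Measurable fun y : EuclideanSpace ℝ (Fin d) ↦ min (‖y‖ ^ p) 1 :=
      (measurable_norm.pow_const p).min measurable_const
    rw [lawOf, Real.toNNReal_coe, integral_map (hL t).aemeasurable this.aestronglyMeasurable]
  constructor
  · refine fun h ↦ ⟨fun f A hf hA t ht ht1 ↦ ?_, fun δ hδ ε hε f hfin ↦ ?_,
      fun p hp hpα ε hε t ht ht1 ↦ ?_⟩
    · lift t to ℝ≥0 using ht.le
      have hA0 := (abs_nonneg _).trans (hA 0)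
      have h0 := cNorm_zero_le_ofReal hf hA
      obtain ⟨h1, h2⟩ := h.h1 f (h0.trans_lt ENNReal.ofReal_lt_top) t ht (by exact_mod_cast ht1)
      rw [semigroup_eq_avg hL t hf] at h1 h2
      refine ⟨h1, (supENorm_le_ofReal_iff (by positivity)).1 (h2.trans ?_)⟩
      rw [ENNReal.ofReal_mul (by positivity : (0 : ℝ) ≤ M.grad * (t : ℝ) ^ (-(1 / α)))]
      gcongr
    · obtain ⟨g, h1, h2⟩ := h.h2 δ hδ ε hε f hfin
      exact ⟨g, (hasGenerator_iff hL (measurable_of_cNorm_lt_top hfin)).1 h1, h2⟩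
    · lift t to ℝ≥0 using ht.le
      rw [← hmom p hp]
      exact h.h3 p hp hpα ε hε t ht (by exact_mod_cast ht1)
  · refine fun h ↦ ⟨fun f hfin t ht ht1 ↦ ?_, fun δ hδ ε hε f hfin ↦ ?_,
      fun p hp hpα ε hε t ht ht1 ↦ ?_⟩
    · have hf := measurable_of_cNorm_lt_top hfin
      rw [semigroup_eq_avg hL t hf]
      obtain ⟨h1, h2⟩ := h.diff f _ hf (abs_le_of_cNorm_lt_top le_rfl hfin) t ht
        (by exact_mod_cast ht1)
      refine ⟨h1, ?_⟩
      have h3 := (supENorm_le_ofReal_iff (by positivity)).2 h2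
      rwa [ENNReal.ofReal_mul (by positivity : (0 : ℝ) ≤ M.grad * (t : ℝ) ^ (-(1 / α))),
        ENNReal.ofReal_toReal hfin.ne] at h3
    · obtain ⟨g, h1, h2⟩ := h.gen δ hδ ε hε f hfin
      exact ⟨g, (hasGenerator_iff hL (measurable_of_cNorm_lt_top hfin)).2 h1, h2⟩
    · rw [hmom p hp]
      exact h.mom p hp hpα ε hε t ht (by exact_mod_cast ht1)

lemma IsLevyProcess.lawOf_add (hL : IsLevyProcess L P) {s t : ℝ} (hs : 0 ≤ s) (ht : 0 ≤ t) :
    lawOf L P (s + t) = lawOf L P s ∗ lawOf L P t := by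
  have h1 := hL.indep.indepFun_eval_sub (zero_le (a := s.toNNReal))
    (le_self_add (b := t.toNNReal)) hL.zero
  have h2 : L (s.toNNReal + t.toNNReal)
      = L s.toNNReal + (L (s.toNNReal + t.toNNReal) - L s.toNNReal) := by abel
  unfold lawOf
  rw [Real.toNNReal_add hs ht, h2, h1.map_add_eq_map_conv_map (hL.measurable _)
    ((hL.measurable _).sub (hL.measurable _))]
  exact congrArg _ (hL.stationary _ _).map_eq

lemma IsLevyProcess.hasIncrementLaws (hL : IsLevyProcess L P) :
    HasIncrementLaws P (lawOf L P) L where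
  zero := hL.zero
  law s t hs hst ht := by
    have h := (hL.stationary s.toNNReal (t - s).toNNReal).map_eq
    rw [← Real.toNNReal_add hs (sub_nonneg.2 hst), add_sub_cancel] at h
    exact h
  rightCont := by filter_upwards [hL.cadlag] with ω hω t _ using (hω t).1

end ProcessLaws

section Bridge

variable {E : Type*} [NormedAddCommGroup E] [InnerProductSpace ℝ E] [FiniteDimensional ℝ E]
  [MeasurableSpace E] [BorelSpace E] {m : ℝ → Measure E}

/-- Telescoping of `P_h - 1` over `n` steps of length `h / n`. -/
lemma abs_avg_sub_le_of_step (hprob : ∀ t, IsProbabilityMeasure (m t))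
    (hconv : ∀ s t, 0 ≤ s → 0 ≤ t → m (s + t) = m s ∗ m t) {f : E → ℝ} {A c s : ℝ}
    (hf : Measurable f) (hA : ∀ x, |f x| ≤ A) (hs : 0 ≤ s)
    (hstep : ∀ x, |avg (m s) f x - f x| ≤ c) (n : ℕ) (x : E) :
    |avg (m ((n + 1 : ℕ) * s)) f x - f x| ≤ (n + 1 : ℕ) * c := by
  induction n generalizing x with
  | zero => simpa using hstep x
  | succ n ih =>
    have h1 : ((n + 1 + 1 : ℕ) : ℝ) * s = s + (n + 1 : ℕ) * s := by push_cast; ring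
    have := hprob s
    have := hprob ((n + 1 : ℕ) * s)
    rw [h1, hconv s _ hs (by positivity), avg_conv hf hA]
    have h2 : |avg (m s) (avg (m ((n + 1 : ℕ) * s)) f) x - avg (m s) f x| ≤ (n + 1 : ℕ) * c := by
      rw [← avg_sub (measurable_avg hf) (abs_avg_le hA) hf hA]
      exact abs_avg_le ih x
    have h3 := abs_sub_le (avg (m s) (avg (m ((n + 1 : ℕ) * s)) f) x) (avg (m s) f x) (f x)
    have h4 := hstep x
    push_cast at *
    linarith

lemma HasSmallTimeLimit.abs_avg_sub_le (hprob : ∀ t, IsProbabilityMeasure (m t))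
    (hconv : ∀ s t, 0 ≤ s → 0 ≤ t → m (s + t) = m s ∗ m t) {f g : E → ℝ} {A G : ℝ}
    (hf : Measurable f) (hA : ∀ x, |f x| ≤ A) (h : HasSmallTimeLimit m f g)
    (hg : ∀ x, |g x| ≤ G) {t : ℝ} (ht : 0 < t) (x : E) : |avg (m t) f x - f x| ≤ t * G := by
  refine le_of_forall_pos_le_add fun η hη ↦ ?_
  have hlim : Tendsto (fun n : ℕ ↦ t / ((n : ℝ) + 1)) atTop (𝓝[>] 0) := by
    refine tendsto_nhdsWithin_iff.2 ⟨?_, Eventually.of_forall fun n ↦ ?_⟩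
    · have := tendsto_one_div_add_atTop_nhds_zero_nat (𝕜 := ℝ) |>.const_mul t
      simpa [div_eq_mul_inv] using this
    · exact Set.mem_Ioi.2 (by positivity)
  obtain ⟨n, hn⟩ := (hlim.eventually (h (η / t) (by positivity))).exists
  set s := t / ((n : ℝ) + 1) with hs
  have hs0 : 0 < s := by positivity
  have hns : ((n + 1 : ℕ) : ℝ) * s = t := by rw [hs]; push_cast; field_simp
  have hstep : ∀ x, |avg (m s) f x - f x| ≤ η / t * s + s * G := fun x ↦ by
    have h1 := abs_le.1 (hn x)
    have h2 := abs_le.1 ((abs_mul s (g x)).trans_le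
      (mul_le_mul (abs_of_pos hs0).le (hg x) (abs_nonneg _) hs0.le))
    exact abs_le.2 ⟨by linarith [h1.1, h2.1], by linarith [h1.2, h2.2]⟩
  have h1 := abs_avg_sub_le_of_step hprob hconv hf hA hs0.le hstep n x
  rw [hns] at h1
  refine h1.trans (le_of_eq ?_)
  have : ((n + 1 : ℕ) : ℝ) * (η / t * s + s * G) = (((n + 1 : ℕ) : ℝ) * s) * (η / t + G) := by ring
  rw [this, hns]
  field_simp
  ring

lemma abs_incr_le_of_fderiv {F : E → ℝ} {c : ℝ} (hF : Differentiable ℝ F)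
    (hc : ∀ x, ‖fderiv ℝ F x‖ ≤ c) (x h : E) : |incr h F x| ≤ c * ‖h‖ := by
  have := Convex.norm_image_sub_le_of_norm_fderiv_le (𝕜 := ℝ) (f := F) (s := Set.univ)
    (fun x _ ↦ hF x) (fun x _ ↦ hc x) convex_univ (Set.mem_univ x) (Set.mem_univ (x + h))
  simpa [incr] using this

theorem SatisfiesHLaws.isHeatSemigroup {M : HConstants} (h : SatisfiesHLaws m 2 2 M)
    (hprob : ∀ t, IsProbabilityMeasure (m t))
    (hconv : ∀ s t, 0 ≤ s → 0 ≤ t → m (s + t) = m s ∗ m t) (h0 : m 0 = Measure.dirac 0) :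
    IsHeatSemigroup m M where
  prob := hprob
  conv := hconv
  diff f A hf hA t ht ht1 := (h.diff f A hf hA t ht ht1).1
  lip f A hf hA t ht ht1 x k := by
    obtain ⟨h1, h2⟩ := h.diff f A hf hA t ht ht1
    exact abs_incr_le_of_fderiv h1 h2 x k
  gen ε hε f hfin t ht x := by
    have hf := measurable_of_cNorm_lt_top hfin
    have hA := abs_le_of_cNorm_lt_top (by linarith) hfin
    rcases ht.eq_or_lt with rfl | ht
    · simp [h0, avg]
    have he : (2 : ℝ) + ((0 : ℕ) : ℝ) + ε = 2 + ε := by simp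
    obtain ⟨g, hg, hgb⟩ := h.gen 0 zero_le_one ε hε f (by rwa [he])
    rw [he, Nat.cast_zero] at hgb
    have hlt : cNorm 0 g < ∞ := hgb.trans_lt (ENNReal.mul_lt_top ENNReal.coe_lt_top hfin)
    refine hg.abs_avg_sub_le hprob hconv hf hA (fun y ↦
      (abs_le_of_cNorm_lt_top le_rfl hlt y).trans ?_) ht x
    have := ENNReal.toReal_mono (ENNReal.mul_lt_top ENNReal.coe_lt_top hfin).ne hgb
    rwa [ENNReal.toReal_mul, ENNReal.coe_toReal] at this
  mom p hp hp2 ε hε t ht ht1 := by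
    refine h.mom p hp ?_ ε hε t ht ht1
    rw [← ENNReal.ofReal_ofNat 2]
    exact (ENNReal.ofReal_lt_ofReal_iff two_pos).2 hp2

end Bridge

/-- A Lévy process that satisfies the assumptions with `α = α' = 2` satisfies the Euler bound, with
a constant that depends only on the constants in the assumptions. -/
theorem exists_eulerBound_of_satisfiesHWith.{u} {d : ℕ} (hd : 0 < d) (M : HConstants) {β p ε : ℝ}
    (B : ℝ) (hβ : 0 < β) (hp : 2 < p) (hε : 0 < ε) :
    ∃ N : ℝ, 0 < N ∧ ∀ (Ω : Type u) [MeasurableSpace Ω] (P : Measure Ω) [IsProbabilityMeasure P]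
      (L : ℝ≥0 → Ω → EuclideanSpace ℝ (Fin d)), IsLevyProcess L P → SatisfiesHWith L P 2 2 M →
        EulerBound L P β p ε B N := by
  obtain ⟨N, hN, h⟩ := exists_eulerBound.{u} hd M B hβ hp hε
  refine ⟨N, hN, fun Ω _ P _ L hL hH ↦ h Ω P (lawOf L P) L ?_ hL.hasIncrementLaws⟩
  refine ((satisfiesHWith_iff hL.measurable).1 hH).isHeatSemigroup
    (fun t ↦ Measure.isProbabilityMeasure_map (hL.measurable _).aemeasurable)
    (fun s t hs ht ↦ hL.lawOf_add hs ht) ?_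
  rw [lawOf, Real.toNNReal_zero, Measure.map_congr hL.zero, Measure.map_const]
  simp

section HolderNorms

variable {E : Type*} [NormedAddCommGroup E] [NormedSpace ℝ E] [MeasurableSpace E] [BorelSpace E]
  {f : E → ℝ}

/-- The norms of `C^0` and `C^1` are subadditive up to a constant. -/
lemma cNorm_add_le {δ : ℕ} (hδ : δ ≤ 1) {g : E → ℝ} (hf : cNorm (δ : ℝ) f < ∞)
    (hg : cNorm (δ : ℝ) g < ∞) :
    cNorm (δ : ℝ) (fun x ↦ f x + g x) ≤ (4 : ℝ≥0) * (cNorm (δ : ℝ) f + cNorm (δ : ℝ) g) := by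
  have hfA := abs_le_of_cNorm_lt_top (Nat.cast_nonneg δ) hf
  have hgA := abs_le_of_cNorm_lt_top (Nat.cast_nonneg δ) hg
  have hs : ∀ x, |f x + g x| ≤ (cNorm (δ : ℝ) f).toReal + (cNorm (δ : ℝ) g).toReal := fun x ↦
    (abs_add_le _ _).trans (add_le_add (hfA x) (hgA x))
  have he : (4 : ℝ≥0) * (cNorm (δ : ℝ) f + cNorm (δ : ℝ) g)
      = ENNReal.ofReal (4 * ((cNorm (δ : ℝ) f).toReal + (cNorm (δ : ℝ) g).toReal)) := by
    rw [ENNReal.ofReal_mul (by norm_num), ENNReal.ofReal_add ENNReal.toReal_nonneg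
      ENNReal.toReal_nonneg, ENNReal.ofReal_toReal hf.ne, ENNReal.ofReal_toReal hg.ne]
    simp
  rw [he]
  have hf0 : 0 ≤ (cNorm (δ : ℝ) f).toReal := ENNReal.toReal_nonneg
  have hg0 : 0 ≤ (cNorm (δ : ℝ) g).toReal := ENNReal.toReal_nonneg
  rcases Nat.le_one_iff_eq_zero_or_eq_one.1 hδ with rfl | rfl
  · rw [Nat.cast_zero] at *
    refine (cNorm_zero_le_ofReal ((measurable_of_cNorm_lt_top hf).add
      (measurable_of_cNorm_lt_top hg)) hs).trans (ENNReal.ofReal_le_ofReal ?_)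
    linarith
  · rw [Nat.cast_one] at *
    have hlip := fun {h : E → ℝ} (hh : cNorm 1 h < ∞) ↦
      holder_of_cNorm_lt_top one_pos le_rfl le_rfl hh
    simp only [Real.rpow_one, Real.norm_eq_abs] at hlip
    refine (cNorm_one_le_of_bounds (c := 3 * ((cNorm 1 f).toReal + (cNorm 1 g).toReal))
      (by positivity) hs fun x y ↦ ?_).trans (ENNReal.ofReal_le_ofReal (by linarith))
    have h1 : f x + g x - (f y + g y) = (f x - f y) + (g x - g y) := by ring
    rw [h1]
    refine (abs_add_le _ _).trans ?_
    linarith [hlip hf x y, hlip hg x y]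

end HolderNorms

/-! ### Sums of independent drivers -/

section Conv

variable {E : Type*} [NormedAddCommGroup E] [NormedSpace ℝ E] [FiniteDimensional ℝ E]
  [MeasurableSpace E] [BorelSpace E] {m m₁ m₂ : ℝ → Measure E} {f g g₁ g₂ : E → ℝ} {A G : ℝ}

/-- Uniform limits of difference quotients of uniformly continuous functions are uniformly
continuous. -/
lemma HasSmallTimeLimit.uniform (hprob : ∀ t, IsProbabilityMeasure (m t)) (hf : Measurable f)
    (hA : ∀ x, |f x| ≤ A)
    (hu : ∀ η : ℝ, 0 < η → ∃ ρ : ℝ, 0 < ρ ∧ ∀ x y, ‖y‖ ≤ ρ → |f (x + y) - f x| ≤ η)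
    (h : HasSmallTimeLimit m f g) (η : ℝ) (hη : 0 < η) :
    ∃ ρ : ℝ, 0 < ρ ∧ ∀ x y, ‖y‖ ≤ ρ → |g (x + y) - g x| ≤ η := by
  obtain ⟨t, ht, ht0⟩ := ((h (η / 4) (by positivity)).and self_mem_nhdsWithin).exists
  have ht0 : 0 < t := ht0
  obtain ⟨ρ, hρ, hρ'⟩ := hu (η * t / 4) (by positivity)
  refine ⟨ρ, hρ, fun x y hy ↦ ?_⟩
  have := hprob t
  have h1 := abs_le.1 (ht x)
  have h2 := abs_le.1 (ht (x + y))
  have h3 := abs_le.1 (hρ' x y hy)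
  have h4 : |avg (m t) f (x + y) - avg (m t) f x| ≤ η * t / 4 :=
    abs_avg_sub_avg_le hf hA fun z ↦ by rw [add_right_comm]; exact hρ' _ _ hy
  rw [abs_le] at h4
  have h5 : t * |g (x + y) - g x| ≤ t * η := by
    rw [← abs_of_pos ht0, ← abs_mul, abs_of_pos ht0]
    exact abs_le.2 ⟨by linarith [h1.1, h1.2, h2.1, h2.2, h3.1, h3.2, h4.1, h4.2],
      by linarith [h1.1, h1.2, h2.1, h2.2, h3.1, h3.2, h4.1, h4.2]⟩
  exact le_of_mul_le_mul_left h5 ht0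

lemma integrable_min_norm_sq {μ : Measure E} [IsProbabilityMeasure μ] :
    Integrable (fun y : E ↦ min (‖y‖ ^ 2) 1) μ := by
  simpa using integrable_min_norm_rpow (m := μ) 2

/-- Measures that concentrate at the origin act almost as the identity on uniformly continuous
functions. -/
lemma eventually_abs_avg_sub_le (hprob : ∀ t, IsProbabilityMeasure (m t)) (hg : Measurable g)
    (hG : ∀ x, |g x| ≤ G)
    (hu : ∀ η : ℝ, 0 < η → ∃ ρ : ℝ, 0 < ρ ∧ ∀ x y, ‖y‖ ≤ ρ → |g (x + y) - g x| ≤ η) {p : ℝ}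
    (hp : 0 < p) (hm : Tendsto (fun t ↦ ∫ y, min (‖y‖ ^ p) 1 ∂(m t)) (𝓝[>] 0) (𝓝 0)) (η : ℝ)
    (hη : 0 < η) : ∀ᶠ t in 𝓝[>] (0 : ℝ), ∀ x, |avg (m t) g x - g x| ≤ η := by
  obtain ⟨ρ, hρ, hρ'⟩ := hu (η / 2) (by positivity)
  have hG0 := (abs_nonneg _).trans (hG 0)
  set c := min (ρ ^ p) 1 with hc
  have hc0 : 0 < c := lt_min (by positivity) one_pos
  have h1 : ∀ x y, |g (x + y) - g x| ≤ η / 2 + 2 * G / c * min (‖y‖ ^ p) 1 := by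
    intro x y
    have h0 : 0 ≤ min (‖y‖ ^ p) 1 := le_min (by positivity) zero_le_one
    rcases le_total ‖y‖ ρ with h | h
    · have : 0 ≤ 2 * G / c * min (‖y‖ ^ p) 1 := by positivity
      linarith [hρ' x y h]
    · have h2 : c ≤ min (‖y‖ ^ p) 1 := by rw [hc]; gcongr
      have h3 : 2 * G / c * c ≤ 2 * G / c * min (‖y‖ ^ p) 1 := by gcongr
      rw [div_mul_cancel₀ _ hc0.ne'] at h3
      have := abs_sub (g (x + y)) (g x)
      linarith [hG x, hG (x + y)]
  have h2 := (hm.const_mul (2 * G / c))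
  rw [mul_zero] at h2
  filter_upwards [h2.eventually_le_const (half_pos hη)] with t ht x
  have := hprob t
  rw [avg_sub_const hg hG, ← Real.norm_eq_abs]
  calc _ ≤ ∫ y, (η / 2 + 2 * G / c * min (‖y‖ ^ p) 1) ∂(m t) :=
        norm_integral_le_of_norm_le ((integrable_const _).add
          ((integrable_min_norm_rpow p).const_mul _)) (ae_of_all _ (h1 x))
    _ = η / 2 + 2 * G / c * ∫ y, min (‖y‖ ^ p) 1 ∂(m t) := by
        rw [integral_add (integrable_const _) ((integrable_min_norm_rpow p).const_mul _),
          integral_const_mul]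
        simp
    _ ≤ η := by linarith

lemma HasSmallTimeLimit.conv (hprob₁ : ∀ t, IsProbabilityMeasure (m₁ t))
    (hprob₂ : ∀ t, IsProbabilityMeasure (m₂ t)) (hf : Measurable f) (hA : ∀ x, |f x| ≤ A)
    (h₁ : HasSmallTimeLimit m₁ f g₁) (h₂ : HasSmallTimeLimit m₂ f g₂) (hg : Measurable g₂)
    (hG : ∀ x, |g₂ x| ≤ G)
    (hc : ∀ η : ℝ, 0 < η → ∀ᶠ t in 𝓝[>] (0 : ℝ), ∀ x, |avg (m₁ t) g₂ x - g₂ x| ≤ η) :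
    HasSmallTimeLimit (fun t ↦ m₁ t ∗ m₂ t) f fun x ↦ g₁ x + g₂ x := by
  intro η hη
  filter_upwards [h₁ (η / 3) (by positivity), h₂ (η / 3) (by positivity),
    hc (η / 3) (by positivity),
    self_mem_nhdsWithin] with t k1 k2 k3 ht x
  rw [Set.mem_Ioi] at ht
  have := hprob₁ t
  have := hprob₂ t
  rw [avg_conv hf hA]
  set F := avg (m₂ t) f with hF
  have hFm : Measurable F := measurable_avg hf
  have hFA : ∀ x, |F x| ≤ A := abs_avg_le hA
  have htG : ∀ x, |t * g₂ x| ≤ t * G := fun x ↦ by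
    rw [abs_mul, abs_of_pos ht]; exact mul_le_mul_of_nonneg_left (hG x) ht.le
  have e1 : avg (m₁ t) (fun y ↦ F y - f y - t * g₂ y) x
      = avg (m₁ t) F x - avg (m₁ t) f x - t * avg (m₁ t) g₂ x := by
    rw [avg_sub (f := fun y ↦ F y - f y) (hFm.sub hf) (B := t * G) (A := A + A)
        (fun y ↦ (abs_sub _ _).trans (add_le_add (hFA y) (hA y))) (hg.const_mul t) htG,
      avg_sub hFm hFA hf hA, avg_const_mul]
  have e2 := abs_le.1 (e1 ▸ abs_avg_le (m := m₁ t) k2 x)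
  have e3 := abs_le.1 (k1 x)
  have e4 : |t * (avg (m₁ t) g₂ x - g₂ x)| ≤ t * (η / 3) := by
    rw [abs_mul, abs_of_pos ht]; exact mul_le_mul_of_nonneg_left (k3 x) ht.le
  rw [abs_le] at e4 ⊢
  constructor <;> linarith [e2.1, e2.2, e3.1, e3.2, e4.1, e4.2]

lemma integral_conv_min_rpow_le {μ ν : Measure E} [IsProbabilityMeasure μ] [IsProbabilityMeasure ν]
    {p : ℝ} (hp : 0 < p) : ∫ z, min (‖z‖ ^ p) 1 ∂(μ ∗ ν) ≤
      2 ^ p * (∫ y, min (‖y‖ ^ p) 1 ∂μ + ∫ y, min (‖y‖ ^ p) 1 ∂ν) := by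
  set q : E → ℝ := fun y ↦ min (‖y‖ ^ p) 1 with hq
  have hq0 : ∀ y, 0 ≤ q y := fun y ↦ le_min (by positivity) zero_le_one
  have hqm : Measurable q := (measurable_norm.pow_const p).min measurable_const
  have h1 : ∀ x y, q (x + y) ≤ 2 ^ p * q x + 2 ^ p * q y := by
    have main : ∀ x y, ‖y‖ ≤ ‖x‖ → q (x + y) ≤ 2 ^ p * q x := by
      intro x y hxy
      have h2 : ‖x + y‖ ^ p ≤ 2 ^ p * ‖x‖ ^ p := by
        rw [← Real.mul_rpow zero_le_two (norm_nonneg _)]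
        gcongr
        linarith [norm_add_le x y]
      have h3 : (1 : ℝ) ≤ 2 ^ p := Real.one_le_rpow one_le_two hp.le
      rw [hq]
      simp only
      rw [mul_min_of_nonneg _ _ (by positivity), mul_one]
      exact min_le_min h2 h3
    intro x y
    have h2 : (0 : ℝ) ≤ 2 ^ p := by positivity
    rcases le_total ‖y‖ ‖x‖ with h | h
    · linarith [main x y h, mul_nonneg h2 (hq0 y)]
    · have := main y x h
      rw [add_comm] at this
      linarith [mul_nonneg h2 (hq0 x)]
  have hi (ρ : Measure E) [IsProbabilityMeasure ρ] : Integrable q ρ := integrable_min_norm_rpow p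
  have e1 : ∫ z, q z ∂(μ ∗ ν) = ∫ x, (∫ y, q (x + y) ∂ν) ∂μ := integral_conv (hi _)
  rw [e1]
  have hin : ∀ x, ∫ y, q (x + y) ∂ν ≤ 2 ^ p * q x + 2 ^ p * ∫ y, q y ∂ν := fun x ↦ by
    calc ∫ y, q (x + y) ∂ν ≤ ∫ y, (2 ^ p * q x + 2 ^ p * q y) ∂ν :=
          integral_mono_of_nonneg (ae_of_all _ fun _ ↦ hq0 _)
            ((integrable_const _).add ((hi ν).const_mul _)) (ae_of_all _ (h1 x))
      _ = _ := by
          rw [integral_add (integrable_const _) ((hi ν).const_mul _)]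
          simp [integral_const_mul]
  calc ∫ x, (∫ y, q (x + y) ∂ν) ∂μ ≤ ∫ x, (2 ^ p * q x + 2 ^ p * ∫ y, q y ∂ν) ∂μ :=
        integral_mono_of_nonneg (ae_of_all _ fun _ ↦ integral_nonneg fun _ ↦ hq0 _)
          (((hi μ).const_mul _).add (integrable_const _)) (ae_of_all _ hin)
    _ = _ := by
        rw [integral_add ((hi μ).const_mul _) (integrable_const _), integral_const_mul]; simp; ring

lemma SatisfiesHLaws.tendsto_moment {α : ℝ} {α' : ℝ≥0∞} {M : HConstants} (hα : 0 < α)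
    (h : SatisfiesHLaws m α α' M) {p : ℝ} (hp : 0 < p) (hpα : ENNReal.ofReal p < α') :
    Tendsto (fun t ↦ ∫ y, min (‖y‖ ^ p) 1 ∂(m t)) (𝓝[>] 0) (𝓝 0) := by
  have he : p / α - p / α / 2 = p / α / 2 := by ring
  have h1 : Tendsto (fun t : ℝ ↦ M.mom p (p / α / 2) * t ^ (p / α / 2)) (𝓝[>] 0) (𝓝 0) := by
    have := ((Real.continuous_rpow_const (q := p / α / 2) (by positivity)).tendsto 0).const_mul
      (M.mom p (p / α / 2) : ℝ)
    rw [Real.zero_rpow (by positivity), mul_zero] at this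
    exact this.mono_left nhdsWithin_le_nhds
  refine squeeze_zero' (Eventually.of_forall fun t ↦ integral_nonneg fun _ ↦
    le_min (by positivity) zero_le_one) ?_ h1
  filter_upwards [Ioc_mem_nhdsGT (zero_lt_one (α := ℝ))] with t ht
  have := h.mom p hp hpα (p / α / 2) (by positivity) t ht.1 ht.2
  rwa [he] at this

lemma min_rpow_le_min_rpow {p q x : ℝ} (hp : 0 < p) (hpq : p ≤ q) (hx : 0 ≤ x) :
    min (x ^ q) 1 ≤ min (x ^ p) 1 := by
  rcases le_total x 1 with h | h
  · refine min_le_min_right _ ?_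
    rcases hx.eq_or_lt with h0 | h0
    · rw [← h0, Real.zero_rpow (hp.trans_le hpq).ne', Real.zero_rpow hp.ne']
    · exact Real.rpow_le_rpow_of_exponent_ge h0 h hpq
  · rw [min_eq_right (Real.one_le_rpow h (hp.le.trans hpq)),
      min_eq_right (Real.one_le_rpow h hp.le)]

/-- The assumptions are stable under convolution, with the larger of the two orders. -/
theorem SatisfiesHLaws.conv {α₁ α₂ : ℝ} {α₁' α₂' : ℝ≥0∞} {M₁ M₂ : HConstants} (hα₁ : 0 < α₁)
    (hα : α₁ ≤ α₂) (hα₁' : 0 < α₁') (hprob₁ : ∀ t, IsProbabilityMeasure (m₁ t))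
    (hprob₂ : ∀ t, IsProbabilityMeasure (m₂ t)) (h₁ : SatisfiesHLaws m₁ α₁ α₁' M₁)
    (h₂ : SatisfiesHLaws m₂ α₂ α₂' M₂) :
    ∃ M, SatisfiesHLaws (fun t ↦ m₁ t ∗ m₂ t) α₂ (min (α₁' * ENNReal.ofReal (α₂ / α₁)) α₂') M := by
  have hα₂ : 0 < α₂ := hα₁.trans_le hα
  refine ⟨⟨M₂.grad, fun δ ε ↦ 4 * (M₁.gen δ ε * (holderOrder (α₁ + δ + ε) + 3 : ℕ) + M₂.gen δ ε),
    fun p ε ↦ 2 ^ p * (M₁.mom (p * α₁ / α₂) ε + M₂.mom p ε)⟩, ?_, ?_, ?_⟩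
  · intro f A hf hA t ht ht1
    have := hprob₁ t
    have := hprob₂ t
    have e : avg (m₁ t ∗ m₂ t) f = avg (m₂ t) (avg (m₁ t) f) := by
      ext x; rw [Measure.conv_comm, avg_conv hf hA]
    simp only [e]
    exact h₂.diff _ A (measurable_avg hf) (abs_avg_le hA) t ht ht1
  · intro δ hδ ε hε f hfin
    have hf := measurable_of_cNorm_lt_top hfin
    have hpos : 0 < α₂ + δ + ε := by positivity
    have hA := abs_le_of_cNorm_lt_top hpos.le hfin
    have hmono := cNorm_mono (f := f) (by positivity : 0 < α₁ + δ + ε)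
      (by linarith : α₁ + δ + ε ≤ α₂ + δ + ε) hfin
    have hfin₁ : cNorm (α₁ + δ + ε) f < ∞ :=
      hmono.trans_lt (ENNReal.mul_lt_top ENNReal.coe_lt_top hfin)
    obtain ⟨g₁, hg₁, hb₁⟩ := h₁.gen δ hδ ε hε f hfin₁
    obtain ⟨g₂, hg₂, hb₂⟩ := h₂.gen δ hδ ε hε f hfin
    have hlt₁ : cNorm (δ : ℝ) g₁ < ∞ := hb₁.trans_lt (ENNReal.mul_lt_top ENNReal.coe_lt_top hfin₁)
    have hlt₂ : cNorm (δ : ℝ) g₂ < ∞ := hb₂.trans_lt (ENNReal.mul_lt_top ENNReal.coe_lt_top hfin)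
    have hgm := measurable_of_cNorm_lt_top hlt₂
    have hgG := abs_le_of_cNorm_lt_top (Nat.cast_nonneg δ) hlt₂
    -- `f`, hence `g₂`, is uniformly continuous
    have hfu : ∀ η : ℝ, 0 < η → ∃ ρ : ℝ, 0 < ρ ∧ ∀ x y, ‖y‖ ≤ ρ → |f (x + y) - f x| ≤ η := by
      intro η hη
      set b := min (α₂ + δ + ε) 1
      have hb : 0 < b := lt_min hpos one_pos
      have hH := holder_of_cNorm_lt_top hb (min_le_right _ _) (min_le_left _ _) hfin
      set N := (cNorm (α₂ + δ + ε) f).toReal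
      have hN : 0 ≤ N := ENNReal.toReal_nonneg
      refine ⟨(η / (3 * N + 1)) ^ (1 / b), by positivity, fun x y hy ↦ (hH (x + y) x).trans ?_⟩
      rw [add_sub_cancel_left]
      calc 3 * N * ‖y‖ ^ b ≤ 3 * N * (η / (3 * N + 1)) := by
            gcongr
            refine (Real.rpow_le_rpow (norm_nonneg _) hy hb.le).trans_eq ?_
            rw [← Real.rpow_mul (by positivity), one_div_mul_cancel hb.ne', Real.rpow_one]
        _ ≤ η := by rw [mul_div_assoc', div_le_iff₀ (by positivity)]; nlinarith
    obtain ⟨p, hp, hpα⟩ : ∃ p : ℝ, 0 < p ∧ ENNReal.ofReal p < α₁' := by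
      obtain ⟨q, hq, hqα⟩ := ENNReal.lt_iff_exists_nnreal_btwn.1 hα₁'
      exact ⟨q, by exact_mod_cast hq, by rwa [ENNReal.ofReal_coe_nnreal]⟩
    refine ⟨fun x ↦ g₁ x + g₂ x, hg₁.conv hprob₁ hprob₂ hf hA hg₂ hgm hgG
      (eventually_abs_avg_sub_le hprob₁ hgm hgG (hg₂.uniform hprob₂ hf hA hfu) hp
        (h₁.tendsto_moment hα₁ hp hpα)), (cNorm_add_le hδ hlt₁ hlt₂).trans ?_⟩
    push_cast
    rw [mul_assoc, add_mul, mul_assoc]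
    gcongr
    refine hb₁.trans ?_
    gcongr
    push_cast at hmono
    exact hmono
  · intro p hp hpα ε hε t ht ht1
    have := hprob₁ t
    have := hprob₂ t
    have hα₁0 := hα₁.ne'
    have hα₂0 := hα₂.ne'
    have k1 : ENNReal.ofReal (p * α₁ / α₂) < α₁' := by
      have h3 := hpα.trans_le (min_le_left _ _)
      have h4 : p = p * α₁ / α₂ * (α₂ / α₁) := by field_simp
      rw [h4, ENNReal.ofReal_mul (by positivity)] at h3
      exact lt_of_mul_lt_mul_right' h3
    have k2 := h₁.mom _ (by positivity) k1 ε hε t ht ht1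
    have k3 := h₂.mom p hp (hpα.trans_le (min_le_right _ _)) ε hε t ht ht1
    have k4 : p * α₁ / α₂ / α₁ - ε = p / α₂ - ε := by field_simp
    rw [k4] at k2
    have k5 : ∫ y, min (‖y‖ ^ p) 1 ∂(m₁ t) ≤ ∫ y, min (‖y‖ ^ (p * α₁ / α₂)) 1 ∂(m₁ t) :=
      integral_mono (integrable_min_norm_rpow _) (integrable_min_norm_rpow _) fun y ↦
        min_rpow_le_min_rpow (by positivity) (by rw [div_le_iff₀ hα₂]; gcongr) (norm_nonneg y)
    refine (integral_conv_min_rpow_le hp).trans ?_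
    push_cast
    rw [mul_assoc, add_mul]
    have : (0 : ℝ) ≤ 2 ^ p := by positivity
    gcongr
    exact k5.trans k2

end Conv

section SumProcess

variable {d : ℕ} {Ω : Type*} {mΩ : MeasurableSpace Ω} {P : Measure Ω} [IsProbabilityMeasure P]
  {L₁ L₂ : ℝ≥0 → Ω → EuclideanSpace ℝ (Fin d)}

/-- If two families of random variables are independent of each other, and each of them is
independent, then so is the family of the sums. -/
lemma iIndepFun_add {ι E : Type*} [Fintype ι] [NormedAddCommGroup E] [InnerProductSpace ℝ E]
    [FiniteDimensional ℝ E] [MeasurableSpace E] [BorelSpace E] {U V : ι → Ω → E}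
    (hU : ∀ i, Measurable (U i)) (hV : ∀ i, Measurable (V i)) (hiU : iIndepFun U P)
    (hiV : iIndepFun V P) (h : IndepFun (fun ω i ↦ U i ω) (fun ω i ↦ V i ω) P) :
    iIndepFun (fun i ω ↦ U i ω + V i ω) P := by
  classical
  refine (iIndepFun_iff_charFun_pi (X := fun i ω ↦ U i ω + V i ω)
    fun i ↦ ((hU i).add (hV i)).aemeasurable).2 fun t ↦ ?_
  have e1 := IndepFun.charFun_map_fun_add_eq_mul
    (X := fun ω ↦ WithLp.toLp 2 (fun i ↦ U i ω)) (Y := fun ω ↦ WithLp.toLp 2 (fun i ↦ V i ω))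
    (P := P)
    (by fun_prop) (by fun_prop) (h.comp (WithLp.measurable_toLp 2 _) (WithLp.measurable_toLp 2 _))
  have e2 : (fun ω ↦ WithLp.toLp 2 (fun i ↦ U i ω + V i ω))
      = fun ω ↦ WithLp.toLp 2 (fun i ↦ U i ω) + WithLp.toLp 2 (fun i ↦ V i ω) := rfl
  rw [e2, e1, Pi.mul_apply, (iIndepFun_iff_charFun_pi fun i ↦ (hU i).aemeasurable).1 hiU,
    (iIndepFun_iff_charFun_pi fun i ↦ (hV i).aemeasurable).1 hiV, ← Finset.prod_mul_distrib]
  refine Finset.prod_congr rfl fun i _ ↦ ?_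
  rw [IndepFun.charFun_map_fun_add_eq_mul (hU i).aemeasurable (hV i).aemeasurable
    (h.comp (measurable_pi_apply i) (measurable_pi_apply i)), Pi.mul_apply]

lemma IsLevyProcess.add (h₁ : IsLevyProcess L₁ P) (h₂ : IsLevyProcess L₂ P)
    (h : IndepFun (fun ω t ↦ L₁ t ω) (fun ω t ↦ L₂ t ω) P) :
    IsLevyProcess (fun t ω ↦ L₁ t ω + L₂ t ω) P where
  measurable t := (h₁.measurable t).add (h₂.measurable t)
  zero := by filter_upwards [h₁.zero, h₂.zero] with ω k1 k2; simp [k1, k2]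
  indep := by
    intro n t ht
    have hm : Measurable fun (x : ℝ≥0 → EuclideanSpace ℝ (Fin d)) (i : Fin n) ↦
        x (t i.succ) - x (t i.castSucc) :=
      measurable_pi_lambda _ fun i ↦ (measurable_pi_apply _).sub (measurable_pi_apply _)
    have := iIndepFun_add (U := fun (i : Fin n) ω ↦ L₁ (t i.succ) ω - L₁ (t i.castSucc) ω)
      (V := fun (i : Fin n) ω ↦ L₂ (t i.succ) ω - L₂ (t i.castSucc) ω)
      (fun i ↦ (h₁.measurable _).sub (h₁.measurable _))
      (fun i ↦ (h₂.measurable _).sub (h₂.measurable _))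
      (h₁.indep n t ht) (h₂.indep n t ht) (h.comp hm hm)
    have e : (fun (i : Fin n) ω ↦ L₁ (t i.succ) ω + L₂ (t i.succ) ω
        - (L₁ (t i.castSucc) ω + L₂ (t i.castSucc) ω))
        = fun (i : Fin n) ω ↦ (L₁ (t i.succ) ω - L₁ (t i.castSucc) ω)
          + (L₂ (t i.succ) ω - L₂ (t i.castSucc) ω) := by
      ext1 i; ext1 ω; abel
    rw [e]
    exact this
  stationary s t := by
    refine ⟨(((h₁.measurable _).add (h₂.measurable _)).sub
      ((h₁.measurable _).add (h₂.measurable _))).aemeasurable,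
      ((h₁.measurable _).add (h₂.measurable _)).aemeasurable, ?_⟩
    have k1 := (h.comp (φ := fun (x : ℝ≥0 → EuclideanSpace ℝ (Fin d)) ↦ x (s + t) - x s)
        (ψ := fun (x : ℝ≥0 → EuclideanSpace ℝ (Fin d)) ↦ x (s + t) - x s)
        (by fun_prop) (by fun_prop)).map_add_eq_map_conv_map
        ((h₁.measurable _).sub (h₁.measurable _)) ((h₂.measurable _).sub (h₂.measurable _))
    have k2 := (h.comp (φ := fun (x : ℝ≥0 → EuclideanSpace ℝ (Fin d)) ↦ x t)
        (ψ := fun (x : ℝ≥0 → EuclideanSpace ℝ (Fin d)) ↦ x t)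
        (by fun_prop) (by fun_prop)).map_add_eq_map_conv_map (h₁.measurable _) (h₂.measurable _)
    have k3 : (fun ω ↦ L₁ (s + t) ω + L₂ (s + t) ω - (L₁ s ω + L₂ s ω))
        = (fun ω ↦ L₁ (s + t) ω - L₁ s ω) + fun ω ↦ L₂ (s + t) ω - L₂ s ω := by
      ext1 ω; simp only [Pi.add_apply]; abel
    rw [k3]
    refine k1.trans (Eq.trans ?_ k2.symm)
    exact congrArg₂ (· ∗ ·) (h₁.stationary s t).map_eq (h₂.stationary s t).map_eq
  cadlag := by
    filter_upwards [h₁.cadlag, h₂.cadlag] with ω k1 k2 t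
    obtain ⟨l₁, hl₁⟩ := (k1 t).2
    obtain ⟨l₂, hl₂⟩ := (k2 t).2
    exact ⟨(k1 t).1.add (k2 t).1, l₁ + l₂, hl₁.add hl₂⟩

lemma lawOf_add_eq_conv (hL₁ : ∀ t, Measurable (L₁ t)) (hL₂ : ∀ t, Measurable (L₂ t))
    (h : IndepFun (fun ω t ↦ L₁ t ω) (fun ω t ↦ L₂ t ω) P) (t : ℝ) :
    lawOf (fun t ω ↦ L₁ t ω + L₂ t ω) P t = lawOf L₁ P t ∗ lawOf L₂ P t :=
  (h.comp (φ := fun (x : ℝ≥0 → EuclideanSpace ℝ (Fin d)) ↦ x t.toNNReal)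
    (ψ := fun (x : ℝ≥0 → EuclideanSpace ℝ (Fin d)) ↦ x t.toNNReal)
    (by fun_prop) (by fun_prop)).map_add_eq_map_conv_map (hL₁ _) (hL₂ _)

theorem SatisfiesH.add {α₁ α₂ : ℝ} {α₁' α₂' : ℝ≥0∞} (hα₁ : 0 < α₁) (hα : α₁ ≤ α₂)
    (hα₁' : 0 < α₁') (hL₁ : IsLevyProcess L₁ P) (hL₂ : IsLevyProcess L₂ P)
    (h : IndepFun (fun ω t ↦ L₁ t ω) (fun ω t ↦ L₂ t ω) P) (h₁ : SatisfiesH L₁ P α₁ α₁')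
    (h₂ : SatisfiesH L₂ P α₂ α₂') :
    SatisfiesH (fun t ω ↦ L₁ t ω + L₂ t ω) P α₂ (min (α₁' * ENNReal.ofReal (α₂ / α₁)) α₂') := by
  obtain ⟨M₁, h₁⟩ := h₁
  obtain ⟨M₂, h₂⟩ := h₂
  rw [satisfiesHWith_iff hL₁.measurable] at h₁
  rw [satisfiesHWith_iff hL₂.measurable] at h₂
  obtain ⟨M, hM⟩ := h₁.conv hα₁ hα hα₁'
    (fun t ↦ Measure.isProbabilityMeasure_map (hL₁.measurable _).aemeasurable)
    (fun t ↦ Measure.isProbabilityMeasure_map (hL₂.measurable _).aemeasurable) h₂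
  refine ⟨M, (satisfiesHWith_iff (hL₁.add hL₂ h).measurable).2 ?_⟩
  rwa [funext (lawOf_add_eq_conv hL₁.measurable hL₂.measurable h)]

end SumProcess

/-! ### Gaussian smoothing and truncated second moments -/

section Gauss

variable {E : Type*} [NormedAddCommGroup E] [InnerProductSpace ℝ E] [FiniteDimensional ℝ E]
  [MeasurableSpace E] [BorelSpace E]

open Module (finrank)

variable (E) in
/-- The integral of `exp (-b |v|²)` over `E`. -/
noncomputable def gaussNorm (b : ℝ) : ℝ := (Real.pi / b) ^ ((finrank ℝ E : ℝ) / 2)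

variable (E) in
/-- The centred Gaussian measure on `E` whose density is proportional to `exp (-b |v|²)`, i.e. with
covariance `(2b)⁻¹` times the identity. -/
noncomputable def gaussMeasure (b : ℝ) : Measure E := (volume : Measure E).withDensity fun v ↦
    ENNReal.ofReal ((gaussNorm E b)⁻¹ * Real.exp (-b * ‖v‖ ^ 2))

variable {b : ℝ}

lemma gaussNorm_pos (hb : 0 < b) : 0 < gaussNorm E b := by
  have := Real.pi_pos
  unfold gaussNorm; positivity

lemma gaussNorm_half (hb : 0 < b) :
    gaussNorm E (b / 2) = 2 ^ ((finrank ℝ E : ℝ) / 2) * gaussNorm E b := by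
  have := Real.pi_pos
  rw [gaussNorm, gaussNorm, ← Real.mul_rpow zero_le_two (by positivity)]
  congr 1; field_simp

lemma integral_exp_neg_mul_sq (hb : 0 < b) : ∫ v : E, Real.exp (-b * ‖v‖ ^ 2) = gaussNorm E b :=
  GaussianFourier.integral_rexp_neg_mul_sq_norm hb

lemma integrable_exp_neg_mul_sq (hb : 0 < b) : Integrable fun v : E ↦ Real.exp (-b * ‖v‖ ^ 2) := by
  by_contra h
  have := integral_exp_neg_mul_sq (E := E) hb
  rw [integral_undef h] at this
  exact (gaussNorm_pos hb).ne this

lemma integral_gaussMeasure {F : Type*} [NormedAddCommGroup F] [NormedSpace ℝ F] (hb : 0 < b)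
    (g : E → F) : ∫ v, g v ∂(gaussMeasure E b)
      = ∫ v, ((gaussNorm E b)⁻¹ * Real.exp (-b * ‖v‖ ^ 2)) • g v := by
  have hZ := gaussNorm_pos (E := E) hb
  rw [gaussMeasure, integral_withDensity_eq_integral_toReal_smul (by fun_prop)
    (ae_of_all _ fun _ ↦ ENNReal.ofReal_lt_top)]
  refine integral_congr_ae (ae_of_all _ fun v ↦ ?_)
  simp only
  rw [ENNReal.toReal_ofReal (by positivity)]

lemma isProbabilityMeasure_gaussMeasure (hb : 0 < b) : IsProbabilityMeasure (gaussMeasure E b) := by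
  have hZ := gaussNorm_pos (E := E) hb
  constructor
  rw [gaussMeasure, withDensity_apply _ MeasurableSet.univ, Measure.restrict_univ,
    ← ofReal_integral_eq_lintegral_ofReal ((integrable_exp_neg_mul_sq hb).const_mul _)
      (ae_of_all _ fun _ ↦ by positivity), integral_const_mul, integral_exp_neg_mul_sq hb,
    inv_mul_cancel₀ hZ.ne', ENNReal.ofReal_one]

lemma charFun_gaussMeasure (hb : 0 < b) (u : E) :
    charFun (gaussMeasure E b) u = Complex.exp (-(‖u‖ ^ 2 / (4 * b) : ℝ)) := by
  have hZ := gaussNorm_pos (E := E) hb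
  have hbc : 0 < (b : ℂ).re := hb
  have h := GaussianFourier.integral_cexp_neg_mul_sq_norm_add hbc Complex.I u
  have h2 : ((Real.pi : ℂ) / b) ^ (finrank ℝ E / 2 : ℂ) = (gaussNorm E b : ℂ) := by
    rw [gaussNorm, Complex.ofReal_cpow (by positivity)]; push_cast; rfl
  rw [h2] at h
  rw [charFun_apply, integral_gaussMeasure hb]
  have e : ∀ v : E, ((gaussNorm E b)⁻¹ * Real.exp (-b * ‖v‖ ^ 2)) •
      Complex.exp ((inner ℝ v u : ℝ) * Complex.I) = ((gaussNorm E b)⁻¹ : ℂ) *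
        Complex.exp (-b * ‖v‖ ^ 2 + Complex.I * (inner ℝ u v : ℝ)) := fun v ↦ by
    rw [Complex.exp_add, Complex.real_smul, real_inner_comm, mul_comm Complex.I]
    push_cast; ring
  simp only [e]
  rw [integral_const_mul, h, ← mul_assoc, inv_mul_cancel₀ (by exact_mod_cast hZ.ne'), one_mul,
    Complex.I_sq]
  congr 1; push_cast; ring

lemma mul_exp_neg_sq_le (hb : 0 < b) (r : ℝ) :
    2 * b * r * Real.exp (-b * r ^ 2) ≤ 2 * √b * Real.exp (-(b / 2) * r ^ 2) := by
  have h0 := Real.sqrt_nonneg b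
  have h1 : √b * r ≤ Real.exp (b / 2 * r ^ 2) := by
    have h2 := Real.add_one_le_exp (b / 2 * r ^ 2)
    have h3 : b * r ^ 2 = (√b * r) ^ 2 := by rw [mul_pow, Real.sq_sqrt hb.le]
    nlinarith [sq_nonneg (√b * r - 1)]
  have h4 : Real.exp (-(b / 2) * r ^ 2) = Real.exp (-b * r ^ 2) * Real.exp (b / 2 * r ^ 2) := by
    rw [← Real.exp_add]; congr 1; ring
  have h5 : b = √b * √b := (Real.mul_self_sqrt hb.le).symm
  calc 2 * b * r * Real.exp (-b * r ^ 2)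
      = 2 * √b * Real.exp (-b * r ^ 2) * (√b * r) := by nth_rw 1 [h5]; ring
    _ ≤ 2 * √b * Real.exp (-b * r ^ 2) * Real.exp (b / 2 * r ^ 2) := by gcongr
    _ = _ := by rw [h4]; ring

/-- Convolution with a Gaussian measure maps bounded functions to differentiable functions. -/
theorem differentiable_avg_gaussMeasure (hb : 0 < b) {f : E → ℝ} {A : ℝ} (hf : Measurable f)
    (hA : ∀ x, |f x| ≤ A) : Differentiable ℝ (avg (gaussMeasure E b) f) ∧
      ∀ x, ‖fderiv ℝ (avg (gaussMeasure E b) f) x‖ ≤ 2 ^ ((finrank ℝ E : ℝ) / 2 + 1) * √b * A := by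
  have hZ := gaussNorm_pos (E := E) hb
  have hA0 := (abs_nonneg _).trans (hA 0)
  set Z := gaussNorm E b with hZdef
  set k : E → ℝ := fun w ↦ Real.exp (-b * ‖w‖ ^ 2) with hk
  set k' : E → E →L[ℝ] ℝ := fun w ↦ (-b * k w) • (2 • innerSL ℝ w) with hk'
  have hder : ∀ w, HasFDerivAt k (k' w) w := fun w ↦ by
    have h1 := ((hasStrictFDerivAt_norm_sq w).hasFDerivAt.const_mul (-b)).exp
    refine h1.congr_fderiv ?_
    ext v; simp [hk', hk]; ring
  have hk'n : ∀ w, ‖k' w‖ ≤ 2 * √b * Real.exp (-(b / 2) * ‖w‖ ^ 2) := fun w ↦ by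
    refine le_trans (le_of_eq ?_) (mul_exp_neg_sq_le hb ‖w‖)
    have h2 : ‖(2 : ℕ) • innerSL ℝ w‖ = 2 * ‖w‖ := by
      rw [← Nat.cast_smul_eq_nsmul ℝ, norm_smul, innerSL_apply_norm]; simp
    rw [hk', norm_smul, h2, norm_mul, Real.norm_eq_abs, abs_neg, abs_of_pos hb,
      Real.norm_of_nonneg (Real.exp_pos _).le]
    ring
  have havg : ∀ x, avg (gaussMeasure E b) f x = Z⁻¹ * ∫ z, k (z - x) * f z := fun x ↦ by
    rw [avg, integral_gaussMeasure hb, ← integral_const_mul,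
      ← integral_sub_right_eq_self (fun v : E ↦ ((gaussNorm E b)⁻¹ * Real.exp (-b * ‖v‖ ^ 2)) •
        f (x + v)) x]
    refine integral_congr_ae (ae_of_all _ fun z ↦ ?_)
    simp only [add_sub_cancel, smul_eq_mul, hk]; ring
  have hint : ∀ {c : ℝ}, 0 < c → ∀ x : E, Integrable fun z ↦ Real.exp (-c * ‖z - x‖ ^ 2) :=
    fun hc x ↦ (integrable_exp_neg_mul_sq hc).comp_sub_right x
  have hF : ∀ x₀, HasFDerivAt (fun x ↦ ∫ z, k (z - x) * f z) (∫ z, -f z • k' (z - x₀)) x₀ := by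
    intro x₀
    have hkc : Continuous k := by fun_prop
    have hk'c : Continuous k' := by fun_prop
    have hmeas : ∀ x, AEStronglyMeasurable (fun z ↦ k (z - x) * f z) volume := fun x ↦
      ((hkc.comp (continuous_id.sub continuous_const)).measurable.mul hf).aestronglyMeasurable
    refine hasFDerivAt_integral_of_dominated_of_fderiv_le (F' := fun x z ↦ -f z • k' (z - x))
      (bound := fun z ↦ A * (2 * √b * Real.exp (b / 2) * Real.exp (-(b / 4) * ‖z - x₀‖ ^ 2)))
      (Metric.ball_mem_nhds x₀ one_pos) (Eventually.of_forall hmeas) ?_ ?_ ?_ ?_ ?_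
    · refine ((hint hb x₀).const_mul A).mono' (hmeas x₀) (ae_of_all _ fun z ↦ ?_)
      rw [norm_mul, Real.norm_of_nonneg (Real.exp_pos _).le, mul_comm]
      exact mul_le_mul_of_nonneg_right (hA z) (Real.exp_pos _).le
    · exact (hf.neg.aestronglyMeasurable).smul
        (hk'c.comp (continuous_id.sub continuous_const)).aestronglyMeasurable
    · refine ae_of_all _ fun z x hx ↦ ?_
      rw [norm_smul, norm_neg]
      refine mul_le_mul (hA z) ((hk'n _).trans ?_) (norm_nonneg _) hA0
      rw [mul_assoc (2 * √b), ← Real.exp_add]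
      gcongr
      have h1 : ‖z - x₀‖ ≤ ‖z - x‖ + 1 := by
        have h3 := norm_sub_le_norm_sub_add_norm_sub z x x₀
        rw [Metric.mem_ball, dist_eq_norm] at hx
        linarith
      have h2 : ‖z - x₀‖ ^ 2 ≤ 2 * ‖z - x‖ ^ 2 + 2 := by
        nlinarith [norm_nonneg (z - x₀), sq_nonneg (‖z - x‖ - 1), norm_nonneg (z - x)]
      nlinarith
    · exact ((hint (by positivity : 0 < b / 4) x₀).const_mul _).const_mul _
    · refine ae_of_all _ fun z x _ ↦ ?_
      have h1 : HasFDerivAt (fun x ↦ k (z - x)) (-k' (z - x)) x := by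
        have h3 : HasFDerivAt (fun x ↦ z - x) (-ContinuousLinearMap.id ℝ E) x :=
          (hasFDerivAt_id x).const_sub z
        refine ((hder (z - x)).comp x h3).congr_fderiv ?_
        ext v; simp
      refine (h1.mul_const (f z)).congr_fderiv ?_
      ext v; simp
  have hD : ∀ x, HasFDerivAt (avg (gaussMeasure E b) f) (Z⁻¹ • ∫ z, -f z • k' (z - x)) x := by
    intro x
    rw [funext havg]
    exact (hF x).const_mul _
  refine ⟨fun x ↦ (hD x).differentiableAt, fun x ↦ ?_⟩
  rw [(hD x).fderiv, norm_smul, Real.norm_of_nonneg (by positivity)]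
  have h1 : ‖∫ z, -f z • k' (z - x)‖ ≤ A * (2 * √b * gaussNorm E (b / 2)) := by
    have h2 : A * (2 * √b * gaussNorm E (b / 2))
        = ∫ z, A * (2 * √b * Real.exp (-(b / 2) * ‖z - x‖ ^ 2)) := by
      rw [integral_const_mul, integral_const_mul,
        integral_sub_right_eq_self (fun v : E ↦ Real.exp (-(b / 2) * ‖v‖ ^ 2)) x,
        integral_exp_neg_mul_sq (by positivity)]
    rw [h2]
    refine norm_integral_le_of_norm_le (((hint (by positivity) x).const_mul _).const_mul _)
      (ae_of_all _ fun z ↦ ?_)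
    rw [norm_smul, norm_neg]
    exact mul_le_mul (hA z) (hk'n _) (norm_nonneg _) hA0
  calc Z⁻¹ * ‖∫ z, -f z • k' (z - x)‖ ≤ Z⁻¹ * (A * (2 * √b * gaussNorm E (b / 2))) := by gcongr
    _ = _ := by
      rw [gaussNorm_half hb, ← hZdef, Real.rpow_add two_pos, Real.rpow_one]
      field_simp

lemma integrable_one_add_sq_gaussMeasure :
    Integrable (fun u : E ↦ 1 + ‖u‖ ^ 2) (gaussMeasure E (1 / 2)) := by
  have hb : (0 : ℝ) < 1 / 2 := by norm_num
  have hZ := gaussNorm_pos (E := E) hb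
  rw [gaussMeasure, integrable_withDensity_iff_integrable_smul' (by fun_prop)
    (ae_of_all _ fun _ ↦ ENNReal.ofReal_lt_top)]
  refine ((integrable_exp_neg_mul_sq (E := E) (by norm_num : (0 : ℝ) < 1 / 4)).const_mul
    ((gaussNorm E (1 / 2))⁻¹ * 4)).mono' (by fun_prop) (ae_of_all _ fun u ↦ ?_)
  rw [ENNReal.toReal_ofReal (by positivity), smul_eq_mul, Real.norm_of_nonneg (by positivity)]
  have h1 := Real.add_one_le_exp (1 / 4 * ‖u‖ ^ 2)
  have h2 : Real.exp (-(1 / 4) * ‖u‖ ^ 2)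
      = Real.exp (-(1 / 2) * ‖u‖ ^ 2) * Real.exp (1 / 4 * ‖u‖ ^ 2) := by
    rw [← Real.exp_add]; congr 1; ring
  rw [h2, mul_assoc, mul_assoc]
  have h3 := Real.exp_pos (-(1 / 2) * ‖u‖ ^ 2)
  refine mul_le_mul_of_nonneg_left ?_ (by positivity)
  nlinarith [sq_nonneg ‖u‖]

variable (E) in
/-- The constant in the bound on truncated second moments by characteristic functions. -/
noncomputable def truncConst : ℝ := 3 * ∫ u : E, (1 + ‖u‖ ^ 2) ∂(gaussMeasure E (1 / 2))

lemma truncConst_nonneg : 0 ≤ truncConst E :=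
  mul_nonneg (by norm_num) (integral_nonneg fun _ ↦ by positivity)

/-- The truncated second moment is controlled by the characteristic function: integrate
`1 - charFun μ` against a Gaussian measure and exchange the integrals. -/
theorem integral_min_sq_le {μ : Measure E} [IsProbabilityMeasure μ] {c : ℝ}
    (h : ∀ u, ‖1 - charFun μ u‖ ≤ c * (1 + ‖u‖ ^ 2)) :
    ∫ y, min (‖y‖ ^ 2) 1 ∂μ ≤ truncConst E * c := by
  have hb : (0 : ℝ) < 1 / 2 := by norm_num
  have := isProbabilityMeasure_gaussMeasure (E := E) hb
  set G := gaussMeasure E (1 / 2) with hG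
  have hGc : ∀ x, charFun G x = (Real.exp (-(‖x‖ ^ 2 / 2)) : ℂ) := fun x ↦ by
    rw [hG, charFun_gaussMeasure hb]; push_cast; congr 1; ring
  have hswap : ∫ x, charFun G x ∂μ = ∫ u, charFun μ u ∂G := by
    simp only [charFun_apply]
    rw [integral_integral_swap]
    · simp only [real_inner_comm]
    · refine Integrable.of_bound (C := 1) ?_ (ae_of_all _ fun p ↦ ?_)
      · exact (by fun_prop : Continuous fun p : E × E ↦
          Complex.exp ((inner ℝ p.2 p.1 : ℝ) * Complex.I)).aestronglyMeasurable
      · rw [Function.uncurry, Complex.norm_exp_ofReal_mul_I]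
  have hcf : ∀ (ρ ρ' : Measure E) [IsProbabilityMeasure ρ] [IsProbabilityMeasure ρ'],
      Integrable (charFun ρ) ρ' := fun ρ ρ' _ _ ↦
    Integrable.of_bound (C := 1) continuous_charFun.aestronglyMeasurable
      (ae_of_all _ fun _ ↦ norm_charFun_le_one _)
  set J := ∫ x, (1 - Real.exp (-(‖x‖ ^ 2 / 2))) ∂μ with hJ
  have hint : Integrable (fun x : E ↦ 1 - Real.exp (-(‖x‖ ^ 2 / 2))) μ := by
    refine Integrable.of_bound (C := 1) (by fun_prop) (ae_of_all _ fun x ↦ ?_)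
    rw [Real.norm_of_nonneg (sub_nonneg.2 (Real.exp_le_one_iff.2 (neg_nonpos.2 (by positivity))))]
    linarith [Real.exp_pos (-(‖x‖ ^ 2 / 2))]
  have h1 : (J : ℂ) = ∫ u, (1 - charFun μ u) ∂G := by
    rw [integral_sub (integrable_const _) (hcf μ G), ← hswap, ← integral_complex_ofReal]
    push_cast [← hGc]
    rw [integral_sub (integrable_const _) (hcf G μ)]
    simp
  have h2 : J ≤ c * ∫ u : E, (1 + ‖u‖ ^ 2) ∂G := by
    calc J ≤ ‖(J : ℂ)‖ := by rw [Complex.norm_real]; exact Real.le_norm_self J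
      _ ≤ ∫ u : E, c * (1 + ‖u‖ ^ 2) ∂G := by
          rw [h1]
          exact norm_integral_le_of_norm_le (integrable_one_add_sq_gaussMeasure.const_mul c)
            (ae_of_all _ h)
      _ = _ := integral_const_mul _ _
  have h3 : ∀ y : E, min (‖y‖ ^ 2) 1 ≤ 3 * (1 - Real.exp (-(‖y‖ ^ 2 / 2))) := fun y ↦ by
    obtain ⟨v, hv⟩ : ∃ v, v = ‖y‖ ^ 2 / 2 := ⟨_, rfl⟩
    have hv0 : 0 ≤ v := by rw [hv]; positivity
    have h4 : ‖y‖ ^ 2 = 2 * v := by rw [hv]; ring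
    have h5 := Real.add_one_le_exp v
    have h6 : Real.exp (-v) ≤ (v + 1)⁻¹ := by rw [Real.exp_neg]; exact inv_anti₀ (by positivity) h5
    have h7 : (v + 1)⁻¹ = 1 - v / (v + 1) := by field_simp; ring
    rw [← hv, h4]
    refine le_trans ?_ (mul_le_mul_of_nonneg_left (by linarith : v / (v + 1) ≤ _) (by norm_num))
    rw [mul_div_assoc', le_div_iff₀ (by positivity)]
    rcases le_total (2 * v) 1 with h8 | h8
    · rw [min_eq_left h8]; nlinarith
    · rw [min_eq_right h8]; linarith
  calc ∫ y, min (‖y‖ ^ 2) 1 ∂μ ≤ ∫ y, 3 * (1 - Real.exp (-(‖y‖ ^ 2 / 2))) ∂μ :=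
        integral_mono_of_nonneg (ae_of_all _ fun _ ↦ by positivity) (hint.const_mul 3)
          (ae_of_all _ h3)
    _ = 3 * J := integral_const_mul _ _
    _ ≤ _ := by rw [truncConst]; linarith

/-- Truncated moments of order `p ≤ 2` by Jensen's inequality. -/
lemma integral_min_rpow_le {μ : Measure E} [IsProbabilityMeasure μ] {p c : ℝ} (hp : 0 < p)
    (hp2 : p ≤ 2) (h : ∫ y, min (‖y‖ ^ 2) 1 ∂μ ≤ c) :
    ∫ y, min (‖y‖ ^ p) 1 ∂μ ≤ c ^ (p / 2) := by
  have h0 : ∀ y : E, 0 ≤ min (‖y‖ ^ 2) 1 := fun y ↦ by positivity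
  have e : ∀ y : E, min (‖y‖ ^ p) 1 = min (‖y‖ ^ 2) 1 ^ (p / 2) := fun y ↦ by
    rw [← Real.rpow_two, min_rpow_rpow (norm_nonneg _) (by positivity),
      mul_div_cancel₀ _ two_ne_zero]
  have hJ := (Real.concaveOn_rpow (p := p / 2) (by positivity) (by linarith)).le_map_integral
    (μ := μ) (f := fun y : E ↦ min (‖y‖ ^ 2) 1)
    ((Real.continuous_rpow_const (by positivity)).continuousOn) isClosed_Ici
    (ae_of_all _ h0) integrable_min_norm_sq
    (by simpa only [e] using! integrable_min_norm_rpow (m := μ) p)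
  simp only [e]
  exact hJ.trans (Real.rpow_le_rpow (integral_nonneg h0) h (by positivity))

end Gauss

/-! ### Brownian motion plus a stable process -/

section SecondOrder

variable {E : Type*} [NormedAddCommGroup E] [NormedSpace ℝ E] [MeasurableSpace E] [BorelSpace E]
  {f : E → ℝ} {A : ℝ}

/-- `f` is twice continuously differentiable, and `f` and its derivatives of order at most two are
bounded by `A`. -/
structure HasC2Bound (f : E → ℝ) (A : ℝ) : Prop where
  contDiff : ContDiff ℝ 2 f
  zero : ∀ x, |f x| ≤ A
  one : ∀ x, ‖fderiv ℝ f x‖ ≤ A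
  two : ∀ x, ‖fderiv ℝ (fderiv ℝ f) x‖ ≤ A

lemma hasC2Bound_of_cNorm {β : ℝ} (hβ : 2 < β) (h : cNorm β f < ∞) :
    HasC2Bound f (cNorm β f).toReal := by
  obtain ⟨h1, h2, -⟩ := bounds_of_cNorm_lt_top (by linarith) h
  have hk : 2 ≤ holderOrder β := by
    have : 2 < ⌈β⌉₊ := Nat.lt_ceil.2 (by exact_mod_cast hβ)
    rw [holderOrder]; omega
  have hcd : ContDiff ℝ ((2 : ℕ) : ℕ∞) f := h1.of_le (by exact_mod_cast hk)
  refine ⟨by exact_mod_cast hcd, fun x ↦ ?_, fun x ↦ ?_, fun x ↦ ?_⟩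
  · simpa using h2 0 (by omega) x
  · simpa using h2 1 (by omega) x
  · rw [← norm_iteratedFDeriv_one, norm_iteratedFDeriv_fderiv]
    exact h2 2 hk x

namespace HasC2Bound

lemma nonneg (h : HasC2Bound f A) : 0 ≤ A := (abs_nonneg _).trans (h.zero 0)

lemma measurable (h : HasC2Bound f A) : Measurable f := h.contDiff.continuous.measurable

lemma differentiable (h : HasC2Bound f A) : Differentiable ℝ f :=
  h.contDiff.differentiable (by norm_num)

lemma contDiff_fderiv (h : HasC2Bound f A) : ContDiff ℝ 1 (fderiv ℝ f) :=
  h.contDiff.fderiv_right (by norm_num)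

lemma abs_sub_sub_le (h : HasC2Bound f A) (x y : E) :
    |f (x + y) - f x - fderiv ℝ f x y| ≤ A * ‖y‖ ^ 2 := by
  have hd : ∀ z, HasFDerivAt (fun z ↦ f z - fderiv ℝ f x z) (fderiv ℝ f z - fderiv ℝ f x) z :=
    fun z ↦ (h.differentiable z).hasFDerivAt.sub (fderiv ℝ f x).hasFDerivAt
  have hb : ∀ z ∈ Metric.closedBall x ‖y‖, ‖fderiv ℝ f z - fderiv ℝ f x‖ ≤ A * ‖y‖ := by
    intro z hz
    have := Convex.norm_image_sub_le_of_norm_fderiv_le (𝕜 := ℝ) (f := fderiv ℝ f) (s := Set.univ)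
      (fun w _ ↦ h.contDiff_fderiv.differentiable (by norm_num) w) (fun w _ ↦ h.two w) convex_univ
      (Set.mem_univ x) (Set.mem_univ z)
    refine this.trans (mul_le_mul_of_nonneg_left ?_ h.nonneg)
    rwa [← dist_eq_norm]
  have := Convex.norm_image_sub_le_of_norm_hasFDerivWithin_le (s := Metric.closedBall x ‖y‖)
    (fun z _ ↦ (hd z).hasFDerivWithinAt) hb (convex_closedBall x ‖y‖)
    (Metric.mem_closedBall_self (norm_nonneg y)) (y := x + y) (by simp)
  have e : f (x + y) - fderiv ℝ f x (x + y) - (f x - fderiv ℝ f x x)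
      = f (x + y) - f x - fderiv ℝ f x y := by rw [map_add]; ring
  rw [e, add_sub_cancel_left, Real.norm_eq_abs] at this
  exact this.trans_eq (by ring)

lemma abs_second_difference_le (h : HasC2Bound f A) (x y : E) :
    |f (x + y) + f (x - y) - 2 * f x| ≤ 4 * A * min (‖y‖ ^ 2) 1 := by
  have h0 := h.nonneg
  rcases le_total (‖y‖ ^ 2) 1 with h1 | h1
  · rw [min_eq_left h1]
    have h2 := abs_le.1 (h.abs_sub_sub_le x y)
    have h3 := abs_le.1 (h.abs_sub_sub_le x (-y))
    rw [map_neg, norm_neg, ← sub_eq_add_neg] at h3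
    have : 0 ≤ A * ‖y‖ ^ 2 := by positivity
    exact abs_le.2 ⟨by linarith [h2.1, h3.1], by linarith [h2.2, h3.2]⟩
  · rw [min_eq_right h1]
    have h2 := abs_le.1 (h.zero (x + y))
    have h3 := abs_le.1 (h.zero (x - y))
    have h4 := abs_le.1 (h.zero x)
    exact abs_le.2 ⟨by linarith [h2.1, h3.1, h4.2], by linarith [h2.2, h3.2, h4.1]⟩

end HasC2Bound

end SecondOrder

section Stable

variable {E : Type*} [NormedAddCommGroup E] [InnerProductSpace ℝ E] [FiniteDimensional ℝ E]
  [MeasurableSpace E] [BorelSpace E]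

open Module (finrank)

/-- For a symmetric measure, averaging changes a function by at most its second differences. -/
lemma abs_avg_sub_le_of_symmetric {μ : Measure E} [IsProbabilityMeasure μ]
    (hμ : μ.map (fun y ↦ -y) = μ) {f : E → ℝ} {A : ℝ} (hf : HasC2Bound f A) (x : E) :
    |avg μ f x - f x| ≤ 2 * A * ∫ y, min (‖y‖ ^ 2) 1 ∂μ := by
  have h1 : Integrable (fun y ↦ f (x + y)) μ := integrable_translate hf.measurable hf.zero x
  have h2 : Integrable (fun y ↦ f (x - y)) μ :=
    Integrable.of_bound (hf.measurable.comp (measurable_const_sub x)).aestronglyMeasurable A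
      (ae_of_all _ fun _ ↦ hf.zero _)
  have h3 : ∫ y, f (x - y) ∂μ = avg μ f x := by
    nth_rw 2 [← hμ]
    have := integral_map (μ := μ) (measurable_neg (G := E)).aemeasurable (f := fun y ↦ f (x + y))
      (hf.measurable.comp (measurable_const_add x)).aestronglyMeasurable
    simp only [← sub_eq_add_neg] at this
    exact this.symm
  have h4 : ∫ y, (f (x + y) + f (x - y) - 2 * f x) ∂μ = 2 * (avg μ f x - f x) := by
    rw [integral_sub (f := fun y ↦ f (x + y) + f (x - y)) (h1.add h2) (integrable_const _),
      integral_add h1 h2, h3]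
    simp [avg]; ring
  have h5 : |∫ y, (f (x + y) + f (x - y) - 2 * f x) ∂μ| ≤ ∫ y, 4 * A * min (‖y‖ ^ 2) 1 ∂μ := by
    rw [← Real.norm_eq_abs]
    exact norm_integral_le_of_norm_le (integrable_min_norm_sq.const_mul _) (ae_of_all _ fun y ↦
      hf.abs_second_difference_le x y)
  rw [h4, abs_mul, abs_two, integral_const_mul] at h5
  linarith

variable (E) in
/-- The constants in the assumptions for the sum of a Brownian motion and a stable process. -/
noncomputable def stableConst (c : ℝ) : HConstants where
  grad := Real.toNNReal (2 ^ ((finrank ℝ E : ℝ) / 2 + 1))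
  gen _ _ := Real.toNNReal (2 * (truncConst E * (1 / 2 + c)))
  mom p _ := Real.toNNReal ((truncConst E * (1 / 2 + c)) ^ (p / 2))

theorem isHeatSemigroup_of_charFun {α c : ℝ} (hα : 0 < α) (hα2 : α < 2) (hc : 0 < c)
    {m μ : ℝ → Measure E} (hm : ∀ t, IsProbabilityMeasure (m t))
    (hμ : ∀ t, IsProbabilityMeasure (μ t))
    (hcf : ∀ t, 0 ≤ t → ∀ u, charFun (m t) u = Complex.exp (-(t * (‖u‖ ^ 2 / 2 + c * ‖u‖ ^ α) : ℝ)))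
    (hdec : ∀ t, 0 < t → m t = gaussMeasure E (1 / (2 * t)) ∗ μ t) :
    IsHeatSemigroup m (stableConst E c) := by
  have hK0 : 0 ≤ truncConst E * (1 / 2 + c) := mul_nonneg truncConst_nonneg (by positivity)
  have hmom : ∀ t, 0 ≤ t → ∫ y, min (‖y‖ ^ 2) 1 ∂(m t) ≤ truncConst E * (1 / 2 + c) * t := by
    intro t ht
    rw [mul_assoc]
    refine integral_min_sq_le fun u ↦ ?_
    rw [hcf t ht, ← Complex.ofReal_neg, ← Complex.ofReal_exp, ← Complex.ofReal_one,
      ← Complex.ofReal_sub,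
      Complex.norm_real, Real.norm_eq_abs]
    set q := t * (‖u‖ ^ 2 / 2 + c * ‖u‖ ^ α) with hq
    have hq0 : 0 ≤ q := by positivity
    have h1 := Real.add_one_le_exp (-q)
    have h2 : Real.exp (-q) ≤ 1 := Real.exp_le_one_iff.2 (by linarith)
    rw [abs_of_nonneg (by linarith)]
    have h3 : ‖u‖ ^ α ≤ 1 + ‖u‖ ^ 2 := by
      rcases le_total ‖u‖ 1 with h | h
      · have := Real.rpow_le_one (norm_nonneg u) h hα.le
        nlinarith [sq_nonneg ‖u‖]
      · have := Real.rpow_le_rpow_of_exponent_le h hα2.le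
        rw [Real.rpow_two] at this; linarith
    have h4 : ‖u‖ ^ 2 / 2 + c * ‖u‖ ^ α ≤ (1 / 2 + c) * (1 + ‖u‖ ^ 2) := by
      nlinarith [sq_nonneg ‖u‖]
    calc 1 - Real.exp (-q) ≤ q := by linarith
      _ ≤ t * ((1 / 2 + c) * (1 + ‖u‖ ^ 2)) := by rw [hq]; gcongr
      _ = _ := by ring
  have hsmooth : ∀ (f : E → ℝ) (A : ℝ), Measurable f → (∀ x, |f x| ≤ A) → ∀ t, 0 < t →
      Differentiable ℝ (avg (m t) f) ∧ ∀ x, ‖fderiv ℝ (avg (m t) f) x‖ ≤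
        2 ^ ((finrank ℝ E : ℝ) / 2 + 1) * √(1 / (2 * t)) * A := by
    intro f A hf hA t ht
    have hb : 0 < 1 / (2 * t) := by positivity
    have := isProbabilityMeasure_gaussMeasure (E := E) hb
    have e : avg (m t) f = avg (gaussMeasure E (1 / (2 * t))) (avg (μ t) f) := by
      ext x; rw [hdec t ht, avg_conv hf hA]
    rw [e]
    exact differentiable_avg_gaussMeasure hb (measurable_avg hf) (abs_avg_le hA)
  refine ⟨hm, ?_, fun f A hf hA t ht _ ↦ (hsmooth f A hf hA t ht).1, ?_, ?_, ?_⟩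
  · intro s t hs ht
    refine Measure.ext_of_charFun ?_
    ext u
    rw [charFun_conv, hcf _ (add_nonneg hs ht), hcf s hs, hcf t ht, ← Complex.exp_add]
    congr 1; push_cast; ring
  · intro f A hf hA t ht ht1 x h
    have hA0 := (abs_nonneg _).trans (hA 0)
    obtain ⟨h1, h2⟩ := hsmooth f A hf hA t ht
    refine abs_incr_le_of_fderiv h1 (fun x ↦ (h2 x).trans ?_) x h
    rw [stableConst, Real.coe_toNNReal _ (by positivity)]
    gcongr
    have h3 : t ^ (-(1 / 2) : ℝ) = √(1 / t) := by
      rw [Real.sqrt_eq_rpow, one_div t, Real.inv_rpow ht.le, Real.rpow_neg ht.le]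
    rw [h3]
    refine Real.sqrt_le_sqrt ?_
    gcongr
    linarith
  · intro ε hε f hfin t ht x
    have hC2 := hasC2Bound_of_cNorm (by linarith : 2 < 2 + ε) hfin
    have hsym : (m t).map (fun y ↦ -y) = m t := by
      have : IsProbabilityMeasure ((m t).map fun y ↦ -y) :=
        Measure.isProbabilityMeasure_map measurable_neg.aemeasurable
      refine Measure.ext_of_charFun ?_
      ext u
      have h1 := charFun_map_smul (μ := m t) (-1 : ℝ) u
      have h2 : (fun y : E ↦ -y) = fun y ↦ (-1 : ℝ) • y := by ext y; simp
      rw [h2, h1, hcf t ht, hcf t ht]; simp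
    have h1 := abs_avg_sub_le_of_symmetric hsym hC2 x
    have hN := hC2.nonneg
    have h2 := mul_le_mul_of_nonneg_left (hmom t ht) (mul_nonneg zero_le_two hN)
    rw [stableConst, Real.coe_toNNReal _ (by positivity)]
    linarith
  · intro p hp hp2 ε hε t ht ht1
    have h1 := integral_min_rpow_le hp hp2.le (hmom t ht.le)
    rw [stableConst, Real.coe_toNNReal _ (by positivity)]
    refine h1.trans ?_
    rw [Real.mul_rpow hK0 ht.le]
    exact mul_le_mul_of_nonneg_left (Real.rpow_le_rpow_of_exponent_ge ht ht1 (by linarith))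
      (by positivity)

end Stable

section BrownianPlusStable

variable {d : ℕ} {Ω : Type*} {mΩ : MeasurableSpace Ω} {P : Measure Ω} [IsProbabilityMeasure P]
  {W Z : ℝ≥0 → Ω → EuclideanSpace ℝ (Fin d)} {α c : ℝ}

lemma IsBrownian.aemeasurable (hW : IsBrownian W P) (t : ℝ≥0) : AEMeasurable (W t) P := by
  have h : AEMeasurable (fun ω i ↦ W t ω i) P :=
    aemeasurable_pi_lambda _ fun i ↦ (hW.1 i).toIsPreBrownianReal.aemeasurable t
  exact (WithLp.measurable_toLp 2 _).comp_aemeasurable h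

lemma IsBrownian.charFun_sub (hW : IsBrownian W P) {s t : ℝ≥0} (hst : s ≤ t)
    (u : EuclideanSpace ℝ (Fin d)) : charFun (P.map fun ω ↦ W t ω - W s ω) u
      = Complex.exp (-(((t : ℝ) - s) * (‖u‖ ^ 2 / 2) : ℝ)) := by
  have hm : ∀ i, AEMeasurable (fun ω ↦ W t ω i - W s ω i) P := fun i ↦
    ((hW.1 i).toIsPreBrownianReal.aemeasurable t).sub ((hW.1 i).toIsPreBrownianReal.aemeasurable s)
  have hind : iIndepFun (fun (i : Fin d) ω ↦ W t ω i - W s ω i) P :=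
    hW.2.comp (fun _ (w : ℝ≥0 → ℝ) ↦ w t - w s) fun _ ↦ by fun_prop
  have h1 := (iIndepFun_iff_charFun_pi (X := fun (i : Fin d) ω ↦ W t ω i - W s ω i) hm).1 hind u
  have h2 : ∀ i, charFun (P.map fun ω ↦ W t ω i - W s ω i) (u i)
      = Complex.exp (-(((t : ℝ) - s) * ((u i) ^ 2 / 2) : ℝ)) := fun i ↦ by
    have h3 := ((hW.1 i).toIsPreBrownianReal.hasLaw_sub t s).map_eq
    have h4 : (nndist t.1 s.1 : ℝ) = t - s := by
      rw [coe_nndist, Real.dist_eq, abs_of_nonneg (sub_nonneg.2 (by exact_mod_cast hst))]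
      rfl
    have h5 : (fun ω ↦ W t ω i - W s ω i) = (fun ω ↦ W t ω i) - fun ω ↦ W s ω i := rfl
    rw [h5, h3, charFun_gaussianReal, h4]
    congr 1; push_cast; ring
  simp only [h2] at h1
  refine h1.trans ?_
  rw [← Complex.exp_sum, EuclideanSpace.norm_sq_eq]
  congr 1
  simp only [Real.norm_eq_abs, sq_abs]
  push_cast
  rw [Finset.sum_neg_distrib, Finset.sum_div, Finset.mul_sum]

lemma charFun_brownian_add_stable (hW : IsBrownian W P) (hZ : IsStandardStable Z P α c)
    (h : IndepFun (fun ω t ↦ W t ω) (fun ω t ↦ Z t ω) P) {s t : ℝ} (hs : 0 ≤ s) (hst : s ≤ t)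
    (u : EuclideanSpace ℝ (Fin d)) :
    charFun (P.map fun ω ↦ W t.toNNReal ω + Z t.toNNReal ω - (W s.toNNReal ω + Z s.toNNReal ω)) u
      = Complex.exp (-((t - s) * (‖u‖ ^ 2 / 2 + c * ‖u‖ ^ α) : ℝ)) := by
  have hm : Measurable fun (x : ℝ≥0 → EuclideanSpace ℝ (Fin d)) ↦ x t.toNNReal - x s.toNNReal := by
    fun_prop
  have hst' : s.toNNReal ≤ t.toNNReal := Real.toNNReal_mono hst
  have h1 := (h.comp hm hm).charFun_map_fun_add_eq_mul ((hW.aemeasurable _).sub (hW.aemeasurable _))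
    ((hZ.1.measurable _).sub (hZ.1.measurable _)).aemeasurable
  have h2 : (fun ω ↦ W t.toNNReal ω + Z t.toNNReal ω - (W s.toNNReal ω + Z s.toNNReal ω))
      = fun ω ↦ (W t.toNNReal ω - W s.toNNReal ω) + (Z t.toNNReal ω - Z s.toNNReal ω) := by
    ext1 ω; abel
  have h3 := (hZ.1.stationary s.toNNReal (t - s).toNNReal).map_eq
  rw [← Real.toNNReal_add hs (sub_nonneg.2 hst), add_sub_cancel] at h3
  have h4 := congrFun h1 u
  rw [Pi.mul_apply] at h4
  rw [h2]
  refine h4.trans ?_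
  have h5 := hW.charFun_sub hst' u
  have h6 := hZ.2 (t - s).toNNReal u
  rw [← h3, Real.coe_toNNReal _ (sub_nonneg.2 hst)] at h6
  rw [Real.coe_toNNReal _ hs, Real.coe_toNNReal _ (hs.trans hst)] at h5
  refine (congrArg₂ (· * ·) h5 h6).trans ?_
  rw [← Complex.exp_add]
  congr 1; push_cast; ring

/-- The Euler bound for the sum of a Brownian motion and an independent stable process. -/
theorem exists_eulerBound_brownian_add_stable.{u} {d : ℕ} (hd : 0 < d) {α c β p ε : ℝ} (B : ℝ)
    (hα : 0 < α) (hα2 : α < 2) (hc : 0 < c) (hβ : 0 < β) (hp : 2 < p) (hε : 0 < ε) :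
    ∃ N : ℝ, 0 < N ∧ ∀ (Ω : Type u) [MeasurableSpace Ω] (P : Measure Ω) [IsProbabilityMeasure P]
      (W Z : ℝ≥0 → Ω → EuclideanSpace ℝ (Fin d)), IsBrownian W P → IsStandardStable Z P α c →
        IndepFun (fun ω t ↦ W t ω) (fun ω t ↦ Z t ω) P →
        EulerBound (fun t ω ↦ W t ω + Z t ω) P β p ε B N := by
  obtain ⟨N, hN, h⟩ :=
    exists_eulerBound.{u} hd (stableConst (EuclideanSpace ℝ (Fin d)) c) B hβ hp hε
  refine ⟨N, hN, fun Ω _ P _ W Z hW hZ hWZ ↦ h Ω P (lawOf (fun t ω ↦ W t ω + Z t ω) P) _ ?_ ?_⟩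
  all_goals
    have hm : ∀ t, AEMeasurable (fun ω ↦ W t ω + Z t ω) P := fun t ↦
      (hW.aemeasurable t).add (hZ.1.measurable t).aemeasurable
    have hW0 : ∀ᵐ ω ∂P, W 0 ω = 0 := by
      have := ae_all_iff.2 fun i ↦ (hW.1 i).toIsPreBrownianReal.eval_zero_ae_eq_zero
      filter_upwards [this] with ω hω
      ext i; exact hω i
    have hprob : ∀ t, IsProbabilityMeasure (lawOf (fun t ω ↦ W t ω + Z t ω) P t) := fun t ↦
      Measure.isProbabilityMeasure_map (hm _)
    have hlaw : ∀ s t : ℝ, 0 ≤ s → s ≤ t → P.map (fun ω ↦ W t.toNNReal ω + Z t.toNNReal ω -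
        (W s.toNNReal ω + Z s.toNNReal ω)) = lawOf (fun t ω ↦ W t ω + Z t ω) P (t - s) := by
      intro s t hs hst
      have := hprob (t - s)
      have : IsProbabilityMeasure (P.map (fun ω ↦ W t.toNNReal ω + Z t.toNNReal ω -
        (W s.toNNReal ω + Z s.toNNReal ω))) :=
        Measure.isProbabilityMeasure_map ((hm _).sub (hm _))
      refine Measure.ext_of_charFun ?_
      ext u
      rw [charFun_brownian_add_stable hW hZ hWZ hs hst]
      have h1 := charFun_brownian_add_stable hW hZ hWZ le_rfl (sub_nonneg.2 hst) u
      rw [sub_zero] at h1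
      rw [← h1, lawOf]
      congr 1
      refine Measure.map_congr ?_
      filter_upwards [hW0, hZ.1.zero] with ω k1 k2
      simp [k1, k2]
  · have hZm : ∀ t : ℝ, IsProbabilityMeasure (lawOf Z P t) := fun t ↦
      Measure.isProbabilityMeasure_map (hZ.1.measurable _).aemeasurable
    have hcf : ∀ t, 0 ≤ t → ∀ u, charFun (lawOf (fun t ω ↦ W t ω + Z t ω) P t) u
        = Complex.exp (-(t * (‖u‖ ^ 2 / 2 + c * ‖u‖ ^ α) : ℝ)) := fun t ht u ↦ by
      have h1 := charFun_brownian_add_stable hW hZ hWZ le_rfl ht u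
      rwa [hlaw 0 t le_rfl ht, sub_zero] at h1
    refine isHeatSemigroup_of_charFun hα hα2 hc hprob hZm hcf fun t ht ↦ ?_
    have := isProbabilityMeasure_gaussMeasure (E := EuclideanSpace ℝ (Fin d))
      (by positivity : 0 < 1 / (2 * t))
    have := hprob t
    have := hZm t
    refine Measure.ext_of_charFun ?_
    ext u
    rw [hcf t ht.le, charFun_conv, charFun_gaussMeasure (by positivity), lawOf, hZ.2,
      ← Complex.exp_add, Real.coe_toNNReal _ ht.le]
    congr 1
    push_cast
    have : (t : ℂ) ≠ 0 := by exact_mod_cast ht.ne'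
    field_simp
    ring
  · refine ⟨?_, fun s t hs hst _ ↦ hlaw s t hs hst, ?_⟩
    · filter_upwards [hW0, hZ.1.zero] with ω k1 k2
      simp [k1, k2]
    · have := ae_all_iff.2 fun i ↦ (hW.1 i).cont
      filter_upwards [this, hZ.1.cadlag] with ω k1 k2 t _
      refine ContinuousWithinAt.add ?_ (k2 t).1
      have : Continuous fun s ↦ W s ω := by
        have h1 : Continuous fun s i ↦ W s ω i := continuous_pi k1
        exact (PiLp.continuous_toLp 2 _).comp h1
      exact this.continuousWithinAt

end BrownianPlusStable

/-! ### The generator of a Lévy triplet and random walks that approximate it -/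

section Generator

variable {E : Type*} [NormedAddCommGroup E] [InnerProductSpace ℝ E] [FiniteDimensional ℝ E]
  [MeasurableSpace E] [BorelSpace E] {f : E → ℝ} {A : ℝ} {n : ℕ}

lemma HasC2Bound.fderiv_incr (hf : HasC2Bound f A) (h : E) :
    fderiv ℝ (incr h f) = fun x ↦ fderiv ℝ f (x + h) - fderiv ℝ f x :=
  LevyEuler.fderiv_incr hf.differentiable h

lemma HasC2Bound.fderiv_fderiv_incr (hf : HasC2Bound f A) (h x : E) :
    fderiv ℝ (fderiv ℝ (incr h f)) x = fderiv ℝ (fderiv ℝ f) (x + h) - fderiv ℝ (fderiv ℝ f) x := by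
  rw [LevyEuler.fderiv_incr hf.differentiable,
    LevyEuler.fderiv_incr (hf.contDiff_fderiv.differentiable one_ne_zero)]
  rfl

/-- Bounds on the second derivative of the increments of `f` give bounds on the increments of the
lower order derivatives. -/
lemma HasC2Bound.incr (hf : HasC2Bound f A) {h : E} {c : ℝ} (hc : min (A * ‖h‖) (2 * A) ≤ c)
    (h2 : ∀ x, ‖fderiv ℝ (fderiv ℝ f) (x + h) - fderiv ℝ (fderiv ℝ f) x‖ ≤ c) :
    HasC2Bound (incr h f) c := by
  refine ⟨contDiff_incr hf.contDiff h, fun x ↦ le_trans (le_min ?_ ?_) hc,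
    fun x ↦ le_trans (le_min ?_ ?_) hc, fun x ↦ ?_⟩
  · exact abs_incr_le_of_fderiv hf.differentiable hf.one x h
  · exact abs_incr_le hf.zero h x
  · rw [hf.fderiv_incr]
    have := Convex.norm_image_sub_le_of_norm_fderiv_le (𝕜 := ℝ) (f := fderiv ℝ f) (s := Set.univ)
      (fun x _ ↦ hf.contDiff_fderiv.differentiable (by norm_num) x) (fun x _ ↦ hf.two x)
      convex_univ (Set.mem_univ x) (Set.mem_univ (x + h))
    simpa using this
  · rw [hf.fderiv_incr]
    exact (norm_sub_le _ _).trans (by linarith [hf.one (x + h), hf.one x])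
  · rw [hf.fderiv_fderiv_incr]
    exact h2 x

/-- The increments of `f` are small in `C²`, of Hölder order `η`. -/
def HasC2Holder (f : E → ℝ) (A η : ℝ) : Prop :=
  HasC2Bound f A ∧ ∀ h, HasC2Bound (incr h f) (2 * A * min (‖h‖ ^ η) 1)

lemma HasC2Bound.hasC2Holder (hf : HasC2Bound f A) {η : ℝ} (hη0 : 0 < η) (hη : η ≤ 1)
    (h2 : ∀ x h, ‖fderiv ℝ (fderiv ℝ f) (x + h) - fderiv ℝ (fderiv ℝ f) x‖ ≤ A * ‖h‖ ^ η) :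
    HasC2Holder f A η := by
  have hA := hf.nonneg
  have hint : ∀ {q : ℝ} {h : E}, q ≤ 2 * A → q ≤ A * ‖h‖ ^ η → q ≤ 2 * A * min (‖h‖ ^ η) 1 := by
    intro q h k1 k2
    rw [mul_min_of_nonneg _ _ (by positivity), mul_one]
    exact le_min (by nlinarith [mul_nonneg hA (Real.rpow_nonneg (norm_nonneg h) η)]) k1
  refine ⟨hf, fun h ↦ hf.incr ?_ fun x ↦ hint ?_ (h2 x h)⟩
  · rw [mul_min_of_nonneg _ _ (by positivity), mul_one]
    refine le_min ?_ (min_le_right _ _)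
    rcases le_total ‖h‖ 1 with h1 | h1
    · have h3 := min_rpow_le_min_rpow hη0 hη (norm_nonneg h)
      rw [Real.rpow_one, min_eq_left h1] at h3
      exact (min_le_left _ _).trans (by
        nlinarith [mul_le_mul_of_nonneg_left (h3.trans (min_le_left _ _)) hA, norm_nonneg h])
    · exact (min_le_right _ _).trans
        (le_mul_of_one_le_right (by positivity) (Real.one_le_rpow h1 hη0.le))
  · have := norm_sub_le (fderiv ℝ (fderiv ℝ f) (x + h)) (fderiv ℝ (fderiv ℝ f) x)
    linarith [hf.two (x + h), hf.two x]

/-- Second order Taylor expansion of symmetric differences. -/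
lemma HasC2Holder.abs_second_difference_sub_le {η : ℝ} (hη : 0 < η) (hf : HasC2Holder f A η)
    (x y : E) : |f (x + y) + f (x - y) - 2 * f x - fderiv ℝ (fderiv ℝ f) x y y| ≤
      4 * A * ‖y‖ ^ η * ‖y‖ ^ 2 := by
  have hA := hf.1.nonneg
  set D := fderiv ℝ (fderiv ℝ f) with hD
  -- expansion of the first derivative
  have h1 : ∀ v, ‖v‖ ≤ ‖y‖ →
      ‖fderiv ℝ f (x + v) - fderiv ℝ f x - D x v‖ ≤ 2 * A * ‖y‖ ^ η * ‖y‖ := by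
    intro v hv
    have hd : ∀ z, HasFDerivAt (fun z ↦ fderiv ℝ f z - D x z) (D z - D x) z := fun z ↦
      (hf.1.contDiff_fderiv.differentiable (by norm_num) z).hasFDerivAt.sub (D x).hasFDerivAt
    have hb : ∀ z ∈ Metric.closedBall x ‖y‖, ‖D z - D x‖ ≤ 2 * A * ‖y‖ ^ η := by
      intro z hz
      rw [Metric.mem_closedBall, dist_eq_norm] at hz
      have h3 := (hf.2 (z - x)).two x
      rw [hf.1.fderiv_fderiv_incr, add_sub_cancel] at h3
      refine h3.trans (mul_le_mul_of_nonneg_left ((min_le_left _ _).trans ?_) (by positivity))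
      gcongr
    have h4 := Convex.norm_image_sub_le_of_norm_hasFDerivWithin_le (s := Metric.closedBall x ‖y‖)
      (fun z _ ↦ (hd z).hasFDerivWithinAt) hb (convex_closedBall x ‖y‖)
      (Metric.mem_closedBall_self (norm_nonneg y)) (y := x + v) (by simpa using hv)
    have e : fderiv ℝ f (x + v) - D x (x + v) - (fderiv ℝ f x - D x x)
        = fderiv ℝ f (x + v) - fderiv ℝ f x - D x v := by rw [map_add]; abel
    rw [e, add_sub_cancel_left] at h4
    exact h4.trans (by gcongr)
  have hl : ∀ s : ℝ, HasDerivAt (fun s : ℝ ↦ x + s • y) y s := fun s ↦ by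
    simpa using ((hasDerivAt_id s).smul_const y).const_add x
  have hl' : ∀ s : ℝ, HasDerivAt (fun s : ℝ ↦ x + -(s • y)) (-y) s := fun s ↦ by
    simpa using ((hasDerivAt_id s).smul_const y).neg.const_add x
  have hder : ∀ s : ℝ, HasDerivAt (fun s : ℝ ↦ f (x + s • y) + f (x + -(s • y)) - s ^ 2 * D x y y)
      (fderiv ℝ f (x + s • y) y + fderiv ℝ f (x + -(s • y)) (-y) - 2 * s * D x y y) s := fun s ↦ by
    have k1 := (hf.1.differentiable (x + s • y)).hasFDerivAt.comp_hasDerivAt s (hl s)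
    have k2 := (hf.1.differentiable (x + -(s • y))).hasFDerivAt.comp_hasDerivAt s (hl' s)
    have k3 := (hasDerivAt_pow 2 s).mul_const (D x y y)
    exact ((k1.add k2).sub k3).congr_deriv (by simp)
  have hbd : ∀ s ∈ Set.Icc (0 : ℝ) 1, ‖fderiv ℝ f (x + s • y) y + fderiv ℝ f (x + -(s • y)) (-y)
      - 2 * s * D x y y‖ ≤ 4 * A * ‖y‖ ^ η * ‖y‖ ^ 2 := by
    intro s hs
    have hsy : ‖s • y‖ ≤ ‖y‖ := by
      rw [norm_smul, Real.norm_of_nonneg hs.1]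
      exact mul_le_of_le_one_left (norm_nonneg _) hs.2
    have k1 := h1 (s • y) hsy
    have k2 := h1 (-(s • y)) (by rwa [norm_neg])
    have e : fderiv ℝ f (x + s • y) y + fderiv ℝ f (x + -(s • y)) (-y) - 2 * s * D x y y
        = ((fderiv ℝ f (x + s • y) - fderiv ℝ f x - D x (s • y))
          - (fderiv ℝ f (x + -(s • y)) - fderiv ℝ f x - D x (-(s • y)))) y := by
      simp; ring
    rw [e]
    refine (ContinuousLinearMap.le_opNorm _ _).trans ?_
    calc _ ≤ (2 * A * ‖y‖ ^ η * ‖y‖ + 2 * A * ‖y‖ ^ η * ‖y‖) * ‖y‖ := by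
          gcongr
          exact (norm_sub_le _ _).trans (add_le_add k1 k2)
      _ = _ := by ring
  have h5 := Convex.norm_image_sub_le_of_norm_hasDerivWithin_le (s := Set.Icc (0 : ℝ) 1)
    (fun s _ ↦ (hder s).hasDerivWithinAt) hbd (convex_Icc 0 1) (Set.left_mem_Icc.2 zero_le_one)
    (Set.right_mem_Icc.2 zero_le_one)
  have e2 : f (x + (1 : ℝ) • y) + f (x + -((1 : ℝ) • y)) - 1 ^ 2 * D x y y
      - (f (x + (0 : ℝ) • y) + f (x + -((0 : ℝ) • y)) - 0 ^ 2 * D x y y)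
      = f (x + y) + f (x - y) - 2 * f x - D x y y := by
    simp [sub_eq_add_neg]; ring
  rw [e2] at h5
  simpa using h5

/-- `ν` integrates `min (|y|²) 1`, as a Lévy measure does. -/
abbrev TruncSqIntegrable (ν : Measure E) : Prop := Integrable (fun y : E ↦ min (‖y‖ ^ 2) 1) ν

/-- The integrand of the jump part of the generator. -/
noncomputable def jumpTerm (f : E → ℝ) (x y : E) : ℝ :=
  f (x + y) - f x - if ‖y‖ ≤ 1 then fderiv ℝ f x y else 0

/-- The generator of the Lévy process with drift `a`, covariance `∑ wᵢ wᵢᵀ` and Lévy measure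
`ν`. -/
noncomputable def levyGen (a : E) (w : Fin n → E) (ν : Measure E) (f : E → ℝ) (x : E) : ℝ :=
  fderiv ℝ f x a + 1 / 2 * ∑ i, fderiv ℝ (fderiv ℝ f) x (w i) (w i) + ∫ y, jumpTerm f x y ∂ν

/-- The norm of the generator as an operator from `C²` to bounded functions is at most this
constant. -/
noncomputable def genConst (a : E) (w : Fin n → E) (ν : Measure E) : ℝ :=
  1 + ‖a‖ + 2 * ∑ i, ‖w i‖ ^ 2 + 2 * ∫ y, min (‖y‖ ^ 2) 1 ∂ν

variable {a : E} {w : Fin n → E} {ν : Measure E}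

lemma genConst_nonneg : 0 ≤ genConst a w ν := by
  have h1 : 0 ≤ ∑ i, ‖w i‖ ^ 2 := Finset.sum_nonneg fun _ _ ↦ by positivity
  have h2 : 0 ≤ ∫ y, min (‖y‖ ^ 2) 1 ∂ν := integral_nonneg fun _ ↦ by positivity
  unfold genConst; positivity

lemma HasC2Bound.abs_jumpTerm_le (hf : HasC2Bound f A) (x y : E) :
    |jumpTerm f x y| ≤ 2 * A * min (‖y‖ ^ 2) 1 := by
  have hA := hf.nonneg
  unfold jumpTerm
  split_ifs with h
  · rw [min_eq_left (pow_le_one₀ (norm_nonneg _) h)]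
    have : 0 ≤ A * ‖y‖ ^ 2 := by positivity
    linarith [hf.abs_sub_sub_le x y]
  · rw [min_eq_right (one_le_pow₀ (not_le.1 h).le), sub_zero]
    have := abs_sub (f (x + y)) (f x)
    linarith [hf.zero (x + y), hf.zero x]

lemma HasC2Bound.integrable_jumpTerm (hf : HasC2Bound f A)
    (hν : TruncSqIntegrable ν) (x : E) : Integrable (jumpTerm f x) ν := by
  refine (hν.const_mul (2 * A)).mono' (Measurable.aestronglyMeasurable ?_)
    (ae_of_all _ (hf.abs_jumpTerm_le x))
  exact ((hf.measurable.comp (measurable_const_add x)).sub measurable_const).sub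
    (Measurable.ite (measurableSet_le measurable_norm measurable_const)
      (fderiv ℝ f x).measurable measurable_const)

lemma HasC2Bound.abs_levyGen_le (hf : HasC2Bound f A) (hν : TruncSqIntegrable ν) (x : E) :
    |levyGen a w ν f x| ≤ genConst a w ν * A := by
  have hA := hf.nonneg
  have h1 : |fderiv ℝ f x a| ≤ A * ‖a‖ := (fderiv ℝ f x).le_of_opNorm_le (hf.one x) a
  have h2 : |∑ i, fderiv ℝ (fderiv ℝ f) x (w i) (w i)| ≤ A * ∑ i, ‖w i‖ ^ 2 := by
    rw [Finset.mul_sum]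
    refine (Finset.abs_sum_le_sum_abs _ _).trans (Finset.sum_le_sum fun i _ ↦ ?_)
    have := ContinuousLinearMap.le_of_opNorm_le _
      (ContinuousLinearMap.le_of_opNorm_le _ (hf.two x) (w i)) (w i)
    exact this.trans_eq (by ring)
  have h3 : |∫ y, jumpTerm f x y ∂ν| ≤ 2 * A * ∫ y, min (‖y‖ ^ 2) 1 ∂ν := by
    rw [← integral_const_mul, ← Real.norm_eq_abs]
    exact norm_integral_le_of_norm_le (hν.const_mul _) (ae_of_all _ (hf.abs_jumpTerm_le x))
  have h4 : 0 ≤ A * ∑ i, ‖w i‖ ^ 2 := mul_nonneg hA (Finset.sum_nonneg fun _ _ ↦ by positivity)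
  unfold levyGen genConst
  rw [abs_le] at *
  constructor <;> linarith [h1.1, h1.2, h2.1, h2.2, h3.1, h3.2]

lemma HasC2Bound.levyGen_incr (hf : HasC2Bound f A) (hν : TruncSqIntegrable ν) (h x : E) :
    levyGen a w ν (LevyEuler.incr h f) x = LevyEuler.incr h (levyGen a w ν f) x := by
  have e : ∀ y, jumpTerm (LevyEuler.incr h f) x y = jumpTerm f (x + h) y - jumpTerm f x y := by
    intro y
    unfold jumpTerm
    rw [hf.fderiv_incr]
    simp only [LevyEuler.incr, add_right_comm x y h, sub_apply]
    split_ifs <;> ring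
  unfold levyGen
  simp only [e]
  rw [integral_sub (hf.integrable_jumpTerm hν _) (hf.integrable_jumpTerm hν _)]
  simp only [hf.fderiv_fderiv_incr]
  simp only [hf.fderiv_incr, sub_apply, Finset.sum_sub_distrib, LevyEuler.incr]
  ring

/-- The drift that remains when the jumps larger than `r` are not compensated. -/
noncomputable def truncDrift (a : E) (ν : Measure E) (r : ℝ) : E :=
  a - ∫ y in {y | r < ‖y‖} ∩ {y | ‖y‖ ≤ 1}, y ∂ν

/-- The law of one step of a random walk whose generator approximates `levyGen a w ν`: with
probability `1/4` a move by the drift, with probability `1/2` a move along one of the `± wᵢ`, and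
a jump larger than `r` with probability `h ν(|y| > r)`. -/
noncomputable def stepMeasure (a : E) (w : Fin n → E) (ν : Measure E) (r h : ℝ) : Measure E :=
  ENNReal.ofReal (1 / 4) • Measure.dirac ((4 * h) • truncDrift a ν r)
    + ∑ i, ENNReal.ofReal (1 / (4 * n)) •
      (Measure.dirac (√(2 * n * h) • w i) + Measure.dirac (-(√(2 * n * h) • w i)))
    + (ENNReal.ofReal (1 / 4 - h * (ν {y | r < ‖y‖}).toReal) • Measure.dirac 0
      + ENNReal.ofReal h • ν.restrict {y | r < ‖y‖})

variable {r h : ℝ}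

lemma measurableSet_lt_norm : MeasurableSet {y : E | r < ‖y‖} :=
  measurableSet_lt measurable_const measurable_norm

lemma measure_lt_norm_lt_top (hν : TruncSqIntegrable ν) (hr : 0 < r) : ν {y | r < ‖y‖} < ∞ := by
  refine lt_of_le_of_lt (measure_mono fun y hy ↦ ?_)
    (hν.measure_ge_lt_top (ε := min (r ^ 2) 1) (by positivity))
  have hy : r < ‖y‖ := hy
  exact min_le_min_right _ (pow_le_pow_left₀ hr.le hy.le 2)

lemma toReal_measure_lt_norm_le (hν : TruncSqIntegrable ν) (hr : 0 < r)
    (hr1 : r ≤ 1) : r ^ 2 * (ν {y | r < ‖y‖}).toReal ≤ ∫ y, min (‖y‖ ^ 2) 1 ∂ν := by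
  have h1 : ∫ y in {y | r < ‖y‖}, r ^ 2 ∂ν ≤ ∫ y in {y | r < ‖y‖}, min (‖y‖ ^ 2) 1 ∂ν := by
    refine setIntegral_mono_on (integrableOn_const (measure_lt_norm_lt_top hν hr).ne)
      hν.integrableOn measurableSet_lt_norm fun y hy ↦ le_min ?_ (pow_le_one₀ hr.le hr1)
    have hy : r < ‖y‖ := hy
    gcongr
  rw [setIntegral_const, smul_eq_mul, mul_comm] at h1
  exact h1.trans (setIntegral_le_integral hν (ae_of_all _ fun _ ↦ by positivity))

lemma integrableOn_id (hν : TruncSqIntegrable ν) (hr : 0 < r) :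
    IntegrableOn (fun y ↦ y) ({y | r < ‖y‖} ∩ {y | ‖y‖ ≤ 1}) ν := by
  refine Measure.integrableOn_of_bounded (M := 1)
    ((measure_mono Set.inter_subset_left).trans_lt (measure_lt_norm_lt_top hν hr)).ne
    measurable_id.aestronglyMeasurable ?_
  exact (ae_restrict_iff' (measurableSet_lt_norm.inter
    (measurableSet_le measurable_norm measurable_const))).2 (ae_of_all _ fun y hy ↦ hy.2)

lemma norm_truncDrift_le (hν : TruncSqIntegrable ν) (hr : 0 < r) :
    r * ‖truncDrift a ν r‖ ≤ r * ‖a‖ + ∫ y, min (‖y‖ ^ 2) 1 ∂ν := by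
  have hS : MeasurableSet ({y : E | r < ‖y‖} ∩ {y | ‖y‖ ≤ 1}) :=
    measurableSet_lt_norm.inter (measurableSet_le measurable_norm measurable_const)
  have h1 : r * ‖∫ y in {y | r < ‖y‖} ∩ {y | ‖y‖ ≤ 1}, y ∂ν‖ ≤ ∫ y, min (‖y‖ ^ 2) 1 ∂ν := by
    refine (mul_le_mul_of_nonneg_left (norm_integral_le_integral_norm _) hr.le).trans ?_
    rw [← integral_const_mul]
    refine le_trans (setIntegral_mono_on ((integrableOn_id hν hr).norm.const_mul r) hν.integrableOn
      hS fun y hy ↦ ?_) (setIntegral_le_integral hν (ae_of_all _ fun _ ↦ by positivity))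
    have k1 : r < ‖y‖ := hy.1
    have k2 : ‖y‖ ≤ 1 := hy.2
    rw [min_eq_left (pow_le_one₀ (norm_nonneg _) k2), sq]
    gcongr
  unfold truncDrift
  have := norm_sub_le a (∫ y in {y | r < ‖y‖} ∩ {y | ‖y‖ ≤ 1}, y ∂ν)
  nlinarith

lemma isProbabilityMeasure_stepMeasure (hn : 0 < n)
    (hν : TruncSqIntegrable ν) (hr : 0 < r) (hh : 0 < h)
    (hrh : h * (ν {y | r < ‖y‖}).toReal ≤ 1 / 4) :
    IsProbabilityMeasure (stepMeasure a w ν r h) := by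
  have hfin := measure_lt_norm_lt_top hν hr
  have hn' : (0 : ℝ) < n := by exact_mod_cast hn
  constructor
  simp only [stepMeasure, Measure.add_apply, Measure.smul_apply, Measure.finsetSum_apply,
    measure_univ, smul_eq_mul, mul_one, Measure.restrict_apply_univ, Finset.sum_const,
    Finset.card_univ, Fintype.card_fin, nsmul_eq_mul]
  have e1 : ν {y | r < ‖y‖} = ENNReal.ofReal (ν {y | r < ‖y‖}).toReal :=
    (ENNReal.ofReal_toReal hfin.ne).symm
  have e2 : (n : ℝ≥0∞) = ENNReal.ofReal n := by simp
  have e3 : (1 : ℝ≥0∞) + 1 = ENNReal.ofReal 2 := by rw [one_add_one_eq_two]; simp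
  rw [e1, e2, e3, ENNReal.toReal_ofReal ENNReal.toReal_nonneg]
  set q := (ν {y | r < ‖y‖}).toReal
  have hq : 0 ≤ q := ENNReal.toReal_nonneg
  rw [← ENNReal.ofReal_mul (by positivity), ← ENNReal.ofReal_mul (by positivity),
    ← ENNReal.ofReal_mul hh.le, ← ENNReal.ofReal_add (by positivity) (by positivity),
    ← ENNReal.ofReal_add (by linarith) (by positivity),
    ← ENNReal.ofReal_add (by positivity) (by linarith [mul_nonneg hh.le hq]),
    ← ENNReal.ofReal_one]
  congr 1
  field_simp
  ring

/-- One step of the random walk, up to the contribution of the small jumps. -/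
lemma avg_stepMeasure_sub (hn : 0 < n) (hν : TruncSqIntegrable ν)
    (hr : 0 < r) (hh : 0 < h) (hrh : h * (ν {y | r < ‖y‖}).toReal ≤ 1 / 4)
    (hf : HasC2Bound f A) (x : E) :
    avg (stepMeasure a w ν r h) f x - f x = 1 / 4 * (f (x + (4 * h) • truncDrift a ν r) - f x
          - fderiv ℝ f x ((4 * h) • truncDrift a ν r))
        + 1 / (4 * n) * ∑ i, (f (x + √(2 * n * h) • w i) + f (x - √(2 * n * h) • w i) - 2 * f x)
        + h * (fderiv ℝ f x a + ∫ y in {y | r < ‖y‖}, jumpTerm f x y ∂ν) := by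
  have hfin := measure_lt_norm_lt_top hν hr
  have hn' : (0 : ℝ) < n := by exact_mod_cast hn
  have hfinm : IsFiniteMeasure (ν.restrict {y | r < ‖y‖}) := ⟨by simpa using hfin⟩
  have hi : ∀ (ρ : Measure E) [IsFiniteMeasure ρ], Integrable (fun y ↦ f (x + y)) ρ := fun ρ _ ↦
    Integrable.of_bound (hf.measurable.comp (measurable_const_add x)).aestronglyMeasurable A
      (ae_of_all _ fun _ ↦ hf.zero _)
  have hi' : ∀ (ρ : Measure E) [IsFiniteMeasure ρ] (c : ℝ),
      Integrable (fun y ↦ f (x + y)) (ENNReal.ofReal c • ρ) := fun ρ _ c ↦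
    (hi ρ).smul_measure ENNReal.ofReal_ne_top
  have e1 : avg (stepMeasure a w ν r h) f x = 1 / 4 * f (x + (4 * h) • truncDrift a ν r)
      + ∑ i, 1 / (4 * (n : ℝ)) * (f (x + √(2 * n * h) • w i) + f (x - √(2 * n * h) • w i))
      + ((1 / 4 - h * (ν {y | r < ‖y‖}).toReal) * f x
        + h * ∫ y in {y | r < ‖y‖}, f (x + y) ∂ν) := by
    have hsum : ∀ i ∈ Finset.univ, Integrable (fun y ↦ f (x + y)) (ENNReal.ofReal (1 / (4 * n)) •
        (Measure.dirac (√(2 * n * h) • w i) + Measure.dirac (-(√(2 * n * h) • w i)))) :=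
      fun i _ ↦ hi' _ _
    rw [avg, stepMeasure, integral_add_measure ((hi' _ _).add_measure
      (integrable_finsetSum_measure.2 hsum)) ((hi' _ _).add_measure (hi' _ _)),
      integral_add_measure (hi' _ _) (integrable_finsetSum_measure.2 hsum),
      integral_add_measure (hi' _ _) (hi' _ _), integral_finsetSum_measure hsum]
    simp only [integral_smul_measure]
    have e2 : ∀ i, ∫ y, f (x + y) ∂(Measure.dirac (√(2 * n * h) • w i)
        + Measure.dirac (-(√(2 * n * h) • w i)))
        = f (x + √(2 * n * h) • w i) + f (x - √(2 * n * h) • w i) := fun i ↦ by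
      rw [integral_add_measure (hi _) (hi _), integral_dirac, integral_dirac, sub_eq_add_neg]
    simp only [e2, integral_dirac, add_zero, smul_eq_mul]
    rw [ENNReal.toReal_ofReal (by norm_num), ENNReal.toReal_ofReal (by positivity),
      ENNReal.toReal_ofReal (by linarith), ENNReal.toReal_ofReal hh.le]
  have hS : MeasurableSet {y : E | ‖y‖ ≤ 1} := measurableSet_le measurable_norm measurable_const
  have e3 : ∫ y in {y | r < ‖y‖}, jumpTerm f x y ∂ν
      = ∫ y in {y | r < ‖y‖}, f (x + y) ∂ν - (ν {y | r < ‖y‖}).toReal * f x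
        - fderiv ℝ f x (∫ y in {y | r < ‖y‖} ∩ {y | ‖y‖ ≤ 1}, y ∂ν) := by
    have k1 : ∀ y, (if ‖y‖ ≤ 1 then fderiv ℝ f x y else 0)
        = {y : E | ‖y‖ ≤ 1}.indicator (fun y ↦ fderiv ℝ f x y) y := fun y ↦ by
      simp [Set.indicator_apply]
    have k2 : IntegrableOn (fun y ↦ fderiv ℝ f x y) ({y | r < ‖y‖} ∩ {y | ‖y‖ ≤ 1}) ν :=
      (fderiv ℝ f x).integrable_comp (integrableOn_id hν hr)
    have k3 : Integrable ({y : E | ‖y‖ ≤ 1}.indicator fun y ↦ fderiv ℝ f x y)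
        (ν.restrict {y | r < ‖y‖}) := by
      rw [integrable_indicator_iff hS, IntegrableOn, Measure.restrict_restrict hS, Set.inter_comm]
      exact k2
    simp only [jumpTerm, k1]
    rw [integral_sub (f := fun y ↦ f (x + y) - f x) ((hi _).sub (integrable_const _)) k3,
      integral_sub (f := fun y ↦ f (x + y)) (hi _) (integrable_const _), setIntegral_const,
      setIntegral_indicator hS, ContinuousLinearMap.integral_comp_comm _
        (integrableOn_id hν hr)]
    rfl
  rw [e1, e3, map_smul, smul_eq_mul]
  have e4 : fderiv ℝ f x (truncDrift a ν r)
      = fderiv ℝ f x a - fderiv ℝ f x (∫ y in {y | r < ‖y‖} ∩ {y | ‖y‖ ≤ 1}, y ∂ν) := map_sub _ _ _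
  have e5 : ∑ i : Fin n, (2 * f x) = n * (2 * f x) := by simp
  rw [e4, Finset.sum_sub_distrib, e5, ← Finset.mul_sum]
  field_simp
  ring

/-- The random walk moves functions by at most `h` times their `C²` norm. -/
lemma abs_avg_stepMeasure_sub_le (hn : 0 < n) (hν : TruncSqIntegrable ν)
    (hr : 0 < r) (hh : 0 < h) (hrh : h * (ν {y | r < ‖y‖}).toReal ≤ 1 / 4)
    (hb : 4 * h * ‖truncDrift a ν r‖ ^ 2 ≤ 1) (hf : HasC2Bound f A) (x : E) :
    |avg (stepMeasure a w ν r h) f x - f x| ≤ h * (genConst a w ν * A) := by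
  have hA := hf.nonneg
  have hn' : (0 : ℝ) < n := by exact_mod_cast hn
  rw [avg_stepMeasure_sub hn hν hr hh hrh hf]
  have h1 := hf.abs_sub_sub_le x ((4 * h) • truncDrift a ν r)
  have h2 : A * ‖(4 * h) • truncDrift a ν r‖ ^ 2 ≤ 4 * (h * A) := by
    rw [norm_smul, Real.norm_of_nonneg (by positivity)]
    have := mul_le_mul_of_nonneg_left hb (by positivity : 0 ≤ 4 * (h * A))
    linarith
  have h3 : |1 / (4 * (n : ℝ)) * ∑ i, (f (x + √(2 * n * h) • w i) + f (x - √(2 * n * h) • w i)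
      - 2 * f x)| ≤ h * A * (2 * ∑ i, ‖w i‖ ^ 2) := by
    have k1 : |∑ i, (f (x + √(2 * n * h) • w i) + f (x - √(2 * n * h) • w i) - 2 * f x)|
        ≤ ∑ i, 4 * A * (2 * n * h * ‖w i‖ ^ 2) := by
      refine (Finset.abs_sum_le_sum_abs _ _).trans (Finset.sum_le_sum fun i _ ↦ ?_)
      refine (hf.abs_second_difference_le _ _).trans
        (mul_le_mul_of_nonneg_left ((min_le_left _ _).trans_eq ?_) (by positivity))
      rw [norm_smul, mul_pow, Real.norm_of_nonneg (Real.sqrt_nonneg _),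
        Real.sq_sqrt (by positivity)]
    rw [abs_mul, abs_of_pos (by positivity : 0 < 1 / (4 * (n : ℝ)))]
    refine (mul_le_mul_of_nonneg_left k1 (by positivity)).trans_eq ?_
    rw [← Finset.mul_sum, ← Finset.mul_sum]
    field_simp
  have h4 : |fderiv ℝ f x a| ≤ A * ‖a‖ := (fderiv ℝ f x).le_of_opNorm_le (hf.one x) a
  have h5 : |∫ y in {y | r < ‖y‖}, jumpTerm f x y ∂ν| ≤ 2 * A * ∫ y, min (‖y‖ ^ 2) 1 ∂ν := by
    have k1 : |∫ y in {y | r < ‖y‖}, jumpTerm f x y ∂ν|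
        ≤ ∫ y in {y | r < ‖y‖}, 2 * A * min (‖y‖ ^ 2) 1 ∂ν := by
      rw [← Real.norm_eq_abs]
      exact norm_integral_le_of_norm_le (hν.integrableOn.const_mul _)
        (ae_of_all _ (hf.abs_jumpTerm_le x))
    rw [← integral_const_mul]
    exact k1.trans (setIntegral_le_integral (hν.const_mul _) (ae_of_all _ fun _ ↦ by positivity))
  have h6 : |h * (fderiv ℝ f x a + ∫ y in {y | r < ‖y‖}, jumpTerm f x y ∂ν)|
      ≤ h * (A * ‖a‖ + 2 * A * ∫ y, min (‖y‖ ^ 2) 1 ∂ν) := by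
    rw [abs_mul, abs_of_pos hh]
    gcongr
    exact (abs_add_le _ _).trans (add_le_add h4 h5)
  unfold genConst
  rw [abs_le] at *
  constructor <;> linarith [h1.1, h1.2, h3.1, h3.2, h6.1, h6.2]

/-- The error of one step of the random walk. -/
noncomputable def stepError (a : E) (w : Fin n → E) (ν : Measure E) (η r h : ℝ) : ℝ :=
  4 * (h * ‖truncDrift a ν r‖ ^ 2) + ∑ i, 2 * ‖√(2 * n * h) • w i‖ ^ η * ‖w i‖ ^ 2
    + 2 * ∫ y in {y | r < ‖y‖}ᶜ, min (‖y‖ ^ 2) 1 ∂ν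

lemma abs_avg_stepMeasure_sub_sub_le {η : ℝ} (hη : 0 < η) (hn : 0 < n) (hν : TruncSqIntegrable ν)
    (hr : 0 < r) (hh : 0 < h) (hrh : h * (ν {y | r < ‖y‖}).toReal ≤ 1 / 4)
    (hf : HasC2Holder f A η) (x : E) :
    |avg (stepMeasure a w ν r h) f x - f x - h * levyGen a w ν f x|
      ≤ h * (A * stepError a w ν η r h) := by
  have hA := hf.1.nonneg
  have hn' : (0 : ℝ) < n := by exact_mod_cast hn
  rw [avg_stepMeasure_sub hn hν hr hh hrh hf.1]
  have h1 := hf.1.abs_sub_sub_le x ((4 * h) • truncDrift a ν r)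
  have h2 : A * ‖(4 * h) • truncDrift a ν r‖ ^ 2
      = 4 * (h * (A * (4 * (h * ‖truncDrift a ν r‖ ^ 2)))) := by
    rw [norm_smul, Real.norm_of_nonneg (by positivity)]; ring
  have hsq : √(2 * n * h) * √(2 * n * h) = 2 * n * h := Real.mul_self_sqrt (by positivity)
  have h3 : |1 / (4 * (n : ℝ)) * (∑ i, (f (x + √(2 * n * h) • w i) + f (x - √(2 * n * h) • w i)
      - 2 * f x)) - h * (1 / 2 * ∑ i, fderiv ℝ (fderiv ℝ f) x (w i) (w i))|
      ≤ h * (A * ∑ i, 2 * ‖√(2 * n * h) • w i‖ ^ η * ‖w i‖ ^ 2) := by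
    have k1 : 1 / (4 * (n : ℝ)) * (∑ i, (f (x + √(2 * n * h) • w i) + f (x - √(2 * n * h) • w i)
        - 2 * f x)) - h * (1 / 2 * ∑ i, fderiv ℝ (fderiv ℝ f) x (w i) (w i))
        = ∑ i, 1 / (4 * (n : ℝ)) * (f (x + √(2 * n * h) • w i) + f (x - √(2 * n * h) • w i)
        - 2 * f x - fderiv ℝ (fderiv ℝ f) x (√(2 * n * h) • w i) (√(2 * n * h) • w i)) := by
      rw [Finset.mul_sum, Finset.mul_sum, Finset.mul_sum, ← Finset.sum_sub_distrib]
      refine Finset.sum_congr rfl fun i _ ↦ ?_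
      simp only [map_smul, smul_apply, smul_eq_mul]
      rw [← mul_assoc √(2 * n * h), hsq]
      field_simp
      ring
    rw [k1, Finset.mul_sum, Finset.mul_sum]
    refine (Finset.abs_sum_le_sum_abs _ _).trans (Finset.sum_le_sum fun i _ ↦ ?_)
    rw [abs_mul, abs_of_pos (by positivity : 0 < 1 / (4 * (n : ℝ)))]
    refine (mul_le_mul_of_nonneg_left (hf.abs_second_difference_sub_le hη x _)
      (by positivity)).trans_eq ?_
    have k2 : ‖√(2 * n * h) • w i‖ ^ 2 = 2 * n * h * ‖w i‖ ^ 2 := by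
      rw [norm_smul, mul_pow, Real.norm_of_nonneg (Real.sqrt_nonneg _),
        Real.sq_sqrt (by positivity)]
    rw [k2]
    field_simp
  have h4 : |∫ y in {y | r < ‖y‖}ᶜ, jumpTerm f x y ∂ν|
      ≤ A * (2 * ∫ y in {y | r < ‖y‖}ᶜ, min (‖y‖ ^ 2) 1 ∂ν) := by
    rw [← mul_assoc, ← integral_const_mul, ← Real.norm_eq_abs]
    refine norm_integral_le_of_norm_le (hν.integrableOn.const_mul _) (ae_of_all _ fun y ↦ ?_)
    exact (hf.1.abs_jumpTerm_le x y).trans_eq (by ring)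
  have h5 := integral_add_compl (measurableSet_lt_norm (r := r)) (hf.1.integrable_jumpTerm hν x)
  have h6 : |h * ∫ y in {y | r < ‖y‖}ᶜ, jumpTerm f x y ∂ν|
      ≤ h * (A * (2 * ∫ y in {y | r < ‖y‖}ᶜ, min (‖y‖ ^ 2) 1 ∂ν)) := by
    rw [abs_mul, abs_of_pos hh]; gcongr
  have h7 : h * ∫ y, jumpTerm f x y ∂ν = h * ∫ y in {y | r < ‖y‖}, jumpTerm f x y ∂ν
      + h * ∫ y in {y | r < ‖y‖}ᶜ, jumpTerm f x y ∂ν := by rw [← mul_add, h5]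
  unfold levyGen stepError
  rw [mul_add h _ (∫ y, jumpTerm f x y ∂ν), h7]
  rw [abs_le] at *
  constructor <;> linarith [h1.1, h1.2, h3.1, h3.2, h6.1, h6.2]

end Generator

/-! ### Convergence of the random walks -/

section Walk

variable {E : Type*} [NormedAddCommGroup E] [InnerProductSpace ℝ E] [FiniteDimensional ℝ E]
  [MeasurableSpace E] [BorelSpace E] {f g : E → ℝ} {A : ℝ} {n : ℕ} {a : E} {w : Fin n → E}
  {ν : Measure E}

/-- The restrictions on the truncation level `r` of the jumps when the step size is `r⁴`. -/
structure IsGoodStep (a : E) (ν : Measure E) (r : ℝ) : Prop where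
  pos : 0 < r
  mass : r ^ 4 * (ν {y | r < ‖y‖}).toReal ≤ 1 / 4
  drift : 4 * r ^ 4 * ‖truncDrift a ν r‖ ^ 2 ≤ 1

lemma drift_le (hν : TruncSqIntegrable ν) {r : ℝ} (hr : 0 < r)
    (hr1 : r ≤ 1) : r ^ 4 * ‖truncDrift a ν r‖ ^ 2
      ≤ r ^ 2 * (‖a‖ + ∫ y, min (‖y‖ ^ 2) 1 ∂ν) ^ 2 := by
  have h1 : r * ‖truncDrift a ν r‖ ≤ ‖a‖ + ∫ y, min (‖y‖ ^ 2) 1 ∂ν :=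
    (norm_truncDrift_le hν hr).trans (by nlinarith [norm_nonneg a])
  calc r ^ 4 * ‖truncDrift a ν r‖ ^ 2 = r ^ 2 * (r * ‖truncDrift a ν r‖) ^ 2 := by ring
    _ ≤ _ := by gcongr

lemma tendsto_sq_mul (c : ℝ) : Tendsto (fun r : ℝ ↦ r ^ 2 * c) (𝓝[>] 0) (𝓝 0) := by
  have : Tendsto (fun r : ℝ ↦ r ^ 2 * c) (𝓝 0) (𝓝 (0 ^ 2 * c)) :=
    (by fun_prop : Continuous fun r : ℝ ↦ r ^ 2 * c).tendsto 0
  rw [zero_pow two_ne_zero, zero_mul] at this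
  exact this.mono_left nhdsWithin_le_nhds

lemma eventually_isGoodStep (hν : TruncSqIntegrable ν) :
    ∀ᶠ r in 𝓝[>] (0 : ℝ), IsGoodStep a ν r := by
  filter_upwards [(tendsto_sq_mul (∫ y, min (‖y‖ ^ 2) 1 ∂ν)).eventually_le_const
      (by norm_num : (0 : ℝ) < 1 / 4),
    (tendsto_sq_mul ((‖a‖ + ∫ y, min (‖y‖ ^ 2) 1 ∂ν) ^ 2)).eventually_le_const
      (by norm_num : (0 : ℝ) < 1 / 4), Ioc_mem_nhdsGT (zero_lt_one (α := ℝ))] with r h1 h2 hr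
  refine ⟨hr.1, le_trans ?_ h1, by linarith [drift_le (a := a) hν hr.1 hr.2]⟩
  have := mul_le_mul_of_nonneg_left (toReal_measure_lt_norm_le hν hr.1 hr.2) (sq_nonneg r)
  linarith

lemma tendsto_stepError (hν : TruncSqIntegrable ν) {η : ℝ} (hη : 0 < η) :
    Tendsto (fun r ↦ stepError a w ν η r (r ^ 4)) (𝓝[>] 0) (𝓝 0) := by
  have h1 : Tendsto (fun r ↦ 4 * (r ^ 4 * ‖truncDrift a ν r‖ ^ 2)) (𝓝[>] 0) (𝓝 (4 * 0)) := by
    refine Tendsto.const_mul _ (squeeze_zero' (Eventually.of_forall fun r ↦ by positivity) ?_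
      (tendsto_sq_mul ((‖a‖ + ∫ y, min (‖y‖ ^ 2) 1 ∂ν) ^ 2)))
    filter_upwards [Ioc_mem_nhdsGT (zero_lt_one (α := ℝ))] with r hr using drift_le hν hr.1 hr.2
  have h2 : Tendsto (fun r : ℝ ↦ ∑ i, 2 * ‖√(2 * n * r ^ 4) • w i‖ ^ η * ‖w i‖ ^ 2) (𝓝[>] 0)
      (𝓝 0) := by
    have : Continuous fun r : ℝ ↦ ∑ i, 2 * ‖√(2 * n * r ^ 4) • w i‖ ^ η * ‖w i‖ ^ 2 :=
      continuous_finsetSum _ fun i _ ↦ (continuous_const.mul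
        (Continuous.rpow_const (by fun_prop) fun _ ↦ Or.inr hη.le)).mul continuous_const
    have h3 := (this.tendsto 0).mono_left (nhdsWithin_le_nhds (s := Set.Ioi 0))
    simpa [Real.zero_rpow hη.ne'] using h3
  have h3 : Tendsto (fun r ↦ 2 * ∫ y in {y : E | r < ‖y‖}ᶜ, min (‖y‖ ^ 2) 1 ∂ν) (𝓝[>] 0)
      (𝓝 (2 * 0)) := by
    refine Tendsto.const_mul _ ?_
    have e : (0 : ℝ) = ∫ _y : E, (0 : ℝ) ∂ν := by simp
    rw [show 𝓝 (0 : ℝ) = 𝓝 (∫ _y : E, (0 : ℝ) ∂ν) by rw [← e]]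
    simp only [← integral_indicator (measurableSet_lt_norm).compl]
    refine tendsto_integral_filter_of_dominated_convergence _ (Eventually.of_forall fun r ↦
      hν.aestronglyMeasurable.indicator measurableSet_lt_norm.compl)
      (Eventually.of_forall fun r ↦ ae_of_all _ fun y ↦ ?_) hν (ae_of_all _ fun y ↦ ?_)
    · refine (norm_indicator_le_norm_self _ _).trans_eq (Real.norm_of_nonneg (by positivity))
    · refine tendsto_const_nhds.congr' ?_
      rcases eq_or_ne y 0 with rfl | hy
      · refine Eventually.of_forall fun r ↦ ?_
        simp [Set.indicator_apply]
      · filter_upwards [Ioo_mem_nhdsGT (norm_pos_iff.2 hy)] with r hr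
        rw [Set.indicator_of_notMem]
        simpa using hr.2
  have h4 := (h1.add h2).add h3
  simpa [stepError] using h4

/-- Convolution powers. -/
noncomputable def convPow (μ : Measure E) : ℕ → Measure E
  | 0 => Measure.dirac 0
  | k + 1 => convPow μ k ∗ μ

lemma isProbabilityMeasure_convPow (μ : Measure E) [IsProbabilityMeasure μ] (k : ℕ) :
    IsProbabilityMeasure (convPow μ k) := by
  induction k with
  | zero => exact Measure.dirac.isProbabilityMeasure
  | succ k ih => rw [convPow]; infer_instance

lemma charFun_convPow (μ : Measure E) [IsProbabilityMeasure μ] (k : ℕ) (u : E) :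
    charFun (convPow μ k) u = charFun μ u ^ k := by
  induction k with
  | zero => simp [convPow, charFun_dirac]
  | succ k ih =>
    have := isProbabilityMeasure_convPow μ k
    rw [convPow, charFun_conv, ih, pow_succ]

/-- Telescoping: if one step of a walk acts as `1 + h g` up to `e`, and the walk changes `g` by at
most `ω`, then `k` steps act as `1 + k h g` up to `k (e + h ω)`. -/
lemma abs_avg_convPow_sub_le {μ : Measure E} [IsProbabilityMeasure μ] {G h e ω : ℝ}
    (hf : Measurable f) (hA : ∀ x, |f x| ≤ A) (hg : Measurable g) (hG : ∀ x, |g x| ≤ G)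
    (hh : 0 ≤ h) (hstep : ∀ x, |avg μ f x - f x - h * g x| ≤ e) (k : ℕ)
    (hω : ∀ j < k, ∀ x, |avg (convPow μ j) g x - g x| ≤ ω) (x : E) :
    |avg (convPow μ k) f x - f x - k * h * g x| ≤ k * (e + h * ω) := by
  induction k generalizing x with
  | zero => simp [convPow, avg]
  | succ k ih =>
    have := isProbabilityMeasure_convPow μ k
    have e1 : avg (convPow μ k) (fun y ↦ avg μ f y - f y - h * g y) x
        = avg (convPow μ (k + 1)) f x - avg (convPow μ k) f x - h * avg (convPow μ k) g x := by
      rw [convPow, avg_conv hf hA, avg_sub (f := fun y ↦ avg μ f y - f y)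
        ((measurable_avg hf).sub hf) (A := A + A)
        (fun y ↦ (abs_sub _ _).trans (add_le_add (abs_avg_le hA y) (hA y))) (hg.const_mul h)
        (B := |h| * G) (fun y ↦ by rw [abs_mul]; gcongr; exact hG y),
        avg_sub (measurable_avg hf) (abs_avg_le hA) hf hA, avg_const_mul]
    have h1 := abs_le.1 (e1 ▸ abs_avg_le (m := convPow μ k) hstep x)
    have h2 := abs_le.1 (ih (fun j hj ↦ hω j (by omega)) x)
    have h3 : |h * (avg (convPow μ k) g x - g x)| ≤ h * ω := by
      rw [abs_mul, abs_of_nonneg hh]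
      exact mul_le_mul_of_nonneg_left (hω k (by omega) x) hh
    rw [abs_le] at *
    push_cast
    constructor <;> linarith [h1.1, h1.2, h2.1, h2.2, h3.1, h3.2]

/-- The real part of a phase-shifted exponential. -/
noncomputable def cosFun (u : E) (θ : ℝ) (x : E) : ℝ := Real.cos (inner ℝ u x + θ)

lemma hasFDerivAt_cosFun (u : E) (θ : ℝ) (x : E) :
    HasFDerivAt (cosFun u θ) (cosFun u (θ + Real.pi / 2) x • innerSL ℝ u) x := by
  have h := ((innerSL ℝ u).hasFDerivAt (x := x).add_const θ).cos
  refine h.congr_fderiv ?_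
  rw [cosFun, ← add_assoc, Real.cos_add_pi_div_two]
  rfl

lemma fderiv_cosFun (u : E) (θ : ℝ) :
    fderiv ℝ (cosFun u θ) = fun x ↦ cosFun u (θ + Real.pi / 2) x • innerSL ℝ u :=
  funext fun x ↦ (hasFDerivAt_cosFun u θ x).fderiv

lemma fderiv_fderiv_cosFun (u : E) (θ : ℝ) (x : E) : fderiv ℝ (fderiv ℝ (cosFun u θ)) x
    = (cosFun u (θ + Real.pi / 2 + Real.pi / 2) x • innerSL ℝ u).smulRight (innerSL ℝ u) := by
  rw [fderiv_cosFun]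
  exact ((hasFDerivAt_cosFun u _ x).smul_const (innerSL ℝ u)).fderiv

lemma hasC2Bound_cosFun (u : E) (θ : ℝ) {A : ℝ} (h1 : 1 ≤ A) (h2 : ‖u‖ ≤ A) (h3 : ‖u‖ ^ 2 ≤ A) :
    HasC2Bound (cosFun u θ) A := by
  have hc : ∀ θ x, |cosFun u θ x| ≤ 1 := fun _ _ ↦ Real.abs_cos_le_one _
  refine ⟨Real.contDiff_cos.comp ((innerSL ℝ u).contDiff.add contDiff_const),
    fun x ↦ (hc _ _).trans h1, fun x ↦ ?_, fun x ↦ ?_⟩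
  · rw [fderiv_cosFun, norm_smul, innerSL_apply_norm]
    exact (mul_le_of_le_one_left (norm_nonneg _) (hc _ _)).trans h2
  · rw [fderiv_fderiv_cosFun, ContinuousLinearMap.norm_smulRight_apply, norm_smul,
      innerSL_apply_norm, mul_assoc, ← sq]
    exact (mul_le_of_le_one_left (by positivity) (hc _ _)).trans h3

lemma hasC2Holder_cosFun (u : E) (θ : ℝ) : HasC2Holder (cosFun u θ) ((1 + ‖u‖) ^ 3) 1 := by
  have h0 := norm_nonneg u
  have hb := hasC2Bound_cosFun u θ (A := (1 + ‖u‖) ^ 3)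
    (by nlinarith [pow_nonneg h0 2, pow_nonneg h0 3])
    (by nlinarith [pow_nonneg h0 2, pow_nonneg h0 3]) (by nlinarith [pow_nonneg h0 3])
  refine hb.hasC2Holder one_pos le_rfl fun x h ↦ ?_
  have h1 := abs_incr_le_of_fderiv (F := cosFun u (θ + Real.pi / 2 + Real.pi / 2)) (c := ‖u‖)
    (fun x ↦ (hasFDerivAt_cosFun _ _ x).differentiableAt) (fun x ↦ by
      rw [fderiv_cosFun, norm_smul, innerSL_apply_norm]
      exact mul_le_of_le_one_left h0 (Real.abs_cos_le_one _)) x h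
  have e : fderiv ℝ (fderiv ℝ (cosFun u θ)) (x + h) - fderiv ℝ (fderiv ℝ (cosFun u θ)) x
      = (incr h (cosFun u (θ + Real.pi / 2 + Real.pi / 2)) x • innerSL ℝ u).smulRight
        (innerSL ℝ u) := by
    rw [fderiv_fderiv_cosFun, fderiv_fderiv_cosFun]
    ext v z
    simp [incr]; ring
  rw [e, ContinuousLinearMap.norm_smulRight_apply, norm_smul, innerSL_apply_norm, Real.rpow_one]
  calc _ ≤ ‖u‖ * ‖h‖ * ‖u‖ * ‖u‖ := by gcongr; exact h1
    _ = ‖u‖ ^ 3 * ‖h‖ := by ring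
    _ ≤ _ := by gcongr; linarith

lemma charFun_eq_avg_cosFun (μ : Measure E) [IsProbabilityMeasure μ] (u : E) :
    charFun μ u = avg μ (cosFun u 0) 0 + avg μ (cosFun u (-(Real.pi / 2))) 0 * Complex.I := by
  have hi : ∀ θ, Integrable (fun y ↦ ((cosFun u θ (0 + y) : ℝ) : ℂ)) μ := fun θ ↦ by
    exact (integrable_translate (f := cosFun u θ) (A := 1) (hasC2Holder_cosFun u θ).1.measurable
      (fun _ ↦ Real.abs_cos_le_one _) 0).ofReal
  simp only [charFun_apply, avg]
  rw [← integral_complex_ofReal, ← integral_complex_ofReal, ← integral_mul_const,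
    ← integral_add (hi _) ((hi _).mul_const _)]
  refine integral_congr_ae (ae_of_all _ fun y ↦ ?_)
  simp only [cosFun, add_zero, zero_add, ← sub_eq_add_neg, Real.cos_sub_pi_div_two,
    real_inner_comm y u]
  rw [Complex.exp_mul_I, Complex.ofReal_cos, Complex.ofReal_sin]

/-- `m` moves functions by at most `c` times their `C²` norm. -/
def MovesC2 (m : Measure E) (c : ℝ) : Prop := ∀ f A, HasC2Bound f A → ∀ x, |avg m f x - f x| ≤ c * A

lemma MovesC2.norm_one_sub_charFun_le {m : Measure E} [IsProbabilityMeasure m] {c : ℝ}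
    (hm : MovesC2 m c) (u : E) : ‖1 - charFun m u‖ ≤ 2 * c * (1 + ‖u‖ ^ 2) := by
  have h : ∀ θ, ‖((avg m (cosFun u θ) 0 - cosFun u θ 0 : ℝ) : ℂ)‖ ≤ c * (1 + ‖u‖ ^ 2) := fun θ ↦ by
    rw [Complex.norm_real]
    exact hm _ _ (hasC2Bound_cosFun u θ (by nlinarith) (by nlinarith [sq_nonneg (‖u‖ - 1)])
      (by linarith)) 0
  have e : 1 - charFun m u = -(((avg m (cosFun u 0) 0 - cosFun u 0 0 : ℝ) : ℂ)
      + ((avg m (cosFun u (-(Real.pi / 2))) 0 - cosFun u (-(Real.pi / 2)) 0 : ℝ) : ℂ)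
        * Complex.I) := by
    rw [charFun_eq_avg_cosFun]
    simp [cosFun]
    ring
  rw [e, norm_neg]
  refine (norm_add_le _ _).trans ?_
  rw [norm_mul, Complex.norm_I, mul_one]
  linarith [h 0, h (-(Real.pi / 2))]

lemma MovesC2.integral_min_sq_le {m : Measure E} [IsProbabilityMeasure m] {c : ℝ}
    (hm : MovesC2 m c) : ∫ y, min (‖y‖ ^ 2) 1 ∂m ≤ truncConst E * (2 * c) :=
  LevyEuler.integral_min_sq_le hm.norm_one_sub_charFun_le

lemma IsGoodStep.isProbabilityMeasure {r : ℝ} (h : IsGoodStep a ν r) (hn : 0 < n)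
    (hν : TruncSqIntegrable ν) :
    IsProbabilityMeasure (stepMeasure a w ν r (r ^ 4)) :=
  isProbabilityMeasure_stepMeasure hn hν h.pos (pow_pos h.pos 4) h.mass

lemma IsGoodStep.movesC2_convPow {r : ℝ} (h : IsGoodStep a ν r) (hn : 0 < n)
    (hν : TruncSqIntegrable ν) (k : ℕ) :
    MovesC2 (convPow (stepMeasure a w ν r (r ^ 4)) k) (k * r ^ 4 * genConst a w ν) := by
  intro f A hf x
  have := h.isProbabilityMeasure (w := w) hn hν
  have h0 := abs_avg_stepMeasure_sub_le (w := w) hn hν h.pos (pow_pos h.pos 4) h.mass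
    (by linarith [h.drift]) hf
  have h1 := abs_avg_convPow_sub_le (μ := stepMeasure a w ν r (r ^ 4)) (g := fun _ ↦ 0) (G := 0)
    (ω := 0) hf.measurable hf.zero measurable_const (fun _ ↦ by simp) (pow_pos h.pos 4).le
    (fun x ↦ by rw [mul_zero, sub_zero]; exact h0 x) k (fun _ _ _ ↦ by simp [avg]) x
  simp only [mul_zero, sub_zero, add_zero] at h1
  exact h1.trans_eq (by ring)

/-- The generator maps functions with Hölder second derivatives to Hölder functions. -/
lemma HasC2Holder.abs_levyGen_sub_le {η : ℝ} (hf : HasC2Holder f A η)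
    (hν : TruncSqIntegrable ν) (x y : E) :
    |levyGen a w ν f (x + y) - levyGen a w ν f x| ≤ genConst a w ν * (2 * A * min (‖y‖ ^ η) 1) := by
  have := (hf.2 y).abs_levyGen_le (a := a) (w := w) hν x
  rwa [hf.1.levyGen_incr hν] at this

lemma HasC2Holder.continuous_levyGen {η : ℝ} (hη : 0 < η) (hf : HasC2Holder f A η)
    (hν : TruncSqIntegrable ν) : Continuous (levyGen a w ν f) := by
  refine continuous_iff_continuousAt.2 fun x ↦ ?_
  rw [ContinuousAt, tendsto_iff_norm_sub_tendsto_zero]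
  have h1 : Continuous fun z ↦ genConst a w ν * (2 * A * ‖z - x‖ ^ η) :=
    continuous_const.mul (continuous_const.mul
      (Continuous.rpow_const (by fun_prop) fun _ ↦ Or.inr hη.le))
  have h2 := h1.tendsto x
  simp only [sub_self, norm_zero, Real.zero_rpow hη.ne', mul_zero] at h2
  refine squeeze_zero (fun _ ↦ norm_nonneg _) (fun z ↦ ?_) h2
  have h3 := hf.abs_levyGen_sub_le (a := a) (w := w) hν x (z - x)
  rw [add_sub_cancel] at h3
  have hA := hf.1.nonneg
  have hG := genConst_nonneg (a := a) (w := w) (ν := ν)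
  exact h3.trans (by gcongr; exact min_le_left _ _)

/-- A measure that moves functions in `C²` by `c` moves the generator of a function with Hölder
second derivatives by a power of `c`. -/
lemma HasC2Holder.abs_avg_levyGen_sub_le {η : ℝ} (hη : 0 < η) (hη2 : η ≤ 2)
    (hf : HasC2Holder f A η) (hν : TruncSqIntegrable ν) {m : Measure E}
    [IsProbabilityMeasure m] {c : ℝ} (hm : MovesC2 m c) (x : E) :
    |avg m (levyGen a w ν f) x - levyGen a w ν f x|
      ≤ genConst a w ν * (2 * A * (truncConst E * (2 * c)) ^ (η / 2)) := by
  have hg := hf.continuous_levyGen (a := a) (w := w) hη hν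
  have hA := hf.1.nonneg
  have hG := genConst_nonneg (a := a) (w := w) (ν := ν)
  rw [avg_sub_const hg.measurable (hf.1.abs_levyGen_le hν), ← Real.norm_eq_abs]
  refine (norm_integral_le_of_norm_le
    (((integrable_min_norm_rpow (m := m) η).const_mul _).const_mul _)
    (ae_of_all _ fun y ↦ hf.abs_levyGen_sub_le hν x y)).trans ?_
  rw [integral_const_mul, integral_const_mul]
  gcongr
  exact integral_min_rpow_le hη hη2 hm.integral_min_sq_le

/-- The logarithm of the characteristic function of the Lévy process at time one, as the
generator applied to an exponential. -/
noncomputable def levyExponent (a : E) (w : Fin n → E) (ν : Measure E) (u : E) : ℂ :=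
  levyGen a w ν (cosFun u 0) 0 + levyGen a w ν (cosFun u (-(Real.pi / 2))) 0 * Complex.I

lemma IsGoodStep.norm_charFun_sub_le {r : ℝ} (h : IsGoodStep a ν r) (hn : 0 < n)
    (hν : TruncSqIntegrable ν) (u : E) :
    ‖charFun (stepMeasure a w ν r (r ^ 4)) u - 1 - (r ^ 4 : ℝ) * levyExponent a w ν u‖
      ≤ r ^ 4 * (2 * (1 + ‖u‖) ^ 3 * stepError a w ν 1 r (r ^ 4)) := by
  have := h.isProbabilityMeasure (w := w) hn hν
  set K := stepMeasure a w ν r (r ^ 4)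
  have k : ∀ θ,
      ‖((avg K (cosFun u θ) 0 - cosFun u θ 0 - r ^ 4 * levyGen a w ν (cosFun u θ) 0 : ℝ) : ℂ)‖
      ≤ r ^ 4 * ((1 + ‖u‖) ^ 3 * stepError a w ν 1 r (r ^ 4)) := fun θ ↦ by
    rw [Complex.norm_real]
    exact abs_avg_stepMeasure_sub_sub_le one_pos hn hν h.pos (pow_pos h.pos 4) h.mass
      (hasC2Holder_cosFun u θ) 0
  have e : charFun K u - 1 - (r ^ 4 : ℝ) * levyExponent a w ν u
      = ((avg K (cosFun u 0) 0 - cosFun u 0 0 - r ^ 4 * levyGen a w ν (cosFun u 0) 0 : ℝ) : ℂ)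
      + ((avg K (cosFun u (-(Real.pi / 2))) 0 - cosFun u (-(Real.pi / 2)) 0
        - r ^ 4 * levyGen a w ν (cosFun u (-(Real.pi / 2))) 0 : ℝ) : ℂ) * Complex.I := by
    rw [charFun_eq_avg_cosFun, levyExponent]
    simp [cosFun]
    ring
  rw [e]
  refine (norm_add_le _ _).trans ?_
  rw [norm_mul, Complex.norm_I, mul_one]
  linarith [k 0, k (-(Real.pi / 2))]

/-- The truncation level for which the random walk reaches time `t` after `k` steps. -/
noncomputable def truncLevel (t : ℝ) (k : ℕ) : ℝ := √√(t / k)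

lemma mul_truncLevel_pow {t : ℝ} (ht : 0 ≤ t) {k : ℕ} (hk : 0 < k) :
    k * truncLevel t k ^ 4 = t := by
  have hk' : (0 : ℝ) < k := by exact_mod_cast hk
  rw [truncLevel, show 4 = 2 * 2 from rfl, pow_mul, Real.sq_sqrt (Real.sqrt_nonneg _),
    Real.sq_sqrt (by positivity)]
  field_simp

lemma tendsto_truncLevel {t : ℝ} (ht : 0 < t) : Tendsto (truncLevel t) atTop (𝓝[>] 0) := by
  refine tendsto_nhdsWithin_iff.2 ⟨?_, ?_⟩
  · have h1 : Tendsto (fun k : ℕ ↦ t / (k : ℝ)) atTop (𝓝 0) :=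
      tendsto_const_div_atTop_nhds_zero_nat t
    have h2 : Continuous fun s : ℝ ↦ √√s := by fun_prop
    have h3 := (h2.tendsto 0).comp h1
    rwa [Real.sqrt_zero, Real.sqrt_zero] at h3
  · filter_upwards [eventually_gt_atTop 0] with k hk
    have hk' : (0 : ℝ) < k := by exact_mod_cast hk
    rw [Set.mem_Ioi, truncLevel]
    positivity

/-- The random walk after `k` steps, at time `t`. -/
noncomputable def walk (a : E) (w : Fin n → E) (ν : Measure E) (t : ℝ) (k : ℕ) : Measure E :=
  convPow (stepMeasure a w ν (truncLevel t k) (truncLevel t k ^ 4)) k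

lemma eventually_isGoodStep_truncLevel {t : ℝ} (ht : 0 < t) (hν : TruncSqIntegrable ν) :
    ∃ N, ∀ k, IsGoodStep a ν (truncLevel t (k + N)) := by
  obtain ⟨N, hN⟩ := eventually_atTop.1
    ((tendsto_truncLevel ht).eventually (eventually_isGoodStep (a := a) hν))
  exact ⟨N, fun k ↦ hN _ (by omega)⟩

lemma tendsto_charFun_walk {t : ℝ} (ht : 0 < t) (hn : 0 < n) (hν : TruncSqIntegrable ν) (u : E) :
    Tendsto (fun k ↦ charFun (walk a w ν t k) u) atTop
      (𝓝 (Complex.exp (t * levyExponent a w ν u))) := by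
  have hgood := (tendsto_truncLevel ht).eventually (eventually_isGoodStep (a := a) hν)
  have h1 : Tendsto (fun k : ℕ ↦ (k : ℂ) * (charFun (stepMeasure a w ν (truncLevel t k)
      (truncLevel t k ^ 4)) u - 1)) atTop (𝓝 (t * levyExponent a w ν u)) := by
    rw [tendsto_iff_norm_sub_tendsto_zero]
    have h2 : Tendsto (fun k ↦ t * (2 * (1 + ‖u‖) ^ 3 *
        stepError a w ν 1 (truncLevel t k) (truncLevel t k ^ 4))) atTop
        (𝓝 (t * (2 * (1 + ‖u‖) ^ 3 * 0))) :=
      (((tendsto_stepError hν one_pos).comp (tendsto_truncLevel ht)).const_mul _).const_mul _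
    simp only [mul_zero] at h2
    refine squeeze_zero' (Eventually.of_forall fun _ ↦ norm_nonneg _) ?_ h2
    filter_upwards [hgood, eventually_gt_atTop 0] with k hk hk0
    have h3 := mul_le_mul_of_nonneg_left (hk.norm_charFun_sub_le (w := w) hn hν u)
      (Nat.cast_nonneg (α := ℝ) k)
    have h4 := mul_truncLevel_pow ht.le hk0
    rw [← mul_assoc, h4, ← Complex.norm_natCast, ← norm_mul] at h3
    refine le_trans (le_of_eq ?_) h3
    congr 1
    have h5 : (t : ℂ) = k * ((truncLevel t k ^ 4 : ℝ) : ℂ) := by exact_mod_cast h4.symm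
    rw [h5]; ring
  refine (Complex.tendsto_one_add_pow_exp_of_tendsto h1).congr' ?_
  filter_upwards [hgood] with k hk
  have := hk.isProbabilityMeasure (w := w) hn hν
  rw [walk, charFun_convPow, add_sub_cancel]

/-- The random walks, with the first few dropped so that the others are probability measures. -/
lemma exists_walk_tendsto {t : ℝ} (ht : 0 < t) (hn : 0 < n) (hν : TruncSqIntegrable ν) :
    ∃ (N : ℕ) (K : ℕ → ProbabilityMeasure E), (∀ k, IsGoodStep a ν (truncLevel t (k + N))) ∧
      (∀ k, (K k : Measure E) = walk a w ν t (k + N)) ∧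
      ∀ u, Tendsto (fun k ↦ charFun (K k : Measure E) u) atTop
        (𝓝 (Complex.exp (t * levyExponent a w ν u))) := by
  obtain ⟨N, hN⟩ := eventually_isGoodStep_truncLevel (a := a) ht hν
  refine ⟨N, fun k ↦ ⟨walk a w ν t (k + N), ?_⟩, hN, fun k ↦ rfl, fun u ↦ ?_⟩
  · have := (hN k).isProbabilityMeasure (w := w) hn hν
    exact isProbabilityMeasure_convPow _ _
  · exact (tendsto_add_atTop_iff_nat N).2 (tendsto_charFun_walk ht hn hν u)

lemma tendsto_avg_of_tendsto_charFun {K : ℕ → ProbabilityMeasure E} {m : Measure E}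
    [hm : IsProbabilityMeasure m]
    (h : ∀ u, Tendsto (fun k ↦ charFun (K k : Measure E) u) atTop (𝓝 (charFun m u)))
    (hf : Continuous f) (hA : ∀ x, |f x| ≤ A) (x : E) :
    Tendsto (fun k ↦ avg (K k) f x) atTop (𝓝 (avg m f x)) := by
  have h1 : Tendsto K atTop (𝓝 (⟨m, hm⟩ : ProbabilityMeasure E)) :=
    ProbabilityMeasure.tendsto_iff_tendsto_charFun.2 h
  exact ProbabilityMeasure.tendsto_iff_forall_integral_tendsto.1 h1
    (BoundedContinuousFunction.ofNormedAddCommGroup (fun y ↦ f (x + y)) (by fun_prop) A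
      fun y ↦ hA _)

variable {m : Measure E} [IsProbabilityMeasure m] {t : ℝ}

/-- The law of the Lévy process moves functions by at most `t` times their `C²` norm. -/
lemma movesC2_of_charFun (ht : 0 < t) (hn : 0 < n) (hν : TruncSqIntegrable ν)
    (hm : ∀ u, charFun m u = Complex.exp (t * levyExponent a w ν u)) :
    MovesC2 m (t * genConst a w ν) := by
  intro f A hf x
  obtain ⟨N, K, hgood, hK, hlim⟩ := exists_walk_tendsto (a := a) (w := w) ht hn hν
  simp only [← hm] at hlim
  refine le_of_tendsto ((tendsto_avg_of_tendsto_charFun hlim hf.contDiff.continuous hf.zero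
    x).sub_const (f x)).abs ?_
  filter_upwards [eventually_gt_atTop 0] with k hk
  have h1 := (hgood k).movesC2_convPow (w := w) hn hν (k + N) f A hf x
  rwa [mul_truncLevel_pow ht.le (by omega), ← walk, ← hK] at h1

/-- The generator is the derivative at zero of the semigroup, with a rate. -/
theorem abs_avg_sub_sub_levyGen_le (ht : 0 < t) (hn : 0 < n) (hν : TruncSqIntegrable ν)
    (hm : ∀ u, charFun m u = Complex.exp (t * levyExponent a w ν u)) {η : ℝ} (hη : 0 < η)
    (hη2 : η ≤ 2) (hf : HasC2Holder f A η) (x : E) :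
    |avg m f x - f x - t * levyGen a w ν f x| ≤ t * (genConst a w ν *
      (2 * A * (truncConst E * (2 * (t * genConst a w ν))) ^ (η / 2))) := by
  have hA := hf.1.nonneg
  have hG := genConst_nonneg (a := a) (w := w) (ν := ν)
  have hT := truncConst_nonneg (E := E)
  obtain ⟨N, K, hgood, hK, hlim⟩ := exists_walk_tendsto (a := a) (w := w) ht hn hν
  simp only [← hm] at hlim
  set q := genConst a w ν * (2 * A * (truncConst E * (2 * (t * genConst a w ν))) ^ (η / 2)) with hq
  have h1 : Tendsto (fun k ↦ t * (A * stepError a w ν η (truncLevel t (k + N))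
      (truncLevel t (k + N) ^ 4) + q)) atTop (𝓝 (t * (A * 0 + q))) :=
    ((((tendsto_stepError hν hη).comp ((tendsto_truncLevel ht).comp
      (tendsto_add_atTop_nat N))).const_mul A).add_const q).const_mul t
  rw [mul_zero, zero_add] at h1
  refine le_of_tendsto_of_tendsto ((((tendsto_avg_of_tendsto_charFun hlim
    hf.1.contDiff.continuous hf.1.zero x).sub_const (f x)).sub_const _).abs) h1 ?_
  filter_upwards [eventually_gt_atTop 0] with k hk
  have hr := hgood k
  have := hr.isProbabilityMeasure (w := w) hn hν
  set r := truncLevel t (k + N)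
  have hkr : ((k + N : ℕ) : ℝ) * r ^ 4 = t := mul_truncLevel_pow ht.le (by omega)
  have h2 := abs_avg_convPow_sub_le (μ := stepMeasure a w ν r (r ^ 4)) (g := levyGen a w ν f)
    hf.1.measurable hf.1.zero (hf.continuous_levyGen hη hν).measurable
    (hf.1.abs_levyGen_le hν) (pow_pos hr.pos 4).le
    (abs_avg_stepMeasure_sub_sub_le hη hn hν hr.pos (pow_pos hr.pos 4) hr.mass hf) (k + N)
    (ω := q) (fun j hj x ↦ ?_) x
  · rw [hkr, ← walk.eq_1 a w ν t, ← hK] at h2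
    refine h2.trans_eq ?_
    rw [← mul_add, ← mul_assoc, hkr]
  · have := isProbabilityMeasure_convPow (stepMeasure a w ν r (r ^ 4)) j
    refine (hf.abs_avg_levyGen_sub_le hη hη2 hν (hr.movesC2_convPow hn hν j) x).trans ?_
    rw [hq]
    gcongr
    rw [← hkr]
    gcongr

end Walk

/-! ### Lévy processes with a non-degenerate Gaussian part -/

section Existence

variable {E : Type*} [NormedAddCommGroup E] [InnerProductSpace ℝ E] [FiniteDimensional ℝ E]
  [MeasurableSpace E] [BorelSpace E] {f : E → ℝ} {n : ℕ} {a : E} {w : Fin n → E} {ν : Measure E}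

lemma levyExponent_eq (u : E) : levyExponent a w ν u = (∫ y, jumpTerm (cosFun u 0) 0 y ∂ν : ℝ)
      + (∫ y, jumpTerm (cosFun u (-(Real.pi / 2))) 0 y ∂ν : ℝ) * Complex.I
      + (inner ℝ u a : ℝ) * Complex.I - 1 / 2 * (∑ i, inner ℝ u (w i) ^ 2 : ℝ) := by
  have h1 : fderiv ℝ (cosFun u 0) 0 a = 0 := by simp [fderiv_cosFun, cosFun]
  have h2 : fderiv ℝ (cosFun u (-(Real.pi / 2))) 0 a = inner ℝ u a := by
    simp [fderiv_cosFun, cosFun]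
  have h3 : ∀ v, fderiv ℝ (fderiv ℝ (cosFun u 0)) 0 v v = -inner ℝ u v ^ 2 := fun v ↦ by
    simp [fderiv_fderiv_cosFun, cosFun, sq]
  have h4 : ∀ v, fderiv ℝ (fderiv ℝ (cosFun u (-(Real.pi / 2)))) 0 v v = 0 := fun v ↦ by
    simp [fderiv_fderiv_cosFun, cosFun]
  unfold levyExponent levyGen
  simp only [h1, h2, h3, h4, Finset.sum_neg_distrib, Finset.sum_const_zero]
  push_cast
  ring

/-- Convergence of characteristic functions to a function that is continuous at zero gives a
limiting probability measure. -/
lemma exists_charFun_eq_of_tendsto {K : ℕ → ProbabilityMeasure E} {φ : E → ℂ}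
    (hφ : ContinuousAt φ 0)
    (h : ∀ u, Tendsto (fun k ↦ charFun (K k : Measure E) u) atTop (𝓝 (φ u))) :
    ∃ m : Measure E, IsProbabilityMeasure m ∧ ∀ u, charFun m u = φ u := by
  have ht : IsTightMeasureSet {((μ : ProbabilityMeasure E) : Measure E) | μ ∈ Set.range K} := by
    have := isTightMeasureSet_of_tendsto_charFun (μ := fun k ↦ (K k : Measure E)) hφ h
    convert this using 1
    ext μ; simp
  obtain ⟨m, -, hm⟩ := (isCompact_closure_of_isTightMeasureSet ht).ultrafilter_le_nhds
    ((Ultrafilter.of atTop).map K) (by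
      rw [le_principal_iff]
      exact Filter.mem_of_superset (Filter.image_mem_map Filter.univ_mem)
        (by rw [Set.image_univ]; exact subset_closure))
  have hm' : Tendsto K (Ultrafilter.of atTop : Ultrafilter ℕ) (𝓝 m) := hm
  refine ⟨m, inferInstance, fun u ↦ tendsto_nhds_unique
    (f := fun k ↦ charFun (K k : Measure E) u) (l := (Ultrafilter.of atTop : Ultrafilter ℕ)) ?_
    ((h u).mono_left (Ultrafilter.of_le _))⟩
  have hc : ∀ θ, Tendsto (fun k ↦ avg (K k) (cosFun u θ) 0)
      (Ultrafilter.of atTop : Ultrafilter ℕ) (𝓝 (avg m (cosFun u θ) 0)) := fun θ ↦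
    ProbabilityMeasure.tendsto_iff_forall_integral_tendsto.1 hm'
      (BoundedContinuousFunction.ofNormedAddCommGroup (fun y ↦ cosFun u θ (0 + y))
        ((hasC2Holder_cosFun u θ).1.contDiff.continuous.comp (continuous_const_add 0)) 1
        fun y ↦ Real.abs_cos_le_one _)
  simp only [charFun_eq_avg_cosFun]
  exact ((Complex.continuous_ofReal.tendsto _).comp (hc 0)).add
    (((Complex.continuous_ofReal.tendsto _).comp (hc _)).mul_const _)

/-- A Lévy process whose Gaussian part dominates an isotropic one has a regularizing Gaussian
factor. -/
lemma exists_eq_gaussMeasure_conv {m : Measure E} [IsProbabilityMeasure m] {t κ : ℝ} (ht : 0 < t)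
    (hκ : 0 < κ) (hν : TruncSqIntegrable ν)
    (hm : ∀ u, charFun m u = Complex.exp (t * levyExponent a w ν u)) {n' : ℕ} (hn' : 0 < n')
    {w' : Fin n' → E}
    (hw : ∀ u, ∑ i, inner ℝ u (w i) ^ 2 = κ * ‖u‖ ^ 2 + ∑ i, inner ℝ u (w' i) ^ 2) :
    ∃ μ : Measure E, IsProbabilityMeasure μ ∧ m = gaussMeasure E (1 / (2 * κ * t)) ∗ μ := by
  have hsplit : ∀ u, t * levyExponent a w' ν u
      = t * levyExponent a w ν u + ((t * (κ * ‖u‖ ^ 2) / 2 : ℝ) : ℂ) := fun u ↦ by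
    rw [levyExponent_eq, levyExponent_eq, hw]; push_cast; ring
  obtain ⟨N, K, -, -, hlim⟩ := exists_walk_tendsto (a := a) (w := w') ht hn' hν
  have hcont : Continuous fun u ↦ Complex.exp (t * levyExponent a w' ν u) := by
    simp only [hsplit, Complex.exp_add, ← hm]
    exact continuous_charFun.mul (by fun_prop)
  obtain ⟨μ, hμ, hμc⟩ := exists_charFun_eq_of_tendsto hcont.continuousAt hlim
  have hb : 0 < 1 / (2 * κ * t) := by positivity
  have := isProbabilityMeasure_gaussMeasure (E := E) hb
  refine ⟨μ, hμ, Measure.ext_of_charFun ?_⟩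
  ext u
  rw [charFun_conv, charFun_gaussMeasure hb, hμc, hsplit, ← Complex.exp_add, hm]
  congr 1
  push_cast
  have : (t : ℂ) ≠ 0 := by exact_mod_cast ht.ne'
  have : (κ : ℂ) ≠ 0 := by exact_mod_cast hκ.ne'
  field_simp
  ring

lemma hasC2Holder_of_cNorm {η : ℝ} (hη : 0 < η) (hη1 : η ≤ 1) (h : cNorm (2 + η) f < ∞) :
    HasC2Holder f (cNorm (2 + η) f).toReal η := by
  have hC2 := hasC2Bound_of_cNorm (by linarith : 2 < 2 + η) h
  obtain ⟨h1, -, h3⟩ := bounds_of_cNorm_lt_top (by linarith : 0 < 2 + η) h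
  rw [holderOrder_two_add hη hη1] at h3
  refine hC2.hasC2Holder hη hη1 fun x v ↦ ?_
  have e : ‖fderiv ℝ (fderiv ℝ f) (x + v) - fderiv ℝ (fderiv ℝ f) x‖
      = ‖iteratedFDeriv ℝ 2 f (x + v) - iteratedFDeriv ℝ 2 f x‖ := by
    rw [← hC2.fderiv_fderiv_incr, ← norm_iteratedFDeriv_one, norm_iteratedFDeriv_fderiv,
      iteratedFDeriv_incr (by exact_mod_cast hC2.contDiff)]
  have h4 := h3 (x + v) x
  rw [add_sub_cancel_left] at h4
  rw [e]
  convert h4 using 3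
  push_cast; ring

/-- The constants in the three assumptions for a Lévy process with generator norm `G` and
Gaussian part at least `κ`. -/
noncomputable def gaussianPartConst (E : Type*) [NormedAddCommGroup E] [InnerProductSpace ℝ E]
    [FiniteDimensional ℝ E] [MeasurableSpace E] [BorelSpace E] (κ G : ℝ) : HConstants where
  grad := (2 ^ ((Module.finrank ℝ E : ℝ) / 2 + 1) * √(1 / (2 * κ))).toNNReal
  gen _ _ := (3 * G).toNNReal * (5 : ℕ)
  mom p _ := ((truncConst E * (2 * G)) ^ (p / 2)).toNNReal

theorem satisfiesHLaws_of_charFun {m : ℝ → Measure E} (hprob : ∀ t, IsProbabilityMeasure (m t))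
    (hn : 0 < n) (hν : TruncSqIntegrable ν)
    (hm : ∀ t, 0 < t → ∀ u, charFun (m t) u = Complex.exp (t * levyExponent a w ν u)) {n' : ℕ}
    (hn' : 0 < n') {w' : Fin n' → E} {κ : ℝ} (hκ : 0 < κ)
    (hw : ∀ u, ∑ i, inner ℝ u (w i) ^ 2 = κ * ‖u‖ ^ 2 + ∑ i, inner ℝ u (w' i) ^ 2) :
    SatisfiesHLaws m 2 2 (gaussianPartConst E κ (genConst a w ν)) := by
  set G := genConst a w ν with hGdef
  have hG : 0 ≤ G := genConst_nonneg (a := a) (w := w) (ν := ν)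
  have hT := truncConst_nonneg (E := E)
  refine ⟨fun f A hf hA t ht _ ↦ ?_, fun δ hδ ε hε f hfin ↦ ?_, fun p hp hp2 ε hε t ht ht1 ↦ ?_⟩
  · have := hprob t
    obtain ⟨μ, hμ, hdec⟩ := exists_eq_gaussMeasure_conv ht hκ hν (hm t ht) hn' hw
    have hb : 0 < 1 / (2 * κ * t) := by positivity
    have := isProbabilityMeasure_gaussMeasure (E := E) hb
    have e : avg (m t) f = avg (gaussMeasure E (1 / (2 * κ * t))) (avg μ f) := by
      ext x; rw [hdec, avg_conv hf hA]
    rw [e]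
    obtain ⟨h1, h2⟩ := differentiable_avg_gaussMeasure hb (measurable_avg (m := μ) hf)
      (abs_avg_le hA)
    refine ⟨h1, fun x ↦ (h2 x).trans_eq ?_⟩
    rw [gaussianPartConst, Real.coe_toNNReal _ (by positivity), Real.rpow_neg ht.le,
      ← Real.sqrt_eq_rpow, ← Real.sqrt_inv, mul_assoc _ √(1 / (2 * κ)),
      ← Real.sqrt_mul (by positivity)]
    congr 3
    field_simp
  · -- `η` is the Hölder exponent of the second derivatives that is used
    set η := min ((δ : ℝ) + ε) 1 with hη
    have hη0 : 0 < η := lt_min (by positivity) one_pos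
    have hη1 : η ≤ 1 := min_le_right _ _
    have hle : 2 + η ≤ 2 + δ + ε := by linarith [min_le_left ((δ : ℝ) + ε) 1]
    have hmono := cNorm_mono (by linarith : 0 < 2 + η) hle hfin
    rw [holderOrder_two_add hη0 hη1] at hmono
    have hfin' : cNorm (2 + η) f < ∞ := hmono.trans_lt (ENNReal.mul_lt_top (by simp) hfin)
    have hH := hasC2Holder_of_cNorm hη0 hη1 hfin'
    set A := (cNorm (2 + η) f).toReal with hAdef
    have hA : 0 ≤ A := ENNReal.toReal_nonneg
    have hgc := hH.continuous_levyGen (a := a) (w := w) hη0 hν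
    have hgb : ∀ x, |levyGen a w ν f x| ≤ G * A := hH.1.abs_levyGen_le hν
    refine ⟨levyGen a w ν f, fun ζ hζ ↦ ?_, ?_⟩
    · have hlim : Tendsto (fun t ↦ G * (2 * A * (truncConst E * (2 * (t * G))) ^ (η / 2)))
          (𝓝[>] (0 : ℝ)) (𝓝 0) := by
        have hc : Continuous fun t : ℝ ↦ G * (2 * A * (truncConst E * (2 * (t * G))) ^ (η / 2)) :=
          continuous_const.mul (continuous_const.mul
            (Continuous.rpow_const (by fun_prop) fun _ ↦ Or.inr (by positivity)))
        have := (hc.tendsto 0).mono_left (nhdsWithin_le_nhds (s := Set.Ioi 0))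
        simpa [Real.zero_rpow (by positivity : η / 2 ≠ 0)] using this
      filter_upwards [hlim.eventually_le_const hζ, self_mem_nhdsWithin] with t h1 ht x
      have := hprob t
      refine (abs_avg_sub_sub_levyGen_le ht hn hν (hm t ht) hη0 (by linarith) hH x).trans ?_
      rw [mul_comm ζ]
      exact mul_le_mul_of_nonneg_left h1 (le_of_lt ht)
    · have hfinal : cNorm (δ : ℝ) (levyGen a w ν f) ≤ ENNReal.ofReal (3 * G * A) := by
        interval_cases δ
        · rw [Nat.cast_zero]
          exact (cNorm_zero_le_ofReal hgc.measurable hgb).trans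
            (ENNReal.ofReal_le_ofReal (by nlinarith [mul_nonneg hG hA]))
        · have hη' : η = 1 := by rw [hη]; push_cast; exact min_eq_right (by linarith)
          rw [Nat.cast_one]
          refine (cNorm_one_le_of_bounds (c := G * (2 * A)) (by positivity) hgb
            fun x y ↦ ?_).trans_eq (by ring_nf)
          have h5 := hH.abs_levyGen_sub_le (a := a) (w := w) hν y (x - y)
          rw [add_sub_cancel, hη', Real.rpow_one] at h5
          rw [mul_assoc]
          exact h5.trans (by gcongr; exact min_le_left _ _)
      refine hfinal.trans ?_
      rw [ENNReal.ofReal_mul (by positivity), hAdef, ENNReal.ofReal_toReal hfin'.ne]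
      simp only [gaussianPartConst]
      push_cast
      rw [mul_assoc, ENNReal.ofReal]
      gcongr
      exact_mod_cast hmono
  · have hp2' : p < 2 := by
      rwa [← ENNReal.ofReal_ofNat, ENNReal.ofReal_lt_ofReal_iff (by norm_num)] at hp2
    have h1 := integral_min_rpow_le hp hp2'.le
      (movesC2_of_charFun ht hn hν (hm t ht)).integral_min_sq_le
    have e : truncConst E * (2 * (t * G)) = truncConst E * (2 * G) * t := by ring
    rw [← hGdef, e, Real.mul_rpow (by positivity) ht.le] at h1
    rw [gaussianPartConst, Real.coe_toNNReal _ (by positivity)]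
    exact h1.trans (mul_le_mul_of_nonneg_left
      (Real.rpow_le_rpow_of_exponent_ge ht ht1 (by linarith)) (by positivity))

end Existence

section Triplet

variable {d : ℕ} {Ω : Type*} {mΩ : MeasurableSpace Ω} {P : Measure Ω} [IsProbabilityMeasure P]
  {L : ℝ≥0 → Ω → EuclideanSpace ℝ (Fin d)} {a : EuclideanSpace ℝ (Fin d)}
  {Q : Matrix (Fin d) (Fin d) ℝ} {ν : Measure (EuclideanSpace ℝ (Fin d))}

lemma exists_sum_inner_sq (hQ : Q.PosSemidef) :
    ∃ (n : ℕ) (w : Fin n → EuclideanSpace ℝ (Fin d)), 0 < n ∧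
      ∀ u : EuclideanSpace ℝ (Fin d), dotProduct u.ofLp (Q.mulVec u.ofLp)
        = ∑ i, inner ℝ u (w i) ^ 2 := by
  obtain ⟨m, v, rfl⟩ := Matrix.posSemidef_iff_eq_sum_vecMulVec.1 hQ
  refine ⟨m + 1, Fin.cons 0 fun i ↦ WithLp.toLp 2 (v i), by omega, fun u ↦ ?_⟩
  rw [Fin.sum_univ_succ, Matrix.sum_mulVec, dotProduct_sum]
  simp only [Fin.cons_zero, inner_zero_right, Fin.cons_succ]
  rw [zero_pow two_ne_zero, zero_add]
  refine Finset.sum_congr rfl fun i _ ↦ ?_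
  rw [Matrix.vecMulVec_mulVec, EuclideanSpace.inner_eq_star_dotProduct]
  simp [sq, dotProduct_comm]

/-- A positive definite form dominates a multiple of the Euclidean norm, by compactness of the
sphere. -/
lemma exists_pos_mul_sq_le (hd : 1 ≤ d) (hQ : Q.PosDef) :
    ∃ κ : ℝ, 0 < κ ∧ (Q - κ • 1).PosSemidef := by
  have hne : Nonempty (Fin d) := ⟨⟨0, hd⟩⟩
  have hcont : Continuous fun u : EuclideanSpace ℝ (Fin d) ↦
      dotProduct u.ofLp (Q.mulVec u.ofLp) := by
    simp only [dotProduct, Matrix.mulVec]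
    fun_prop
  obtain ⟨u₀, hu₀, hmin⟩ := (isCompact_sphere (0 : EuclideanSpace ℝ (Fin d)) 1).exists_isMinOn
    (NormedSpace.sphere_nonempty.2 zero_le_one) hcont.continuousOn
  have hpos := (Matrix.posDef_iff_dotProduct_mulVec.1 hQ).2
  have hu₀' : u₀.ofLp ≠ 0 := fun h ↦ by
    have : u₀ = 0 := by ext i; simp [h]
    simp [this] at hu₀
  refine ⟨_, hpos hu₀', Matrix.posSemidef_iff_dotProduct_mulVec.2
    ⟨hQ.1.sub (by simp [Matrix.IsHermitian]), fun x ↦ ?_⟩⟩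
  rcases eq_or_ne x 0 with rfl | hx
  · simp
  set y : EuclideanSpace ℝ (Fin d) := WithLp.toLp 2 x with hy
  have hy0 : 0 < ‖y‖ := norm_pos_iff.2 fun h ↦ hx (by simpa [hy] using congrArg WithLp.ofLp h)
  have h1 := hmin (a := ‖y‖⁻¹ • y) (by simp [norm_smul, hy0.ne'])
  have h2 : dotProduct x x = ‖y‖ ^ 2 := by rw [EuclideanSpace.norm_sq_eq]; simp [dotProduct, hy, sq]
  simp only [Set.mem_ofPred_eq, WithLp.ofLp_smul, Matrix.mulVec_smul, dotProduct_smul,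
    smul_dotProduct, smul_eq_mul] at h1
  rw [Matrix.sub_mulVec, dotProduct_sub, Matrix.smul_mulVec, Matrix.one_mulVec, dotProduct_smul,
    star_trivial, star_trivial, h2, smul_eq_mul, sub_nonneg]
  calc _ ≤ (‖y‖⁻¹ * (‖y‖⁻¹ * (dotProduct x (Q.mulVec x)))) * ‖y‖ ^ 2 := by gcongr
    _ = _ := by field_simp

lemma HasTriplet.integrable_min (h : HasTriplet L P a Q ν) : TruncSqIntegrable ν := by
  refine ⟨(by fun_prop : Continuous fun y : EuclideanSpace ℝ (Fin d) ↦
    min (‖y‖ ^ 2) 1).aestronglyMeasurable, ?_⟩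
  rw [hasFiniteIntegral_iff_ofReal (ae_of_all _ fun y ↦ by positivity)]
  simpa only [min_comm] using h.integrable

/-- The symbol of the generating triplet in terms of the generator. -/
lemma symbol_eq_neg_levyExponent {n : ℕ} {w : Fin n → EuclideanSpace ℝ (Fin d)}
    (hν : TruncSqIntegrable ν)
    {u : EuclideanSpace ℝ (Fin d)}
    (hw : dotProduct u.ofLp (Q.mulVec u.ofLp) = ∑ i, inner ℝ u (w i) ^ 2) :
    symbol a Q ν u = -levyExponent a w ν u := by
  have hi : ∀ θ, Integrable (fun y ↦ ((jumpTerm (cosFun u θ) 0 y : ℝ) : ℂ)) ν := fun θ ↦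
    ((hasC2Holder_cosFun u θ).1.integrable_jumpTerm hν 0).ofReal
  have e : ∀ y, 1 - Complex.exp (Complex.I * (inner ℝ u y : ℝ))
        + Complex.I * (inner ℝ u y : ℝ) * (if ‖y‖ ≤ 1 then 1 else 0)
      = -((jumpTerm (cosFun u 0) 0 y : ℝ) + (jumpTerm (cosFun u (-(Real.pi / 2))) 0 y : ℝ)
        * Complex.I) := fun y ↦ by
    rw [mul_comm Complex.I, Complex.exp_mul_I]
    simp only [jumpTerm, fderiv_cosFun, cosFun, ← sub_eq_add_neg, Real.cos_sub_pi_div_two]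
    split_ifs <;> simp <;> ring
  rw [symbol, levyExponent_eq, hw]
  simp only [e]
  rw [integral_neg, integral_add (hi _) ((hi _).mul_const _), integral_mul_const,
    integral_complex_ofReal, integral_complex_ofReal, real_inner_comm]
  ring

/-- A Lévy process with a positive definite Gaussian part satisfies the three assumptions with both
parameters equal to `2`. -/
theorem HasTriplet.satisfiesH (hd : 1 ≤ d) (hL : IsLevyProcess L P) (h : HasTriplet L P a Q ν)
    (hQ : Q.PosDef) : SatisfiesH L P 2 2 := by
  obtain ⟨κ, hκ, hQ'⟩ := exists_pos_mul_sq_le hd hQ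
  obtain ⟨n, w, hn, hw⟩ := exists_sum_inner_sq hQ.posSemidef
  obtain ⟨n', w', hn', hw'⟩ := exists_sum_inner_sq hQ'
  refine ⟨_, (satisfiesHWith_iff hL.measurable).2 (satisfiesHLaws_of_charFun (a := a) (w := w)
    (ν := ν) (fun _ ↦ Measure.isProbabilityMeasure_map (hL.measurable _).aemeasurable) hn
    h.integrable_min (fun t ht u ↦ ?_) hn' (w' := w') hκ fun u ↦ ?_)⟩
  · rw [h.charFun_eq, symbol_eq_neg_levyExponent h.integrable_min (hw u), Real.coe_toNNReal _ ht.le]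
    congr 1; ring
  · have h2 : dotProduct u.ofLp u.ofLp = ‖u‖ ^ 2 := by
      rw [EuclideanSpace.norm_sq_eq]; simp [dotProduct, sq]
    rw [← hw, ← hw', Matrix.sub_mulVec, dotProduct_sub, Matrix.smul_mulVec, Matrix.one_mulVec,
      dotProduct_smul, h2, smul_eq_mul]
    ring

end Triplet

end LevyEuler

theorem mainTheorem8 (d : ℕ) (hd : 1 ≤ d) :
    -- (a) the sum of two independent Lévy processes
    (∀ (Ω : Type*) [MeasurableSpace Ω] (P : Measure Ω) [IsProbabilityMeasure P]
      (L₁ L₂ : ℝ≥0 → Ω → EuclideanSpace ℝ (Fin d)) (α₁ α₂ : ℝ) (α₁' α₂' : ℝ≥0∞),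
      0 < α₁ → α₁ ≤ α₂ → α₂ ≤ 2 → 0 < α₁' → 0 < α₂' →
      LevyEuler.IsLevyProcess L₁ P → LevyEuler.IsLevyProcess L₂ P →
      IndepFun (fun ω t ↦ L₁ t ω) (fun ω t ↦ L₂ t ω) P →
      LevyEuler.SatisfiesH L₁ P α₁ α₁' → LevyEuler.SatisfiesH L₂ P α₂ α₂' →
      LevyEuler.IsLevyProcess (fun t ω ↦ L₁ t ω + L₂ t ω) P ∧
      LevyEuler.SatisfiesH (fun t ω ↦ L₁ t ω + L₂ t ω) P α₂
        (min (α₁' * ENNReal.ofReal (α₂ / α₁)) α₂')) ∧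
    -- (b) rate for the sum of a Brownian motion and a standard stable process
    (∀ α c β p ε B : ℝ, 0 < α → α < 2 → 0 < c → 0 < β → 2 < p → 0 < ε →
      ∃ N : ℝ, 0 < N ∧
      ∀ (Ω : Type*) [MeasurableSpace Ω] (P : Measure Ω) [IsProbabilityMeasure P]
        (W Z : ℝ≥0 → Ω → EuclideanSpace ℝ (Fin d)),
        LevyEuler.IsBrownian W P → LevyEuler.IsStandardStable Z P α c →
        IndepFun (fun ω t ↦ W t ω) (fun ω t ↦ Z t ω) P →
        LevyEuler.EulerBound (fun t ω ↦ W t ω + Z t ω) P β p ε B N) ∧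
    -- (c) non-degenerate Gaussian part: the assumptions hold with both parameters equal to 2
    (∀ (Ω : Type*) [MeasurableSpace Ω] (P : Measure Ω) [IsProbabilityMeasure P]
      (L : ℝ≥0 → Ω → EuclideanSpace ℝ (Fin d)) (a : EuclideanSpace ℝ (Fin d))
      (Q : Matrix (Fin d) (Fin d) ℝ) (ν : Measure (EuclideanSpace ℝ (Fin d))) (γ : ℝ),
      LevyEuler.IsLevyProcess L P → LevyEuler.HasTriplet L P a Q ν → Q.PosDef → 0 < γ →
      ∫⁻ y in {y | 1 < ‖y‖}, ENNReal.ofReal (‖y‖ ^ γ) ∂ν < ∞ →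
      LevyEuler.SatisfiesH L P 2 2) ∧
    -- (c) non-degenerate Gaussian part: the rate
    (∀ (β p ε B : ℝ) (M : LevyEuler.HConstants), 0 < β → 2 < p → 0 < ε →
      ∃ N : ℝ, 0 < N ∧
      ∀ (Ω : Type*) [MeasurableSpace Ω] (P : Measure Ω) [IsProbabilityMeasure P]
        (L : ℝ≥0 → Ω → EuclideanSpace ℝ (Fin d)) (a : EuclideanSpace ℝ (Fin d))
        (Q : Matrix (Fin d) (Fin d) ℝ) (ν : Measure (EuclideanSpace ℝ (Fin d))) (γ : ℝ),
        LevyEuler.IsLevyProcess L P → LevyEuler.HasTriplet L P a Q ν → Q.PosDef → 0 < γ →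
        ∫⁻ y in {y | 1 < ‖y‖}, ENNReal.ofReal (‖y‖ ^ γ) ∂ν < ∞ →
        LevyEuler.SatisfiesHWith L P 2 2 M →
        LevyEuler.EulerBound L P β p ε B N) := by
  refine ⟨?_, ?_, ?_, ?_⟩
  · intro Ω _ P _ L₁ L₂ α₁ α₂ α₁' α₂' hα₁ hα _ hα₁' _ hL₁ hL₂ h h₁ h₂
    exact ⟨hL₁.add hL₂ h, LevyEuler.SatisfiesH.add hα₁ hα hα₁' hL₁ hL₂ h h₁ h₂⟩
  · intro α c β p ε B hα hα2 hc hβ hp hε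
    exact LevyEuler.exists_eulerBound_brownian_add_stable hd B hα hα2 hc hβ hp hε
  · intro Ω _ P _ L a Q ν γ hL h hQ _ _
    exact h.satisfiesH hd hL hQ
  · intro β p ε B M hβ hp hε
    obtain ⟨N, hN, h⟩ := LevyEuler.exists_eulerBound_of_satisfiesHWith hd M B hβ hp hε
    exact ⟨N, hN, fun Ω _ P _ L _ _ _ _ hL _ _ _ _ hH ↦ h Ω P L hL hH⟩
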